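/- Let $k\in\{3,4\}$ and let $\ell\in\mathbb{N}$ be a constant. There is an algorithm with the following property. Its input is a straight-line triangulation $G=(V,E)$ (an edge-maximal planar straight-line graph) on a set $V$ of $n\ge 3$ points in convex position in the plane, given by the coordinates of the points and a list of the edges in arbitrary order. In $O(n)$ time, where the constant depends only on $k$ and $\ell$, it finds a set $F$ of new edges (pairs of points of $V$ that are not in $E$), of minimum cardinality, such that the graph $G'=(V,E\cup F)$, drawn with straight-line edges, is $k$-connected and $\ell$-planar, or it reports that no such set $F$ exists. Here $G'$ is $k$-connected if $n>k$ and the deletion of any fewer than $k$ vertices leaves a connected graph; $G'$ is $\ell$-planar if in its straight-line drawing each edge, old or new, is crossed by at most $\ell$ other edges. Time is the number of steps on a real RAM: unit-cost exact arithmetic and comparisons on real numbers, unit-cost arithmetic and random access with integer words of $O(\log n)$ bits, and no rounding of reals to integers. -/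

import Mathlib

/-! ## Geometric graphs

The vertex set is `Fin n`; the vertex `v` is drawn as the point `p v` of the Euclidean plane and
an edge as the straight-line segment between its endpoints. -/

abbrev Plane : Type := EuclideanSpace ℝ (Fin 2)

/-- Two distinct edges cross if the interiors of the two segments have a common point. -/
def Crosses {n : ℕ} (p : Fin n → Plane) (e f : Sym2 (Fin n)) : Prop :=
  e ≠ f ∧ ∃ a b c d : Fin n, e = s(a, b) ∧ f = s(c, d) ∧
    (openSegment ℝ (p a) (p b) ∩ openSegment ℝ (p c) (p d)).Nonempty

/-- A planar straight-line graph (on points of which no three are collinear):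
no two edges cross. -/
def IsPSLG {n : ℕ} (p : Fin n → Plane) (G : SimpleGraph (Fin n)) : Prop :=
  ∀ e ∈ G.edgeSet, ∀ f ∈ G.edgeSet, ¬ Crosses p e f

/-- A straight-line triangulation: an edge-maximal planar straight-line graph. -/
def IsTriangulation {n : ℕ} (p : Fin n → Plane) (G : SimpleGraph (Fin n)) : Prop :=
  Maximal (IsPSLG p) G

/-- `k`-connectivity (vertex-connectivity at least `k`): there are more than `k` vertices, and
deleting fewer than `k` of them leaves a connected graph. -/
def IsKConnected {n : ℕ} (k : ℕ) (G : SimpleGraph (Fin n)) : Prop :=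
  k < n ∧ ∀ S : Finset (Fin n), S.card < k → (G.induce {v | v ∉ S}).Connected

/-- Every edge of the geometric graph is crossed by at most `l` edges of the graph. -/
def IsLPlanar {n : ℕ} (l : ℕ) (p : Fin n → Plane) (G : SimpleGraph (Fin n)) : Prop :=
  ∀ e ∈ G.edgeSet, {f | f ∈ G.edgeSet ∧ Crosses p e f}.ncard ≤ l

/-- The graph `(V, E ∪ F)`. -/
def augment {n : ℕ} (G : SimpleGraph (Fin n)) (F : Finset (Sym2 (Fin n))) :
    SimpleGraph (Fin n) :=
  G ⊔ SimpleGraph.fromEdgeSet (F : Set (Sym2 (Fin n)))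

/-- `F` is a set of new edges that augments `G` to a `k`-connected `l`-planar geometric graph. -/
def IsAugmentation {n : ℕ} (k l : ℕ) (p : Fin n → Plane) (G : SimpleGraph (Fin n))
    (F : Finset (Sym2 (Fin n))) : Prop :=
  (∀ e ∈ F, ¬ e.IsDiag ∧ e ∉ G.edgeSet) ∧
    IsKConnected k (augment G F) ∧ IsLPlanar l p (augment G F)

/-- An augmentation with the minimum number of new edges. -/
def IsMinAugmentation {n : ℕ} (k l : ℕ) (p : Fin n → Plane) (G : SimpleGraph (Fin n))
    (F : Finset (Sym2 (Fin n))) : Prop :=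
  IsAugmentation k l p G F ∧ ∀ F', IsAugmentation k l p G F' → F.card ≤ F'.card

/-! ## The machine model: a real RAM

A program is a finite text over word variables, real variables, word arrays and real arrays (each
kind is named by natural numbers; a text mentions finitely many of them). Arrays are infinite and
randomly accessible at word addresses. Every operation and memory access has unit cost. Words are
natural numbers not exceeding a bound `W`; reals are exact, can be added, subtracted, multiplied,
divided and compared, and cannot be rounded to words. -/

namespace RealRAM

structure State where
  var : ℕ → ℕ
  arr : ℕ → ℕ → ℕ
  rvar : ℕ → ℝ
  rarr : ℕ → ℕ → ℝ

/-- Word expressions; `sub` is truncated and `div` is integer division (with `a / 0 = 0`). -/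
inductive Expr where
  | const (c : ℕ)
  | var (x : ℕ)
  | read (A : ℕ) (i : Expr)
  | add (a b : Expr)
  | sub (a b : Expr)
  | mul (a b : Expr)
  | div (a b : Expr)

namespace Expr

def val (s : State) : Expr → ℕ
  | const c => c
  | var x => s.var x
  | read A i => s.arr A (i.val s)
  | add a b => a.val s + b.val s
  | sub a b => a.val s - b.val s
  | mul a b => a.val s * b.val s
  | div a b => a.val s / b.val s

/-- The number of operations in the evaluation of an expression. -/
def cost : Expr → ℕ
  | const _ => 1
  | var _ => 1
  | read _ i => i.cost + 1
  | add a b => a.cost + b.cost + 1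
  | sub a b => a.cost + b.cost + 1
  | mul a b => a.cost + b.cost + 1
  | div a b => a.cost + b.cost + 1

end Expr

/-- Real expressions; `ofWord` converts a word into a real number. -/
inductive RExpr where
  | ofWord (a : Expr)
  | var (x : ℕ)
  | read (A : ℕ) (i : Expr)
  | add (a b : RExpr)
  | sub (a b : RExpr)
  | mul (a b : RExpr)
  | div (a b : RExpr)

namespace RExpr

noncomputable def val (s : State) : RExpr → ℝ
  | ofWord a => (a.val s : ℝ)
  | var x => s.rvar x
  | read A i => s.rarr A (i.val s)
  | add a b => a.val s + b.val s
  | sub a b => a.val s - b.val s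
  | mul a b => a.val s * b.val s
  | div a b => a.val s / b.val s

def cost : RExpr → ℕ
  | ofWord a => a.cost + 1
  | var _ => 1
  | read _ i => i.cost + 1
  | add a b => a.cost + b.cost + 1
  | sub a b => a.cost + b.cost + 1
  | mul a b => a.cost + b.cost + 1
  | div a b => a.cost + b.cost + 1

end RExpr

/-- Tests. -/
inductive Test where
  | lt (a b : Expr)
  | eq (a b : Expr)
  | rlt (a b : RExpr)
  | not (b : Test)
  | and (b c : Test)

namespace Test

def Holds (s : State) : Test → Prop
  | lt a b => a.val s < b.val s
  | eq a b => a.val s = b.val s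
  | rlt a b => a.val s < b.val s
  | not b => ¬ b.Holds s
  | and b c => b.Holds s ∧ c.Holds s

def cost : Test → ℕ
  | lt a b => a.cost + b.cost + 1
  | eq a b => a.cost + b.cost + 1
  | rlt a b => a.cost + b.cost + 1
  | not b => b.cost + 1
  | and b c => b.cost + c.cost + 1

end Test

/-- Programs. -/
inductive Prog where
  | skip
  | assign (x : ℕ) (e : Expr)
  | store (A : ℕ) (i e : Expr)
  | rassign (x : ℕ) (e : RExpr)
  | rstore (A : ℕ) (i : Expr) (e : RExpr)
  | seq (P Q : Prog)
  | ite (b : Test) (P Q : Prog)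
  | while (b : Test) (P : Prog)

/-- `Exec W P s t s'`: started in state `s`, the program `P` halts after `t` steps in state `s'`,
and all words it stores and all addresses it writes to are at most `W`. -/
inductive Exec (W : ℕ) : Prog → State → ℕ → State → Prop
  | skip (s : State) : Exec W .skip s 1 s
  | assign (s : State) (x : ℕ) (e : Expr) (h : e.val s ≤ W) :
      Exec W (.assign x e) s (e.cost + 1) { s with var := Function.update s.var x (e.val s) }
  | store (s : State) (A : ℕ) (i e : Expr) (hi : i.val s ≤ W) (h : e.val s ≤ W) :
      Exec W (.store A i e) s (i.cost + e.cost + 1)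
        { s with
          arr := Function.update s.arr A (Function.update (s.arr A) (i.val s) (e.val s)) }
  | rassign (s : State) (x : ℕ) (e : RExpr) :
      Exec W (.rassign x e) s (e.cost + 1) { s with rvar := Function.update s.rvar x (e.val s) }
  | rstore (s : State) (A : ℕ) (i : Expr) (e : RExpr) (hi : i.val s ≤ W) :
      Exec W (.rstore A i e) s (i.cost + e.cost + 1)
        { s with
          rarr := Function.update s.rarr A (Function.update (s.rarr A) (i.val s) (e.val s)) }
  | seq {P Q : Prog} {s s₁ s₂ : State} {t₁ t₂ : ℕ}
      (h₁ : Exec W P s t₁ s₁) (h₂ : Exec W Q s₁ t₂ s₂) : Exec W (.seq P Q) s (t₁ + t₂) s₂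
  | iteTrue {b : Test} {P Q : Prog} {s s' : State} {t : ℕ}
      (hb : b.Holds s) (h : Exec W P s t s') : Exec W (.ite b P Q) s (b.cost + 1 + t) s'
  | iteFalse {b : Test} {P Q : Prog} {s s' : State} {t : ℕ}
      (hb : ¬ b.Holds s) (h : Exec W Q s t s') : Exec W (.ite b P Q) s (b.cost + 1 + t) s'
  | whileFalse {b : Test} {P : Prog} {s : State}
      (hb : ¬ b.Holds s) : Exec W (.while b P) s (b.cost + 1) s
  | whileTrue {b : Test} {P : Prog} {s s₁ s₂ : State} {t₁ t₂ : ℕ}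
      (hb : b.Holds s) (h₁ : Exec W P s t₁ s₁) (h₂ : Exec W (.while b P) s₁ t₂ s₂) :
      Exec W (.while b P) s (b.cost + 1 + t₁ + t₂) s₂

/-- Programs are deterministic, so that a statement about some halting execution is one about the
execution. -/
theorem Exec.deterministic {W : ℕ} {P : Prog} {s s₁ s₂ : State} {t₁ t₂ : ℕ}
    (h₁ : Exec W P s t₁ s₁) (h₂ : Exec W P s t₂ s₂) : t₁ = t₂ ∧ s₁ = s₂ := by
  induction h₁ generalizing t₂ s₂ with
  | skip | assign | store | rassign | rstore => cases h₂; exact ⟨rfl, rfl⟩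
  | seq _ _ ih₁ ih₂ =>
    cases h₂ with
    | seq k₁ k₂ =>
      obtain ⟨rfl, rfl⟩ := ih₁ k₁
      obtain ⟨rfl, rfl⟩ := ih₂ k₂
      exact ⟨rfl, rfl⟩
  | iteTrue hb _ ih =>
    cases h₂ with
    | iteTrue _ k => obtain ⟨rfl, rfl⟩ := ih k; exact ⟨rfl, rfl⟩
    | iteFalse hb' _ => exact absurd hb hb'
  | iteFalse hb _ ih =>
    cases h₂ with
    | iteTrue hb' _ => exact absurd hb' hb
    | iteFalse _ k => obtain ⟨rfl, rfl⟩ := ih k; exact ⟨rfl, rfl⟩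
  | whileFalse hb =>
    cases h₂ with
    | whileFalse _ => exact ⟨rfl, rfl⟩
    | whileTrue hb' _ _ => exact absurd hb' hb
  | whileTrue hb _ _ ih₁ ih₂ =>
    cases h₂ with
    | whileFalse hb' => exact absurd hb hb'
    | whileTrue _ k₁ k₂ =>
      obtain ⟨rfl, rfl⟩ := ih₁ k₁
      obtain ⟨rfl, rfl⟩ := ih₂ k₂
      exact ⟨rfl, rfl⟩

end RealRAM

/-! ## Input and output -/

/-- The list `es` enumerates the set `E` of edges, each exactly once, in any order and with any
order of the two endpoints. -/
def ListsEdges {n : ℕ} (es : List (Fin n × Fin n)) (E : Set (Sym2 (Fin n))) : Prop :=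
  (es.map fun q => s(q.1, q.2)).Nodup ∧ {e | e ∈ es.map fun q => s(q.1, q.2)} = E

/-- The initial state: variables `0`, `1` hold the number of points and the number of edges, real
arrays `0`, `1` the coordinates of the points, and word arrays `0`, `1` the first and second
endpoints of the edges. Everything else is `0`. -/
noncomputable def inputState {n : ℕ} (p : Fin n → Plane) (es : List (Fin n × Fin n)) :
    RealRAM.State where
  var x := if x = 0 then n else if x = 1 then es.length else 0
  arr A i :=
    if h : i < es.length then
      if A = 0 then (es[i].1 : ℕ) else if A = 1 then (es[i].2 : ℕ) else 0
    else 0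
  rvar _ := 0
  rarr A i :=
    if h : i < n then
      if A = 0 then p ⟨i, h⟩ 0 else if A = 1 then p ⟨i, h⟩ 1 else 0
    else 0

/-- The final state presents `F`: variable `0` is `1`, variable `1` holds the number of edges in
`F`, and the first cells of word arrays `0`, `1` hold their endpoints. -/
def OutputsEdges {n : ℕ} (s : RealRAM.State) (F : Finset (Sym2 (Fin n))) : Prop :=
  s.var 0 = 1 ∧ ∃ fs : List (Fin n × Fin n), ListsEdges fs (F : Set (Sym2 (Fin n))) ∧
    s.var 1 = fs.length ∧
    ∀ (i : ℕ) (h : i < fs.length), s.arr 0 i = fs[i].1 ∧ s.arr 1 i = fs[i].2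

/-- The final state reports that there is no solution. -/
def ReportsNone (s : RealRAM.State) : Prop := s.var 0 = 0

/-! ## Binary trees as triangulated polygons

The vertices of the polygon are dyadic rationals in `[0, 1]`: the root edge is `(0, 1)`, and the apex
of the triangle below an edge is its midpoint. -/

/-! For points in convex position two edges cross exactly when their ends interleave in the cyclic
order, and the triangulation is a triangulated polygon. Rooted at a hull edge, its triangles form a
binary tree. The problem is thus combinatorial, and the program never reads the coordinates. A tree
`Tr` gives every vertex a dyadic address in `[0, 1]`, whose level measures its depth.

Labels. A new edge of an `l`-planar solution crosses at most `l` old edges, so its ends lie a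
bounded number of levels below the topmost triangle that it passes through. It is recorded in the
label of that triangle. Only finitely many labels occur, an augmentation is a labelled tree, and its
size is the sum of the sizes of the labels (`Tr.ofChords_spec`, `Tr.Model.exists_tree`).

Connectivity. The hull is a Hamiltonian cycle, so only pairs and, for `k = 4`, triples of vertices
can separate. Connectivity amounts to the condition `Tr.Linked`: an edge joins the two sides of a
chord `u v` and avoids a third removed vertex `w` (`Tr.colour_const`). If `u v` is no old edge, then
old edges cross it; one of them avoids `w`, or all pass through `w` and then `w u` and `w v` are old
edges (`Tr.Good.linked`). So only separators at one edge or at two edges with a common end need a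
test.

Locality. Edges that cross a chord of low level have low level. The danger is a separator at two
edges `w u`, `w v` whose poles lie far below `w`. If the pairs `w, u` and `w, v` do not separate, an
edge that joins their sides also links `u, v`, unless the poles have bounded level
(`Tr.linked_or_dy`). Hence all conditions can be tested in windows of bounded depth
(`Tr.localAll_iff_good`, `Tr.good_one_iff`). The windows are the states of a finite tree automaton
(`Tr.exists_auto`), and a dynamic program over the tree finds the cheapest accepted labelling
(`Auto.best_spec`, `Auto.dp_le_cost`).

Linear time. Ears, that is, vertices of degree two, are removed one after another by means of a
queue. For each vertex the number, the sum and the sum of the squares of its remaining neighbours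
are stored; the two neighbours of an ear follow from a table of square roots (`RealRAM.recover`).
Tables are addressed directly by pairs of vertices, and fresh memory, which is `0`, stands for
infinity. A traversal with a stack puts out the optimal labels. Each phase is a loop of `O(n)`
rounds with a body of constant cost. -/

inductive Tr (α : Type) where
  | leaf
  | node (a : α) (l r : Tr α)

abbrev Lab : Type := Finset (ℚ × ℚ)

/-- Dyadic rationals of level `j`. -/
def Dy (j : ℕ) (x : ℚ) : Prop := ∃ z : ℤ, x * 2 ^ j = z

/-- `goL` and `goR` place the coordinates of the left and of the right child on `[0, 1/2]` and
`[1/2, 1]`. -/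
def goL (e : ℚ × ℚ) : ℚ × ℚ := (e.1 / 2, e.2 / 2)
def goR (e : ℚ × ℚ) : ℚ × ℚ := ((1 + e.1) / 2, (1 + e.2) / 2)

/-- The chord `p q` separates `x` from `y`. -/
def Separates (p q x y : ℚ) : Prop :=
  (p < x ∧ x < q ∧ (y < p ∨ q < y)) ∨ (p < y ∧ y < q ∧ (x < p ∨ q < x))

theorem separates_two_mul {p q x y : ℚ} :
    Separates (2 * p) (2 * q) (2 * x) (2 * y) ↔ Separates p q x y := by
  simp only [Separates, mul_lt_mul_iff_right₀ (two_pos : (0 : ℚ) < 2)]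

theorem separates_two_mul_sub {p q x y : ℚ} :
    Separates (2 * p - 1) (2 * q - 1) (2 * x - 1) (2 * y - 1) ↔ Separates p q x y := by
  simp only [Separates, sub_lt_sub_iff_right, mul_lt_mul_iff_right₀ (two_pos : (0 : ℚ) < 2)]

theorem separates_comm {p q x y : ℚ} : Separates p q x y ↔ Separates p q y x :=
  Or.comm

/-- For sorted pairs both sides say that the ends interleave strictly, so `Separates` is the
crossing relation of chords. -/
theorem separates_swap {p q x y : ℚ} (hp : p < q) (hx : x < y) :
    Separates p q x y ↔ Separates x y p q := by
  unfold Separates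
  grind

theorem goL_injective : Function.Injective goL := by
  rintro ⟨a, b⟩ ⟨c, d⟩ h
  simp only [goL, Prod.mk.injEq] at h ⊢
  constructor <;> linarith [h.1, h.2]

theorem goR_injective : Function.Injective goR := by
  rintro ⟨a, b⟩ ⟨c, d⟩ h
  simp only [goR, Prod.mk.injEq] at h ⊢
  constructor <;> linarith [h.1, h.2]

theorem mem_image_goL {s : Finset (ℚ × ℚ)} {x y : ℚ} :
    (x, y) ∈ s.image goL ↔ (2 * x, 2 * y) ∈ s := by
  rw [Finset.mem_image]
  constructor
  · rintro ⟨⟨a, b⟩, h, he⟩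
    simp only [goL, Prod.mk.injEq] at he
    rw [← he.1, ← he.2]
    convert h using 2 <;> ring
  · intro h
    exact ⟨_, h, by simp [goL]⟩

theorem mem_image_goR {s : Finset (ℚ × ℚ)} {x y : ℚ} :
    (x, y) ∈ s.image goR ↔ (2 * x - 1, 2 * y - 1) ∈ s := by
  rw [Finset.mem_image]
  constructor
  · rintro ⟨⟨a, b⟩, h, he⟩
    simp only [goR, Prod.mk.injEq] at he
    rw [← he.1, ← he.2]
    convert h using 2 <;> ring
  · intro h
    exact ⟨_, h, by simp [goR]⟩

namespace Dy

theorem succ {j : ℕ} {x : ℚ} (h : Dy j x) : Dy (j + 1) x := by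
  obtain ⟨z, hz⟩ := h
  exact ⟨2 * z, by rw [pow_succ]; push_cast; rw [← hz]; ring⟩

theorem mono {j k : ℕ} {x : ℚ} (h : Dy j x) (hjk : j ≤ k) : Dy k x := by
  induction hjk with
  | refl => exact h
  | step _ ih => exact ih.succ

theorem two_mul_iff {j : ℕ} {x : ℚ} : Dy j (2 * x) ↔ Dy (j + 1) x := by
  constructor <;> rintro ⟨z, hz⟩ <;> exact ⟨z, by rw [← hz]; ring⟩

theorem two_mul_sub_iff {j : ℕ} {x : ℚ} : Dy j (2 * x - 1) ↔ Dy (j + 1) x := by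
  constructor <;> rintro ⟨z, hz⟩
  · exact ⟨z + 2 ^ j, by push_cast; rw [← hz]; ring⟩
  · exact ⟨z - 2 ^ j, by push_cast; rw [← hz]; ring⟩

theorem zero (j : ℕ) : Dy j 0 := ⟨0, by simp⟩
theorem one (j : ℕ) : Dy j 1 := ⟨2 ^ j, by simp⟩

theorem half {j : ℕ} (hj : 1 ≤ j) : Dy j (1 / 2) :=
  (two_mul_iff.1 (by norm_num; exact one 0) : Dy 1 (1 / 2)).mono hj

/-- Scaled by `2 ^ j` the ends become consecutive integers. This is the source of all locality: a
cell of the grid of level `j` has no points of that level inside. -/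
theorem not_between {j : ℕ} {u v x : ℚ} (hu : Dy j u) (huv : v - u = 1 / 2 ^ j) (hx : Dy j x)
    (h1 : u < x) (h2 : x < v) : False := by
  obtain ⟨a, ha⟩ := hu
  obtain ⟨b, hb⟩ := hx
  have hp : (0 : ℚ) < 2 ^ j := by positivity
  have e : v * 2 ^ j = a + 1 := by
    have : (v - u) * 2 ^ j = 1 := by rw [huv]; field_simp
    linarith
  have l1 := mul_lt_mul_of_pos_right h1 hp
  have l2 := mul_lt_mul_of_pos_right h2 hp
  rw [ha, hb] at l1
  rw [hb, e] at l2
  have : a < b := by exact_mod_cast l1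
  have : b < a + 1 := by exact_mod_cast l2
  omega

theorem not_lt_one {x : ℚ} (h : Dy 0 x) (h0 : 0 < x) (h1 : x < 1) : False :=
  not_between (zero 0) (by norm_num) h h0 h1

end Dy

namespace Tr

variable {α β : Type}

def map (f : α → β) : Tr α → Tr β
  | leaf => leaf
  | node a l r => node (f a) (l.map f) (r.map f)

/-- The vertices of the polygon. -/
def vs : Tr α → ℚ → Prop
  | leaf, x => x = 0 ∨ x = 1
  | node _ l r, x => l.vs (2 * x) ∨ r.vs (2 * x - 1)

/-- The edges of the triangulation. -/
def E : Tr α → Finset (ℚ × ℚ)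
  | leaf => {(0, 1)}
  | node _ l r => insert (0, 1) (l.E.image goL ∪ r.E.image goR)

/-- The chords described by the labels. -/
def F : Tr Lab → Finset (ℚ × ℚ)
  | leaf => ∅
  | node a l r => a ∪ (l.F.image goL ∪ r.F.image goR)

/-- The part of the tree to depth `j`. -/
def trunc : ℕ → Tr α → Tr α
  | 0, _ => leaf
  | _ + 1, leaf => leaf
  | j + 1, node a l r => node a (l.trunc j) (r.trunc j)

/-- A label contains chords whose topmost triangle is the one of the node, with ends of level `M`. -/
def GoodLab (M : ℕ) (a : Lab) : Prop :=
  ∀ e ∈ a, Dy M e.1 ∧ Dy M e.2 ∧ 0 ≤ e.1 ∧ e.1 < 1 / 2 ∧ 1 / 2 < e.2 ∧ e.2 ≤ 1 ∧ e ≠ (0, 1)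

/-- Each label is measured in the coordinates of its own node, so a fixed `M` leaves finitely many
labels at every depth. -/
def WL (M : ℕ) : Tr Lab → Prop
  | leaf => True
  | node a l r => GoodLab M a ∧ l.WL M ∧ r.WL M

theorem mem_E_node {a : α} {l r : Tr α} {x y : ℚ} : (x, y) ∈ (node a l r).E ↔
    (x = 0 ∧ y = 1) ∨ (2 * x, 2 * y) ∈ l.E ∨ (2 * x - 1, 2 * y - 1) ∈ r.E := by
  simp only [E, Finset.mem_insert, Finset.mem_union, mem_image_goL, mem_image_goR, Prod.mk.injEq]

theorem mem_F_node {a : Lab} {l r : Tr Lab} {x y : ℚ} : (x, y) ∈ (node a l r).F ↔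
    (x, y) ∈ a ∨ (2 * x, 2 * y) ∈ l.F ∨ (2 * x - 1, 2 * y - 1) ∈ r.F := by
  simp only [F, Finset.mem_union, mem_image_goL, mem_image_goR]

theorem root_mem_E (T : Tr α) : ((0, 1) : ℚ × ℚ) ∈ T.E := by
  cases T <;> simp [E]

theorem vs_bounds {T : Tr α} {x : ℚ} (h : T.vs x) : 0 ≤ x ∧ x ≤ 1 := by
  induction T generalizing x with
  | leaf => rcases h with rfl | rfl <;> norm_num
  | node a l r ihl ihr =>
    rcases h with h | h
    · have := ihl h; constructor <;> linarith
    · have := ihr h; constructor <;> linarith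

theorem vs_zero_one (T : Tr α) : T.vs 0 ∧ T.vs 1 := by
  induction T with
  | leaf => simp [vs]
  | node a l r ihl ihr =>
    refine ⟨Or.inl (by simpa using ihl.1), Or.inr ?_⟩
    norm_num; exact ihr.2

theorem vs_zero (T : Tr α) : T.vs 0 := T.vs_zero_one.1
theorem vs_one (T : Tr α) : T.vs 1 := T.vs_zero_one.2

theorem vs_half (a : α) (l r : Tr α) : (node a l r).vs (1 / 2) :=
  Or.inl (by norm_num; exact l.vs_one)

theorem vs_left {a : α} {l r : Tr α} {x : ℚ} (hx : x ≤ 1 / 2) :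
    (node a l r).vs x ↔ l.vs (2 * x) := by
  refine ⟨?_, Or.inl⟩
  rintro (h | h)
  · exact h
  · have := (vs_bounds h).1
    have : x = 1 / 2 := by linarith
    subst this
    norm_num
    exact l.vs_one

theorem vs_right {a : α} {l r : Tr α} {x : ℚ} (hx : 1 / 2 ≤ x) :
    (node a l r).vs x ↔ r.vs (2 * x - 1) := by
  refine ⟨?_, Or.inr⟩
  rintro (h | h)
  · have := (vs_bounds h).2
    have : x = 1 / 2 := by linarith
    subst this
    norm_num
    exact r.vs_zero
  · exact h

theorem E_bounds {T : Tr α} {x y : ℚ} (h : (x, y) ∈ T.E) : 0 ≤ x ∧ x < y ∧ y ≤ 1 := by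
  induction T generalizing x y with
  | leaf => simp only [E, Finset.mem_singleton, Prod.mk.injEq] at h; rw [h.1, h.2]; norm_num
  | node a l r ihl ihr =>
    rcases mem_E_node.1 h with ⟨rfl, rfl⟩ | h | h
    · norm_num
    · have := ihl h; refine ⟨?_, ?_, ?_⟩ <;> linarith
    · have := ihr h; refine ⟨?_, ?_, ?_⟩ <;> linarith

theorem E_vs {T : Tr α} {x y : ℚ} (h : (x, y) ∈ T.E) : T.vs x ∧ T.vs y := by
  induction T generalizing x y with
  | leaf => simp only [E, Finset.mem_singleton, Prod.mk.injEq] at h; simp [vs, h.1, h.2]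
  | node a l r ihl ihr =>
    rcases mem_E_node.1 h with ⟨rfl, rfl⟩ | h | h
    · exact vs_zero_one _
    · exact ⟨Or.inl (ihl h).1, Or.inl (ihl h).2⟩
    · exact ⟨Or.inr (ihr h).1, Or.inr (ihr h).2⟩

/-- An edge at depth `j` fills one cell of the grid of level `j`. For edges, short therefore means
deep, and long means that both ends have low level. -/
theorem E_dyadic {T : Tr α} {x y : ℚ} (h : (x, y) ∈ T.E) :
    ∃ j : ℕ, y - x = 1 / 2 ^ j ∧ Dy j x ∧ Dy j y := by
  induction T generalizing x y with
  | leaf =>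
    simp only [E, Finset.mem_singleton, Prod.mk.injEq] at h; rw [h.1, h.2]
    exact ⟨0, by norm_num, Dy.zero _, Dy.one _⟩
  | node a l r ihl ihr =>
    rcases mem_E_node.1 h with ⟨rfl, rfl⟩ | h | h
    · exact ⟨0, by norm_num, Dy.zero _, Dy.one _⟩
    · obtain ⟨j, h1, h2, h3⟩ := ihl h
      refine ⟨j + 1, ?_, Dy.two_mul_iff.1 h2, Dy.two_mul_iff.1 h3⟩
      have : y - x = (2 * y - 2 * x) / 2 := by ring
      rw [this, h1, pow_succ]; field_simp
    · obtain ⟨j, h1, h2, h3⟩ := ihr h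
      refine ⟨j + 1, ?_, Dy.two_mul_sub_iff.1 h2, Dy.two_mul_sub_iff.1 h3⟩
      have : y - x = (2 * y - 1 - (2 * x - 1)) / 2 := by ring
      rw [this, h1, pow_succ]; field_simp

/-- The edges of a triangulation do not cross. -/
theorem E_not_separates {T : Tr α} {p q x y : ℚ} (h : (p, q) ∈ T.E) (h' : (x, y) ∈ T.E) :
    ¬ Separates p q x y := by
  induction T generalizing p q x y with
  | leaf =>
    simp only [E, Finset.mem_singleton, Prod.mk.injEq] at h h'
    rw [h.1, h.2, h'.1, h'.2]; unfold Separates; norm_num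
  | node a l r ihl ihr =>
    have b' := E_bounds h'
    have b := E_bounds h
    rcases mem_E_node.1 h with ⟨rfl, rfl⟩ | h | h
    · unfold Separates; rintro (⟨_, _, h | h⟩ | ⟨_, _, h | h⟩) <;> linarith
    · have c := E_bounds h
      rcases mem_E_node.1 h' with ⟨rfl, rfl⟩ | h' | h'
      · unfold Separates; rintro (⟨_, _, h | h⟩ | ⟨_, _, h | h⟩) <;> linarith
      · intro hs
        exact ihl h h' (separates_two_mul.2 hs)
      · have c' := E_bounds h'
        unfold Separates; rintro (⟨_, _, h | h⟩ | ⟨_, _, h | h⟩) <;> linarith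
    · have c := E_bounds h
      rcases mem_E_node.1 h' with ⟨rfl, rfl⟩ | h' | h'
      · unfold Separates; rintro (⟨_, _, h | h⟩ | ⟨_, _, h | h⟩) <;> linarith
      · have c' := E_bounds h'
        unfold Separates; rintro (⟨_, _, h | h⟩ | ⟨_, _, h | h⟩) <;> linarith
      · intro hs
        exact ihr h h' (separates_two_mul_sub.2 hs)

/-- The edge set of a triangulation is maximal: each chord outside it is crossed. -/
theorem exists_E_separates {T : Tr α} {x y : ℚ} (hx : T.vs x) (hy : T.vs y) (hxy : x < y)
    (h : (x, y) ∉ T.E) : ∃ p q, (p, q) ∈ T.E ∧ Separates p q x y := by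
  induction T generalizing x y with
  | leaf =>
    exfalso
    apply h
    rcases hx with rfl | rfl <;> rcases hy with rfl | rfl
    · exact absurd hxy (lt_irrefl _)
    · simp [E]
    · norm_num at hxy
    · exact absurd hxy (lt_irrefl _)
  | node a l r ihl ihr =>
    have bx := vs_bounds hx
    have bY := vs_bounds hy
    rw [mem_E_node] at h
    push Not at h
    rcases le_or_gt y (1 / 2) with h2 | h2
    · obtain ⟨p, q, hm, hs⟩ := ihl ((vs_left (by linarith)).1 hx) ((vs_left h2).1 hy)
        (by linarith) h.2.1
      refine ⟨p / 2, q / 2, mem_E_node.2 (Or.inr (Or.inl ?_)), ?_⟩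
      · convert hm using 2 <;> ring
      · rw [← separates_two_mul, mul_div_cancel₀ _ two_ne_zero, mul_div_cancel₀ _ two_ne_zero]
        exact hs
    rcases le_or_gt (1 / 2) x with h1 | h1
    · obtain ⟨p, q, hm, hs⟩ := ihr ((vs_right h1).1 hx) ((vs_right (by linarith)).1 hy)
        (by linarith) h.2.2
      refine ⟨(p + 1) / 2, (q + 1) / 2, mem_E_node.2 (Or.inr (Or.inr ?_)), ?_⟩
      · convert hm using 2 <;> ring
      · rw [← separates_two_mul_sub, mul_div_cancel₀ _ two_ne_zero,
          mul_div_cancel₀ _ two_ne_zero, add_sub_cancel_right, add_sub_cancel_right]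
        exact hs
    -- The chord passes over the apex `1/2`. If it starts at `0`, the side `1/2, 1` of the root
    -- triangle crosses it, otherwise the side `0, 1/2` does.
    · by_cases h0 : x = 0
      · have hy1 : y < 1 := lt_of_le_of_ne bY.2 (h.1 h0)
        refine ⟨1 / 2, 1, mem_E_node.2 (Or.inr (Or.inr ?_)), Or.inr ⟨h2, hy1, Or.inl h1⟩⟩
        norm_num; exact root_mem_E r
      · have hx0 : 0 < x := lt_of_le_of_ne bx.1 (Ne.symm h0)
        refine ⟨0, 1 / 2, mem_E_node.2 (Or.inr (Or.inl ?_)), Or.inl ⟨hx0, h1, Or.inr h2⟩⟩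
        norm_num; exact root_mem_E l

/-- A property that is constant along the edges between `c` and `d` agrees at `c` and `d`. -/
theorem path_induction {T : Tr α} {χ : ℚ → Prop} {c d : ℚ} (hc : T.vs c) (hd : T.vs d)
    (hcd : c ≤ d) (h : ∀ x y, (x, y) ∈ T.E → c ≤ x → y ≤ d → (χ x ↔ χ y)) : χ c ↔ χ d := by
  induction T generalizing c d χ with
  | leaf =>
    rcases hc with rfl | rfl <;> rcases hd with rfl | rfl
    · rfl
    · exact h 0 1 (by simp [E]) le_rfl le_rfl
    · norm_num at hcd
    · rfl
  | node a l r ihl ihr =>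
    have left : ∀ c d, c ≤ d → d ≤ 1 / 2 → (node a l r).vs c → (node a l r).vs d →
        (∀ x y, (x, y) ∈ (node a l r).E → c ≤ x → y ≤ d → (χ x ↔ χ y)) → (χ c ↔ χ d) := by
      intro c d hcd hd2 hc hd h
      have := ihl (χ := fun x => χ (x / 2)) ((vs_left (by linarith)).1 hc) ((vs_left hd2).1 hd)
        (by linarith) (fun x y hxy h1 h2 => h _ _ (mem_E_node.2 (Or.inr (Or.inl (by
          convert hxy using 2 <;> ring)))) (by linarith) (by linarith))
      simpa using this
    have right : ∀ c d, c ≤ d → 1 / 2 ≤ c → (node a l r).vs c → (node a l r).vs d →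
        (∀ x y, (x, y) ∈ (node a l r).E → c ≤ x → y ≤ d → (χ x ↔ χ y)) → (χ c ↔ χ d) := by
      intro c d hcd hd2 hc hd h
      have := ihr (χ := fun x => χ ((x + 1) / 2)) ((vs_right hd2).1 hc)
        ((vs_right (by linarith)).1 hd)
        (by linarith) (fun x y hxy h1 h2 => h _ _ (mem_E_node.2 (Or.inr (Or.inr (by
          convert hxy using 2 <;> ring)))) (by linarith) (by linarith))
      simpa using this
    rcases le_or_gt d (1 / 2) with h2 | h2
    · exact left c d hcd h2 hc hd h
    rcases le_or_gt (1 / 2) c with h1 | h1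
    · exact right c d hcd h1 hc hd h
    -- A path between the two halves can be routed through the apex.
    · exact (left c (1 / 2) h1.le le_rfl hc (vs_half a l r)
        (fun x y m h3 h4 => h x y m h3 (by linarith))).trans
        (right (1 / 2) d h2.le le_rfl (vs_half a l r) hd
        (fun x y m h3 h4 => h x y m (by linarith) h4))

/-- Near a vertex of high level there are two vertices of level `M + 2`. -/
theorem exists_two_vs {T : Tr α} {x : ℚ} {M : ℕ} (hx : T.vs x) (hM : ¬ Dy (M + 1) x) :
    ∃ y₁ y₂, y₁ ≠ y₂ ∧ T.vs y₁ ∧ T.vs y₂ ∧ Dy (M + 2) y₁ ∧ Dy (M + 2) y₂ ∧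
      ∀ z, Dy M z → ((z < x ↔ z < y₁) ∧ (z < x ↔ z < y₂) ∧ (x < z ↔ y₁ < z) ∧ (x < z ↔ y₂ < z)) := by
  induction M generalizing T x with
  | zero =>
    have b := vs_bounds hx
    have key : ∀ y₁ y₂ : ℚ, 0 < y₁ → y₁ < 1 → 0 < y₂ → y₂ < 1 → ∀ z, Dy 0 z →
        ((z < x ↔ z < y₁) ∧ (z < x ↔ z < y₂) ∧ (x < z ↔ y₁ < z) ∧ (x < z ↔ y₂ < z)) := by
      intro y₁ y₂ h1 h2 h3 h4 z hz
      have hx0 : 0 < x := lt_of_le_of_ne b.1 (fun h => hM (h ▸ Dy.zero _))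
      have hx1 : x < 1 := lt_of_le_of_ne b.2 (fun h => hM (h ▸ Dy.one _))
      rcases le_or_gt z 0 with h0 | h0
      · refine ⟨⟨?_, ?_⟩, ⟨?_, ?_⟩, ⟨?_, ?_⟩, ⟨?_, ?_⟩⟩ <;> intro _ <;> linarith
      rcases lt_or_ge z 1 with h0' | h0'
      · exact absurd hz (fun h => Dy.not_lt_one h h0 h0')
      · refine ⟨⟨?_, ?_⟩, ⟨?_, ?_⟩, ⟨?_, ?_⟩, ⟨?_, ?_⟩⟩ <;> intro _ <;> linarith
    cases T with
    | leaf => rcases hx with rfl | rfl; exacts [absurd (Dy.zero _) hM, absurd (Dy.one _) hM]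
    | node a l r =>
      rcases hx with hx | hx
      · cases l with
        | leaf =>
          exfalso; apply hM
          apply Dy.two_mul_iff.1
          rcases hx with h | h <;> rw [h]
          exacts [Dy.zero _, Dy.one _]
        | node a' l' r' =>
          -- The left child is a node because `x` has level above `1`. Its apex `1/4` and the apex
          -- `1/2` lie in `(0, 1)`, as `x` does, so no integer tells them apart from `x`.
          refine ⟨1 / 2, 1 / 4, by norm_num, vs_half _ _ _, Or.inl ?_, Dy.half (by norm_num),
            ⟨1, by norm_num⟩, key _ _ (by norm_num) (by norm_num) (by norm_num) (by norm_num)⟩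
          have := vs_half a' l' r'
          convert this using 1; norm_num
      · cases r with
        | leaf =>
          exfalso; apply hM
          apply Dy.two_mul_sub_iff.1
          rcases hx with h | h <;> rw [h]
          exacts [Dy.zero _, Dy.one _]
        | node a' l' r' =>
          refine ⟨1 / 2, 3 / 4, by norm_num, vs_half _ _ _, Or.inr ?_, Dy.half (by norm_num),
            ⟨3, by norm_num⟩, key _ _ (by norm_num) (by norm_num) (by norm_num) (by norm_num)⟩
          have := vs_half a' l' r'
          convert this using 1; norm_num
  | succ M ih =>
    cases T with
    | leaf => rcases hx with rfl | rfl; exacts [absurd (Dy.zero _) hM, absurd (Dy.one _) hM]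
    | node a l r =>
      rcases hx with hx | hx
      · obtain ⟨y₁, y₂, hne, h1, h2, h3, h4, h5⟩ := ih hx (fun h => hM (Dy.two_mul_iff.1 h))
        refine ⟨y₁ / 2, y₂ / 2, fun h => hne (by linarith), Or.inl ?_, Or.inl ?_,
          Dy.two_mul_iff.1 ?_, Dy.two_mul_iff.1 ?_, fun z hz => ?_⟩
        · convert h1 using 1; ring
        · convert h2 using 1; ring
        · convert h3 using 1; ring
        · convert h4 using 1; ring
        · obtain ⟨a1, a2, a3, a4⟩ := h5 (2 * z) (Dy.two_mul_iff.2 hz)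
          have e1 : (z < x ↔ 2 * z < 2 * x) := by constructor <;> intro _ <;> linarith
          have e2 : (x < z ↔ 2 * x < 2 * z) := by constructor <;> intro _ <;> linarith
          refine ⟨e1.trans (a1.trans ?_), e1.trans (a2.trans ?_), e2.trans (a3.trans ?_),
            e2.trans (a4.trans ?_)⟩ <;> constructor <;> intro _ <;> linarith
      · obtain ⟨y₁, y₂, hne, h1, h2, h3, h4, h5⟩ := ih hx (fun h => hM (Dy.two_mul_sub_iff.1 h))
        refine ⟨(y₁ + 1) / 2, (y₂ + 1) / 2, fun h => hne (by linarith), Or.inr ?_, Or.inr ?_,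
          Dy.two_mul_sub_iff.1 ?_, Dy.two_mul_sub_iff.1 ?_, fun z hz => ?_⟩
        · convert h1 using 1; ring
        · convert h2 using 1; ring
        · convert h3 using 1; ring
        · convert h4 using 1; ring
        · obtain ⟨a1, a2, a3, a4⟩ := h5 (2 * z - 1) (Dy.two_mul_sub_iff.2 hz)
          have e1 : (z < x ↔ 2 * z - 1 < 2 * x - 1) := by constructor <;> intro _ <;> linarith
          have e2 : (x < z ↔ 2 * x - 1 < 2 * z - 1) := by constructor <;> intro _ <;> linarith
          refine ⟨e1.trans (a1.trans ?_), e1.trans (a2.trans ?_), e2.trans (a3.trans ?_),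
            e2.trans (a4.trans ?_)⟩ <;> constructor <;> intro _ <;> linarith

end Tr

/-! ### Labelled trees: the global conditions and their local versions -/

namespace Tr

variable {α β : Type}

def EF (S : Tr Lab) : Finset (ℚ × ℚ) := S.E ∪ S.F

open Classical in
/-- The number of edges that cross the chord `e`. -/
noncomputable def crossCount (S : Tr Lab) (e : ℚ × ℚ) : ℕ :=
  (S.EF.filter fun h => Separates h.1 h.2 e.1 e.2).card

/-- After the removal of `u`, `v`, `w` an edge joins the two sides of the chord `u v`, if both are
nonempty. -/
def Linked (S : Tr Lab) (u v w : ℚ) : Prop :=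
  (∃ a, S.vs a ∧ u < a ∧ a < v ∧ a ≠ w) → (∃ b, S.vs b ∧ (b < u ∨ v < b) ∧ b ≠ w) →
    ∃ h ∈ S.EF, Separates h.1 h.2 u v ∧ h.1 ≠ w ∧ h.2 ≠ w

def SE (S : Tr α) (x y : ℚ) : Prop := (x, y) ∈ S.E ∨ (y, x) ∈ S.E

/-- Separators whose two poles are adjacent. -/
def AnchI (k : ℕ) (d : ℚ) (S : Tr α) (u v w : ℚ) : Prop :=
  (u, v) ∈ S.E ∧ v - u ≤ d ∧ (k = 4 ∨ 1 < w)

/-- Separators whose two poles are adjacent to the third vertex. -/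
def AnchII (k : ℕ) (d : ℚ) (S : Tr α) (u v w : ℚ) : Prop :=
  k = 4 ∧ u < v ∧ S.SE w u ∧ S.SE w v ∧ |u - w| ≤ d ∧ |v - w| ≤ d

/-- The conditions that become visible at the root of `S`. Chords in the root label have ends of
level `M`, edges that cross them have level at most `2 * M`, and `linked_or_dy` bounds the poles of
the critical separators by `M + 2 * M + 1`. -/
def Local (k l M : ℕ) (S : Tr Lab) : Prop :=
  (∀ x y, (x, y) ∈ S.F → Dy M x → Dy M y → S.vs x ∧ S.vs y) ∧
  (∀ x y, (x, y) ∈ S.EF → Dy (2 * M) x → Dy (2 * M) y → S.crossCount (x, y) ≤ l) ∧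
  (∀ u v w, S.AnchI k (1 / 2 ^ M) u v w → Dy (3 * M + 1) u → Dy (3 * M + 1) v → S.Linked u v w) ∧
  (∀ u v w, S.AnchII k (1 / 2 ^ M) u v w → Dy (3 * M + 1) u → Dy (3 * M + 1) v →
    Dy (3 * M + 1) w → S.Linked u v w)

/-- Anchors longer than `1 / 2 ^ M` escape `Local`; they are tested once, at the root of the whole
tree. -/
def LocalRoot (k M : ℕ) (S : Tr Lab) : Prop :=
  (∀ u v w, S.AnchI k 1 u v w → Dy (3 * M + 1) u → Dy (3 * M + 1) v → S.Linked u v w) ∧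
  (∀ u v w, S.AnchII k 1 u v w → Dy (3 * M + 1) u → Dy (3 * M + 1) v →
    Dy (3 * M + 1) w → S.Linked u v w)

/-- The bound `d` makes the condition pass to subtrees: for `d = 1 / 2 ^ M` no chord in the label of
a node crosses the anchors in question, so the rest of the tree cannot help to link them. The full
condition is the case `d = 1`. -/
def Good (k l : ℕ) (d : ℚ) (S : Tr Lab) : Prop :=
  (∀ x y, (x, y) ∈ S.F → S.vs x ∧ S.vs y) ∧
  (∀ x y, (x, y) ∈ S.EF → S.crossCount (x, y) ≤ l) ∧
  (∀ u v w, S.AnchI k d u v w → S.Linked u v w) ∧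
  (∀ u v w, S.AnchII k d u v w → S.Linked u v w)

def LocalAll (k l M : ℕ) : Tr Lab → Prop
  | leaf => True
  | node a L R => (node a L R).Local k l M ∧ L.LocalAll k l M ∧ R.LocalAll k l M

theorem mem_EF {S : Tr Lab} {e : ℚ × ℚ} : e ∈ S.EF ↔ e ∈ S.E ∨ e ∈ S.F := Finset.mem_union

theorem mem_EF_node {a : Lab} {l r : Tr Lab} {x y : ℚ} : (x, y) ∈ (node a l r).EF ↔
    (x, y) ∈ a ∨ (x = 0 ∧ y = 1) ∨ (2 * x, 2 * y) ∈ l.EF ∨ (2 * x - 1, 2 * y - 1) ∈ r.EF := by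
  simp only [mem_EF, mem_E_node, mem_F_node]
  tauto

theorem F_bounds {S : Tr Lab} {M : ℕ} (hS : S.WL M) {x y : ℚ} (h : (x, y) ∈ S.F) :
    0 ≤ x ∧ x < y ∧ y ≤ 1 ∧ ¬ (x = 0 ∧ y = 1) := by
  induction S generalizing x y with
  | leaf => simp [F] at h
  | node a l r ihl ihr =>
    obtain ⟨ha, hl, hr⟩ := hS
    rcases mem_F_node.1 h with h | h | h
    · obtain ⟨_, _, h1, h2, h3, h4, h5⟩ := ha _ h
      refine ⟨h1, ?_, h4, ?_⟩
      · simp only at h2 h3; linarith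
      · simpa using h5
    · obtain ⟨h1, h2, h3, h4⟩ := ihl hl h
      refine ⟨by linarith, by linarith, by linarith, ?_⟩
      rintro ⟨rfl, rfl⟩
      norm_num at h3
    · obtain ⟨h1, h2, h3, h4⟩ := ihr hr h
      refine ⟨by linarith, by linarith, by linarith, ?_⟩
      rintro ⟨rfl, rfl⟩
      norm_num at h1

theorem EF_bounds {S : Tr Lab} {M : ℕ} (hS : S.WL M) {x y : ℚ} (h : (x, y) ∈ S.EF) :
    0 ≤ x ∧ x < y ∧ y ≤ 1 := by
  rcases mem_EF.1 h with h | h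
  · exact E_bounds h
  · obtain ⟨h1, h2, h3, _⟩ := F_bounds hS h
    exact ⟨h1, h2, h3⟩

/-- A chord with a vertex of level `k` between its ends has level at most `k + M`. -/
theorem dy_of_between {S : Tr Lab} {M k : ℕ} (hS : S.WL M) {x y z : ℚ} (h : (x, y) ∈ S.EF)
    (hz : Dy k z) (h1 : x < z) (h2 : z < y) : Dy (k + M) x ∧ Dy (k + M) y := by
  induction S generalizing x y z k with
  | leaf =>
    simp only [EF, E, F, Finset.union_empty, Finset.mem_singleton, Prod.mk.injEq] at h
    rw [h.1, h.2]; exact ⟨Dy.zero _, Dy.one _⟩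
  | node a l r ihl ihr =>
    obtain ⟨ha, hl, hr⟩ := hS
    rcases mem_EF_node.1 h with h | ⟨rfl, rfl⟩ | h | h
    · obtain ⟨h3, h4, _⟩ := ha _ h
      exact ⟨h3.mono (by omega), h4.mono (by omega)⟩
    · exact ⟨Dy.zero _, Dy.one _⟩
    · have b := EF_bounds hl h
      cases k with
      | zero => exact (Dy.not_lt_one hz (by linarith) (by linarith)).elim
      | succ k =>
        obtain ⟨h3, h4⟩ := ihl hl h (Dy.two_mul_iff.2 hz) (by linarith) (by linarith)
        rw [add_right_comm]
        exact ⟨Dy.two_mul_iff.1 h3, Dy.two_mul_iff.1 h4⟩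
    · have b := EF_bounds hr h
      cases k with
      | zero => exact (Dy.not_lt_one hz (by linarith) (by linarith)).elim
      | succ k =>
        obtain ⟨h3, h4⟩ := ihr hr h (Dy.two_mul_sub_iff.2 hz) (by linarith) (by linarith)
        rw [add_right_comm]
        exact ⟨Dy.two_mul_sub_iff.1 h3, Dy.two_mul_sub_iff.1 h4⟩

/-- One of `u`, `v` lies strictly between `x` and `y`. -/
theorem dy_of_separates {S : Tr Lab} {M k : ℕ} (hS : S.WL M) {x y u v : ℚ} (h : (x, y) ∈ S.EF)
    (hu : Dy k u) (hv : Dy k v) (hs : Separates x y u v) : Dy (k + M) x ∧ Dy (k + M) y := by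
  rcases hs with ⟨h1, h2, _⟩ | ⟨h1, h2, _⟩
  · exact dy_of_between hS h hu h1 h2
  · exact dy_of_between hS h hv h1 h2

/-- What `trunc j` cuts off hangs on edges of depth `j`, and all further vertices there have level
above `j`. -/
theorem vs_trunc {T : Tr α} {j : ℕ} {x : ℚ} (hx : Dy j x) : (T.trunc j).vs x ↔ T.vs x := by
  induction j generalizing T x with
  | zero =>
    have : ∀ T : Tr α, T.vs x ↔ x = 0 ∨ x = 1 := by
      refine fun T => ⟨fun h => ?_, ?_⟩
      · have b := vs_bounds h
        by_contra hc
        push Not at hc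
        exact Dy.not_lt_one hx (lt_of_le_of_ne b.1 hc.1.symm) (lt_of_le_of_ne b.2 hc.2)
      · rintro (rfl | rfl)
        exacts [vs_zero _, vs_one _]
    rw [this, this]
  | succ j ih =>
    cases T with
    | leaf => rfl
    | node a l r =>
      simp only [trunc, vs]
      rw [ih (Dy.two_mul_iff.2 hx), ih (Dy.two_mul_sub_iff.2 hx)]

theorem E_trunc {T : Tr α} {j : ℕ} {x y : ℚ} (hx : Dy j x) (hy : Dy j y) :
    (x, y) ∈ (T.trunc j).E ↔ (x, y) ∈ T.E := by
  induction j generalizing T x y with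
  | zero =>
    have : ∀ T : Tr α, (x, y) ∈ T.E ↔ x = 0 ∧ y = 1 := by
      refine fun T => ⟨fun h => ?_, ?_⟩
      · have b := E_bounds h
        by_contra hc
        by_cases h0 : x = 0
        · exact Dy.not_lt_one hy (by linarith) (lt_of_le_of_ne b.2.2 (fun h => hc ⟨h0, h⟩))
        · exact Dy.not_lt_one hx (lt_of_le_of_ne b.1 (Ne.symm h0)) (by linarith)
      · rintro ⟨rfl, rfl⟩
        exact root_mem_E _
    rw [this, this]
  | succ j ih =>
    cases T with
    | leaf => rfl
    | node a l r =>
      simp only [trunc, mem_E_node]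
      rw [ih (Dy.two_mul_iff.2 hx) (Dy.two_mul_iff.2 hy),
        ih (Dy.two_mul_sub_iff.2 hx) (Dy.two_mul_sub_iff.2 hy)]

/-- A chord in a label at depth `j` or more lies within one cell of level `j` without being the
whole cell, so one of its ends has level above `j`. -/
theorem F_trunc {T : Tr Lab} {M j : ℕ} (hT : T.WL M) {x y : ℚ} (hx : Dy j x) (hy : Dy j y) :
    (x, y) ∈ (T.trunc j).F ↔ (x, y) ∈ T.F := by
  induction j generalizing T x y with
  | zero =>
    simp only [trunc, F, Finset.notMem_empty, false_iff]
    intro h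
    obtain ⟨h1, h2, h3, h4⟩ := F_bounds hT h
    by_cases h0 : x = 0
    · exact Dy.not_lt_one hy (by linarith) (lt_of_le_of_ne h3 (fun h => h4 ⟨h0, h⟩))
    · exact Dy.not_lt_one hx (lt_of_le_of_ne h1 (Ne.symm h0)) (by linarith)
  | succ j ih =>
    cases T with
    | leaf => rfl
    | node a l r =>
      simp only [trunc, mem_F_node]
      rw [ih hT.2.1 (Dy.two_mul_iff.2 hx) (Dy.two_mul_iff.2 hy),
        ih hT.2.2 (Dy.two_mul_sub_iff.2 hx) (Dy.two_mul_sub_iff.2 hy)]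

theorem WL_trunc {T : Tr Lab} {M : ℕ} (j : ℕ) (hT : T.WL M) : (T.trunc j).WL M := by
  induction j generalizing T with
  | zero => trivial
  | succ j ih =>
    cases T with
    | leaf => trivial
    | node a l r => exact ⟨hT.1, ih hT.2.1, ih hT.2.2⟩

theorem trunc_trunc {T : Tr α} {i j : ℕ} (h : i ≤ j) : (T.trunc j).trunc i = T.trunc i := by
  induction i generalizing T j with
  | zero => rfl
  | succ i ih =>
    cases T with
    | leaf => cases j <;> rfl
    | node a l r =>
      cases j with
      | zero => omega
      | succ j => simp only [trunc]; rw [ih (by omega), ih (by omega)]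

/-- Two trees look the same at level `R`. -/
def Agree (R : ℕ) (S S' : Tr Lab) : Prop :=
  (∀ x, Dy R x → (S.vs x ↔ S'.vs x)) ∧
  (∀ x y, Dy R x → Dy R y → ((x, y) ∈ S.E ↔ (x, y) ∈ S'.E)) ∧
  (∀ x y, Dy R x → Dy R y → ((x, y) ∈ S.F ↔ (x, y) ∈ S'.F))

theorem Agree.symm {R : ℕ} {S S' : Tr Lab} (h : Agree R S S') : Agree R S' S :=
  ⟨fun x hx => (h.1 x hx).symm, fun x y hx hy => (h.2.1 x y hx hy).symm,
    fun x y hx hy => (h.2.2 x y hx hy).symm⟩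

theorem Agree.EF {R : ℕ} {S S' : Tr Lab} (h : Agree R S S') {x y : ℚ} (hx : Dy R x) (hy : Dy R y) :
    (x, y) ∈ S.EF ↔ (x, y) ∈ S'.EF := by
  rw [mem_EF, mem_EF, h.2.1 x y hx hy, h.2.2 x y hx hy]

theorem agree_trunc {S : Tr Lab} {M R : ℕ} (hS : S.WL M) : Agree R (S.trunc R) S :=
  ⟨fun _ hx => vs_trunc hx, fun _ _ hx hy => E_trunc hx hy, fun _ _ hx hy => F_trunc hS hx hy⟩

/-- An edge across `u v` has level at most `K + M` and is visible in both trees. The sides of `u v`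
may be nonempty only by vertices of high level; `exists_two_vs` replaces such a vertex by two of
level `K + 2` in the same gap between points of level `K`, and one of the two differs from `w`. -/
theorem Agree.linked {M K R : ℕ} {S S' : Tr Lab} (hS : S.WL M) (h : Agree R S S')
    (h2 : K + 2 ≤ R) (hM : K + M ≤ R) {u v w : ℚ} (hu : Dy K u) (hv : Dy K v)
    (hL : S.Linked u v w) : S'.Linked u v w := by
  rintro ⟨a, ha, ha1, ha2, ha3⟩ ⟨b, hb, hb1, hb2⟩
  have A : ∃ a, S.vs a ∧ u < a ∧ a < v ∧ a ≠ w := by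
    by_cases hd : Dy (K + 1) a
    · exact ⟨a, (h.1 a (hd.mono (by omega))).2 ha, ha1, ha2, ha3⟩
    · obtain ⟨y₁, y₂, hne, g1, g2, g3, g4, g5⟩ := exists_two_vs ha hd
      obtain ⟨c1, c2, -, -⟩ := g5 u hu
      obtain ⟨-, -, c3, c4⟩ := g5 v hv
      by_cases hy : y₁ = w
      · exact ⟨y₂, (h.1 _ (g4.mono h2)).2 g2, c2.1 ha1, c4.1 ha2, fun e => hne (hy.trans e.symm)⟩
      · exact ⟨y₁, (h.1 _ (g3.mono h2)).2 g1, c1.1 ha1, c3.1 ha2, hy⟩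
  have B : ∃ b, S.vs b ∧ (b < u ∨ v < b) ∧ b ≠ w := by
    by_cases hd : Dy (K + 1) b
    · exact ⟨b, (h.1 b (hd.mono (by omega))).2 hb, hb1, hb2⟩
    · obtain ⟨y₁, y₂, hne, g1, g2, g3, g4, g5⟩ := exists_two_vs hb hd
      obtain ⟨-, -, c1, c2⟩ := g5 u hu
      obtain ⟨c3, c4, -, -⟩ := g5 v hv
      by_cases hy : y₁ = w
      · exact ⟨y₂, (h.1 _ (g4.mono h2)).2 g2, hb1.imp c2.1 c4.1, fun e => hne (hy.trans e.symm)⟩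
      · exact ⟨y₁, (h.1 _ (g3.mono h2)).2 g1, hb1.imp c1.1 c3.1, hy⟩
  obtain ⟨⟨x, y⟩, hh, hs, hw⟩ := hL A B
  obtain ⟨dx, dy⟩ := dy_of_separates hS hh hu hv hs
  exact ⟨(x, y), (h.EF (dx.mono hM) (dy.mono hM)).1 hh, hs, hw⟩

/-- All edges that cross a chord of level `K` have level at most `K + M`, so both trees show them.
-/
theorem Agree.crossCount_eq {M K R : ℕ} {S S' : Tr Lab} (hS : S.WL M) (hS' : S'.WL M)
    (h : Agree R S S') (hM : K + M ≤ R) {u v : ℚ} (hu : Dy K u) (hv : Dy K v) :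
    S.crossCount (u, v) = S'.crossCount (u, v) := by
  unfold crossCount
  congr 1
  ext ⟨x, y⟩
  simp only [Finset.mem_filter]
  constructor
  · rintro ⟨h1, h2⟩
    obtain ⟨dx, dy⟩ := dy_of_separates hS h1 hu hv h2
    exact ⟨(h.EF (dx.mono hM) (dy.mono hM)).1 h1, h2⟩
  · rintro ⟨h1, h2⟩
    obtain ⟨dx, dy⟩ := dy_of_separates hS' h1 hu hv h2
    exact ⟨(h.EF (dx.mono hM) (dy.mono hM)).2 h1, h2⟩

theorem Agree.SE {R : ℕ} {S S' : Tr Lab} (h : Agree R S S') {x y : ℚ} (hx : Dy R x)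
    (hy : Dy R y) (hs : S.SE x y) : S'.SE x y :=
  hs.imp (h.2.1 x y hx hy).1 (h.2.1 y x hy hx).1

theorem Agree.localRoot {k M R : ℕ} {S S' : Tr Lab} (hS : S.WL M)
    (h : Agree R S S') (hR : 4 * M + 3 ≤ R) (hL : S.LocalRoot k M) : S'.LocalRoot k M := by
  constructor
  · rintro u v w ⟨h1, h2⟩ hu hv
    exact Agree.linked hS h (by omega) (by omega) hu hv (hL.1 u v w
      ⟨(h.2.1 u v (hu.mono (by omega)) (hv.mono (by omega))).2 h1, h2⟩ hu hv)
  · rintro u v w ⟨h0, h1, h2, h3, h4⟩ hu hv hw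
    exact Agree.linked hS h (by omega) (by omega) hu hv (hL.2 u v w
      ⟨h0, h1, h.symm.SE (hw.mono (by omega)) (hu.mono (by omega)) h2,
        h.symm.SE (hw.mono (by omega)) (hv.mono (by omega)) h3, h4⟩ hu hv hw)

theorem Agree.local {k l M R : ℕ} {S S' : Tr Lab} (hS : S.WL M) (hS' : S'.WL M)
    (h : Agree R S S') (hR : 4 * M + 3 ≤ R) (hL : S.Local k l M) : S'.Local k l M := by
  refine ⟨fun x y hF hx hy => ?_, fun x y he hx hy => ?_, ?_, ?_⟩
  · obtain ⟨h1, h2⟩ := hL.1 x y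
      ((h.2.2 x y (hx.mono (by omega)) (hy.mono (by omega))).2 hF) hx hy
    exact ⟨(h.1 x (hx.mono (by omega))).1 h1, (h.1 y (hy.mono (by omega))).1 h2⟩
  · rw [← Agree.crossCount_eq hS hS' h (K := 2 * M) (by omega) hx hy]
    exact hL.2.1 x y ((h.EF (hx.mono (by omega)) (hy.mono (by omega))).2 he) hx hy
  · rintro u v w ⟨h1, h2⟩ hu hv
    exact Agree.linked hS h (by omega) (by omega) hu hv (hL.2.2.1 u v w
      ⟨(h.2.1 u v (hu.mono (by omega)) (hv.mono (by omega))).2 h1, h2⟩ hu hv)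
  · rintro u v w ⟨h0, h1, h2, h3, h4⟩ hu hv hw
    exact Agree.linked hS h (by omega) (by omega) hu hv (hL.2.2.2 u v w
      ⟨h0, h1, h.symm.SE (hw.mono (by omega)) (hu.mono (by omega)) h2,
        h.symm.SE (hw.mono (by omega)) (hv.mono (by omega)) h3, h4⟩ hu hv hw)

end Tr

/-! ### Separators at two edges are linked or of bounded level -/

namespace Tr

/-- No vertex exceeds `1`, so a `w` beyond `1` removes nothing. Such values encode separating pairs.
-/
theorem linked_of_one_lt {S : Tr Lab} {M : ℕ} (hS : S.WL M) {u v w w' : ℚ} (hw : 1 < w)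
    (hw' : 1 < w') (h : S.Linked u v w) : S.Linked u v w' := by
  rintro ⟨a, ha, ha1, ha2, -⟩ ⟨b, hb, hb1, -⟩
  obtain ⟨⟨x, y⟩, h1, h2, -⟩ := h ⟨a, ha, ha1, ha2, by have := (vs_bounds ha).2; intro e; linarith⟩
    ⟨b, hb, hb1, by have := (vs_bounds hb).2; intro e; linarith⟩
  obtain ⟨b1, b2, b3⟩ := EF_bounds hS h1
  exact ⟨_, h1, h2, by intro e; simp only at e; linarith, by intro e; simp only at e; linarith⟩

theorem dy_of_E_between {S : Tr Lab} {M k : ℕ} (hS : S.WL M) {x y z : ℚ} (h : (x, y) ∈ S.E)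
    (hz : Dy k z) (h1 : x < z) (h2 : z < y) : Dy (k + M) x ∧ Dy (k + M) y :=
  dy_of_between hS (mem_EF.2 (Or.inl h)) hz h1 h2

/-- An edge that links one of the pairs `u, w` and `w, v` links `u, v` too, unless it stays within
`[u, v]` and passes over `w`. Passing over `w` bounds its level. Its ends lie inside the edges `u w`
and `w v` or at a pole, and this bounds the level of both poles. -/
theorem linked_or_dy_of_opposite {S : Tr Lab} {M k : ℕ} (hS : S.WL M) {u v w : ℚ} (hk : Dy k w)
    (h1 : (u, w) ∈ S.E) (h2 : (w, v) ∈ S.E) (l1 : S.Linked u w 2) (l2 : S.Linked w v 2) :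
    S.Linked u v w ∨ (Dy (k + 2 * M + 1) u ∧ Dy (k + 2 * M + 1) v) := by
  by_contra hc
  push Not at hc
  obtain ⟨hc, hd⟩ := hc
  apply hc
  rintro ⟨a, ha, ha1, ha2, ha3⟩ ⟨b, hb, hb1, hb2⟩
  have n2 : ∀ {x}, S.vs x → x ≠ 2 := fun hx e => by have := (vs_bounds hx).2; linarith
  have huw := (E_bounds h1).2.1
  have hwv := (E_bounds h2).2.1
  by_contra hcon
  push Not at hcon
  rcases lt_or_gt_of_ne ha3 with ha4 | ha4
  · obtain ⟨⟨p, q⟩, hh, hs, -⟩ := l1 ⟨a, ha, ha1, ha4, n2 ha⟩ ⟨v, (E_vs h2).2, Or.inr hwv, n2 (E_vs h2).2⟩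
    have hb := EF_bounds hS hh
    by_cases hx : Separates p q u v ∧ p ≠ w ∧ q ≠ w
    · exact hx.2.2 (hcon _ hh hx.1 hx.2.1)
    · have hw : p < w ∧ w < q ∧ u < p ∧ q ≤ v := by unfold Separates at hs hx; grind
      obtain ⟨hw1, hw2, hw3, hw4⟩ := hw
      obtain ⟨dp, dq⟩ := dy_of_between hS hh hk hw1 hw2
      have d1 := (dy_of_E_between hS h1 dp hw3 hw1).1
      refine hd (d1.mono (by omega)) ?_
      rcases hw4.lt_or_eq with h | rfl
      · exact (dy_of_E_between hS h2 dq hw2 h).2.mono (by omega)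
      · exact dq.mono (by omega)
  · obtain ⟨⟨p, q⟩, hh, hs, -⟩ := l2 ⟨a, ha, ha4, ha2, n2 ha⟩ ⟨u, (E_vs h1).1, Or.inl huw, n2 (E_vs h1).1⟩
    have hb := EF_bounds hS hh
    by_cases hx : Separates p q u v ∧ p ≠ w ∧ q ≠ w
    · exact hx.2.2 (hcon _ hh hx.1 hx.2.1)
    · have hw : p < w ∧ w < q ∧ u ≤ p ∧ q < v := by unfold Separates at hs hx; grind
      obtain ⟨hw1, hw2, hw3, hw4⟩ := hw
      obtain ⟨dp, dq⟩ := dy_of_between hS hh hk hw1 hw2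
      have d1 := (dy_of_E_between hS h2 dq hw2 hw4).2
      refine hd ?_ (d1.mono (by omega))
      rcases hw3.lt_or_eq with h | rfl
      · exact (dy_of_E_between hS h1 dp h hw1).1.mono (by omega)
      · exact dp.mono (by omega)

/-- An edge inside another one with the same end is at most half as long. -/
theorem E_half {α : Type} {T : Tr α} {p q r s : ℚ} (h : (p, q) ∈ T.E) (h' : (r, s) ∈ T.E)
    (hlt : q - p < s - r) : q - p ≤ (s - r) / 2 := by
  obtain ⟨i, hi, -⟩ := E_dyadic h
  obtain ⟨j, hj, -⟩ := E_dyadic h'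
  rw [hi, hj] at hlt ⊢
  have : j < i := by
    by_contra hc
    push Not at hc
    exact absurd hlt (not_lt.2 (one_div_le_one_div_of_le (by positivity)
      (pow_le_pow_right₀ (by norm_num) hc)))
  rw [div_div, ← pow_succ]
  exact one_div_le_one_div_of_le (by positivity) (pow_le_pow_right₀ (by norm_num) this)

theorem dy_mid {k : ℕ} {x y : ℚ} {j : ℕ} (hx : Dy k x) (hy : Dy k y) (hj : k + 1 ≤ j) :
    Dy j ((x + y) / 2) := by
  obtain ⟨a, ha⟩ := hx
  obtain ⟨b, hb⟩ := hy
  exact Dy.mono ⟨a + b, by push_cast; rw [← ha, ← hb]; ring⟩ hj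

/-- If some vertex lies beyond `w v`, there is an edge across `w v`. It has bounded level because
`w` and `v` have, and it links `u, v` unless its inner end is `u` or lies inside `w u`, which bounds
the level of `u`. Otherwise a vertex between `w` and `u` remains, and an edge across `w u` plays the
same part. -/
theorem linked_or_dy_of_right {S : Tr Lab} {M k : ℕ} (hS : S.WL M) {u v w : ℚ} (hw : Dy k w)
    (hv : Dy k v) (huv : u < v) (h1 : (w, u) ∈ S.E) (h2 : (w, v) ∈ S.E) (l1 : S.Linked w u 2)
    (l2 : S.Linked w v 2) : S.Linked u v w ∨ Dy (k + 2 * M + 1) u := by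
  by_contra hc
  push Not at hc
  obtain ⟨hc, hd⟩ := hc
  apply hc
  rintro ⟨a, ha, ha1, ha2, ha3⟩ ⟨b, hb, hb1, hb2⟩
  have n2 : ∀ {x}, S.vs x → x ≠ 2 := fun hx e => by have := (vs_bounds hx).2; linarith
  have hwu := (E_bounds h1).2.1
  by_contra hcon
  push Not at hcon
  have hm : u ≤ (w + v) / 2 := by
    have := E_half h1 h2 (by linarith)
    linarith
  by_cases hbo : b < w ∨ v < b
  · obtain ⟨⟨p, q⟩, hh, hs, -⟩ := l2 ⟨a, ha, by linarith, ha2, n2 ha⟩ ⟨b, hb, hbo, n2 hb⟩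
    have hb := EF_bounds hS hh
    obtain ⟨dp, dq⟩ := dy_of_separates hS hh hw hv hs
    by_cases hx : Separates p q u v ∧ p ≠ w ∧ q ≠ w
    · exact hx.2.2 (hcon _ hh hx.1 hx.2.1)
    · have : (p = u ∨ q = u) ∨ (w < p ∧ p < u) ∨ (w < q ∧ q < u) := by
        unfold Separates at hs hx; grind
      rcases this with (rfl | rfl) | ⟨h3, h4⟩ | ⟨h3, h4⟩
      · exact hd (dp.mono (by omega))
      · exact hd (dq.mono (by omega))
      · exact hd ((dy_of_E_between hS h1 dp h3 h4).2.mono (by omega))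
      · exact hd ((dy_of_E_between hS h1 dq h3 h4).2.mono (by omega))
  · have hb' : w < b ∧ b < u := by grind
    obtain ⟨⟨p, q⟩, hh, hs, -⟩ := l1 ⟨b, hb, hb'.1, hb'.2, n2 hb⟩ ⟨v, (E_vs h2).2, Or.inr huv, n2 (E_vs h2).2⟩
    have hb := EF_bounds hS hh
    by_cases hx : Separates p q u v ∧ p ≠ w ∧ q ≠ w
    · exact hx.2.2 (hcon _ hh hx.1 hx.2.1)
    by_cases hq : q = v
    · subst hq
      have hp : w < p ∧ p < u := by unfold Separates at hs hx; grind
      -- The edge runs from inside `w u` to the pole `v`, so it does not cross `w v`. It passes over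
      -- the midpoint of `w v`, which has level `k + 1`, unless `u` is this midpoint. This is the
      -- reason for the `+ 1` in the bound.
      have dm := dy_mid hw hv le_rfl
      rcases hm.lt_or_eq with h | h
      · obtain ⟨dp, -⟩ := dy_of_between hS hh dm (by linarith) (by linarith)
        exact hd ((dy_of_E_between hS h1 dp hp.1 hp.2).2.mono (by omega))
      · rw [h] at hd
        exact hd (dm.mono (by omega))
    · have hs' : Separates p q w v := by unfold Separates at hs hx ⊢; grind
      obtain ⟨dp, dq⟩ := dy_of_separates hS hh hw hv hs'
      have : (w < p ∧ p < u) ∨ (w < q ∧ q < u) := by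
        unfold Separates at hs; grind
      rcases this with ⟨h3, h4⟩ | ⟨h3, h4⟩
      · exact hd ((dy_of_E_between hS h1 dp h3 h4).2.mono (by omega))
      · exact hd ((dy_of_E_between hS h1 dq h3 h4).2.mono (by omega))

/-- The mirror image of `linked_or_dy_of_right`. -/
theorem linked_or_dy_of_left {S : Tr Lab} {M k : ℕ} (hS : S.WL M) {u v w : ℚ} (hw : Dy k w)
    (hu : Dy k u) (huv : u < v) (h1 : (v, w) ∈ S.E) (h2 : (u, w) ∈ S.E) (l1 : S.Linked v w 2)
    (l2 : S.Linked u w 2) : S.Linked u v w ∨ Dy (k + 2 * M + 1) v := by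
  by_contra hc
  push Not at hc
  obtain ⟨hc, hd⟩ := hc
  apply hc
  rintro ⟨a, ha, ha1, ha2, ha3⟩ ⟨b, hb, hb1, hb2⟩
  have n2 : ∀ {x}, S.vs x → x ≠ 2 := fun hx e => by have := (vs_bounds hx).2; linarith
  have hwv := (E_bounds h1).2.1
  by_contra hcon
  push Not at hcon
  have hm : (u + w) / 2 ≤ v := by
    have := E_half h1 h2 (by linarith)
    linarith
  by_cases hbo : b < u ∨ w < b
  · obtain ⟨⟨p, q⟩, hh, hs, -⟩ := l2 ⟨a, ha, ha1, by linarith, n2 ha⟩ ⟨b, hb, hbo, n2 hb⟩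
    have hb := EF_bounds hS hh
    obtain ⟨dp, dq⟩ := dy_of_separates hS hh hu hw hs
    by_cases hx : Separates p q u v ∧ p ≠ w ∧ q ≠ w
    · exact hx.2.2 (hcon _ hh hx.1 hx.2.1)
    · have : (p = v ∨ q = v) ∨ (v < p ∧ p < w) ∨ (v < q ∧ q < w) := by
        unfold Separates at hs hx; grind
      rcases this with (rfl | rfl) | ⟨h3, h4⟩ | ⟨h3, h4⟩
      · exact hd (dp.mono (by omega))
      · exact hd (dq.mono (by omega))
      · exact hd ((dy_of_E_between hS h1 dp h3 h4).1.mono (by omega))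
      · exact hd ((dy_of_E_between hS h1 dq h3 h4).1.mono (by omega))
  · have hb' : v < b ∧ b < w := by grind
    obtain ⟨⟨p, q⟩, hh, hs, -⟩ := l1 ⟨b, hb, hb'.1, hb'.2, n2 hb⟩ ⟨u, (E_vs h2).1, Or.inl huv, n2 (E_vs h2).1⟩
    have hb := EF_bounds hS hh
    by_cases hx : Separates p q u v ∧ p ≠ w ∧ q ≠ w
    · exact hx.2.2 (hcon _ hh hx.1 hx.2.1)
    by_cases hq : p = u
    · subst hq
      have hp : v < q ∧ q < w := by unfold Separates at hs hx; grind
      have dm := dy_mid hu hw le_rfl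
      rcases hm.lt_or_eq with h | h
      · obtain ⟨-, dq⟩ := dy_of_between hS hh dm (by linarith) (by linarith)
        exact hd ((dy_of_E_between hS h1 dq hp.1 hp.2).1.mono (by omega))
      · rw [← h] at hd
        exact hd (dm.mono (by omega))
    · have hs' : Separates p q u w := by unfold Separates at hs hx ⊢; grind
      obtain ⟨dp, dq⟩ := dy_of_separates hS hh hu hw hs'
      have : (v < p ∧ p < w) ∨ (v < q ∧ q < w) := by
        unfold Separates at hs; grind
      rcases this with ⟨h3, h4⟩ | ⟨h3, h4⟩
      · exact hd ((dy_of_E_between hS h1 dp h3 h4).1.mono (by omega))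
      · exact hd ((dy_of_E_between hS h1 dq h3 h4).1.mono (by omega))

/-- A separator whose poles are adjacent to its third vertex has bounded level or is linked. -/
theorem linked_or_dy {S : Tr Lab} {M k : ℕ} (hS : S.WL M) {u v w : ℚ} (huv : u < v)
    (h1 : S.SE w u) (h2 : S.SE w v) (l : ∀ p q, (p, q) ∈ S.E → (p = w ∧ (q = u ∨ q = v)) ∨
      (q = w ∧ (p = u ∨ p = v)) → S.Linked p q 2)
    (hw : Dy k w) (hu : w < u → Dy k v) (hv : v < w → Dy k u) :
    S.Linked u v w ∨ (Dy (k + 2 * M + 1) u ∧ Dy (k + 2 * M + 1) v) := by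
  rcases h1 with h1 | h1 <;> rcases h2 with h2 | h2
  · have b := E_bounds h1
    rcases linked_or_dy_of_right hS hw (hu b.2.1) huv h1 h2 (l _ _ h1 (by simp))
      (l _ _ h2 (by simp)) with h | h
    · exact Or.inl h
    · exact Or.inr ⟨h, (hu b.2.1).mono (by omega)⟩
  · have b := (E_bounds h1).2.1
    have b' := (E_bounds h2).2.1
    linarith
  · exact linked_or_dy_of_opposite hS hw h1 h2 (l _ _ h1 (by simp))
      (l _ _ h2 (by simp))
  · have b := E_bounds h2
    rcases linked_or_dy_of_left hS hw (hv b.2.1) huv h2 h1 (l _ _ h2 (by simp))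
      (l _ _ h1 (by simp)) with h | h
    · exact Or.inl h
    · exact Or.inr ⟨(hv b.2.1).mono (by omega), h⟩

end Tr

/-! ### From a triangle to its children and back -/

theorem separates_affine {ε p q x y : ℚ} :
    Separates (2 * p - ε) (2 * q - ε) (2 * x - ε) (2 * y - ε) ↔ Separates p q x y := by
  simp only [Separates, sub_lt_sub_iff_right, mul_lt_mul_iff_right₀ (two_pos : (0 : ℚ) < 2)]

/-- A chord that avoids `w` and separates `u` from `v` separates one of them from `w`. -/
theorem Separates.trans {p q u v w : ℚ} (h : Separates p q u v) (h1 : p ≠ w) (h2 : q ≠ w) :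
    Separates p q w u ∨ Separates p q w v := by
  unfold Separates at *
  grind

namespace Tr

/-- `c` is the left or the right child, drawn below `(0, 1/2)` or `(1/2, 1)` respectively. -/
def IsChild (ε : ℚ) (c l r : Tr Lab) : Prop := (ε = 0 ∧ c = l) ∨ (ε = 1 ∧ c = r)

variable {ε : ℚ} {a : Lab} {c l r : Tr Lab} {M : ℕ}

namespace IsChild

theorem eps (h : IsChild ε c l r) : 0 ≤ ε ∧ ε ≤ 1 := by
  rcases h with ⟨rfl, -⟩ | ⟨rfl, -⟩ <;> norm_num

theorem wl (h : IsChild ε c l r) (hS : (node a l r).WL M) : c.WL M := by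
  rcases h with ⟨-, rfl⟩ | ⟨-, rfl⟩
  exacts [hS.2.1, hS.2.2]

theorem vs (h : IsChild ε c l r) {x : ℚ} (hx : c.vs (2 * x - ε)) : (node a l r).vs x := by
  rcases h with ⟨rfl, rfl⟩ | ⟨rfl, rfl⟩
  · exact Or.inl (by simpa using hx)
  · exact Or.inr hx

theorem vs_iff (h : IsChild ε c l r) {x : ℚ} (h0 : 0 ≤ 2 * x - ε) (h1 : 2 * x - ε ≤ 1) :
    (node a l r).vs x ↔ c.vs (2 * x - ε) := by
  rcases h with ⟨rfl, rfl⟩ | ⟨rfl, rfl⟩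
  · rw [vs_left (by linarith), sub_zero]
  · exact vs_right (by linarith)

theorem E (h : IsChild ε c l r) {x y : ℚ} (hx : (2 * x - ε, 2 * y - ε) ∈ c.E) :
    (x, y) ∈ (node a l r).E := by
  rcases h with ⟨rfl, rfl⟩ | ⟨rfl, rfl⟩
  · exact mem_E_node.2 (Or.inr (Or.inl (by simpa using hx)))
  · exact mem_E_node.2 (Or.inr (Or.inr hx))

theorem F (h : IsChild ε c l r) {x y : ℚ} (hx : (2 * x - ε, 2 * y - ε) ∈ c.F) :
    (x, y) ∈ (node a l r).F := by
  rcases h with ⟨rfl, rfl⟩ | ⟨rfl, rfl⟩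
  · exact mem_F_node.2 (Or.inr (Or.inl (by simpa using hx)))
  · exact mem_F_node.2 (Or.inr (Or.inr hx))

theorem EF (h : IsChild ε c l r) {x y : ℚ} (hx : (2 * x - ε, 2 * y - ε) ∈ c.EF) :
    (x, y) ∈ (node a l r).EF :=
  mem_EF.2 ((mem_EF.1 hx).imp h.E h.F)

/-- A chord within the polygon of `c` is crossed neither by the root edge nor by anything in the
other child. -/
theorem mem_EF_of_separates (h : IsChild ε c l r) (hS : (node a l r).WL M) {p q u v : ℚ}
    (hpq : (p, q) ∈ (node a l r).EF) (hs : Separates p q u v) (hu0 : 0 ≤ 2 * u - ε)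
    (hu1 : 2 * u - ε ≤ 1) (hv0 : 0 ≤ 2 * v - ε) (hv1 : 2 * v - ε ≤ 1) :
    (p, q) ∈ a ∨ (2 * p - ε, 2 * q - ε) ∈ c.EF := by
  have he := h.eps
  rcases mem_EF_node.1 hpq with h1 | ⟨rfl, rfl⟩ | h1 | h1
  · exact Or.inl h1
  · exfalso
    rcases hs with ⟨_, _, h | h⟩ | ⟨_, _, h | h⟩ <;> linarith
  · have b := EF_bounds hS.2.1 h1
    rcases h with ⟨rfl, rfl⟩ | ⟨rfl, rfl⟩
    · exact Or.inr (by simpa using h1)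
    · exfalso
      rcases hs with ⟨_, _, h | h⟩ | ⟨_, _, h | h⟩ <;> linarith
  · have b := EF_bounds hS.2.2 h1
    rcases h with ⟨rfl, rfl⟩ | ⟨rfl, rfl⟩
    · exfalso
      rcases hs with ⟨_, _, h | h⟩ | ⟨_, _, h | h⟩ <;> linarith
    · exact Or.inr h1

/-- The child must supply its own vertex outside `[u, v]`, since the one that the node supplies may
lie in the other child. -/
theorem linked (h : IsChild ε c l r) (a : Lab) {u v w : ℚ}
    (hu0 : 0 ≤ 2 * u - ε) (hv1 : 2 * v - ε ≤ 1)
    (hb : ∃ b, c.vs b ∧ (b < 2 * u - ε ∨ 2 * v - ε < b) ∧ b ≠ 2 * w - ε)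
    (hL : c.Linked (2 * u - ε) (2 * v - ε) (2 * w - ε)) : (node a l r).Linked u v w := by
  rintro ⟨x, hx, hx1, hx2, hx3⟩ -
  obtain ⟨⟨p, q⟩, h1, h2, h3, h4⟩ := hL ⟨2 * x - ε, (h.vs_iff (by linarith) (by linarith)).1 hx,
    by linarith, by linarith, fun e => hx3 (by linarith)⟩ hb
  have e1 : p = 2 * ((p + ε) / 2) - ε := by ring
  have e2 : q = 2 * ((q + ε) / 2) - ε := by ring
  refine ⟨((p + ε) / 2, (q + ε) / 2), h.EF (by rw [← e1, ← e2]; exact h1), ?_, ?_, ?_⟩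
  · rw [← separates_affine (ε := ε), ← e1, ← e2]; exact h2
  · intro e; apply h3; rw [← e]; ring
  · intro e; apply h4; rw [← e]; ring

/-- The link gets lost on the way down only if it is a chord in the label of the node, which `hn`
excludes. -/
theorem linked_child (h : IsChild ε c l r) (hS : (node a l r).WL M) {u v w : ℚ} (huv : u < v)
    (hu0 : 0 ≤ 2 * u - ε) (hv1 : 2 * v - ε ≤ 1)
    (hn : ∀ p q, (p, q) ∈ a → Separates p q u v → p ≠ w → q ≠ w → False)
    (hL : (node a l r).Linked u v w) : c.Linked (2 * u - ε) (2 * v - ε) (2 * w - ε) := by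
  rintro ⟨x, hx, hx1, hx2, hx3⟩ ⟨y, hy, hy1, hy2⟩
  have e1 : x = 2 * ((x + ε) / 2) - ε := by ring
  have e2 : y = 2 * ((y + ε) / 2) - ε := by ring
  obtain ⟨⟨p, q⟩, h1, h2, h3, h4⟩ := hL
    ⟨(x + ε) / 2, h.vs (by rw [← e1]; exact hx), by linarith, by linarith,
      fun e => hx3 (by linarith)⟩
    ⟨(y + ε) / 2, h.vs (by rw [← e2]; exact hy), hy1.imp (by intro _; linarith)
      (by intro _; linarith), fun e => hy2 (by linarith)⟩
  rcases h.mem_EF_of_separates hS h1 h2 hu0 (by linarith) (by linarith) hv1 with h5 | h5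
  · exact (hn p q h5 h2 h3 h4).elim
  · exact ⟨_, h5, separates_affine.2 h2, fun e => h3 (by simp only at e ⊢; linarith),
      fun e => h4 (by simp only at e ⊢; linarith)⟩

theorem crossCount_le (h : IsChild ε c l r) (x y : ℚ) :
    c.crossCount (2 * x - ε, 2 * y - ε) ≤ (node a l r).crossCount (x, y) := by
  classical
  refine Finset.card_le_card_of_injOn (fun e => ((e.1 + ε) / 2, (e.2 + ε) / 2)) ?_ ?_
  · rintro ⟨p, q⟩ hpq
    simp only [Finset.coe_filter, Set.mem_ofPred_eq] at hpq ⊢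
    have e1 : p = 2 * ((p + ε) / 2) - ε := by ring
    have e2 : q = 2 * ((q + ε) / 2) - ε := by ring
    refine ⟨h.EF (by rw [← e1, ← e2]; exact hpq.1), ?_⟩
    rw [← separates_affine (ε := ε), ← e1, ← e2]
    exact hpq.2
  · rintro ⟨p, q⟩ - ⟨p', q'⟩ - he
    simp only [Prod.mk.injEq] at he ⊢
    constructor <;> linarith [he.1, he.2]

theorem le_crossCount (h : IsChild ε c l r) (hS : (node a l r).WL M) {x y : ℚ}
    (hu0 : 0 ≤ 2 * x - ε) (hu1 : 2 * x - ε ≤ 1) (hv0 : 0 ≤ 2 * y - ε) (hv1 : 2 * y - ε ≤ 1)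
    (hn : ∀ p q, (p, q) ∈ a → ¬ Separates p q x y) :
    (node a l r).crossCount (x, y) ≤ c.crossCount (2 * x - ε, 2 * y - ε) := by
  classical
  refine Finset.card_le_card_of_injOn (fun e => (2 * e.1 - ε, 2 * e.2 - ε)) ?_ ?_
  · rintro ⟨p, q⟩ hpq
    simp only [Finset.coe_filter, Set.mem_ofPred_eq] at hpq ⊢
    refine ⟨?_, separates_affine.2 hpq.2⟩
    rcases h.mem_EF_of_separates hS hpq.1 hpq.2 hu0 hu1 hv0 hv1 with h5 | h5
    · exact (hn p q h5 hpq.2).elim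
    · exact h5
  · rintro ⟨p, q⟩ - ⟨p', q'⟩ - he
    simp only [Prod.mk.injEq] at he ⊢
    constructor <;> linarith [he.1, he.2]

theorem se (h : IsChild ε c l r) {x y : ℚ} (hx : c.SE (2 * x - ε) (2 * y - ε)) :
    (node a l r).SE x y :=
  hx.imp h.E h.E

end IsChild

theorem exists_child {x y : ℚ} (h : (x, y) ∈ (node a l r).E) (h0 : ¬ (x = 0 ∧ y = 1)) :
    ∃ ε c, IsChild ε c l r ∧ (2 * x - ε, 2 * y - ε) ∈ c.E := by
  rcases mem_E_node.1 h with h | h | h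
  · exact (h0 h).elim
  · exact ⟨0, l, Or.inl ⟨rfl, rfl⟩, by simpa using h⟩
  · exact ⟨1, r, Or.inr ⟨rfl, rfl⟩, h⟩

theorem exists_child_F {x y : ℚ} (h : (x, y) ∈ (node a l r).F) (h0 : (x, y) ∉ a) :
    ∃ ε c, IsChild ε c l r ∧ (2 * x - ε, 2 * y - ε) ∈ c.F := by
  rcases mem_F_node.1 h with h | h | h
  · exact (h0 h).elim
  · exact ⟨0, l, Or.inl ⟨rfl, rfl⟩, by simpa using h⟩
  · exact ⟨1, r, Or.inr ⟨rfl, rfl⟩, h⟩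

/-- Short edges contain no vertices of low level. -/
theorem not_between_of_short {α : Type} {S : Tr α} {x y z : ℚ} (h : (x, y) ∈ S.E)
    (hd : y - x ≤ 1 / 2 ^ M) (hz : Dy M z) (h1 : x < z) (h2 : z < y) : False := by
  obtain ⟨j, hj, hx, -⟩ := E_dyadic h
  rw [hj] at hd
  have : M ≤ j := by
    by_contra hc
    push Not at hc
    exact absurd hd (not_le.2 (one_div_lt_one_div_of_lt (by positivity)
      (pow_lt_pow_right₀ (by norm_num) hc)))
  exact Dy.not_between hx hj (hz.mono this) h1 h2

theorem not_separates_of_short {α : Type} {S : Tr α} {x y p q : ℚ} (h : (x, y) ∈ S.E)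
    (hd : y - x ≤ 1 / 2 ^ M) (hp : Dy M p) (hq : Dy M q) (hpq : p < q) : ¬ Separates p q x y := by
  intro hs
  have hxy := (E_bounds h).2.1
  rcases (separates_swap hpq hxy).1 hs with ⟨h1, h2, -⟩ | ⟨h1, h2, -⟩
  · exact not_between_of_short h hd hp h1 h2
  · exact not_between_of_short h hd hq h1 h2

theorem not_separates_of_short' {α : Type} {S : Tr α} {x y p q : ℚ} (h : S.SE x y)
    (hd : |y - x| ≤ 1 / 2 ^ M) (hp : Dy M p) (hq : Dy M q) (hpq : p < q) :
    ¬ Separates p q x y := by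
  rcases h with h | h
  · exact not_separates_of_short h ((le_abs_self _).trans hd) hp hq hpq
  · rw [separates_comm]
    exact not_separates_of_short h ((le_abs_self _).trans (by rwa [abs_sub_comm])) hp hq hpq

theorem dy_of_long {α : Type} {S : Tr α} {x y : ℚ} (h : (x, y) ∈ S.E)
    (hd : ¬ (y - x ≤ 1 / 2 ^ (M + 1))) : Dy M x ∧ Dy M y := by
  obtain ⟨j, hj, hx, hy⟩ := E_dyadic h
  rw [hj] at hd
  have : j ≤ M := by
    by_contra hc
    push Not at hc
    exact hd (one_div_le_one_div_of_le (by positivity) (pow_le_pow_right₀ (by norm_num) hc))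
  exact ⟨hx.mono this, hy.mono this⟩

theorem dy_of_long' {α : Type} {S : Tr α} {x y : ℚ} (h : S.SE x y)
    (hd : ¬ (|y - x| ≤ 1 / 2 ^ (M + 1))) : Dy M x ∧ Dy M y := by
  rcases h with h | h
  · rw [abs_of_pos (by linarith [(E_bounds h).2.1])] at hd
    exact dy_of_long h hd
  · rw [abs_sub_comm, abs_of_pos (by linarith [(E_bounds h).2.1])] at hd
    exact (dy_of_long h hd).symm

/-- Of the vertices `0`, `1/2`, `1` at most one lies in `[u, v]` and at most one is `w`. -/
theorem exists_vs_outside {α : Type} {T : Tr α} {x y u v w : ℚ} (hE : (x, y) ∈ T.E)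
    (hxy : y - x < 1) (huv : v - u ≤ 1 / 4) : ∃ b, T.vs b ∧ (b < u ∨ v < b) ∧ b ≠ w := by
  cases T with
  | leaf =>
    simp only [E, Finset.mem_singleton, Prod.mk.injEq] at hE
    rw [hE.1, hE.2] at hxy; norm_num at hxy
  | node a l r =>
    by_contra hc
    push Not at hc
    have h0 := hc 0 (vs_zero _)
    have h1 := hc 1 (vs_one _)
    have h2 := hc (1 / 2) (vs_half _ _ _)
    grind

theorem abs_affine {x y d : ℚ} : |2 * x - ε - (2 * y - ε)| ≤ d ↔ |x - y| ≤ d / 2 := by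
  have : 2 * x - ε - (2 * y - ε) = 2 * (x - y) := by ring
  rw [this, abs_mul, abs_two, le_div_iff₀ two_pos, mul_comm]

/-- Chords in the root label have ends of level `M`. An anchor of the child shrinks to length at
most `1 / 2 ^ (M + 1)` in the parent and has no point of level `M` inside, so the root label
contributes no link, and the links of the parent exist in the child. -/
theorem Good.child {k l' : ℕ} (h : IsChild ε c l r) (hS : (node a l r).WL M)
    (hG : (node a l r).Good k l' (1 / 2 ^ M)) : c.Good k l' (1 / 2 ^ M) := by
  have e : ∀ x : ℚ, x = 2 * ((x + ε) / 2) - ε := fun x => by ring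
  have hp : (0 : ℚ) < 1 / 2 ^ M := by positivity
  refine ⟨fun x y hF => ?_, fun x y hE => ?_, ?_, ?_⟩
  · rw [e x, e y] at hF
    have b := F_bounds (h.wl hS) hF
    obtain ⟨h1, h2⟩ := hG.1 _ _ (h.F hF)
    rw [h.vs_iff b.1 (by linarith)] at h1
    rw [h.vs_iff (by linarith) b.2.2.1] at h2
    rw [e x, e y]
    exact ⟨h1, h2⟩
  · rw [e x, e y] at hE ⊢
    exact (h.crossCount_le _ _).trans (hG.2.1 _ _ (h.EF hE))
  · rintro u v w ⟨h1, h2, h3⟩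
    rw [e u, e v] at h1
    have b := E_bounds h1
    have h1' := h.E (a := a) h1
    have hd : (v + ε) / 2 - (u + ε) / 2 ≤ 1 / 2 ^ M := by linarith
    have key : ∀ w, c.Linked u v w ∨ ¬ (node a l r).Linked ((u + ε) / 2) ((v + ε) / 2) ((w + ε) / 2) := by
      intro w
      by_cases hL : (node a l r).Linked ((u + ε) / 2) ((v + ε) / 2) ((w + ε) / 2)
      · left
        rw [e u, e v, e w]
        refine h.linked_child hS (by linarith) b.1 b.2.2 (fun p q ha hs _ _ => ?_) hL
        obtain ⟨g1, g2, g3, g4, g5, g6, -⟩ := hS.1 _ ha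
        simp only at g4 g5
        exact not_separates_of_short h1' hd g1 g2 (by linarith) hs
      · exact Or.inr hL
    rcases h3 with h3 | h3
    · exact (key w).resolve_right (not_not.2 (hG.2.2.1 _ _ _ ⟨h1', hd, Or.inl h3⟩))
    · refine linked_of_one_lt (h.wl hS) (w := 4) (by norm_num) h3 ((key 4).resolve_right
        (not_not.2 (hG.2.2.1 _ _ _ ⟨h1', hd, Or.inr ?_⟩)))
      linarith [h.eps.1]
  · rintro u v w ⟨h1, h2, h3, h4, h5, h6⟩
    have hb : ∀ x y, c.SE x y → 0 ≤ y ∧ y ≤ 1 := by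
      rintro x y (hxy | hxy)
      · have := E_bounds hxy; constructor <;> linarith
      · have := E_bounds hxy; constructor <;> linarith
    have bu := hb _ _ h3
    have bv := hb _ _ h4
    rw [e u, e w] at h3 h5
    rw [e v, e w] at h4 h6
    have h3' := h.se (a := a) h3
    have h4' := h.se (a := a) h4
    rw [abs_affine] at h5 h6
    rw [e u, e v, e w]
    refine h.linked_child hS (by linarith) (by linarith) (by linarith) (fun p q ha hs hpw hqw => ?_)
      (hG.2.2.2 _ _ _ ⟨h1, by linarith, h3', h4', by linarith, by linarith⟩)
    obtain ⟨g1, g2, g3, g4, g5, g6, -⟩ := hS.1 _ ha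
    simp only at g4 g5
    -- A chord across `u v` that avoids `w` crosses `w u` or `w v`, and both are short.
    rcases hs.trans hpw hqw with hs | hs
    · exact not_separates_of_short' h3' (by linarith) g1 g2 (by linarith) hs
    · exact not_separates_of_short' h4' (by linarith) g1 g2 (by linarith) hs

theorem crossCount_root {S : Tr Lab} (hS : S.WL M) : S.crossCount (0, 1) = 0 := by
  classical
  unfold crossCount
  rw [Finset.card_eq_zero, Finset.filter_eq_empty_iff]
  rintro ⟨x, y⟩ h
  have b := EF_bounds hS h
  unfold Separates
  grind

/-- An edge of length below `1` is not the root edge and belongs to a child. Two edges from `w` that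
belong to different children meet at the apex. -/
theorem SE_child_or {w u v : ℚ} (hu : (node a l r).SE w u) (hv : (node a l r).SE w v)
    (hu1 : |u - w| < 1) (hv1 : |v - w| < 1) :
    (∃ ε c, IsChild ε c l r ∧ c.SE (2 * w - ε) (2 * u - ε) ∧ c.SE (2 * w - ε) (2 * v - ε)) ∨
      (w = 1 / 2 ∧ ((u < w ∧ w < v) ∨ (v < w ∧ w < u))) := by
  have key : ∀ {x y : ℚ}, (node a l r).SE x y → |y - x| < 1 →
      l.SE (2 * x) (2 * y) ∨ r.SE (2 * x - 1) (2 * y - 1) := by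
    rintro x y (h | h) hd
    · rcases mem_E_node.1 h with ⟨rfl, rfl⟩ | h | h
      · norm_num at hd
      · exact Or.inl (Or.inl h)
      · exact Or.inr (Or.inl h)
    · rcases mem_E_node.1 h with ⟨rfl, rfl⟩ | h | h
      · norm_num at hd
      · exact Or.inl (Or.inr h)
      · exact Or.inr (Or.inr h)
  have bd : ∀ {α : Type} {T : Tr α} {x y : ℚ}, T.SE x y → 0 ≤ x ∧ x ≤ 1 ∧ 0 ≤ y ∧ y ≤ 1 ∧ x ≠ y := by
    rintro α T x y (h | h)
    · have := E_bounds h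
      exact ⟨by linarith, by linarith, by linarith, by linarith, fun e => by linarith⟩
    · have := E_bounds h
      exact ⟨by linarith, by linarith, by linarith, by linarith, fun e => by linarith⟩
  rcases key hu hu1 with h1 | h1 <;> rcases key hv hv1 with h2 | h2
  · exact Or.inl ⟨0, l, Or.inl ⟨rfl, rfl⟩, by simpa using h1, by simpa using h2⟩
  · right
    have b1 := bd h1
    have b2 := bd h2
    grind
  · right
    have b1 := bd h1
    have b2 := bd h2
    grind
  · exact Or.inl ⟨1, r, Or.inr ⟨rfl, rfl⟩, h1, h2⟩

/-- What lies deep is settled in a child, and the rest has bounded level, so that `Local` applies.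
The bound `3 ≤ M` ensures that a separator spans at most `1/4` of the child, as `exists_vs_outside`
requires. -/
theorem Good.node {k l' : ℕ} (hM : 3 ≤ M) (hS : (node a l r).WL M)
    (hL : l.Good k l' (1 / 2 ^ M)) (hR : r.Good k l' (1 / 2 ^ M))
    (h : (node a l r).Local k l' M) : (node a l r).Good k l' (1 / 2 ^ M) := by
  have hC : ∀ {ε c}, IsChild ε c l r → c.Good k l' (1 / 2 ^ M) := by
    rintro ε c (⟨-, rfl⟩ | ⟨-, rfl⟩) <;> assumption
  have hp : (1 : ℚ) / 2 ^ M ≤ 1 / 8 := by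
    have : (1 : ℚ) / 8 = 1 / 2 ^ 3 := by norm_num
    rw [this]
    exact one_div_le_one_div_of_le (by positivity) (pow_le_pow_right₀ (by norm_num) hM)
  have hps : (1 : ℚ) / 2 ^ (M + 1) = 1 / 2 ^ M / 2 := by rw [pow_succ]; field_simp
  have hI : ∀ u v w, (Tr.node a l r).AnchI k (1 / 2 ^ M) u v w → (Tr.node a l r).Linked u v w := by
    rintro u v w ⟨h1, h2, h3⟩
    -- Lengths double in the child, so these edges satisfy its bound. The remaining ones have length
    -- `1 / 2 ^ M` and ends of level `M`.
    by_cases hd : v - u ≤ 1 / 2 ^ (M + 1)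
    · obtain ⟨ε, c, hc, hE⟩ := exists_child h1 (by rintro ⟨rfl, rfl⟩; linarith)
      have b := E_bounds hE
      have he := hc.eps
      refine hc.linked a b.1 b.2.2 (exists_vs_outside hE (by linarith) (by linarith)) ?_
      exact (hC hc).2.2.1 _ _ _ ⟨hE, by linarith, h3.imp_right (by intro _; linarith)⟩
    · obtain ⟨d1, d2⟩ := dy_of_long h1 hd
      exact h.2.2.1 u v w ⟨h1, h2, h3⟩ (d1.mono (by omega)) (d2.mono (by omega))
  refine ⟨fun x y hF => ?_, fun x y hE => ?_, hI, ?_⟩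
  · by_cases ha : (x, y) ∈ a
    · obtain ⟨d1, d2, -⟩ := hS.1 _ ha
      exact h.1 x y hF d1 d2
    · obtain ⟨ε, c, hc, hF⟩ := exists_child_F hF ha
      obtain ⟨h1, h2⟩ := (hC hc).1 _ _ hF
      exact ⟨hc.vs h1, hc.vs h2⟩
  -- Only edges crossed by the root label have more crossings than in the child, and these edges
  -- have level at most `2 * M`.
  · by_cases ha : ∃ p q, (p, q) ∈ a ∧ Separates p q x y
    · obtain ⟨p, q, ha, hs⟩ := ha
      obtain ⟨d1, d2, g3, g4, g5, g6, -⟩ := hS.1 _ ha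
      simp only at g4 g5 d1 d2
      have bE := EF_bounds hS hE
      obtain ⟨e1, e2⟩ := dy_of_separates hS hE d1 d2 ((separates_swap (by linarith) bE.2.1).1 hs)
      exact h.2.1 x y hE (e1.mono (by omega)) (e2.mono (by omega))
    · push Not at ha
      by_cases ha' : (x, y) ∈ a
      · obtain ⟨d1, d2, -⟩ := hS.1 _ ha'
        exact h.2.1 x y hE (d1.mono (by omega)) (d2.mono (by omega))
      by_cases h0 : x = 0 ∧ y = 1
      · rw [h0.1, h0.2, crossCount_root hS]; exact Nat.zero_le _
      · have : ∃ ε c, IsChild ε c l r ∧ (2 * x - ε, 2 * y - ε) ∈ c.EF := by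
          rcases mem_EF.1 hE with hE | hE
          · obtain ⟨ε, c, hc, hE⟩ := exists_child hE h0
            exact ⟨ε, c, hc, mem_EF.2 (Or.inl hE)⟩
          · obtain ⟨ε, c, hc, hE⟩ := exists_child_F hE ha'
            exact ⟨ε, c, hc, mem_EF.2 (Or.inr hE)⟩
        obtain ⟨ε, c, hc, hE⟩ := this
        have b := EF_bounds (hc.wl hS) hE
        exact (hc.le_crossCount hS b.1 (by linarith) (by linarith) b.2.2 ha).trans
          ((hC hc).2.1 _ _ hE)
  · rintro u v w ⟨hk, huv, h1, h2, h3, h4⟩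
    by_cases hdd : (∃ ε c, IsChild ε c l r ∧ c.SE (2 * w - ε) (2 * u - ε) ∧
        c.SE (2 * w - ε) (2 * v - ε)) ∧ |u - w| ≤ 1 / 2 ^ (M + 1) ∧ |v - w| ≤ 1 / 2 ^ (M + 1)
    · obtain ⟨⟨ε, c, hc, g1, g2⟩, g3, g4⟩ := hdd
      have hb : ∀ x y, c.SE x y → |y - x| ≤ 1 / 8 → 0 ≤ y ∧ y ≤ 1 ∧ ∃ p q, (p, q) ∈ c.E ∧ q - p < 1 := by
        rintro x y (hxy | hxy) hd
        · have := E_bounds hxy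
          have := abs_le.1 hd
          exact ⟨by linarith, by linarith, _, _, hxy, by linarith⟩
        · have := E_bounds hxy
          have := abs_le.1 hd
          exact ⟨by linarith, by linarith, _, _, hxy, by linarith⟩
      have f1 : |2 * u - ε - (2 * w - ε)| ≤ 1 / 2 ^ M := by rw [abs_affine]; linarith
      have f2 : |2 * v - ε - (2 * w - ε)| ≤ 1 / 2 ^ M := by rw [abs_affine]; linarith
      obtain ⟨b1, b2, p, q, hpq, hpq1⟩ := hb _ _ g1 (f1.trans hp)
      obtain ⟨b3, b4, -⟩ := hb _ _ g2 (f2.trans hp)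
      refine hc.linked a b1 b4 (exists_vs_outside hpq hpq1 ?_)
        ((hC hc).2.2.2 _ _ _ ⟨hk, by linarith, g1, g2, f1, f2⟩)
      have := abs_le.1 f1
      have := abs_le.1 f2
      linarith
    · have hl : ∀ p q, (p, q) ∈ (Tr.node a l r).E → (p = w ∧ (q = u ∨ q = v)) ∨
          (q = w ∧ (p = u ∨ p = v)) → (Tr.node a l r).Linked p q 2 := by
        intro p q hE hw
        have b := E_bounds hE
        refine hI p q 2 ⟨hE, ?_, Or.inr (by norm_num)⟩
        have a1 := abs_le.1 h3
        have a2 := abs_le.1 h4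
        rcases hw with ⟨rfl, rfl | rfl⟩ | ⟨rfl, rfl | rfl⟩ <;> linarith
      -- Either one of the edges at `w` is long, or `w` is the apex `1/2` with the poles on both
      -- sides. If the poles lie on the same side of `w`, the edge to the farther pole is the long
      -- one, and that pole has level `M`.
      have hlev : Dy M w ∧ (w < u → Dy M v) ∧ (v < w → Dy M u) := by
        rcases SE_child_or h1 h2 (by linarith) (by linarith) with hch | ⟨rfl, hch⟩
        · have : ¬ (|u - w| ≤ 1 / 2 ^ (M + 1) ∧ |v - w| ≤ 1 / 2 ^ (M + 1)) := fun hh => hdd ⟨hch, hh⟩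
          rw [not_and_or] at this
          refine ⟨?_, fun hw => ?_, fun hw => ?_⟩
          · rcases this with ht | ht
            · exact (dy_of_long' h1 ht).1
            · exact (dy_of_long' h2 ht).1
          · refine (dy_of_long' h2 fun ht => ?_).2
            rcases this with ht' | ht'
            · apply ht'
              rw [abs_of_pos (by linarith)] at ht ⊢
              linarith
            · exact ht' ht
          · refine (dy_of_long' h1 fun ht => ?_).2
            rcases this with ht' | ht'
            · exact ht' ht
            · apply ht'
              rw [abs_sub_comm, abs_of_pos (by linarith)] at ht ⊢
              linarith
        · refine ⟨Dy.half (by omega), fun _ => ?_, fun _ => ?_⟩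
          · exfalso; rcases hch with hh | hh <;> linarith
          · exfalso; rcases hch with hh | hh <;> linarith
      rcases linked_or_dy hS huv h1 h2 hl hlev.1 hlev.2.1 hlev.2.2 with hL | ⟨d1, d2⟩
      · exact hL
      · exact h.2.2.2 u v w ⟨hk, huv, h1, h2, h3, h4⟩ (d1.mono (by omega)) (d2.mono (by omega))
          (hlev.1.mono (by omega))

/-- Induction on the tree: `Good.node` leads from the children to the node, `Good.child` back. In a
leaf the only edge has length `1` and anchors nothing. -/
theorem localAll_iff_good {k l' : ℕ} (hM : 3 ≤ M) {S : Tr Lab} (hS : S.WL M) :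
    S.LocalAll k l' M ↔ S.Good k l' (1 / 2 ^ M) := by
  induction S with
  | leaf =>
    have hp : (1 : ℚ) / 2 ^ M < 1 := by
      rw [div_lt_one (by positivity)]
      exact one_lt_pow₀ (by norm_num) (by omega)
    refine ⟨fun _ => ⟨by simp [F], ?_, ?_, ?_⟩, fun _ => trivial⟩
    · intro x y h
      simp only [EF, E, F, Finset.union_empty, Finset.mem_singleton] at h
      rw [h, crossCount_root hS]; exact Nat.zero_le _
    · rintro u v w ⟨h1, h2, -⟩
      simp only [E, Finset.mem_singleton, Prod.mk.injEq] at h1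
      rw [h1.1, h1.2] at h2; linarith
    · rintro u v w ⟨-, -, h1, -, h2, -⟩
      exfalso
      simp only [SE, E, Finset.mem_singleton, Prod.mk.injEq] at h1
      rcases h1 with ⟨rfl, rfl⟩ | ⟨rfl, rfl⟩
      · rw [sub_zero, abs_one] at h2; linarith
      · rw [zero_sub, abs_neg, abs_one] at h2; linarith
  | node a l r ihl ihr =>
    constructor
    · rintro ⟨h1, h2, h3⟩
      exact Good.node hM hS ((ihl hS.2.1).1 h2) ((ihr hS.2.2).1 h3) h1
    · intro h
      exact ⟨⟨fun x y hF _ _ => h.1 x y hF, fun x y hF _ _ => h.2.1 x y hF,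
        fun u v w hA _ _ => h.2.2.1 u v w hA, fun u v w hA _ _ _ => h.2.2.2 u v w hA⟩,
        (ihl hS.2.1).2 (h.child (Or.inl ⟨rfl, rfl⟩) hS),
        (ihr hS.2.2).2 (h.child (Or.inr ⟨rfl, rfl⟩) hS)⟩

/-- Globally good labelled trees are recognized by windows of bounded depth. -/
theorem good_one_iff {k l' : ℕ} (hM : 3 ≤ M) {S : Tr Lab} (hS : S.WL M) :
    S.Good k l' 1 ↔ S.LocalAll k l' M ∧ S.LocalRoot k M := by
  rw [localAll_iff_good hM hS]
  have hp : (1 : ℚ) / 2 ^ M ≤ 1 := by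
    rw [div_le_one (by positivity)]
    exact one_le_pow₀ (by norm_num)
  constructor
  · intro h
    exact ⟨⟨h.1, h.2.1, fun u v w ⟨h1, h2, h3⟩ => h.2.2.1 u v w ⟨h1, h2.trans hp, h3⟩,
      fun u v w ⟨h0, h1, h2, h3, h4, h5⟩ =>
        h.2.2.2 u v w ⟨h0, h1, h2, h3, h4.trans hp, h5.trans hp⟩⟩,
      fun u v w hA _ _ => h.2.2.1 u v w hA, fun u v w hA _ _ _ => h.2.2.2 u v w hA⟩
  · rintro ⟨h, hr⟩
    have hps : (1 : ℚ) / 2 ^ (M + 1) ≤ 1 / 2 ^ M :=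
      one_div_le_one_div_of_le (by positivity) (pow_le_pow_right₀ (by norm_num) (by omega))
    have hI : ∀ u v w, S.AnchI k 1 u v w → S.Linked u v w := by
      rintro u v w ⟨h1, h2, h3⟩
      -- The longer edges have ends of level `M`, so they are within the reach of `LocalRoot`.
      by_cases hd : v - u ≤ 1 / 2 ^ (M + 1)
      · exact h.2.2.1 u v w ⟨h1, hd.trans hps, h3⟩
      · obtain ⟨d1, d2⟩ := dy_of_long h1 hd
        exact hr.1 u v w ⟨h1, h2, h3⟩ (d1.mono (by omega)) (d2.mono (by omega))
    refine ⟨h.1, h.2.1, hI, ?_⟩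
    rintro u v w ⟨hk, huv, h1, h2, h3, h4⟩
    by_cases hdd : |u - w| ≤ 1 / 2 ^ (M + 1) ∧ |v - w| ≤ 1 / 2 ^ (M + 1)
    · exact h.2.2.2 u v w ⟨hk, huv, h1, h2, hdd.1.trans hps, hdd.2.trans hps⟩
    · rw [not_and_or] at hdd
      have hlev : Dy M w ∧ (w < u → Dy M v) ∧ (v < w → Dy M u) := by
        refine ⟨?_, fun hw => ?_, fun hw => ?_⟩
        · rcases hdd with ht | ht
          · exact (dy_of_long' h1 ht).1
          · exact (dy_of_long' h2 ht).1
        · refine (dy_of_long' h2 fun ht => ?_).2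
          rcases hdd with ht' | ht'
          · apply ht'
            rw [abs_of_pos (by linarith)] at ht ⊢
            linarith
          · exact ht' ht
        · refine (dy_of_long' h1 fun ht => ?_).2
          rcases hdd with ht' | ht'
          · exact ht' ht
          · apply ht'
            rw [abs_sub_comm, abs_of_pos (by linarith)] at ht ⊢
            linarith
      have hl : ∀ p q, (p, q) ∈ S.E → (p = w ∧ (q = u ∨ q = v)) ∨
          (q = w ∧ (p = u ∨ p = v)) → S.Linked p q 2 := by
        intro p q hE _
        have b := E_bounds hE
        exact hI p q 2 ⟨hE, by linarith, Or.inr (by norm_num)⟩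
      rcases linked_or_dy hS huv h1 h2 hl hlev.1 hlev.2.1 hlev.2.2 with hL | ⟨d1, d2⟩
      · exact hL
      · exact hr.2 u v w ⟨hk, huv, h1, h2, h3, h4⟩ (d1.mono (by omega)) (d2.mono (by omega))
          (hlev.1.mono (by omega))

end Tr

/-! ### Separators at triangles suffice; sets of chords as labels -/

namespace Tr

variable {M : ℕ}

/-- An old edge across `w u` cannot cross `p q`, so it would cross `u v` and avoid `w`, against
`hn`. Being uncrossed, `w u` is an edge by maximality. -/
theorem SE_of_blocked {α : Type} {S : Tr α} {u v w p q : ℚ} (hu : S.vs u) (hE : (p, q) ∈ S.E)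
    (hs : Separates p q u v) (hw : w = p ∨ w = q)
    (hn : ∀ p' q', (p', q') ∈ S.E → Separates p' q' u v → p' = w ∨ q' = w) : S.SE w u := by
  have hvw : S.vs w := by rcases hw with rfl | rfl; exacts [(E_vs hE).1, (E_vs hE).2]
  have hwu : w ≠ u := by
    rintro rfl
    unfold Separates at hs
    grind
  have key : ∀ p' q', (p', q') ∈ S.E → ¬ Separates p' q' w u := by
    intro p' q' hE' hs'
    have h1 := E_not_separates hE hE'
    have b := (E_bounds hE).2.1
    have b' := (E_bounds hE').2.1
    have : Separates p' q' u v ∧ p' ≠ w ∧ q' ≠ w := by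
      unfold Separates at *
      grind
    rcases hn p' q' hE' this.1 with h | h
    exacts [this.2.1 h, this.2.2 h]
  by_contra hc
  unfold SE at hc
  push Not at hc
  rcases lt_or_gt_of_ne hwu with h | h
  · obtain ⟨p', q', hE', hs'⟩ := exists_E_separates hvw hu h hc.1
    exact key p' q' hE' hs'
  · obtain ⟨p', q', hE', hs'⟩ := exists_E_separates hu hvw h hc.2
    exact key p' q' hE' (separates_comm.1 hs')

theorem SE.bounds {α : Type} {S : Tr α} {x y : ℚ} (h : S.SE x y) :
    0 ≤ x ∧ x ≤ 1 ∧ 0 ≤ y ∧ y ≤ 1 := by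
  rcases h with h | h
  · have := E_bounds h
    exact ⟨by linarith, by linarith, by linarith, by linarith⟩
  · have := E_bounds h
    exact ⟨by linarith, by linarith, by linarith, by linarith⟩

/-- It suffices to check separators at triangles. -/
theorem Good.linked {k l : ℕ} {S : Tr Lab} (hG : S.Good k l 1) {u v w : ℚ}
    (hu : S.vs u) (hv : S.vs v) (huv : u < v) (hw : k = 4 ∨ 1 < w) : S.Linked u v w := by
  have bu := vs_bounds hu
  have bv := vs_bounds hv
  by_cases hE : (u, v) ∈ S.E
  · exact hG.2.2.1 u v w ⟨hE, by linarith, hw⟩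
  -- Either all old edges across `u v` pass through `w`, which is then adjacent to both poles, or
  -- one of them avoids `w` and is the required link.
  by_cases hn : ∀ p' q', (p', q') ∈ S.E → Separates p' q' u v → p' = w ∨ q' = w
  · obtain ⟨p, q, hE', hs⟩ := exists_E_separates hu hv huv hE
    have hwp : w = p ∨ w = q := (hn p q hE' hs).imp Eq.symm Eq.symm
    have h1 := SE_of_blocked hu hE' hs hwp hn
    have h2 := SE_of_blocked hv hE' (separates_comm.1 hs) hwp
      (fun p' q' h h' => hn p' q' h (separates_comm.1 h'))
    have bw := h1.bounds
    refine hG.2.2.2 u v w ⟨hw.resolve_right (by linarith), huv, h1, h2, ?_, ?_⟩ <;>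
    · rw [abs_le]; constructor <;> linarith
  · push Not at hn
    obtain ⟨p, q, h1, h2, h3⟩ := hn
    exact fun _ _ => ⟨(p, q), mem_EF.2 (Or.inl h1), h2, h3⟩

/-! ### Labelled trees from sets of chords -/

def cost : Tr Lab → ℕ
  | leaf => 0
  | node a l r => a.card + l.cost + r.cost

noncomputable def chords : Tr Lab → List (ℚ × ℚ)
  | leaf => []
  | node a l r => a.toList ++ (l.chords.map goL ++ r.chords.map goR)

theorem mem_chords {S : Tr Lab} {e : ℚ × ℚ} : e ∈ S.chords ↔ e ∈ S.F := by
  induction S generalizing e with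
  | leaf => simp [chords, F]
  | node a l r ihl ihr => simp [chords, F, ihl, ihr]

theorem length_chords (S : Tr Lab) : S.chords.length = S.cost := by
  induction S with
  | leaf => rfl
  | node a l r ihl ihr => simp [chords, cost, ihl, ihr, add_assoc]

/-- The chords in the label pass over `1/2` and those of the children stay on one side of it, so the
three groups are disjoint. -/
theorem nodup_chords {S : Tr Lab} (hS : S.WL M) : S.chords.Nodup := by
  induction S with
  | leaf => exact List.nodup_nil
  | node a l r ihl ihr =>
    have hl : ∀ e ∈ l.chords.map goL, e.2 ≤ 1 / 2 := by
      intro e he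
      obtain ⟨⟨x, y⟩, h, rfl⟩ := List.mem_map.1 he
      have := F_bounds hS.2.1 (mem_chords.1 h)
      simp only [goL]; linarith
    have hr : ∀ e ∈ r.chords.map goR, 1 / 2 ≤ e.1 := by
      intro e he
      obtain ⟨⟨x, y⟩, h, rfl⟩ := List.mem_map.1 he
      have := F_bounds hS.2.2 (mem_chords.1 h)
      simp only [goR]; linarith
    have hlt : ∀ e ∈ l.chords.map goL, e.1 < e.2 := by
      intro e he
      obtain ⟨⟨x, y⟩, h, rfl⟩ := List.mem_map.1 he
      have := F_bounds hS.2.1 (mem_chords.1 h)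
      simp only [goL]; linarith
    rw [chords, List.nodup_append', List.nodup_append']
    refine ⟨Finset.nodup_toList a, ⟨(ihl hS.2.1).map goL_injective, (ihr hS.2.2).map goR_injective,
      fun e he he' => ?_⟩, fun e he he' => ?_⟩
    · have := hl e he
      have := hr e he'
      have := hlt e he
      linarith
    · obtain ⟨_, _, _, g1, g2, _⟩ := hS.1 e (Finset.mem_toList.1 he)
      rcases List.mem_append.1 he' with he' | he'
      · have := hl e he'; linarith
      · have := hr e he'; linarith

theorem card_F {S : Tr Lab} (hS : S.WL M) : S.F.card = S.cost := by
  have : S.F = S.chords.toFinset := by ext e; rw [List.mem_toFinset, mem_chords]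
  rw [this, List.toFinset_card_of_nodup (nodup_chords hS), length_chords]

theorem F_notMem_E {S : Tr Lab} (hS : S.WL M) {x y : ℚ} (h : (x, y) ∈ S.F) : (x, y) ∉ S.E := by
  induction S generalizing x y with
  | leaf => simp [F] at h
  | node a l r ihl ihr =>
    have b := F_bounds hS h
    intro hE
    rcases mem_E_node.1 hE with hE | hE | hE
    · exact b.2.2.2 hE
    · have c := E_bounds hE
      rcases mem_F_node.1 h with h | h | h
      · obtain ⟨_, _, _, g1, g2, _⟩ := hS.1 _ h
        simp only at g1 g2; linarith
      · exact ihl hS.2.1 h hE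
      · have := F_bounds hS.2.2 h; linarith
    · have c := E_bounds hE
      rcases mem_F_node.1 h with h | h | h
      · obtain ⟨_, _, _, g1, g2, _⟩ := hS.1 _ h
        simp only at g1 g2; linarith
      · have := F_bounds hS.2.1 h; linarith
      · exact ihr hS.2.2 h hE

/-- The labelled tree of a set of chords. -/
noncomputable def ofChords {α : Type} : Tr α → Finset (ℚ × ℚ) → Tr Lab
  | leaf, _ => leaf
  | node _ l r, Fs => node (Fs.filter fun e => e.1 < 1 / 2 ∧ 1 / 2 < e.2)
      (l.ofChords ((Fs.filter fun e => e.2 ≤ 1 / 2).image fun e => (2 * e.1, 2 * e.2)))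
      (r.ofChords ((Fs.filter fun e => 1 / 2 ≤ e.1).image fun e => (2 * e.1 - 1, 2 * e.2 - 1)))

theorem map_ofChords {α : Type} (T : Tr α) (Fs : Finset (ℚ × ℚ)) :
    (T.ofChords Fs).map (fun _ => ()) = T.map (fun _ => ()) := by
  induction T generalizing Fs with
  | leaf => rfl
  | node a l r ihl ihr => simp [map, ofChords, ihl, ihr]

theorem E_map {α β : Type} (f : α → β) (T : Tr α) : (T.map f).E = T.E := by
  induction T with
  | leaf => rfl
  | node a l r ihl ihr => simp [map, E, ihl, ihr]

theorem vs_map {α β : Type} (f : α → β) (T : Tr α) (x : ℚ) : (T.map f).vs x ↔ T.vs x := by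
  induction T generalizing x with
  | leaf => rfl
  | node a l r ihl ihr => simp [map, vs, ihl, ihr]

/-- Equality after erasing the labels says that the trees have the same shape. -/
theorem E_congr {α β : Type} {S : Tr α} {T : Tr β}
    (h : S.map (fun _ => ()) = T.map (fun _ => ())) : S.E = T.E := by
  rw [← E_map (fun _ => ()) S, h, E_map]

theorem vs_congr {α β : Type} {S : Tr α} {T : Tr β}
    (h : S.map (fun _ => ()) = T.map (fun _ => ())) (x : ℚ) : S.vs x ↔ T.vs x := by
  rw [← vs_map (fun _ => ()) S, h, vs_map]

/-- A vertex of high level lies below many edges. -/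
theorem lt_card_above {α : Type} {T : Tr α} {x : ℚ} {j : ℕ} (hx : T.vs x) (hj : ¬ Dy j x) :
    j < (T.E.filter fun e => e.1 < x ∧ x < e.2).card := by
  induction j generalizing T x with
  | zero =>
    rw [Finset.card_pos]
    have b := vs_bounds hx
    refine ⟨(0, 1), Finset.mem_filter.2 ⟨root_mem_E T, ?_, ?_⟩⟩
    · exact lt_of_le_of_ne b.1 (fun h => hj (h ▸ Dy.zero _))
    · exact lt_of_le_of_ne b.2 (fun h => hj (h ▸ Dy.one _))
  | succ j ih =>
    have b := vs_bounds hx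
    have hmem : ((0, 1) : ℚ × ℚ) ∈ T.E.filter fun e => e.1 < x ∧ x < e.2 :=
      Finset.mem_filter.2 ⟨root_mem_E T, lt_of_le_of_ne b.1 (fun h => hj (h ▸ Dy.zero _)),
        lt_of_le_of_ne b.2 (fun h => hj (h ▸ Dy.one _))⟩
    cases T with
    | leaf => rcases hx with rfl | rfl; exacts [absurd (Dy.zero _) hj, absurd (Dy.one _) hj]
    | node a l r =>
      rw [← Finset.card_erase_add_one hmem]
      refine Nat.succ_lt_succ ?_
      rcases hx with hx | hx
      · refine (ih hx (fun h => hj (Dy.two_mul_iff.1 h))).trans_le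
          (Finset.card_le_card_of_injOn goL ?_ goL_injective.injOn)
        rintro ⟨p, q⟩ he
        simp only [Finset.coe_filter, Set.mem_ofPred_eq] at he
        have b := E_bounds he.1
        simp only [goL, Finset.coe_erase, Finset.coe_filter, Set.mem_sdiff, Set.mem_ofPred_eq,
          Set.mem_singleton_iff, Prod.mk.injEq]
        refine ⟨⟨mem_E_node.2 (Or.inr (Or.inl ?_)), by linarith, by linarith⟩, fun h => by linarith⟩
        convert he.1 using 2 <;> ring
      · refine (ih hx (fun h => hj (Dy.two_mul_sub_iff.1 h))).trans_le
          (Finset.card_le_card_of_injOn goR ?_ goR_injective.injOn)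
        rintro ⟨p, q⟩ he
        simp only [Finset.coe_filter, Set.mem_ofPred_eq] at he
        have b := E_bounds he.1
        simp only [goR, Finset.coe_erase, Finset.coe_filter, Set.mem_sdiff, Set.mem_ofPred_eq,
          Set.mem_singleton_iff, Prod.mk.injEq]
        refine ⟨⟨mem_E_node.2 (Or.inr (Or.inr ?_)), by linarith, by linarith⟩, fun h => by linarith⟩
        convert he.1 using 2 <;> ring

open Classical in
noncomputable def crossE {α : Type} (T : Tr α) (x y : ℚ) : ℕ :=
  (T.E.filter fun e => Separates e.1 e.2 x y).card

theorem crossE_left {α : Type} {a : α} {l r : Tr α} {x y : ℚ} :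
    l.crossE (2 * x) (2 * y) ≤ (node a l r).crossE x y := by
  classical
  refine Finset.card_le_card_of_injOn goL ?_ goL_injective.injOn
  rintro ⟨p, q⟩ he
  simp only [Finset.coe_filter, Set.mem_ofPred_eq, goL] at he ⊢
  have e1 : p = 2 * (p / 2) := by ring
  have e2 : q = 2 * (q / 2) := by ring
  rw [e1, e2, separates_two_mul] at he
  exact ⟨mem_E_node.2 (Or.inr (Or.inl he.1)), he.2⟩

theorem crossE_right {α : Type} {a : α} {l r : Tr α} {x y : ℚ} :
    r.crossE (2 * x - 1) (2 * y - 1) ≤ (node a l r).crossE x y := by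
  classical
  refine Finset.card_le_card_of_injOn goR ?_ goR_injective.injOn
  rintro ⟨p, q⟩ he
  simp only [Finset.coe_filter, Set.mem_ofPred_eq, goR] at he ⊢
  have e1 : p = 2 * ((1 + p) / 2) - 1 := by ring
  have e2 : q = 2 * ((1 + q) / 2) - 1 := by ring
  rw [e1, e2, separates_two_mul_sub] at he
  exact ⟨mem_E_node.2 (Or.inr (Or.inr he.1)), he.2⟩

/-- Every edge of the left child above `x` ends at `1/2` at the latest, hence separates `x` from
`y`. -/
theorem lt_crossE_left {α : Type} {a : α} {l r : Tr α} {x y : ℚ} {j : ℕ} (hx : (node a l r).vs x)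
    (hx2 : x < 1 / 2) (hy : 1 / 2 < y) (hj : ¬ Dy (j + 1) x) : j < (node a l r).crossE x y := by
  classical
  refine (lt_card_above ((vs_left hx2.le).1 hx) (fun h => hj (Dy.two_mul_iff.1 h))).trans_le
    (Finset.card_le_card_of_injOn goL ?_ goL_injective.injOn)
  rintro ⟨p, q⟩ he
  simp only [Finset.coe_filter, Set.mem_ofPred_eq, goL] at he ⊢
  have b := E_bounds he.1
  refine ⟨mem_E_node.2 (Or.inr (Or.inl ?_)), Or.inl ⟨by linarith, by linarith, Or.inr (by linarith)⟩⟩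
  convert he.1 using 2 <;> ring

theorem lt_crossE_right {α : Type} {a : α} {l r : Tr α} {x y : ℚ} {j : ℕ} (hy : (node a l r).vs y)
    (hx2 : x < 1 / 2) (hy2 : 1 / 2 < y) (hj : ¬ Dy (j + 1) y) : j < (node a l r).crossE x y := by
  classical
  refine (lt_card_above ((vs_right hy2.le).1 hy) (fun h => hj (Dy.two_mul_sub_iff.1 h))).trans_le
    (Finset.card_le_card_of_injOn goR ?_ goR_injective.injOn)
  rintro ⟨p, q⟩ he
  simp only [Finset.coe_filter, Set.mem_ofPred_eq, goR] at he ⊢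
  have b := E_bounds he.1
  refine ⟨mem_E_node.2 (Or.inr (Or.inr ?_)), Or.inr ⟨by linarith, by linarith, Or.inl (by linarith)⟩⟩
  convert he.1 using 2 <;> ring

/-- Chords that cross few edges come from a labelled tree. -/
theorem ofChords_spec {α : Type} {T : Tr α} {Fs : Finset (ℚ × ℚ)} {l' : ℕ} (hM : l' < M)
    (hF : ∀ x y, (x, y) ∈ Fs → T.vs x ∧ T.vs y ∧ x < y ∧ (x, y) ∉ T.E ∧ T.crossE x y ≤ l') :
    (T.ofChords Fs).WL M ∧ (T.ofChords Fs).F = Fs := by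
  induction T generalizing Fs with
  | leaf =>
    refine ⟨trivial, ?_⟩
    symm
    rw [ofChords, F, Finset.eq_empty_iff_forall_notMem]
    rintro ⟨x, y⟩ h
    obtain ⟨h1, h2, h3, h4, -⟩ := hF x y h
    apply h4
    rcases h1 with rfl | rfl <;> rcases h2 with rfl | rfl
    · exact absurd h3 (lt_irrefl _)
    · exact root_mem_E _
    · norm_num at h3
    · exact absurd h3 (lt_irrefl _)
  | node a l r ihl ihr =>
    obtain ⟨w1, f1⟩ := ihl (Fs := (Fs.filter fun e => e.2 ≤ 1 / 2).image fun e => (2 * e.1, 2 * e.2)) (by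
      intro x y h
      simp only [Finset.mem_image, Finset.mem_filter, Prod.mk.injEq, Prod.exists] at h
      obtain ⟨x, y, ⟨h1, h2⟩, rfl, rfl⟩ := h
      obtain ⟨g1, g2, g3, g4, g5⟩ := hF x y h1
      exact ⟨(vs_left (by linarith)).1 g1, (vs_left h2).1 g2, by linarith,
        fun h => g4 (mem_E_node.2 (Or.inr (Or.inl h))), crossE_left.trans g5⟩)
    obtain ⟨w2, f2⟩ := ihr (Fs := (Fs.filter fun e => 1 / 2 ≤ e.1).image fun e =>
        (2 * e.1 - 1, 2 * e.2 - 1)) (by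
      intro x y h
      simp only [Finset.mem_image, Finset.mem_filter, Prod.mk.injEq, Prod.exists] at h
      obtain ⟨x, y, ⟨h1, h2⟩, rfl, rfl⟩ := h
      obtain ⟨g1, g2, g3, g4, g5⟩ := hF x y h1
      exact ⟨(vs_right h2).1 g1, (vs_right (by linarith)).1 g2, by linarith,
        fun h => g4 (mem_E_node.2 (Or.inr (Or.inr h))), crossE_right.trans g5⟩)
    refine ⟨⟨?_, w1, w2⟩, ?_⟩
    · rintro ⟨x, y⟩ h
      simp only [Finset.mem_filter] at h
      obtain ⟨h1, h2, h3⟩ := h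
      obtain ⟨g1, g2, g3, g4, g5⟩ := hF x y h1
      refine ⟨?_, ?_, (vs_bounds g1).1, h2, h3, (vs_bounds g2).2, ?_⟩
      -- An end of level above `M` lies below more than `l'` edges that do not reach across `1/2`,
      -- and the chord crosses all of them.
      · by_contra hc
        have := lt_crossE_left (j := l') g1 h2 h3 (fun h => hc (h.mono hM))
        omega
      · by_contra hc
        have := lt_crossE_right (j := l') g2 h2 h3 (fun h => hc (h.mono hM))
        omega
      · intro he
        rw [he] at g4
        exact g4 (root_mem_E _)
    · ext ⟨x, y⟩
      rw [ofChords, mem_F_node, f1, f2]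
      simp only [Finset.mem_image, Finset.mem_filter, Prod.mk.injEq, Prod.exists]
      constructor
      · rintro (h | ⟨x', y', h, h1, h2⟩ | ⟨x', y', h, h1, h2⟩)
        · exact h.1
        · have e1 : x' = x := by linarith
          have e2 : y' = y := by linarith
          rw [← e1, ← e2]; exact h.1
        · have e1 : x' = x := by linarith
          have e2 : y' = y := by linarith
          rw [← e1, ← e2]; exact h.1
      · intro h
        by_cases h1 : y ≤ 1 / 2
        · exact Or.inr (Or.inl ⟨x, y, ⟨h, h1⟩, rfl, rfl⟩)
        by_cases h2 : 1 / 2 ≤ x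
        · exact Or.inr (Or.inr ⟨x, y, ⟨h, h2⟩, rfl, rfl⟩)
        · push Not at h1 h2
          exact Or.inl ⟨h, h2, h1⟩

end Tr

/-! ### Tree automata -/

/-- The automaton works bottom-up: `(a, q₁, q₂, q)` leads from the states of the left and the right
child to `q` at a node labelled `a`, and leaves have the state `start`. -/
structure Auto where
  trans : List (Lab × ℕ × ℕ × ℕ)
  start : ℕ
  final : List ℕ

/-- The labelled tree has a run that ends in the state `q`. -/
def Auto.Acc (A : Auto) : Tr Lab → ℕ → Prop
  | .leaf, q => q = A.start
  | .node a l r, q => ∃ q₁ q₂, (a, q₁, q₂, q) ∈ A.trans ∧ A.Acc l q₁ ∧ A.Acc r q₂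

namespace Tr

variable {M : ℕ}

theorem finite_dy (M : ℕ) : {x : ℚ | Dy M x ∧ 0 ≤ x ∧ x ≤ 1}.Finite := by
  refine ((Set.finite_Icc (0 : ℤ) (2 ^ M)).image fun z : ℤ => (z : ℚ) / 2 ^ M).subset ?_
  rintro x ⟨⟨z, hz⟩, h0, h1⟩
  have hp : (0 : ℚ) < 2 ^ M := by positivity
  refine ⟨z, ⟨?_, ?_⟩, ?_⟩
  · have : (0 : ℚ) ≤ z := by rw [← hz]; positivity
    exact_mod_cast this
  · have : (z : ℚ) ≤ 2 ^ M := by rw [← hz]; nlinarith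
    exact_mod_cast this
  · simp only; rw [← hz]; field_simp

theorem finite_goodLab (M : ℕ) : {a : Lab | GoodLab M a}.Finite := by
  have h := (finite_dy M).prod (finite_dy M)
  refine (h.toFinset.powerset.finite_toSet).subset ?_
  intro a ha
  simp only [Finset.coe_powerset, Set.mem_preimage, Set.mem_powerset_iff]
  intro e he
  obtain ⟨h1, h2, h3, h4, h5, h6, -⟩ := ha e he
  simp only [Set.Finite.coe_toFinset]
  exact ⟨⟨h1, h3, by linarith⟩, ⟨h2, by linarith, h6⟩⟩

/-- Windows have bounded depth and labels from a finite set. -/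
theorem finite_windows (M R : ℕ) : {W : Tr Lab | W.WL M ∧ W.trunc R = W}.Finite := by
  induction R with
  | zero =>
    refine (Set.finite_singleton leaf).subset ?_
    rintro W ⟨-, h⟩
    exact h.symm
  | succ R ih =>
    refine ((Set.finite_singleton leaf).union (((finite_goodLab M).prod (ih.prod ih)).image
      fun t => node t.1 t.2.1 t.2.2)).subset ?_
    rintro W ⟨h1, h2⟩
    cases W with
    | leaf => exact Or.inl rfl
    | node a l r =>
      simp only [trunc, node.injEq, true_and] at h2
      exact Or.inr ⟨(a, l, r), ⟨h1.1, ⟨h1.2.1, h2.1⟩, ⟨h1.2.2, h2.2⟩⟩, rfl⟩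

theorem trunc_node_trunc {R : ℕ} (a : Lab) (l r : Tr Lab) (hR : 0 < R) :
    (node a (l.trunc R) (r.trunc R)).trunc R = (node a l r).trunc R := by
  obtain ⟨R, rfl⟩ := Nat.exists_eq_succ_of_ne_zero hR.ne'
  simp only [Nat.succ_eq_add_one, trunc, node.injEq, true_and]
  exact ⟨trunc_trunc (by omega), trunc_trunc (by omega)⟩

/-- Children cut at depth `R` make up the node cut at depth `R + 1`, which shows everything on which
`Local` depends. -/
theorem local_window_iff {k l' R : ℕ} (hR : 4 * M + 3 ≤ R) {a : Lab} {l r : Tr Lab}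
    (hS : (node a l r).WL M) :
    (node a (l.trunc R) (r.trunc R)).Local k l' M ↔ (node a l r).Local k l' M := by
  have h : Agree (R + 1) (node a (l.trunc R) (r.trunc R)) (node a l r) :=
    agree_trunc (R := R + 1) hS
  have hS' : (node a (l.trunc R) (r.trunc R)).WL M := WL_trunc (R + 1) hS
  exact ⟨Agree.local hS' hS h (by omega), Agree.local hS hS' h.symm (by omega)⟩

/-- A finite tree automaton recognizes the good labelled trees. -/
theorem exists_auto (k l' M : ℕ) (hM : 3 ≤ M) : ∃ (A : Auto) (N : ℕ), A.start < N ∧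
    (∀ τ ∈ A.trans, GoodLab M τ.1 ∧ τ.2.1 < N ∧ τ.2.2.1 < N ∧ τ.2.2.2 < N ∧ τ.2.2.2 ≠ A.start) ∧
    (∀ q ∈ A.final, q < N) ∧
    ∀ S : Tr Lab, (∃ q ∈ A.final, A.Acc S q) ↔ S.WL M ∧ S.Good k l' 1 := by
  classical
  -- The tests concern separators of level `3 * M + 1`. Edges across them have level at most `4 * M
  -- + 1`, and vertices of level `3 * M + 3` suffice to see that a side is nonempty.
  set R := 4 * M + 3 with hR
  have hfin := finite_windows M R
  set s := hfin.toFinset with hs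
  have mem_s : ∀ {W : Tr Lab}, W ∈ s ↔ W.WL M ∧ W.trunc R = W := by
    intro W; rw [hs, Set.Finite.mem_toFinset]; rfl
  have trunc_s : ∀ {S : Tr Lab}, S.WL M → S.trunc R ∈ s := fun hS =>
    mem_s.2 ⟨WL_trunc R hS, trunc_trunc le_rfl⟩
  obtain ⟨code, hlt, hinj⟩ : ∃ code : Tr Lab → ℕ, (∀ W ∈ s, code W < s.card) ∧
      ∀ W ∈ s, ∀ W' ∈ s, code W = code W' → W = W' := by
    refine ⟨fun W => if h : W ∈ s then s.equivFin ⟨W, h⟩ else 0, ?_, ?_⟩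
    · intro W hW
      simp only [hW, dite_true]
      exact (s.equivFin ⟨W, hW⟩).2
    · intro W hW W' hW' h
      simp only [hW, hW', dite_true] at h
      have := s.equivFin.injective (Fin.ext h)
      simpa using this
  have hleaf : leaf ∈ s := mem_s.2 ⟨trivial, rfl⟩
  -- The state of a subtree is its window. A transition exists only if the node passes the local
  -- test; afterwards everything below depth `R` is forgotten.
  have hset : {τ : Lab × ℕ × ℕ × ℕ | ∃ a W₁ W₂, GoodLab M a ∧ W₁ ∈ s ∧ W₂ ∈ s ∧
      (node a W₁ W₂).Local k l' M ∧
      τ = (a, code W₁, code W₂, code ((node a W₁ W₂).trunc R))}.Finite := by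
    refine (((finite_goodLab M).prod (s.finite_toSet.prod s.finite_toSet)).image fun t =>
      (t.1, code t.2.1, code t.2.2, code ((node t.1 t.2.1 t.2.2).trunc R))).subset ?_
    rintro τ ⟨a, W₁, W₂, h1, h2, h3, -, rfl⟩
    exact ⟨(a, W₁, W₂), ⟨h1, h2, h3⟩, rfl⟩
  let A : Auto := ⟨hset.toFinset.toList, code leaf,
    ((s.filter fun W => W.LocalRoot k M).image code).toList⟩
  have memA : ∀ {τ}, τ ∈ A.trans ↔ ∃ a W₁ W₂, GoodLab M a ∧ W₁ ∈ s ∧ W₂ ∈ s ∧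
      (node a W₁ W₂).Local k l' M ∧
      τ = (a, code W₁, code W₂, code ((node a W₁ W₂).trunc R)) := by
    intro τ
    simp only [A, Finset.mem_toList, Set.Finite.mem_toFinset]
    rfl
  have node_s : ∀ {a W₁ W₂}, GoodLab M a → W₁ ∈ s → W₂ ∈ s → (node a W₁ W₂).trunc R ∈ s :=
    fun h1 h2 h3 => trunc_s ⟨h1, (mem_s.1 h2).1, (mem_s.1 h3).1⟩
  have acc : ∀ S q, A.Acc S q ↔ S.WL M ∧ S.LocalAll k l' M ∧ q = code (S.trunc R) := by
    intro S
    induction S with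
    | leaf => intro q; simp [Auto.Acc, WL, LocalAll, A]; rfl
    | node a l r ihl ihr =>
      intro q
      simp only [Auto.Acc, ihl, ihr]
      constructor
      · rintro ⟨q₁, q₂, ht, ⟨w1, l1, e1⟩, ⟨w2, l2, e2⟩⟩
        obtain ⟨a', W₁, W₂, g1, g2, g3, g4, he⟩ := memA.1 ht
        simp only [Prod.mk.injEq] at he
        obtain ⟨rfl, h1, h2, h3⟩ := he
        have E1 := hinj _ g2 _ (trunc_s w1) (h1.symm.trans e1)
        have E2 := hinj _ g3 _ (trunc_s w2) (h2.symm.trans e2)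
        subst E1 E2
        rw [trunc_node_trunc _ _ _ (by omega)] at h3
        exact ⟨⟨g1, w1, w2⟩, ⟨(local_window_iff le_rfl ⟨g1, w1, w2⟩).1 g4, l1, l2⟩, h3⟩
      · rintro ⟨hS, ⟨h1, h2, h3⟩, rfl⟩
        refine ⟨_, _, memA.2 ⟨a, l.trunc R, r.trunc R, hS.1, trunc_s hS.2.1, trunc_s hS.2.2,
          (local_window_iff le_rfl hS).2 h1, ?_⟩, ⟨hS.2.1, h2, rfl⟩, ⟨hS.2.2, h3, rfl⟩⟩
        rw [trunc_node_trunc _ _ _ (by omega)]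
  refine ⟨A, s.card, hlt _ hleaf, ?_, ?_, ?_⟩
  · intro τ hτ
    obtain ⟨a, W₁, W₂, g1, g2, g3, g4, rfl⟩ := memA.1 hτ
    refine ⟨g1, hlt _ g2, hlt _ g3, hlt _ (node_s g1 g2 g3), fun h => ?_⟩
    -- The window of a node is again a node because `R` is positive.
    have := hinj _ (node_s g1 g2 g3) _ hleaf h
    rw [hR] at this
    simp [trunc] at this
  · intro q hq
    simp only [A, Finset.mem_toList, Finset.mem_image, Finset.mem_filter] at hq
    obtain ⟨W, ⟨h1, -⟩, rfl⟩ := hq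
    exact hlt W h1
  · intro S
    constructor
    · rintro ⟨q, hq, ha⟩
      obtain ⟨w, hl, rfl⟩ := (acc S q).1 ha
      simp only [A, Finset.mem_toList, Finset.mem_image, Finset.mem_filter] at hq
      obtain ⟨W, ⟨h1, h2⟩, h3⟩ := hq
      have := hinj _ h1 _ (trunc_s w) h3
      subst this
      exact ⟨w, (good_one_iff hM w).2 ⟨hl, Agree.localRoot (WL_trunc R w) (agree_trunc w) le_rfl h2⟩⟩
    · rintro ⟨w, hG⟩
      obtain ⟨h1, h2⟩ := (good_one_iff hM w).1 hG
      refine ⟨code (S.trunc R), ?_, (acc S _).2 ⟨w, h1, rfl⟩⟩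
      simp only [A, Finset.mem_toList, Finset.mem_image, Finset.mem_filter]
      exact ⟨_, ⟨trunc_s w, Agree.localRoot w (agree_trunc w).symm le_rfl h2⟩, rfl⟩

end Tr

namespace Tr

/-! ### Connectivity -/

section Colour

variable {S : Tr Lab} {Z : Finset ℚ} {χ : ℚ → Prop} {M : ℕ}

/-- `χ` stands for membership in a component after the removal of `Z`. It does not change along a
stretch of the boundary without removed vertices. -/
theorem colour_path (hχ : ∀ x y, (x, y) ∈ S.EF → x ∉ Z → y ∉ Z → (χ x ↔ χ y)) {c d : ℚ}
    (hc : S.vs c) (hd : S.vs d) (hcd : c ≤ d) (h : ∀ z ∈ Z, ¬ (c ≤ z ∧ z ≤ d)) : χ c ↔ χ d := by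
  refine path_induction hc hd hcd fun x y hE h1 h2 => hχ x y (mem_EF.2 (Or.inl hE)) ?_ ?_
  · intro hz; exact h x hz ⟨h1, by linarith [(E_bounds hE).2.1]⟩
  · intro hz; exact h y hz ⟨by linarith [(E_bounds hE).2.1], h2⟩

/-- The way around the other side of the polygon: through `0`, the root edge and `1`. -/
theorem colour_wrap (hχ : ∀ x y, (x, y) ∈ S.EF → x ∉ Z → y ∉ Z → (χ x ↔ χ y)) {c d : ℚ}
    (hc : S.vs c) (hd : S.vs d) (h : ∀ z ∈ Z, c < z ∧ z < d) : χ c ↔ χ d := by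
  have bc := vs_bounds hc
  have bd := vs_bounds hd
  have h1 : χ 0 ↔ χ c := colour_path hχ (vs_zero S) hc bc.1 fun z hz hh => by
    have := h z hz; linarith
  have h2 : χ d ↔ χ 1 := colour_path hχ hd (vs_one S) bd.2 fun z hz hh => by
    have := h z hz; linarith
  have h3 : χ 0 ↔ χ 1 := hχ 0 1 (mem_EF.2 (Or.inl (root_mem_E S)))
    (fun hz => by have := h 0 hz; linarith) (fun hz => by have := h 1 hz; linarith)
  exact (h1.symm.trans h3).trans h2.symm

/-- Two removed vertices leave two arcs of the boundary, and an edge across `u v` joins them. -/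
theorem colour_two (hS : S.WL M) (hF : ∀ x y, (x, y) ∈ S.F → S.vs x ∧ S.vs y)
    (hχ : ∀ x y, (x, y) ∈ S.EF → x ∉ Z → y ∉ Z → (χ x ↔ χ y)) {u v : ℚ}
    (huv : u < v) (hZ : ∀ z, z ∈ Z ↔ z = u ∨ z = v) (hL : S.Linked u v 2) {i o : ℚ}
    (hi : S.vs i) (hi1 : u < i) (hi2 : i < v) (ho : S.vs o) (ho1 : o < u ∨ v < o) : χ i ↔ χ o := by
  have hEF : ∀ {x y}, (x, y) ∈ S.EF → S.vs x ∧ S.vs y := fun h =>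
    (mem_EF.1 h).elim E_vs (hF _ _)
  have inside : ∀ x y, S.vs x → S.vs y → x ≤ y → u < x → y < v → (χ x ↔ χ y) :=
    fun x y hx hy hxy h1 h2 => colour_path hχ hx hy hxy fun z hz hh => by
      rcases (hZ z).1 hz with rfl | rfl <;> linarith
  have inside' : ∀ x, S.vs x → u < x → x < v → (χ x ↔ χ i) := fun x hx h1 h2 => by
    rcases le_total x i with h | h
    · exact inside x i hx hi h h1 hi2
    · exact (inside i x hi hx h hi1 h2).symm
  have outside : ∀ x y, S.vs x → S.vs y → x ≤ y → (x < u ∨ v < x) → (y < u ∨ v < y) →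
      (χ x ↔ χ y) := by
    intro x y hx hy hxy h1 h2
    rcases h1 with h1 | h1
    · rcases h2 with h2 | h2
      · exact colour_path hχ hx hy hxy fun z hz hh => by
          rcases (hZ z).1 hz with rfl | rfl <;> linarith
      · exact colour_wrap hχ hx hy fun z hz => by
          rcases (hZ z).1 hz with rfl | rfl <;> constructor <;> linarith
    · exact colour_path hχ hx hy hxy fun z hz hh => by
          rcases (hZ z).1 hz with rfl | rfl <;> linarith
  have outside' : ∀ x, S.vs x → (x < u ∨ v < x) → (χ x ↔ χ o) := fun x hx h1 => by
    rcases le_total x o with h | h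
    · exact outside x o hx ho h h1 ho1
    · exact (outside o x ho hx h ho1 h1).symm
  have bi := vs_bounds hi
  have bo := vs_bounds ho
  obtain ⟨⟨x, y⟩, hE, hs, -⟩ := hL ⟨i, hi, hi1, hi2, fun e => by linarith⟩
    ⟨o, ho, ho1, fun e => by linarith⟩
  have b := EF_bounds hS hE
  obtain ⟨hx, hy⟩ := hEF hE
  have hxy := hχ x y hE
  rw [hZ, hZ] at hxy
  have : (u < x ∧ x < v ∧ (y < u ∨ v < y)) ∨ (u < y ∧ y < v ∧ (x < u ∨ v < x)) :=
    (separates_swap b.2.1 huv).1 hs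
  rcases this with ⟨h1, h2, h3⟩ | ⟨h1, h2, h3⟩
  · rw [← inside' x hx h1 h2, ← outside' y hy h3]
    exact hxy (by rintro (rfl | rfl) <;> linarith) (by rintro (rfl | rfl) <;> grind)
  · rw [← inside' y hy h1 h2, ← outside' x hx h3]
    exact (hxy (by rintro (rfl | rfl) <;> grind) (by rintro (rfl | rfl) <;> linarith)).symm

/-- The number of the arc between `s₁`, `s₂`, `s₃` that contains `x`. -/
def arc (s₁ s₂ s₃ x : ℚ) : ℕ := if x < s₁ ∨ s₃ < x then 0 else if x < s₂ then 1 else 2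

theorem arc_ne {s₁ s₂ s₃ x y z : ℚ} (h12 : s₁ < s₂) (h23 : s₂ < s₃)
    (hz : z = s₁ ∨ z = s₂ ∨ z = s₃) (hx : x < z) (hy : z < y) (hw : ¬ (x < s₁ ∧ s₃ < y)) :
    arc s₁ s₂ s₃ x ≠ arc s₁ s₂ s₃ y := by
  unfold arc
  rcases hz with rfl | rfl | rfl <;> split_ifs <;> grind

theorem arc_eq_zero {s₁ s₂ s₃ x : ℚ} : arc s₁ s₂ s₃ x = 0 ↔ x < s₁ ∨ s₃ < x := by
  unfold arc
  split_ifs <;> simp_all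

theorem arc_eq_one {s₁ s₂ s₃ x : ℚ} : arc s₁ s₂ s₃ x = 1 ↔ ¬ (x < s₁ ∨ s₃ < x) ∧ x < s₂ := by
  unfold arc
  split_ifs <;> simp_all

theorem arc_eq_two {s₁ s₂ s₃ x : ℚ} : arc s₁ s₂ s₃ x = 2 ↔ ¬ (x < s₁ ∨ s₃ < x) ∧ ¬ x < s₂ := by
  unfold arc
  split_ifs <;> simp_all

/-- Three removed vertices leave three arcs. By the link conditions the arcs of `c` and of `d`, if
distinct, are each joined to some other arc. If neither is joined to the other directly, both are
joined to the third. -/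
theorem colour_three (hS : S.WL M) (hF : ∀ x y, (x, y) ∈ S.F → S.vs x ∧ S.vs y)
    (hχ : ∀ x y, (x, y) ∈ S.EF → x ∉ Z → y ∉ Z → (χ x ↔ χ y)) {s₁ s₂ s₃ : ℚ}
    (h12 : s₁ < s₂) (h23 : s₂ < s₃) (hZ : ∀ z, z ∈ Z ↔ z = s₁ ∨ z = s₂ ∨ z = s₃)
    (l1 : S.Linked s₁ s₂ s₃) (l2 : S.Linked s₂ s₃ s₁) (l3 : S.Linked s₁ s₃ s₂) {c d : ℚ}
    (hc : S.vs c) (hd : S.vs d) (hcZ : c ∉ Z) (hdZ : d ∉ Z) : χ c ↔ χ d := by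
  have hEF : ∀ {x y}, (x, y) ∈ S.EF → S.vs x ∧ S.vs y := fun h =>
    (mem_EF.1 h).elim E_vs (hF _ _)
  have arc_le : ∀ x, arc s₁ s₂ s₃ x ≤ 2 := fun x => by unfold arc; split_ifs <;> omega
  have same' : ∀ x y, S.vs x → S.vs y → x ∉ Z → y ∉ Z → x ≤ y → arc s₁ s₂ s₃ x = arc s₁ s₂ s₃ y → (χ x ↔ χ y) := by
    intro x y hx hy hxZ hyZ hxy he
    rw [hZ] at hxZ hyZ
    by_cases hw : x < s₁ ∧ s₃ < y
    · exact colour_wrap hχ hx hy fun z hz => by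
        rcases (hZ z).1 hz with rfl | rfl | rfl <;> constructor <;> linarith
    · refine colour_path hχ hx hy hxy fun z hz hh => ?_
      have hz' := (hZ z).1 hz
      refine arc_ne h12 h23 hz' (lt_of_le_of_ne hh.1 ?_) (lt_of_le_of_ne hh.2 ?_) hw he
      · rintro rfl; exact hxZ hz'
      · rintro rfl; exact hyZ hz'
  have same : ∀ x y, S.vs x → S.vs y → x ∉ Z → y ∉ Z → arc s₁ s₂ s₃ x = arc s₁ s₂ s₃ y → (χ x ↔ χ y) := by
    intro x y hx hy hxZ hyZ he
    rcases le_total x y with h | h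
    · exact same' x y hx hy hxZ hyZ h he
    · exact (same' y x hy hx hyZ hxZ h he.symm).symm
  have link : ∀ i o, S.vs i → S.vs o → i ∉ Z → o ∉ Z → arc s₁ s₂ s₃ i ≠ arc s₁ s₂ s₃ o →
      ∃ x y, S.vs x ∧ S.vs y ∧ x ∉ Z ∧ y ∉ Z ∧ arc s₁ s₂ s₃ x = arc s₁ s₂ s₃ i ∧ arc s₁ s₂ s₃ y ≠ arc s₁ s₂ s₃ i ∧ (χ x ↔ χ y) := by
    intro i o hi ho hiZ hoZ hne
    have fin : ∀ u v w, (∀ x, x ∈ Z ↔ x = u ∨ x = v ∨ x = w) → S.Linked u v w → u < v →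
        (∃ a, S.vs a ∧ u < a ∧ a < v ∧ a ≠ w) → (∃ b, S.vs b ∧ (b < u ∨ v < b) ∧ b ≠ w) →
        ∃ x y, S.vs x ∧ S.vs y ∧ x ∉ Z ∧ y ∉ Z ∧ u < x ∧ x < v ∧ (y < u ∨ v < y) ∧ (χ x ↔ χ y) := by
      intro u v w hZ' hL huv hA hB
      obtain ⟨⟨x, y⟩, hE, hs, h1, h2⟩ := hL hA hB
      have b := EF_bounds hS hE
      obtain ⟨hx, hy⟩ := hEF hE
      have hxy := hχ x y hE
      rcases (separates_swap b.2.1 huv).1 hs with ⟨h3, h4, h5⟩ | ⟨h3, h4, h5⟩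
      · have hxZ : x ∉ Z := by rw [hZ']; simp only at h1; grind
        have hyZ : y ∉ Z := by rw [hZ']; simp only at h2; grind
        exact ⟨x, y, hx, hy, hxZ, hyZ, h3, h4, h5, hxy hxZ hyZ⟩
      · have hxZ : x ∉ Z := by rw [hZ']; simp only at h1; grind
        have hyZ : y ∉ Z := by rw [hZ']; simp only at h2; grind
        exact ⟨y, x, hy, hx, hyZ, hxZ, h3, h4, h5, (hxy hxZ hyZ).symm⟩
    have hiZ' := hiZ
    have hoZ' := hoZ
    rw [hZ] at hiZ' hoZ'
    by_cases h0 : i < s₁ ∨ s₃ < i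
    · rw [arc_eq_zero.2 h0] at hne ⊢
      rw [Ne, eq_comm, arc_eq_zero] at hne
      push Not at hne hoZ'
      obtain ⟨x, y, hx, hy, hxZ, hyZ, h1, h2, h3, h4⟩ := fin s₁ s₃ s₂ (fun z => by rw [hZ]; tauto)
        l3 (h12.trans h23) ⟨o, ho, lt_of_le_of_ne hne.1 hoZ'.1.symm,
          lt_of_le_of_ne hne.2 hoZ'.2.2, hoZ'.2.1⟩ ⟨i, hi, h0, by tauto⟩
      refine ⟨y, x, hy, hx, hyZ, hxZ, arc_eq_zero.2 h3, fun e => ?_, h4.symm⟩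
      rcases arc_eq_zero.1 e with e | e <;> linarith
    have h0' := h0
    push Not at h0' hiZ'
    by_cases h1 : i < s₂
    · rw [arc_eq_one.2 ⟨h0, h1⟩] at hne ⊢
      have ho' : o < s₁ ∨ s₂ < o := by
        by_contra hn
        push Not at hn hoZ'
        exact hne (arc_eq_one.2 ⟨by rintro (h | h) <;> linarith, lt_of_le_of_ne hn.2 hoZ'.2.1⟩).symm
      obtain ⟨x, y, hx, hy, hxZ, hyZ, g1, g2, h3, h4⟩ := fin s₁ s₂ s₃ hZ
        l1 h12 ⟨i, hi, lt_of_le_of_ne h0'.1 hiZ'.1.symm, h1, hiZ'.2.2⟩ ⟨o, ho, ho', by tauto⟩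
      refine ⟨x, y, hx, hy, hxZ, hyZ, arc_eq_one.2 ⟨by rintro (h | h) <;> linarith, g2⟩,
        fun e => ?_, h4⟩
      have := arc_eq_one.1 e
      rcases h3 with h3 | h3
      · exact this.1 (Or.inl h3)
      · linarith
    · rw [arc_eq_two.2 ⟨h0, h1⟩] at hne ⊢
      push Not at h1
      have ho' : o < s₂ ∨ s₃ < o := by
        by_contra hn
        push Not at hn hoZ'
        exact hne (arc_eq_two.2 ⟨by rintro (h | h) <;> linarith, by linarith⟩).symm
      obtain ⟨x, y, hx, hy, hxZ, hyZ, g1, g2, h3, h4⟩ := fin s₂ s₃ s₁ (fun z => by rw [hZ]; tauto)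
        l2 h23 ⟨i, hi, lt_of_le_of_ne h1 hiZ'.2.1.symm, lt_of_le_of_ne h0'.2 hiZ'.2.2, hiZ'.1⟩
        ⟨o, ho, ho', by tauto⟩
      refine ⟨x, y, hx, hy, hxZ, hyZ, arc_eq_two.2 ⟨by rintro (h | h) <;> linarith, by linarith⟩,
        fun e => ?_, h4⟩
      have := arc_eq_two.1 e
      rcases h3 with h3 | h3
      · exact this.2 h3
      · exact this.1 (Or.inr h3)
  by_cases he : arc s₁ s₂ s₃ c = arc s₁ s₂ s₃ d
  · exact same c d hc hd hcZ hdZ he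
  obtain ⟨x, y, hx, hy, hxZ, hyZ, e1, e2, e3⟩ := link c d hc hd hcZ hdZ he
  obtain ⟨x', y', hx', hy', hxZ', hyZ', e1', e2', e3'⟩ := link d c hd hc hdZ hcZ (Ne.symm he)
  have g1 := same x c hx hc hxZ hcZ e1
  have g1' := same x' d hx' hd hxZ' hdZ e1'
  by_cases f1 : arc s₁ s₂ s₃ y = arc s₁ s₂ s₃ d
  · exact (g1.symm.trans e3).trans (same y d hy hd hyZ hdZ f1)
  by_cases f2 : arc s₁ s₂ s₃ y' = arc s₁ s₂ s₃ c
  · exact ((g1'.symm.trans e3').trans (same y' c hy' hc hyZ' hcZ f2)).symm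
  have f3 : arc s₁ s₂ s₃ y = arc s₁ s₂ s₃ y' := by
    have := arc_le c; have := arc_le d; have := arc_le y; have := arc_le y'
    omega
  exact ((g1.symm.trans e3).trans (same y y' hy hy' hyZ hyZ' f3)).trans (e3'.symm.trans g1')

/-- Unless `Z` meets both boundary paths between `c` and `d`, one of the paths survives. Otherwise
`Z` has two or three elements, which are the cases of `colour_two` and `colour_three`. -/
theorem colour_const {k : ℕ} (hk : k = 3 ∨ k = 4) (hS : S.WL M)
    (hF : ∀ x y, (x, y) ∈ S.F → S.vs x ∧ S.vs y)
    (hχ : ∀ x y, (x, y) ∈ S.EF → x ∉ Z → y ∉ Z → (χ x ↔ χ y)) (hZk : Z.card < k)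
    (hZv : ∀ z ∈ Z, S.vs z)
    (hL : ∀ u v w, S.vs u → S.vs v → u < v → (k = 4 ∨ 1 < w) → S.Linked u v w) {c d : ℚ}
    (hc : S.vs c) (hd : S.vs d) (hcZ : c ∉ Z) (hdZ : d ∉ Z) (hcd : c < d) : χ c ↔ χ d := by
  by_contra hne
  obtain ⟨s, hs, hs1⟩ : ∃ s ∈ Z, c < s ∧ s < d := by
    by_contra hn
    push Not at hn
    apply hne
    refine colour_path hχ hc hd hcd.le fun z hz hh => ?_
    have h1 : c < z := lt_of_le_of_ne hh.1 (fun e => hcZ (e ▸ hz))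
    have h2 : z < d := lt_of_le_of_ne hh.2 (fun e => hdZ (e ▸ hz))
    have := hn z hz h1
    linarith
  obtain ⟨s', hs', hs1'⟩ : ∃ s ∈ Z, s < c ∨ d < s := by
    by_contra hn
    push Not at hn
    apply hne
    refine colour_wrap hχ hc hd fun z hz => ?_
    have := hn z hz
    exact ⟨lt_of_le_of_ne this.1 (fun e => hcZ (e ▸ hz)),
      lt_of_le_of_ne this.2 (fun e => hdZ (e ▸ hz))⟩
  have hss : s ≠ s' := by rintro rfl; grind
  by_cases h2 : Z.card ≤ 2
  · have hZ : Z = {s, s'} := by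
      refine (Finset.eq_of_subset_of_card_le ?_ ?_).symm
      · intro z; simp only [Finset.mem_insert, Finset.mem_singleton]; rintro (rfl | rfl) <;> assumption
      · rw [Finset.card_pair hss]; exact h2
    have hZ' : ∀ z, z ∈ Z ↔ z = s ∨ z = s' := by intro z; rw [hZ]; simp
    rcases hs1' with h | h
    · exact hne (colour_two hS hF hχ (u := s') (v := s) (by linarith)
        (fun z => by rw [hZ']; exact or_comm) (hL _ _ _ (hZv _ hs') (hZv _ hs) (by linarith)
        (Or.inr (by norm_num))) hc (by linarith) (by linarith) hd (Or.inr hs1.2))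
    · exact hne (colour_two hS hF hχ (u := s) (v := s') (by linarith)
        hZ' (hL _ _ _ (hZv _ hs) (hZv _ hs') (by linarith)
        (Or.inr (by norm_num))) hd (by linarith) (by linarith) hc (Or.inl hs1.1)).symm
  · have hk4 : k = 4 := by omega
    have h3 : Z.card = 3 := by omega
    have e := Z.orderEmbOfFin h3
    have hmem := fun i => Z.orderEmbOfFin_mem h3 i
    have hZ' : ∀ z, z ∈ Z ↔ z = Z.orderEmbOfFin h3 0 ∨ z = Z.orderEmbOfFin h3 1 ∨
        z = Z.orderEmbOfFin h3 2 := by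
      intro z
      rw [← Finset.mem_coe, ← Finset.range_orderEmbOfFin Z h3]
      simp only [Set.mem_range, Fin.exists_fin_succ, Fin.succ_zero_eq_one, IsEmpty.exists_iff,
        or_false, Fin.succ_one_eq_two, eq_comm]
    have o1 : Z.orderEmbOfFin h3 0 < Z.orderEmbOfFin h3 1 := (Z.orderEmbOfFin h3).strictMono (by decide)
    have o2 : Z.orderEmbOfFin h3 1 < Z.orderEmbOfFin h3 2 := (Z.orderEmbOfFin h3).strictMono (by decide)
    have hv := fun i => hZv _ (hmem i)
    exact hne (colour_three hS hF hχ o1 o2 hZ' (hL _ _ _ (hv _) (hv _) o1 (Or.inl hk4))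
      (hL _ _ _ (hv _) (hv _) o2 (Or.inl hk4)) (hL _ _ _ (hv _) (hv _) (o1.trans o2) (Or.inl hk4))
      hc hd hcZ hdZ)

end Colour

/-! ### From geometric graphs to labelled trees -/

/-- The points of a triangulation correspond to the vertices of a tree. -/
structure Model {n : ℕ} {α : Type} (p : Fin n → Plane) (G : SimpleGraph (Fin n)) (T : Tr α)
    (κ : Fin n → ℚ) : Prop where
  inj : Function.Injective κ
  range : ∀ x, T.vs x ↔ ∃ v, κ v = x
  adj : ∀ a b, G.Adj a b ↔ T.SE (κ a) (κ b)
  cross : ∀ a b c d, κ a < κ b → κ c < κ d →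
    (Crosses p s(a, b) s(c, d) ↔ Separates (κ c) (κ d) (κ a) (κ b))

section Transport

variable {n : ℕ} {α : Type} {p : Fin n → Plane} {G : SimpleGraph (Fin n)} {T : Tr α} {κ : Fin n → ℚ}

/-- The edges between the points given by a set of chords. -/
noncomputable def pull (κ : Fin n → ℚ) (H : Finset (ℚ × ℚ)) : Finset (Sym2 (Fin n)) :=
  (Finset.univ.filter fun e : Fin n × Fin n => (κ e.1, κ e.2) ∈ H).image fun e => s(e.1, e.2)

theorem mem_pull {H : Finset (ℚ × ℚ)} {a b : Fin n} :
    s(a, b) ∈ pull κ H ↔ (κ a, κ b) ∈ H ∨ (κ b, κ a) ∈ H := by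
  simp only [pull, Finset.mem_image, Finset.mem_filter, Finset.mem_univ, true_and, Prod.exists,
    Sym2.eq_iff]
  constructor
  · rintro ⟨x, y, h, ⟨rfl, rfl⟩ | ⟨rfl, rfl⟩⟩
    exacts [Or.inl h, Or.inr h]
  · rintro (h | h)
    exacts [⟨_, _, h, Or.inl ⟨rfl, rfl⟩⟩, ⟨_, _, h, Or.inr ⟨rfl, rfl⟩⟩]

theorem Model.card_pull (m : Model p G T κ) {H : Finset (ℚ × ℚ)}
    (hH : ∀ x y, (x, y) ∈ H → T.vs x ∧ T.vs y ∧ x < y) : (pull κ H).card = H.card := by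
  rw [pull, Finset.card_image_of_injOn]
  · refine Finset.card_bij (fun e _ => (κ e.1, κ e.2)) ?_ ?_ ?_
    · intro e he; exact (Finset.mem_filter.1 he).2
    · rintro ⟨a, b⟩ - ⟨c, d⟩ - h
      simp only [Prod.mk.injEq] at h
      rw [m.inj h.1, m.inj h.2]
    · rintro ⟨x, y⟩ h
      obtain ⟨h1, h2, -⟩ := hH x y h
      obtain ⟨a, rfl⟩ := (m.range x).1 h1
      obtain ⟨b, rfl⟩ := (m.range y).1 h2
      exact ⟨(a, b), Finset.mem_filter.2 ⟨Finset.mem_univ _, h⟩, rfl⟩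
  · rintro ⟨a, b⟩ h ⟨c, d⟩ h' he
    simp only [Finset.coe_filter, Finset.mem_univ, true_and, Set.mem_ofPred_eq] at h h'
    rcases Sym2.eq_iff.1 he with ⟨h1, h2⟩ | ⟨h1, h2⟩
    · simp only at h1 h2; rw [h1, h2]
    · simp only at h1 h2
      subst h1 h2
      have := (hH _ _ h).2.2
      have := (hH _ _ h').2.2
      linarith

theorem Model.adj_augment (m : Model p G T κ) {H : Finset (ℚ × ℚ)}
    (hH : ∀ x y, (x, y) ∈ H → T.vs x ∧ T.vs y ∧ x < y) (a b : Fin n) :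
    (augment G (pull κ H)).Adj a b ↔ (κ a, κ b) ∈ T.E ∪ H ∨ (κ b, κ a) ∈ T.E ∪ H := by
  rw [augment, SimpleGraph.sup_adj, m.adj, SimpleGraph.fromEdgeSet_adj, Finset.mem_coe, mem_pull]
  simp only [SE, Finset.mem_union]
  constructor
  · rintro (h | h) <;> tauto
  · intro h
    have : (κ a, κ b) ∈ H ∨ (κ b, κ a) ∈ H → a ≠ b := by
      rintro (h | h) rfl <;> exact lt_irrefl _ (hH _ _ h).2.2
    tauto

open Classical in
theorem Model.ncard_crosses (m : Model p G T κ) {H : Finset (ℚ × ℚ)} {G' : SimpleGraph (Fin n)}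
    (hH : ∀ x y, (x, y) ∈ H → T.vs x ∧ T.vs y ∧ x < y)
    (hG : ∀ a b, G'.Adj a b ↔ (κ a, κ b) ∈ H ∨ (κ b, κ a) ∈ H) {a b : Fin n} (hab : κ a < κ b) :
    {f | f ∈ G'.edgeSet ∧ Crosses p s(a, b) f}.ncard =
      (H.filter fun h => Separates h.1 h.2 (κ a) (κ b)).card := by
  set s : Set (Fin n × Fin n) := {e | (κ e.1, κ e.2) ∈ H ∧ Separates (κ e.1) (κ e.2) (κ a) (κ b)} with hs
  have h1 : {f | f ∈ G'.edgeSet ∧ Crosses p s(a, b) f} = (fun e : Fin n × Fin n => s(e.1, e.2)) '' s := by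
    ext f
    induction f with
    | _ c d =>
    simp only [Set.mem_ofPred_eq, SimpleGraph.mem_edgeSet, hG, Set.mem_image, Prod.exists, hs]
    constructor
    · rintro ⟨h | h, hc⟩
      · exact ⟨c, d, ⟨h, (m.cross a b c d hab (hH _ _ h).2.2).1 hc⟩, rfl⟩
      · rw [Sym2.eq_swap (a := c) (b := d)] at hc
        exact ⟨d, c, ⟨h, (m.cross a b d c hab (hH _ _ h).2.2).1 hc⟩, Sym2.eq_swap⟩
    · rintro ⟨x, y, ⟨h, h'⟩, he⟩
      rw [← he, m.cross a b x y hab (hH _ _ h).2.2]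
      refine ⟨?_, h'⟩
      rcases Sym2.eq_iff.1 he with ⟨rfl, rfl⟩ | ⟨rfl, rfl⟩
      exacts [Or.inl h, Or.inr h]
  have h2 : ((H.filter fun h => Separates h.1 h.2 (κ a) (κ b) : Finset _) : Set (ℚ × ℚ)) =
      (fun e : Fin n × Fin n => (κ e.1, κ e.2)) '' s := by
    ext ⟨x, y⟩
    simp only [Finset.coe_filter, Set.mem_ofPred_eq, Set.mem_image, Prod.exists, hs, Prod.mk.injEq]
    constructor
    · rintro ⟨h, h'⟩
      obtain ⟨c, rfl⟩ := (m.range x).1 (hH _ _ h).1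
      obtain ⟨d, rfl⟩ := (m.range y).1 (hH _ _ h).2.1
      exact ⟨c, d, ⟨h, h'⟩, rfl, rfl⟩
    · rintro ⟨c, d, h, rfl, rfl⟩
      exact h
  rw [← Set.ncard_coe_finset, h1, h2, Set.InjOn.ncard_image, Set.InjOn.ncard_image]
  · rintro ⟨a, b⟩ - ⟨c, d⟩ - h
    simp only [Prod.mk.injEq] at h
    rw [m.inj h.1, m.inj h.2]
  · rintro ⟨a, b⟩ h ⟨c, d⟩ h' he
    rcases Sym2.eq_iff.1 he with ⟨h1, h2⟩ | ⟨h1, h2⟩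
    · simp only at h1 h2; rw [h1, h2]
    · simp only at h1 h2
      subst h1 h2
      have := (hH _ _ h.1).2.2
      have := (hH _ _ h'.1).2.2
      linarith

open Classical in
theorem Model.isLPlanar_iff (m : Model p G T κ) {l : ℕ} {H : Finset (ℚ × ℚ)}
    {G' : SimpleGraph (Fin n)} (hH : ∀ x y, (x, y) ∈ H → T.vs x ∧ T.vs y ∧ x < y)
    (hG : ∀ a b, G'.Adj a b ↔ (κ a, κ b) ∈ H ∨ (κ b, κ a) ∈ H) :
    IsLPlanar l p G' ↔ ∀ x y, (x, y) ∈ H → (H.filter fun h => Separates h.1 h.2 x y).card ≤ l := by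
  constructor
  · intro h x y hxy
    obtain ⟨h1, h2, h3⟩ := hH x y hxy
    obtain ⟨a, rfl⟩ := (m.range x).1 h1
    obtain ⟨b, rfl⟩ := (m.range y).1 h2
    rw [← m.ncard_crosses hH hG h3]
    exact h _ (by rw [SimpleGraph.mem_edgeSet, hG]; exact Or.inl hxy)
  · intro h e he
    induction e with
    | _ a b =>
    rcases (hG a b).1 he with hab | hab
    · rw [m.ncard_crosses hH hG (hH _ _ hab).2.2]
      exact h _ _ hab
    · rw [Sym2.eq_swap, m.ncard_crosses hH hG (hH _ _ hab).2.2]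
      exact h _ _ hab

/-- A walk between the two sides of `u v` that avoids the removed vertices contains an edge that
changes sides. -/
theorem Model.linked_of_connected (m : Model p G T κ) {k M : ℕ} (hk : k = 3 ∨ k = 4) {S : Tr Lab}
    (hS : S.WL M)
    (hT : ∀ x, S.vs x ↔ T.vs x) {G' : SimpleGraph (Fin n)}
    (hG : ∀ a b, G'.Adj a b ↔ (κ a, κ b) ∈ S.EF ∨ (κ b, κ a) ∈ S.EF)
    (hc : IsKConnected k G') {u v w : ℚ} (hu : S.vs u) (hv : S.vs v) (huv : u < v)
    (hw : k = 4 ∨ 1 < w) : S.Linked u v w := by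
  classical
  rintro ⟨a, ha, ha1, ha2, ha3⟩ ⟨b, hb, hb1, hb2⟩
  have rg : ∀ {x}, S.vs x → ∃ i, κ i = x := fun h => (m.range _).1 ((hT _).1 h)
  obtain ⟨i, rfl⟩ := rg hu
  obtain ⟨j, rfl⟩ := rg hv
  obtain ⟨a, rfl⟩ := rg ha
  obtain ⟨b, rfl⟩ := rg hb
  -- If `w` is a vertex, then `k = 4` and three vertices may be removed. Otherwise only the two
  -- poles are removed.
  obtain ⟨Z, hZk, hZ⟩ : ∃ Z : Finset (Fin n), Z.card < k ∧
      ∀ x, x ∈ Z ↔ κ x = κ i ∨ κ x = κ j ∨ κ x = w := by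
    by_cases hww : ∃ x, κ x = w
    · obtain ⟨x, rfl⟩ := hww
      have hk4 : k = 4 := hw.resolve_right fun h => by
        have := (vs_bounds ((m.range _).2 ⟨x, rfl⟩)).2; linarith
      refine ⟨{i, j, x}, ?_, fun y => by simp [m.inj.eq_iff]⟩
      have := Finset.card_le_three (a := i) (b := j) (c := x)
      omega
    · refine ⟨{i, j}, ?_, fun y => ?_⟩
      · have := Finset.card_le_two (a := i) (b := j)
        omega
      · have : κ y ≠ w := fun h => hww ⟨y, h⟩
        simp [m.inj.eq_iff, this]
  have haZ : a ∉ Z := by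
    rw [hZ]
    rintro (h | h | h)
    exacts [ha1.ne h.symm, ha2.ne h, ha3 h]
  have hbZ : b ∉ Z := by
    rw [hZ]
    rintro (h | h | h)
    · rcases hb1 with h' | h' <;> linarith
    · rcases hb1 with h' | h' <;> linarith
    · exact hb2 h
  obtain ⟨W⟩ := (hc.2 Z hZk).preconnected ⟨a, haZ⟩ ⟨b, hbZ⟩
  obtain ⟨d, -, h1, h2⟩ := W.exists_boundary_dart {x | κ i < κ x.1 ∧ κ x.1 < κ j} ⟨ha1, ha2⟩
    (fun hb3 => by
      have h1 : κ i < κ b := hb3.1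
      have h2 : κ b < κ j := hb3.2
      rcases hb1 with h | h <;> linarith)
  obtain ⟨⟨⟨x, hx⟩, ⟨y, hy⟩⟩, hxy⟩ := d
  have hadj : G'.Adj x y := hxy
  have hx' : x ∉ Z := hx
  have hy' : y ∉ Z := hy
  rw [hZ] at hx' hy'
  simp only [Set.mem_ofPred_eq] at h1 h2
  have hs : κ i < κ x ∧ κ x < κ j ∧ (κ y < κ i ∨ κ j < κ y) := by
    refine ⟨h1.1, h1.2, ?_⟩
    by_contra hn
    push Not at hn hy'
    exact h2 ⟨lt_of_le_of_ne hn.1 hy'.1.symm, lt_of_le_of_ne hn.2 hy'.2.1⟩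
  rcases (hG x y).1 hadj with h | h
  · have bb := (EF_bounds hS h).2.1
    exact ⟨_, h, (separates_swap bb huv).2 (Or.inl hs), fun e => hx' (Or.inr (Or.inr e)),
      fun e => hy' (Or.inr (Or.inr e))⟩
  · have bb := (EF_bounds hS h).2.1
    exact ⟨_, h, (separates_swap bb huv).2 (Or.inr hs), fun e => hy' (Or.inr (Or.inr e)),
      fun e => hx' (Or.inr (Or.inr e))⟩

/-- The vertices are coloured by reachability from a fixed vertex, and `colour_const` shows that
there is only one colour. -/
theorem Model.connected_of_linked (m : Model p G T κ) {k M : ℕ} (hk : k = 3 ∨ k = 4) {S : Tr Lab}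
    (hS : S.WL M) (hF : ∀ x y, (x, y) ∈ S.F → S.vs x ∧ S.vs y)
    (hT : ∀ x, S.vs x ↔ T.vs x) {G' : SimpleGraph (Fin n)}
    (hG : ∀ a b, G'.Adj a b ↔ (κ a, κ b) ∈ S.EF ∨ (κ b, κ a) ∈ S.EF) (hn : k < n)
    (hL : ∀ u v w, S.vs u → S.vs v → u < v → (k = 4 ∨ 1 < w) → S.Linked u v w) :
    IsKConnected k G' := by
  classical
  refine ⟨hn, fun Z hZ => ?_⟩
  have hEF : ∀ {x y}, (x, y) ∈ S.EF → S.vs x ∧ S.vs y := fun h =>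
    (mem_EF.1 h).elim E_vs (hF _ _)
  have hv : ∀ i, S.vs (κ i) := fun i => (hT _).2 ((m.range _).2 ⟨i, rfl⟩)
  have hmem : ∀ i, κ i ∈ Z.image κ ↔ i ∈ Z := fun i => by simp [m.inj.eq_iff]
  have hne : ∃ x, x ∉ Z := by
    by_contra hc
    push Not at hc
    have : Z = Finset.univ := Finset.eq_univ_iff_forall.2 hc
    rw [this, Finset.card_univ, Fintype.card_fin] at hZ
    omega
  have : Nonempty {v | v ∉ Z} := ⟨⟨hne.choose, hne.choose_spec⟩⟩
  refine ⟨?_⟩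
  rintro ⟨a, ha⟩ ⟨b, hb⟩
  have ha' : a ∉ Z := ha
  have hb' : b ∉ Z := hb
  let χ : ℚ → Prop := fun x => ∃ (i : Fin n) (h : i ∉ Z), κ i = x ∧
    (G'.induce {v | v ∉ Z}).Reachable ⟨a, ha⟩ ⟨i, h⟩
  have hχ : ∀ x y, (x, y) ∈ S.EF → x ∉ Z.image κ → y ∉ Z.image κ → (χ x ↔ χ y) := by
    intro x y hxy hx hy
    obtain ⟨h1, h2⟩ := hEF hxy
    obtain ⟨i, rfl⟩ := (m.range _).1 ((hT _).1 h1)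
    obtain ⟨j, rfl⟩ := (m.range _).1 ((hT _).1 h2)
    rw [hmem] at hx hy
    have hadj : (G'.induce {v | v ∉ Z}).Adj ⟨i, hx⟩ ⟨j, hy⟩ := (hG i j).2 (Or.inl hxy)
    constructor
    · rintro ⟨i', h, he, hr⟩
      obtain rfl := m.inj he
      exact ⟨j, hy, rfl, hr.trans hadj.reachable⟩
    · rintro ⟨i', h, he, hr⟩
      obtain rfl := m.inj he
      exact ⟨i, hx, rfl, hr.trans hadj.symm.reachable⟩
  have hZv : ∀ z ∈ Z.image κ, S.vs z := by
    intro z hz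
    obtain ⟨i, -, rfl⟩ := Finset.mem_image.1 hz
    exact hv i
  have hc : (Z.image κ).card < k := Finset.card_image_le.trans_lt hZ
  have haχ : χ (κ a) := ⟨a, ha', rfl, SimpleGraph.Reachable.refl _⟩
  have hbχ : χ (κ b) := by
    rcases lt_trichotomy (κ a) (κ b) with h | h | h
    · exact (colour_const hk hS hF hχ hc hZv hL (hv a) (hv b) (by rwa [hmem]) (by rwa [hmem]) h).1 haχ
    · exact h ▸ haχ
    · exact (colour_const hk hS hF hχ hc hZv hL (hv b) (hv a) (by rwa [hmem]) (by rwa [hmem]) h).2 haχ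
  obtain ⟨i, h, he, hr⟩ := hbχ
  obtain rfl := m.inj he
  exact hr

/-- Augmentations given by labelled trees. -/
theorem Model.isAugmentation_pull (m : Model p G T κ) {k l M : ℕ} (hk : k = 3 ∨ k = 4) {S : Tr Lab}
    (hS : S.WL M) (hF : ∀ x y, (x, y) ∈ S.F → S.vs x ∧ S.vs y)
    (hST : S.map (fun _ => ()) = T.map (fun _ => ())) :
    IsAugmentation k l p G (pull κ S.F) ↔ k < n ∧ S.Good k l 1 := by
  classical
  have hE := E_congr hST
  have hvs := vs_congr hST
  have hH : ∀ x y, (x, y) ∈ S.F → T.vs x ∧ T.vs y ∧ x < y := fun x y h =>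
    ⟨(hvs x).1 (hF x y h).1, (hvs y).1 (hF x y h).2, (F_bounds hS h).2.1⟩
  have hEF : ∀ x y, (x, y) ∈ S.EF → T.vs x ∧ T.vs y ∧ x < y := fun x y h => by
    rcases mem_EF.1 h with h | h
    · exact ⟨(hvs x).1 (E_vs h).1, (hvs y).1 (E_vs h).2, (E_bounds h).2.1⟩
    · exact hH x y h
  have hadj := m.adj_augment hH
  rw [← hE] at hadj
  have hpl := m.isLPlanar_iff (l := l) hEF hadj
  have hcc : ∀ x y, S.crossCount (x, y) =
      (S.EF.filter fun h => Separates h.1 h.2 x y).card := fun x y => by unfold crossCount; congr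
  constructor
  · rintro ⟨-, h2, h3⟩
    have hL := fun u v w => m.linked_of_connected hk hS hvs hadj h2 (u := u) (v := v) (w := w)
    refine ⟨h2.1, hF, fun x y hxy => ?_, ?_, ?_⟩
    · rw [hcc]; exact hpl.1 h3 x y hxy
    · rintro u v w ⟨g1, -, g2⟩
      exact hL u v w (E_vs g1).1 (E_vs g1).2 (E_bounds g1).2.1 g2
    · rintro u v w ⟨g0, g1, g2, g3, -⟩
      have : ∀ {x y}, S.SE x y → S.vs y := by
        rintro x y (h | h)
        exacts [(E_vs h).2, (E_vs h).1]
      exact hL u v w (this g2) (this g3) g1 (Or.inl g0)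
  · rintro ⟨hn, hG⟩
    refine ⟨?_, m.connected_of_linked hk hS hF hvs hadj hn (fun u v w hu hv huv hw =>
      hG.linked hu hv huv hw), hpl.2 fun x y hxy => by rw [← hcc]; exact hG.2.1 x y hxy⟩
    intro e he
    induction e with
    | _ a b =>
    rw [Sym2.mk_isDiag_iff, SimpleGraph.mem_edgeSet, m.adj, SE, ← hE]
    rcases mem_pull.1 he with h | h
    · refine ⟨fun e => lt_irrefl _ (e ▸ (hH _ _ h).2.2), ?_⟩
      rintro (h' | h')
      · exact F_notMem_E hS h h'
      · have := (E_bounds h').2.1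
        have := (hH _ _ h).2.2
        linarith
    · refine ⟨fun e => lt_irrefl _ (e ▸ (hH _ _ h).2.2), ?_⟩
      rintro (h' | h')
      · have := (E_bounds h').2.1
        have := (hH _ _ h).2.2
        linarith
      · exact F_notMem_E hS h h'

/-- Each augmentation is given by a labelled tree. -/
theorem Model.exists_tree (m : Model p G T κ) {k l M : ℕ} (hM : l < M)
    {F' : Finset (Sym2 (Fin n))} (h : IsAugmentation k l p G F') :
    ∃ S : Tr Lab, S.WL M ∧ (∀ x y, (x, y) ∈ S.F → S.vs x ∧ S.vs y) ∧
      S.map (fun _ => ()) = T.map (fun _ => ()) ∧ pull κ S.F = F' := by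
  classical
  set H : Finset (ℚ × ℚ) := (Finset.univ.filter fun e : Fin n × Fin n =>
    κ e.1 < κ e.2 ∧ s(e.1, e.2) ∈ F').image fun e => (κ e.1, κ e.2) with hH
  have memH : ∀ {a b}, (κ a, κ b) ∈ H ↔ κ a < κ b ∧ s(a, b) ∈ F' := by
    intro a b
    simp only [hH, Finset.mem_image, Finset.mem_filter, Finset.mem_univ, true_and, Prod.exists,
      Prod.mk.injEq]
    constructor
    · rintro ⟨c, d, h, h1, h2⟩
      rw [← m.inj h1, ← m.inj h2]; exact h
    · intro h; exact ⟨a, b, h, rfl, rfl⟩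
  have Hvs : ∀ x y, (x, y) ∈ H → ∃ a b, κ a = x ∧ κ b = y := by
    intro x y h
    simp only [hH, Finset.mem_image, Finset.mem_filter, Finset.mem_univ, true_and, Prod.exists,
      Prod.mk.injEq] at h
    obtain ⟨c, d, -, h1, h2⟩ := h
    exact ⟨c, d, h1, h2⟩
  have hpull : pull κ H = F' := by
    ext e
    induction e with
    | _ a b =>
    rw [mem_pull, memH, memH, Sym2.eq_swap (a := b)]
    constructor
    · rintro (h | h)
      exacts [h.2, h.2]
    · intro hab
      have hne : a ≠ b := fun e => (h.1 _ hab).1 (Sym2.mk_isDiag_iff.2 e)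
      rcases lt_or_gt_of_ne (fun e => hne (m.inj e)) with hl | hl
      exacts [Or.inl ⟨hl, hab⟩, Or.inr ⟨hl, hab⟩]
  have hHvs : ∀ x y, (x, y) ∈ H → T.vs x ∧ T.vs y ∧ x < y := by
    intro x y hxy
    obtain ⟨a, b, rfl, rfl⟩ := Hvs x y hxy
    exact ⟨(m.range _).2 ⟨a, rfl⟩, (m.range _).2 ⟨b, rfl⟩, (memH.1 hxy).1⟩
  have hEH : ∀ x y, (x, y) ∈ T.E ∪ H → T.vs x ∧ T.vs y ∧ x < y := by
    intro x y hxy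
    rcases Finset.mem_union.1 hxy with hxy | hxy
    · exact ⟨(E_vs hxy).1, (E_vs hxy).2, (E_bounds hxy).2.1⟩
    · exact hHvs x y hxy
  -- Only the crossings of new edges with old ones are needed to confine the new edges to bounded
  -- levels.
  have hpl := (m.isLPlanar_iff (l := l) hEH (m.adj_augment hHvs)).1 (by rw [hpull]; exact h.2.2)
  obtain ⟨h1, h2⟩ := ofChords_spec (T := T) (Fs := H) hM (by
    intro x y hxy
    obtain ⟨g1, g2, g3⟩ := hHvs x y hxy
    refine ⟨g1, g2, g3, ?_, ?_⟩
    · obtain ⟨a, b, rfl, rfl⟩ := Hvs x y hxy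
      intro hE
      exact (h.1 _ (memH.1 hxy).2).2 ((m.adj a b).2 (Or.inl hE))
    · refine le_trans ?_ (hpl x y (Finset.mem_union_right _ hxy))
      unfold crossE
      exact Finset.card_le_card (Finset.filter_subset_filter _ Finset.subset_union_left))
  refine ⟨T.ofChords H, h1, ?_, map_ofChords T H, by rw [h2]; exact hpull⟩
  intro x y hxy
  rw [h2] at hxy
  rw [vs_congr (map_ofChords T H), vs_congr (map_ofChords T H)]
  exact ⟨(hHvs x y hxy).1, (hHvs x y hxy).2.1⟩

end Transport

end Tr

/-! ### Points in convex position -/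

/-- Twice the signed area of the triangle. The factor `ε` in the lemmas on signs allows both
orientations to be treated at once. -/
def orient (p q r : Plane) : ℝ := (q 0 - p 0) * (r 1 - p 1) - (q 1 - p 1) * (r 0 - p 0)

theorem plane_ext {p q : Plane} (h0 : p 0 = q 0) (h1 : p 1 = q 1) : p = q := by
  ext i; fin_cases i
  exacts [h0, h1]

section Convex

variable {n : ℕ} {p : Fin n → Plane}

/-- The points `b`, `c`, `d` need not be distinct, so segments are covered as well. -/
theorem not_mem_triangle (hp : ConvexIndependent ℝ p) {a b c d : Fin n} (hab : a ≠ b) (hac : a ≠ c)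
    (had : a ≠ d) {x y z : ℝ} (hx : 0 ≤ x) (hy : 0 ≤ y) (hz : 0 ≤ z) (hs : x + y + z = 1)
    (h : p a = x • p b + y • p c + z • p d) : False := by
  have hc : Convex ℝ (convexHull ℝ (p '' {b, c, d})) := convex_convexHull ℝ _
  have hm : ∀ i ∈ ({b, c, d} : Set (Fin n)), p i ∈ convexHull ℝ (p '' {b, c, d}) :=
    fun i hi => subset_convexHull ℝ _ ⟨i, hi, rfl⟩
  have := hp {b, c, d} a (by
    rw [h]
    have := hc.sum_mem (t := Finset.univ) (w := ![x, y, z]) (z := ![p b, p c, p d])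
      (by intro i _; fin_cases i <;> assumption) (by simp [Fin.sum_univ_three, hs])
      (by intro i _; fin_cases i <;> apply hm <;> simp)
    simpa [Fin.sum_univ_three] using this)
  simp only [Set.mem_insert_iff, Set.mem_singleton_iff] at this
  tauto

/-- Divided by the area of `b c d`, the three areas are the barycentric coordinates of `a`, so `a`
would lie in the triangle. -/
theorem not_orient_triangle (hp : ConvexIndependent ℝ p) {a b c d : Fin n} (hab : a ≠ b)
    (hac : a ≠ c) (had : a ≠ d) {ε : ℝ} (h : 0 < ε * orient (p b) (p c) (p d))
    (h1 : 0 ≤ ε * orient (p a) (p c) (p d)) (h2 : 0 ≤ ε * orient (p b) (p a) (p d))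
    (h3 : 0 ≤ ε * orient (p b) (p c) (p a)) : False := by
  set D := ε * orient (p b) (p c) (p d) with hD
  have hne : orient (p b) (p c) (p d) ≠ 0 := fun e => by rw [hD, e, mul_zero] at h; exact lt_irrefl _ h
  have hε : ε ≠ 0 := fun e => by rw [hD, e, zero_mul] at h; exact lt_irrefl _ h
  refine not_mem_triangle hp hab hac had (x := ε * orient (p a) (p c) (p d) / D)
    (y := ε * orient (p b) (p a) (p d) / D) (z := ε * orient (p b) (p c) (p a) / D)
    (by positivity) (by positivity) (by positivity) ?_ ?_
  · rw [← add_div, ← add_div, div_eq_one_iff_eq h.ne', hD]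
    unfold orient; ring
  · apply plane_ext <;>
    · simp only [PiLp.add_apply, PiLp.smul_apply, smul_eq_mul, hD, mul_div_mul_left _ _ hε]
      field_simp
      unfold orient; ring

/-- Of three collinear points one lies between the others; the parameter `t` of `c` on the line `a
b` tells which. -/
theorem orient_ne_zero (hp : ConvexIndependent ℝ p) {a b c : Fin n} (hab : a ≠ b) (hac : a ≠ c)
    (hbc : b ≠ c) : orient (p a) (p b) (p c) ≠ 0 := by
  intro h
  unfold orient at h
  set u0 := p b 0 - p a 0 with hu0
  set u1 := p b 1 - p a 1 with hu1
  set v0 := p c 0 - p a 0 with hv0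
  set v1 := p c 1 - p a 1 with hv1
  have hu : 0 < u0 ^ 2 + u1 ^ 2 := by
    by_contra hn
    have h0 : u0 = 0 := by nlinarith [sq_nonneg u0, sq_nonneg u1]
    have h1 : u1 = 0 := by nlinarith [sq_nonneg u0, sq_nonneg u1]
    exact hab (hp.injective (plane_ext (by linarith) (by linarith)))
  set t := (u0 * v0 + u1 * v1) / (u0 ^ 2 + u1 ^ 2) with ht
  have e0 : v0 = t * u0 := by rw [ht]; field_simp; linear_combination (-u1) * h
  have e1 : v1 = t * u1 := by rw [ht]; field_simp; linear_combination u0 * h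
  have c0 : p c 0 = (1 - t) * p a 0 + t * p b 0 := by rw [hv0, hu0] at e0; linarith
  have c1 : p c 1 = (1 - t) * p a 1 + t * p b 1 := by rw [hv1, hu1] at e1; linarith
  rcases lt_or_ge t 0 with h0 | h0
  · have : (0 : ℝ) < 1 - t := by linarith
    refine not_mem_triangle hp hab hac hac (x := -t / (1 - t)) (y := 1 / (1 - t)) (z := 0)
      (div_nonneg (by linarith) this.le) (by positivity) le_rfl (by field_simp; ring) ?_
    apply plane_ext <;> simp only [PiLp.add_apply, PiLp.smul_apply, smul_eq_mul] <;> field_simp <;>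
      linarith
  · rcases le_or_gt t 1 with h1 | h1
    · refine not_mem_triangle hp hac.symm hbc.symm hbc.symm (x := 1 - t) (y := t) (z := 0)
        (by linarith) h0 le_rfl (by ring) ?_
      apply plane_ext <;> simp only [PiLp.add_apply, PiLp.smul_apply, smul_eq_mul] <;> linarith
    · refine not_mem_triangle hp hab.symm hbc hbc (x := (t - 1) / t) (y := 1 / t) (z := 0)
        (div_nonneg (by linarith) (by linarith)) (by positivity) le_rfl (by field_simp; ring) ?_
      apply plane_ext <;> simp only [PiLp.add_apply, PiLp.smul_apply, smul_eq_mul] <;> field_simp <;>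
        linarith

theorem orient_rotate (a b c : Plane) : orient a b c = orient b c a := by unfold orient; ring
theorem orient_swap (a b c : Plane) : orient a c b = -orient a b c := by unfold orient; ring

/-- An enumeration of the points in cyclic order that starts with `x`. -/
theorem exists_pos (hp : ConvexIndependent ℝ p) (x : Fin n) {ε : ℝ} (hε : ε = 1 ∨ ε = -1) :
    ∃ pos : Fin n ≃ Fin n, (pos x : ℕ) = 0 ∧
      (∀ a b, a ≠ x → b ≠ x → a ≠ b → (pos a < pos b ↔ 0 < ε * orient (p x) (p a) (p b))) ∧
      ∀ a b c, pos a < pos b → pos b < pos c → 0 < ε * orient (p a) (p b) (p c) := by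
  classical
  have hε0 : ε ≠ 0 := by rcases hε with rfl | rfl <;> norm_num
  have one : ∀ a b c : Fin n, a ≠ b → a ≠ c → b ≠ c →
      0 < ε * orient (p a) (p b) (p c) ∨ 0 < ε * orient (p a) (p c) (p b) := by
    intro a b c h1 h2 h3
    rw [orient_swap (p a) (p b) (p c)]
    have := mul_ne_zero hε0 (orient_ne_zero hp h1 h2 h3)
    rcases lt_or_gt_of_ne this with h | h
    · right; linarith
    · exact Or.inl h
  let lt : Fin n → Fin n → Prop := fun a b =>
    (a = x ∧ b ≠ x) ∨ (a ≠ x ∧ b ≠ x ∧ 0 < ε * orient (p x) (p a) (p b))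
  have tot : ∀ a b, a ≠ b → lt a b ∨ lt b a := by
    intro a b hab
    by_cases ha : a = x
    · exact Or.inl (Or.inl ⟨ha, fun hb => hab (ha.trans hb.symm)⟩)
    by_cases hb : b = x
    · exact Or.inr (Or.inl ⟨hb, ha⟩)
    · rcases one x a b (Ne.symm ha) (Ne.symm hb) hab with h | h
      · exact Or.inl (Or.inr ⟨ha, hb, h⟩)
      · exact Or.inr (Or.inr ⟨hb, ha, h⟩)
  have asymm : ∀ a b, lt a b → ¬ lt b a := by
    rintro a b (⟨h1, h2⟩ | ⟨h1, h2, h3⟩) (⟨g1, g2⟩ | ⟨g1, g2, g3⟩)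
    · exact h2 g1
    · exact g2 h1
    · exact h2 g1
    · rw [orient_swap] at g3; linarith
  have trans : ∀ a b c, lt a b → lt b c → lt a c := by
    rintro a b c (⟨h1, h2⟩ | ⟨h1, h2, h3⟩) (⟨g1, g2⟩ | ⟨g1, g2, g3⟩)
    · exact absurd g1 h2
    · exact Or.inl ⟨h1, g2⟩
    · exact absurd g1 h2
    · have hab : a ≠ b := by
        rintro rfl
        have : orient (p x) (p a) (p a) = 0 := by unfold orient; ring
        rw [this, mul_zero] at h3; exact lt_irrefl _ h3
      have hbc : b ≠ c := by
        rintro rfl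
        have : orient (p x) (p b) (p b) = 0 := by unfold orient; ring
        rw [this, mul_zero] at g3; exact lt_irrefl _ g3
      have hac : a ≠ c := by
        rintro rfl
        rw [orient_swap] at g3; linarith
      refine Or.inr ⟨h1, g2, ?_⟩
      -- If the angular order were cyclic on `a`, `b`, `c`, then `x` would lie in their triangle.
      by_contra hn
      push Not at hn
      have e : ε * orient (p a) (p b) (p c) = ε * orient (p x) (p a) (p b) +
          ε * orient (p x) (p b) (p c) - ε * orient (p x) (p a) (p c) := by unfold orient; ring
      refine not_orient_triangle hp (a := x) (b := a) (c := b) (d := c) (Ne.symm h1) (Ne.symm h2)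
        (Ne.symm g2) (ε := ε) (by linarith) g3.le ?_ ?_
      · rw [orient_rotate, orient_swap]; linarith
      · rw [← orient_rotate]; exact h3.le
  let rank : Fin n → ℕ := fun a => (Finset.univ.filter fun b => lt b a).card
  have mono : ∀ a b, lt a b → rank a < rank b := by
    intro a b hab
    refine Finset.card_lt_card (Finset.ssubset_iff_subset_ne.2 ⟨fun c hc => ?_, fun he => ?_⟩)
    · simp only [Finset.mem_filter, Finset.mem_univ, true_and] at hc ⊢
      exact trans _ _ _ hc hab
    · have : a ∈ Finset.univ.filter fun c => lt c b := by simpa using hab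
      rw [← he] at this
      simp only [Finset.mem_filter, Finset.mem_univ, true_and] at this
      exact asymm _ _ this this
  have hlt : ∀ a, rank a < n := by
    intro a
    have : (Finset.univ.filter fun b => lt b a).card < (Finset.univ : Finset (Fin n)).card := by
      refine Finset.card_lt_card (Finset.ssubset_iff_subset_ne.2 ⟨Finset.subset_univ _, fun he => ?_⟩)
      have : a ∈ Finset.univ.filter fun c => lt c a := by rw [he]; exact Finset.mem_univ _
      simp only [Finset.mem_filter, Finset.mem_univ, true_and] at this
      exact asymm _ _ this this
    simpa using this
  have hinj : Function.Injective fun a => (⟨rank a, hlt a⟩ : Fin n) := by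
    intro a b h
    by_contra hab
    have h := Fin.mk.inj_iff.1 h
    rcases tot a b hab with h' | h'
    · exact (mono _ _ h').ne h
    · exact (mono _ _ h').ne' h
  have hiff : ∀ a b, rank a < rank b ↔ lt a b := by
    refine fun a b => ⟨fun h => ?_, mono a b⟩
    have hab : a ≠ b := by rintro rfl; exact lt_irrefl _ h
    rcases tot a b hab with h' | h'
    · exact h'
    · exact absurd (mono _ _ h') (by omega)
  refine ⟨Equiv.ofBijective _ (Finite.injective_iff_bijective.1 hinj), ?_, ?_, ?_⟩
  · show rank x = 0
    rw [Finset.card_eq_zero, Finset.filter_eq_empty_iff]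
    rintro a - (⟨_, h⟩ | ⟨_, h, _⟩) <;> exact h rfl
  · intro a b ha hb hab
    show rank a < rank b ↔ _
    rw [hiff]
    simp only [lt]
    tauto
  · intro a b c hab hbc
    have hab : lt a b := (hiff a b).1 hab
    have hbc : lt b c := (hiff b c).1 hbc
    have hac := trans _ _ _ hab hbc
    rcases hab with ⟨rfl, h2⟩ | ⟨h1, h2, h3⟩
    · rcases hbc with ⟨g1, g2⟩ | ⟨g1, g2, g3⟩
      · exact absurd g1 h2
      · exact g3
    · rcases hbc with ⟨g1, g2⟩ | ⟨g1, g2, g3⟩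
      · exact absurd g1 h2
      · rcases hac with ⟨f1, f2⟩ | ⟨f1, f2, f3⟩
        · exact absurd f1 h1
        -- With the wrong orientation the middle point `b` would lie in the triangle `x a c`.
        · by_contra hn
          push Not at hn
          have hab : b ≠ a := by
            rintro rfl
            have : orient (p x) (p b) (p b) = 0 := by unfold orient; ring
            rw [this, mul_zero] at h3; exact lt_irrefl _ h3
          have hbc : b ≠ c := by
            rintro rfl
            have : orient (p x) (p b) (p b) = 0 := by unfold orient; ring
            rw [this, mul_zero] at g3; exact lt_irrefl _ g3
          refine not_orient_triangle hp (a := b) (b := x) (c := a) (d := c) h2 hab hbc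
            (ε := ε) f3 ?_ g3.le h3.le
          rw [orient_rotate, orient_swap]
          linarith

theorem crosses_iff_nonempty {a b c d : Fin n} : Crosses p s(a, b) s(c, d) ↔ s(a, b) ≠ s(c, d) ∧
    (openSegment ℝ (p a) (p b) ∩ openSegment ℝ (p c) (p d)).Nonempty := by
  unfold Crosses
  refine and_congr_right fun _ => ⟨?_, fun h => ⟨a, b, c, d, rfl, rfl, h⟩⟩
  rintro ⟨a', b', c', d', h1, h2, h⟩
  have e1 : openSegment ℝ (p a) (p b) = openSegment ℝ (p a') (p b') := by
    rcases Sym2.eq_iff.1 h1 with ⟨rfl, rfl⟩ | ⟨rfl, rfl⟩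
    exacts [rfl, openSegment_symm _ _ _]
  have e2 : openSegment ℝ (p c) (p d) = openSegment ℝ (p c') (p d') := by
    rcases Sym2.eq_iff.1 h2 with ⟨rfl, rfl⟩ | ⟨rfl, rfl⟩
    exacts [rfl, openSegment_symm _ _ _]
  rw [e1, e2]; exact h

/-- `c` and `d` lie on one closed side of the line `a b` and not both on it, so the open segment `c
d` misses the line. -/
theorem disjoint_of_orient {a b c d : Plane} {ε : ℝ} (h : (0 ≤ ε * orient a b c ∧
    0 ≤ ε * orient a b d ∧ 0 < ε * orient a b c + ε * orient a b d)) :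
    ¬ (openSegment ℝ a b ∩ openSegment ℝ c d).Nonempty := by
  rintro ⟨z, ⟨s, t, hs, ht, hst, rfl⟩, ⟨s', t', hs', ht', hst', he⟩⟩
  have e0 := congrArg (fun q : Plane => q 0) he
  have e1 := congrArg (fun q : Plane => q 1) he
  simp only [PiLp.add_apply, PiLp.smul_apply, smul_eq_mul] at e0 e1
  have key : s' * (ε * orient a b c) + t' * (ε * orient a b d) = 0 := by
    have hs1 : s = 1 - t := by linarith
    have hs1' : s' = 1 - t' := by linarith
    subst hs1 hs1'
    unfold orient
    linear_combination ε * (b 0 - a 0) * e1 - ε * (b 1 - a 1) * e0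
  rcases h.1.lt_or_eq with h1 | h1
  · have := mul_pos hs' h1
    have := mul_nonneg ht'.le h.2.1
    linarith
  · have h2 : 0 < ε * orient a b d := by linarith [h.2.2]
    have := mul_pos ht' h2
    rw [← h1] at key
    linarith

/-- The weights are ratios of areas, and both combinations give the point in which the two lines
meet. -/
theorem nonempty_of_orient {a b c d : Plane} {ε : ℝ} (h1 : 0 < ε * orient a c b)
    (h2 : 0 < ε * orient a b d) (h3 : 0 < ε * orient c d a) (h4 : 0 < ε * orient c b d) :
    (openSegment ℝ a b ∩ openSegment ℝ c d).Nonempty := by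
  set Δ := ε * orient a c b + ε * orient a b d with hΔ
  have hΔ' : Δ = ε * orient c d a + ε * orient c b d := by rw [hΔ]; unfold orient; ring
  have hpos : 0 < Δ := by rw [hΔ]; linarith
  refine ⟨(ε * orient c b d / Δ) • a + (ε * orient c d a / Δ) • b,
    ⟨_, _, div_pos h4 hpos, div_pos h3 hpos, ?_, rfl⟩,
    ⟨ε * orient a b d / Δ, ε * orient a c b / Δ, div_pos h2 hpos, div_pos h1 hpos, ?_, ?_⟩⟩
  · rw [← add_div, div_eq_one_iff_eq hpos.ne', hΔ', add_comm]
  · rw [← add_div, div_eq_one_iff_eq hpos.ne', hΔ, add_comm]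
  · apply plane_ext <;>
    · simp only [PiLp.add_apply, PiLp.smul_apply, smul_eq_mul]
      field_simp
      unfold orient; ring

/-- Segments between points in convex position cross if their ends interleave. -/
theorem crosses_iff_interleave {pos : Fin n ≃ Fin n} {ε : ℝ}
    (h : ∀ a b c, pos a < pos b → pos b < pos c → 0 < ε * orient (p a) (p b) (p c))
    {a b c d : Fin n} (hab : pos a < pos b) (hcd : pos c < pos d) :
    Crosses p s(a, b) s(c, d) ↔
      (pos a < pos c ∧ pos c < pos b ∧ pos b < pos d) ∨
      (pos c < pos a ∧ pos a < pos d ∧ pos d < pos b) := by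
  rw [crosses_iff_nonempty]
  have cross : ∀ {a b c d}, pos a < pos c → pos c < pos b → pos b < pos d →
      (openSegment ℝ (p a) (p b) ∩ openSegment ℝ (p c) (p d)).Nonempty := by
    intro a b c d h1 h2 h3
    refine nonempty_of_orient (ε := ε) (h _ _ _ h1 h2) (h _ _ _ (h1.trans h2) h3) ?_ (h _ _ _ h2 h3)
    rw [← orient_rotate]
    exact h _ _ _ h1 (h2.trans h3)
  have out : ∀ {c}, pos c < pos a ∨ pos b < pos c → 0 < ε * orient (p a) (p b) (p c) := by
    rintro c (h1 | h1)
    · rw [← orient_rotate]; exact h _ _ _ h1 hab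
    · exact h _ _ _ hab h1
  have ins : ∀ {c}, pos a < pos c → pos c < pos b → 0 < (-ε) * orient (p a) (p b) (p c) := by
    intro c h1 h2
    have := h _ _ _ h1 h2
    rw [orient_swap] at this; linarith
  have za : orient (p a) (p b) (p a) = 0 := by unfold orient; ring
  have zb : orient (p a) (p b) (p b) = 0 := by unfold orient; ring
  have eqp : ∀ {x y}, pos x = pos y → x = y := fun e => pos.injective e
  constructor
  · rintro ⟨hne, hx⟩
    by_contra hn
    have key : ∀ {x}, (x = a ∨ x = b ∨ (pos x < pos a ∨ pos b < pos x)) ∨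
        (pos a < pos x ∧ pos x < pos b) := by
      intro x
      rcases lt_trichotomy (pos x) (pos a) with h1 | h1 | h1
      · tauto
      · exact Or.inl (Or.inl (eqp h1))
      rcases lt_trichotomy (pos x) (pos b) with h2 | h2 | h2
      · tauto
      · exact Or.inl (Or.inr (Or.inl (eqp h2)))
      · tauto
    rcases key (x := c) with hc | hc <;> rcases key (x := d) with hd | hd
    · refine disjoint_of_orient (ε := ε) ?_ hx
      rcases hc with rfl | rfl | hc <;> rcases hd with rfl | rfl | hd
      · exact absurd hcd (lt_irrefl _)
      · exact absurd rfl hne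
      · have := out hd; rw [za]; refine ⟨by simp, this.le, by linarith⟩
      · exact absurd hab (by omega)
      · exact absurd hcd (lt_irrefl _)
      · have := out hd; rw [zb]; refine ⟨by simp, this.le, by linarith⟩
      · have := out hc; rw [za]; refine ⟨this.le, by simp, by linarith⟩
      · have := out hc; rw [zb]; refine ⟨this.le, by simp, by linarith⟩
      · have := out hc; have := out hd; refine ⟨by linarith, by linarith, by linarith⟩
    · have h1 := ins hd.1 hd.2
      rcases hc with rfl | rfl | hc
      · exact disjoint_of_orient (ε := -ε) ⟨by rw [za]; simp, h1.le, by rw [za]; linarith⟩ hx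
      · exact absurd hcd (by omega)
      · exact hn (by omega)
    · have h1 := ins hc.1 hc.2
      rcases hd with rfl | rfl | hd
      · exact absurd hcd (by omega)
      · exact disjoint_of_orient (ε := -ε) ⟨h1.le, by rw [zb]; simp, by rw [zb]; linarith⟩ hx
      · exact hn (by omega)
    · have h1 := ins hc.1 hc.2
      have h2 := ins hd.1 hd.2
      exact disjoint_of_orient (ε := -ε) ⟨h1.le, h2.le, by linarith⟩ hx
  · rintro (⟨h1, h2, h3⟩ | ⟨h1, h2, h3⟩)
    · refine ⟨fun e => ?_, cross h1 h2 h3⟩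
      rcases Sym2.eq_iff.1 e with ⟨rfl, rfl⟩ | ⟨rfl, rfl⟩ <;> exact lt_irrefl _ ‹_›
    · refine ⟨fun e => ?_, by rw [Set.inter_comm]; exact cross h1 h2 h3⟩
      rcases Sym2.eq_iff.1 e with ⟨rfl, rfl⟩ | ⟨rfl, rfl⟩ <;> exact lt_irrefl _ ‹_›

theorem Crosses.symm {e f : Sym2 (Fin n)} (h : Crosses p e f) : Crosses p f e := by
  obtain ⟨h1, a, b, c, d, h2, h3, h4⟩ := h
  exact ⟨h1.symm, c, d, a, b, h3, h2, by rwa [Set.inter_comm]⟩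

/-- Otherwise `a b` could be added to the graph, against maximality. -/
theorem IsTriangulation.exists_crosses {G : SimpleGraph (Fin n)} (hG : IsTriangulation p G)
    {a b : Fin n} (hab : a ≠ b) (h : ¬ G.Adj a b) : ∃ c d, G.Adj c d ∧ Crosses p s(a, b) s(c, d) := by
  by_contra hn
  push Not at hn
  have hP : IsPSLG p (G ⊔ SimpleGraph.fromEdgeSet {s(a, b)}) := by
    have key : ∀ e ∈ (G ⊔ SimpleGraph.fromEdgeSet {s(a, b)}).edgeSet, e ∈ G.edgeSet ∨ e = s(a, b) := by
      intro e he
      induction e with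
      | _ c d =>
      simp only [SimpleGraph.mem_edgeSet, SimpleGraph.sup_adj, SimpleGraph.fromEdgeSet_adj,
        Set.mem_singleton_iff] at he ⊢
      tauto
    have hn' : ∀ e ∈ G.edgeSet, ¬ Crosses p s(a, b) e := by
      intro e he
      induction e with
      | _ c d => exact hn c d he
    intro e he f hf hc
    rcases key e he with he | rfl <;> rcases key f hf with hf | rfl
    · exact hG.1 e he f hf hc
    · exact hn' e he hc.symm
    · exact hn' f hf hc
    · exact hc.1 rfl
  have := hG.2 hP le_sup_left
  exact h (this (Or.inr ⟨rfl, hab⟩))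

end Convex

/-! ### Triangulated polygons -/

namespace Tr

variable {V : Type}

/-- The vertex of the polygon at a dyadic rational, if the nodes are labelled by their apexes and
the root edge is `a b`. -/
def vat : Tr V → V → V → ℚ → V
  | leaf, a, b, x => if x ≤ 0 then a else b
  | node v l r, a, b, x => if x ≤ 1 / 2 then l.vat a v (2 * x) else r.vat v b (2 * x - 1)

theorem vat_zero (T : Tr V) (a b : V) : T.vat a b 0 = a := by
  induction T generalizing a b with
  | leaf => simp [vat]
  | node v l r ihl _ => simp [vat, ihl]

theorem vat_one (T : Tr V) (a b : V) : T.vat a b 1 = b := by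
  induction T generalizing a b with
  | leaf => simp [vat]
  | node v l r _ ihr =>
    simp only [vat]
    rw [if_neg (by norm_num)]
    convert ihr v b using 2
    norm_num

theorem vat_goL {v : V} {l r : Tr V} {a b : V} {x : ℚ} (hx : x ≤ 1) :
    (node v l r).vat a b (x / 2) = l.vat a v x := by
  simp only [vat]
  rw [if_pos (by linarith)]
  congr 1; ring

theorem vat_goR {v : V} {l r : Tr V} {a b : V} {x : ℚ} (hx : 0 ≤ x) :
    (node v l r).vat a b ((1 + x) / 2) = r.vat v b x := by
  rcases hx.eq_or_lt with rfl | hx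
  · rw [vat_zero, show ((1 : ℚ) + 0) / 2 = 1 / 2 by norm_num, vat_goL le_rfl, vat_one]
  · simp only [vat]
    rw [if_neg (by linarith)]
    congr 1; ring

end Tr

/-- The tree of the polygon on the edge `a b`, where `v` is the apex over the edge `A v`, `B v`, and
only apexes in `X` are considered. -/
inductive Hang {V : Type} (A B : V → V) (X : V → Prop) : V → V → Tr V → Prop
  | leaf (a b : V) (h : ∀ v, X v → s(A v, B v) ≠ s(a, b)) : Hang A B X a b .leaf
  | node (a b v : V) (l r : Tr V) (hv : X v) (h : s(A v, B v) = s(a, b)) (hl : Hang A B X a v l)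
      (hr : Hang A B X v b r) : Hang A B X a b (.node v l r)

/-- A triangulated polygon: `pos` is the cyclic order of the vertices. -/
structure TriPolygon {n : ℕ} (G : SimpleGraph (Fin n)) (pos : Fin n ≃ Fin n) : Prop where
  noX : ∀ {a b c d}, G.Adj a b → G.Adj c d → pos a < pos c → pos c < pos b → pos b < pos d → False
  max : ∀ {a b}, pos a < pos b → ¬ G.Adj a b →
    ∃ c d, G.Adj c d ∧ pos a < pos c ∧ pos c < pos b ∧ (pos d < pos a ∨ pos b < pos d)

namespace TriPolygon

variable {n : ℕ} {G : SimpleGraph (Fin n)} {pos : Fin n ≃ Fin n}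

/-- `a` and `b` are the first and the last neighbour of `v`. An edge across `a b` would cross `a v`
or `v b`, or lead from `v` beyond `a` or `b`. -/
theorem exists_base (P : TriPolygon G pos) {v : Fin n} (h0 : (pos v : ℕ) ≠ 0) (h1 : (pos v : ℕ) + 1 ≠ n) :
    ∃ a b, pos a < pos v ∧ pos v < pos b ∧ G.Adj a v ∧ G.Adj v b ∧ G.Adj a b ∧
      ∀ u, G.Adj u v → pos a ≤ pos u ∧ pos u ≤ pos b := by
  classical
  have hv := (pos v).2
  have adj1 : ∀ {a b}, (pos a : ℕ) + 1 = pos b → G.Adj a b := by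
    intro a b h
    by_contra hn
    obtain ⟨c, d, -, h1, h2, -⟩ := P.max (by omega) hn
    omega
  have hp : G.Adj (pos.symm ⟨pos v - 1, by omega⟩) v := adj1 (by simp; omega)
  have hs : G.Adj v (pos.symm ⟨pos v + 1, by omega⟩) := adj1 (by simp)
  obtain ⟨a, ha, ha'⟩ := Finset.exists_min_image (Finset.univ.filter fun u => G.Adj u v) pos
    ⟨_, by simpa using hp⟩
  obtain ⟨b, hb, hb'⟩ := Finset.exists_max_image (Finset.univ.filter fun u => G.Adj u v) pos
    ⟨_, by simpa using hs.symm⟩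
  simp only [Finset.mem_filter, Finset.mem_univ, true_and] at ha ha' hb hb'
  have hav : pos a < pos v := by
    have := ha' _ hp
    simp [Fin.le_def] at this
    omega
  have hvb : pos v < pos b := by
    have := hb' _ hs.symm
    simp [Fin.le_def] at this
    omega
  refine ⟨a, b, hav, hvb, ha, hb.symm, ?_, fun u hu => ⟨ha' u hu, hb' u hu⟩⟩
  by_contra hn
  obtain ⟨c, d, hcd, h1, h2, h3⟩ := P.max (hav.trans hvb) hn
  rcases lt_trichotomy (pos c) (pos v) with h | h | h
  · rcases h3 with h3 | h3
    · exact P.noX hcd.symm ha h3 h1 h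
    · exact P.noX ha hcd h1 h (hvb.trans h3)
  · rw [pos.injective h] at hcd
    have := ha' d hcd.symm
    have := hb' d hcd.symm
    omega
  · rcases h3 with h3 | h3
    · exact P.noX hcd.symm hb.symm (h3.trans hav) h h2
    · exact P.noX hb.symm hcd h h2 h3

/-- `v` is the last neighbour of `a` before `b`. An edge across `v b` would cross `a b` or `a v`, or
provide a later neighbour. -/
theorem exists_apex (P : TriPolygon G pos) {a b c : Fin n} (hab : G.Adj a b) (h1 : pos a < pos c) (h2 : pos c < pos b) :
    ∃ v, pos a < pos v ∧ pos v < pos b ∧ G.Adj a v ∧ G.Adj v b := by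
  classical
  have hb := (pos b).2
  have hs : G.Adj a (pos.symm ⟨pos a + 1, by omega⟩) := by
    by_contra hn
    obtain ⟨c, d, -, h1, h2, -⟩ := P.max (by simp [Fin.lt_def]) hn
    rw [Equiv.apply_symm_apply] at h2
    have : (pos c : ℕ) < pos a + 1 := h2
    omega
  obtain ⟨v, hv, hv'⟩ := Finset.exists_max_image
    (Finset.univ.filter fun u => G.Adj a u ∧ pos a < pos u ∧ pos u < pos b) pos
    ⟨_, by
      simp only [Finset.mem_filter, Finset.mem_univ, true_and]
      exact ⟨hs, by simp [Fin.lt_def], by simp [Fin.lt_def]; omega⟩⟩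
  simp only [Finset.mem_filter, Finset.mem_univ, true_and] at hv hv'
  refine ⟨v, hv.2.1, hv.2.2, hv.1, ?_⟩
  by_contra hn
  obtain ⟨c, d, hcd, h1, h2, h3⟩ := P.max hv.2.2 hn
  rcases h3 with h3 | h3
  · rcases lt_trichotomy (pos d) (pos a) with h | h | h
    · exact P.noX hcd.symm hab h (by omega) h2
    · rw [pos.injective h] at hcd
      have := hv' c ⟨hcd.symm, by omega, h2⟩
      omega
    · exact P.noX hv.1 hcd.symm h h3 h1
  · exact P.noX hab hcd (hv.2.1.trans h1) h2 h3

end TriPolygon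

/-- A triangulated polygon as a sequence of ears on the root edge `x y`: the ear `v` is attached to
the edge `A v`, `B v`. -/
structure Elim {n : ℕ} (G : SimpleGraph (Fin n)) (x y : Fin n) (A B : Fin n → Fin n)
    (pos : Fin n ≃ Fin n) (d : Fin n → ℕ) : Prop where
  root : G.Adj x y
  adj : ∀ u w, G.Adj u w ↔ s(u, w) = s(x, y) ∨ (w ≠ x ∧ w ≠ y ∧ (u = A w ∨ u = B w)) ∨
    (u ≠ x ∧ u ≠ y ∧ (w = A u ∨ w = B u))
  base : ∀ v, v ≠ x → v ≠ y → G.Adj (A v) (B v)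
  dA : ∀ v, v ≠ x → v ≠ y → d (A v) < d v
  dB : ∀ v, v ≠ x → v ≠ y → d (B v) < d v
  pA : ∀ v, v ≠ x → v ≠ y → pos (A v) < pos v
  pB : ∀ v, v ≠ x → v ≠ y → pos v < pos (B v)
  inj : ∀ u v, u ≠ x → u ≠ y → v ≠ x → v ≠ y → s(A u, B u) = s(A v, B v) → u = v

namespace TriPolygon

variable {n : ℕ} {G : SimpleGraph (Fin n)} {pos : Fin n ≃ Fin n}

/-- Each vertex other than `x` and `y` is the apex over the edge from its first to its last
neighbour. Every edge except the root edge joins an apex to an end of its base: for an edge `u w`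
without this property, `A w` to `w` and `u` to `B u` would cross. -/
theorem exists_elim (P : TriPolygon G pos) {x y : Fin n} (hx : (pos x : ℕ) = 0)
    (hy : (pos y : ℕ) + 1 = n) (hxy : x ≠ y) : ∃ A B d, Elim G x y A B pos d ∧
      (∀ a b v, G.Adj a v → G.Adj v b → G.Adj a b → pos a < pos v → pos v < pos b →
        A v = a ∧ B v = b) ∧ ∀ v, v ≠ x → v ≠ y → G.Adj (A v) v ∧ G.Adj v (B v) := by
  classical
  have hx0 : ∀ v, v ≠ x ↔ (pos v : ℕ) ≠ 0 := by
    intro v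
    rw [not_iff_not]
    exact ⟨fun h => by rw [h, hx], fun h => pos.injective (Fin.ext (by rw [h, hx]))⟩
  have hy0 : ∀ v, v ≠ y ↔ (pos v : ℕ) + 1 ≠ n := by
    intro v
    rw [not_iff_not]
    exact ⟨fun h => by rw [h, hy], fun h => pos.injective (Fin.ext (by omega))⟩
  have h : ∀ v, ∃ a b, v ≠ x → v ≠ y → pos a < pos v ∧ pos v < pos b ∧ G.Adj a v ∧ G.Adj v b ∧
      G.Adj a b ∧ ∀ u, G.Adj u v → pos a ≤ pos u ∧ pos u ≤ pos b := by
    intro v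
    by_cases h : v ≠ x ∧ v ≠ y
    · obtain ⟨a, b, h'⟩ := P.exists_base ((hx0 v).1 h.1) ((hy0 v).1 h.2)
      exact ⟨a, b, fun _ _ => h'⟩
    · exact ⟨x, x, fun h1 h2 => absurd ⟨h1, h2⟩ h⟩
  choose A B hAB using h
  have hpy : ∀ v, pos v ≤ pos y := fun v => by have := (pos v).2; omega
  have root : G.Adj x y := by
    by_contra hn
    have hlt : pos x < pos y := by
      have := (hx0 y).1 hxy.symm
      omega
    obtain ⟨c, d, -, h1, h2, h3⟩ := P.max hlt hn
    have := hpy d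
    omega
  have uniq : ∀ a b v, G.Adj a v → G.Adj v b → G.Adj a b → pos a < pos v → pos v < pos b →
        A v = a ∧ B v = b := by
    intro a b v hav hvb hab h1 h2
    obtain ⟨g1, g2, g3, g4, g5, g6⟩ := hAB v ((hx0 v).2 (by omega))
      ((hy0 v).2 (by have := (pos b).2; omega))
    have l1 := g6 a hav
    have l2 := g6 b hvb.symm
    constructor
    · refine pos.injective (le_antisymm l1.1 ?_)
      by_contra hn
      exact P.noX g3 hab (by omega) h1 h2
    · refine pos.injective (le_antisymm ?_ l2.2)
      by_contra hn
      exact P.noX hab g4 h1 h2 (by omega)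
  -- The ends of a base have longer bases themselves, or belong to the root edge. So `d`, which
  -- falls as the base grows, decreases towards the root.
  set d : Fin n → ℕ := fun v => if v = x ∨ v = y then 0 else n - ((pos (B v) : ℕ) - pos (A v))
    with hd
  have hdx : d x = 0 := by simp [hd]
  have hdy : d y = 0 := by simp [hd]
  have hdpos : ∀ v, v ≠ x → v ≠ y → d v = n - ((pos (B v) : ℕ) - pos (A v)) ∧ 0 < d v := by
    intro v h1 h2
    have : d v = n - ((pos (B v) : ℕ) - pos (A v)) := by simp [hd, h1, h2]
    refine ⟨this, ?_⟩
    have := (pos (B v)).2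
    omega
  have adj : ∀ u w, pos u < pos w → G.Adj u w → s(u, w) = s(x, y) ∨
      (w ≠ x ∧ w ≠ y ∧ u = A w) ∨ (u ≠ x ∧ u ≠ y ∧ w = B u) := by
    intro u w huw h
    by_contra hn
    push Not at hn
    obtain ⟨n1, n2, n3⟩ := hn
    have hwx : w ≠ x := (hx0 w).2 (by omega)
    have huy : u ≠ y := by
      rintro rfl
      have := hpy w
      omega
    by_cases hwy : w = y
    · have hux : u ≠ x := by rintro rfl; exact n1 (by rw [hwy])
      have g := hAB u hux huy
      have := (g.2.2.2.2.2 w h.symm).2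
      have := hpy (B u)
      rw [← hwy] at this
      exact n3 hux huy (pos.injective (by omega))
    · have gw := hAB w hwx hwy
      have hlt : pos (A w) < pos u := by
        have := (gw.2.2.2.2.2 u h).1
        rcases this.lt_or_eq with h' | h'
        · exact h'
        · exact absurd (pos.injective h').symm (n2 hwx hwy)
      have hux : u ≠ x := (hx0 u).2 (by omega)
      have gu := hAB u hux huy
      have hlt' : pos w < pos (B u) := by
        have := (gu.2.2.2.2.2 w h.symm).2
        rcases this.lt_or_eq with h' | h'
        · exact h'
        · exact absurd (pos.injective h') (n3 hux huy)
      exact P.noX gw.2.2.1 gu.2.2.2.1 hlt huw hlt'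
  refine ⟨A, B, d, ⟨root, ?_, fun v h1 h2 => (hAB v h1 h2).2.2.2.2.1, ?_, ?_,
    fun v h1 h2 => (hAB v h1 h2).1, fun v h1 h2 => (hAB v h1 h2).2.1, ?_⟩, uniq,
    fun v h1 h2 => ⟨(hAB v h1 h2).2.2.1, (hAB v h1 h2).2.2.2.1⟩⟩
  · intro u w
    constructor
    · intro h
      rcases lt_trichotomy (pos u) (pos w) with h' | h' | h'
      · rcases adj u w h' h with h | h | h <;> tauto
      · exact absurd (pos.injective h') h.ne
      · rw [Sym2.eq_swap]
        rcases adj w u h' h.symm with h | h | h <;> tauto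
    · rintro (h | ⟨h1, h2, rfl | rfl⟩ | ⟨h1, h2, rfl | rfl⟩)
      · rw [← SimpleGraph.mem_edgeSet, h]; exact root
      · exact (hAB w h1 h2).2.2.1
      · exact (hAB w h1 h2).2.2.2.1.symm
      · exact (hAB u h1 h2).2.2.1.symm
      · exact (hAB u h1 h2).2.2.2.1
  · intro v h1 h2
    obtain ⟨g1, g2, g3, g4, g5, g6⟩ := hAB v h1 h2
    have hv := hdpos v h1 h2
    by_cases hx' : A v = x
    · rw [hx', hdx]; exact hv.2
    have hy' : A v ≠ y := (hy0 _).2 (by have := (pos v).2; omega)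
    have hA := hdpos (A v) hx' hy'
    obtain ⟨f1, f2, f3, f4, f5, f6⟩ := hAB (A v) hx' hy'
    have := f6 (B v) g5.symm
    have := (pos (B (A v))).2
    omega
  · intro v h1 h2
    obtain ⟨g1, g2, g3, g4, g5, g6⟩ := hAB v h1 h2
    have hv := hdpos v h1 h2
    by_cases hy' : B v = y
    · rw [hy', hdy]; exact hv.2
    have hx' : B v ≠ x := (hx0 _).2 (by omega)
    have hB := hdpos (B v) hx' hy'
    obtain ⟨f1, f2, f3, f4, f5, f6⟩ := hAB (B v) hx' hy'
    have := f6 (A v) g5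
    have := (pos (B (B v))).2
    omega
  · intro u v hu1 hu2 hv1 hv2 h
    obtain ⟨g1, g2, g3, g4, g5, g6⟩ := hAB v hv1 hv2
    obtain ⟨f1, f2, f3, f4, f5, f6⟩ := hAB u hu1 hu2
    rcases Sym2.eq_iff.1 h with ⟨e1, e2⟩ | ⟨e1, e2⟩
    · rw [e1] at f1 f3
      rw [e2] at f2 f4
      rcases lt_trichotomy (pos u) (pos v) with h' | h' | h'
      · exact (P.noX g3 f4 f1 h' g2).elim
      · exact pos.injective h'
      · exact (P.noX f3 g4 g1 h' f2).elim
    · rw [e1] at f1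
      rw [e2] at f2
      omega

/-- Recursion on the span of the edge `a b`: its apex `v` splits the vertices into two ranges, whose
addresses are scaled to the two halves of `[0, 1]`. -/
theorem exists_tree (P : TriPolygon G pos) {A B : Fin n → Fin n} {X : Fin n → Prop}
    (hX : ∀ v, X v → pos (A v) < pos v ∧ pos v < pos (B v))
    (hAB : ∀ a b v, G.Adj a v → G.Adj v b → G.Adj a b → pos a < pos v → pos v < pos b →
        X v ∧ A v = a ∧ B v = b) (m : ℕ) : ∀ a b, G.Adj a b → pos a < pos b →
    (pos b : ℕ) - pos a ≤ m → ∃ (T : Tr (Fin n)) (κ : Fin n → ℚ), Hang A B X a b T ∧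
      κ a = 0 ∧ κ b = 1 ∧
      (∀ u w, pos a ≤ pos u → pos u < pos w → pos w ≤ pos b → κ u < κ w) ∧
      (∀ x, T.vs x ↔ ∃ v, pos a ≤ pos v ∧ pos v ≤ pos b ∧ κ v = x) ∧
      (∀ u w, pos a ≤ pos u → pos u < pos w → pos w ≤ pos b →
        (G.Adj u w ↔ (κ u, κ w) ∈ T.E)) ∧
      ∀ v, pos a ≤ pos v → pos v ≤ pos b → T.vat a b (κ v) = v := by
  classical
  induction m with
  | zero => intro a b _ h h'; omega
  | succ m ih =>
  intro a b hab hlt hm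
  have eqp : ∀ {x y}, pos x = pos y → x = y := fun e => pos.injective e
  by_cases hc : ∃ c, pos a < pos c ∧ pos c < pos b
  · obtain ⟨c, hc1, hc2⟩ := hc
    obtain ⟨v, hv1, hv2, hav, hvb⟩ := P.exists_apex hab hc1 hc2
    obtain ⟨hXv, hAv, hBv⟩ := hAB a b v hav hvb hab hv1 hv2
    obtain ⟨l, κ₁, H₁, z₁, o₁, m₁, r₁, e₁, t₁⟩ := ih a v hav hv1 (by omega)
    obtain ⟨r, κ₂, H₂, z₂, o₂, m₂, r₂, e₂, t₂⟩ := ih v b hvb hv2 (by omega)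
    have b₁ : ∀ u, pos a ≤ pos u → pos u ≤ pos v → 0 ≤ κ₁ u ∧ κ₁ u ≤ 1 :=
      fun u h1 h2 => Tr.vs_bounds ((r₁ _).2 ⟨u, h1, h2, rfl⟩)
    have b₂ : ∀ u, pos v ≤ pos u → pos u ≤ pos b → 0 ≤ κ₂ u ∧ κ₂ u ≤ 1 :=
      fun u h1 h2 => Tr.vs_bounds ((r₂ _).2 ⟨u, h1, h2, rfl⟩)
    set κ : Fin n → ℚ := fun u => if pos u ≤ pos v then κ₁ u / 2 else (1 + κ₂ u) / 2 with hκ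
    have κl : ∀ u, pos u ≤ pos v → κ u = κ₁ u / 2 := fun u h => by simp [hκ, h]
    have κr : ∀ u, pos v ≤ pos u → κ u = (1 + κ₂ u) / 2 := by
      intro u h
      rcases h.eq_or_lt with h | h
      · rw [κl u h.ge, ← eqp h, o₁, z₂]; norm_num
      · simp [hκ, not_le.2 h]
    have κlt : ∀ u, pos a ≤ pos u → pos u < pos v → κ₁ u < 1 := fun u h1 h2 => by
      rw [← o₁]; exact m₁ _ _ h1 h2 le_rfl
    have κgt : ∀ u, pos v < pos u → pos u ≤ pos b → 0 < κ₂ u := fun u h1 h2 => by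
      rw [← z₂]; exact m₂ _ _ le_rfl h1 h2
    have mono : ∀ u w, pos a ≤ pos u → pos u < pos w → pos w ≤ pos b → κ u < κ w := by
      intro u w h1 h2 h3
      rcases le_or_gt (pos w) (pos v) with h | h
      · rw [κl u (by omega), κl w h]
        linarith [m₁ u w h1 h2 h]
      rcases le_or_gt (pos v) (pos u) with h' | h'
      · rw [κr u h', κr w h.le]
        linarith [m₂ u w h' h2 h3]
      · rw [κl u h'.le, κr w h.le]
        linarith [κlt u h1 h', κgt w h h3]
    refine ⟨.node v l r, κ, .node a b v l r hXv (by rw [hAv, hBv]) H₁ H₂,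
      by rw [κl a hv1.le, z₁]; norm_num, by rw [κr b hv2.le, o₂]; norm_num, mono, ?_, ?_, ?_⟩
    · intro x
      simp only [Tr.vs, r₁, r₂]
      constructor
      · rintro (⟨u, h1, h2, h3⟩ | ⟨u, h1, h2, h3⟩)
        · exact ⟨u, h1, by omega, by rw [κl u h2]; linarith⟩
        · exact ⟨u, by omega, h2, by rw [κr u h1]; linarith⟩
      · rintro ⟨u, h1, h2, h3⟩
        rcases le_or_gt (pos u) (pos v) with h | h
        · exact Or.inl ⟨u, h1, h, by rw [κl u h] at h3; linarith⟩
        · exact Or.inr ⟨u, h.le, h2, by rw [κr u h.le] at h3; linarith⟩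
    · intro u w h1 h2 h3
      rw [Tr.mem_E_node]
      rcases le_or_gt (pos w) (pos v) with h | h
      · have hu : pos u ≤ pos v := by omega
        rw [e₁ u w h1 h2 h, κl u hu, κl w h, show 2 * (κ₁ u / 2) = κ₁ u by ring,
          show 2 * (κ₁ w / 2) = κ₁ w by ring]
        have bu := b₁ u h1 hu
        have bw := b₁ w (by omega) h
        have lt := m₁ u w h1 h2 h
        refine ⟨fun h => Or.inr (Or.inl h), ?_⟩
        rintro (h | h | h)
        · exfalso; linarith [h.2]
        · exact h
        · have := Tr.E_bounds h
          exfalso; linarith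
      rcases le_or_gt (pos v) (pos u) with h' | h'
      · rw [e₂ u w h' h2 h3, κr u h', κr w h.le, show 2 * ((1 + κ₂ u) / 2) - 1 = κ₂ u by ring,
          show 2 * ((1 + κ₂ w) / 2) - 1 = κ₂ w by ring]
        have bu := b₂ u h' (by omega)
        have bw := b₂ w (by omega) h3
        have lt := m₂ u w h' h2 h3
        refine ⟨fun h => Or.inr (Or.inr h), ?_⟩
        rintro (h | h | h)
        · exfalso; linarith [h.1]
        · have := Tr.E_bounds h
          exfalso; linarith
        · exact h
      · constructor
        · intro hadj
          have hua : u = a := by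
            by_contra hn
            have : pos a < pos u := lt_of_le_of_ne h1 fun e => hn (eqp e).symm
            exact P.noX hav hadj this h' h
          have hwb : w = b := by
            by_contra hn
            have : pos w < pos b := lt_of_le_of_ne h3 fun e => hn (eqp e)
            exact P.noX hadj hvb h' h this
          left
          rw [hua, hwb, κl a hv1.le, κr b hv2.le, z₁, o₂]
          norm_num
        · have lu := κlt u h1 h'
          have lw := κgt w h h3
          have ku := κl u h'.le
          have kw := κr w h.le
          rintro (⟨hu, hw⟩ | he | he)
          · have hua : u = a := by
              by_contra hn
              have : pos a < pos u := lt_of_le_of_ne h1 fun e => hn (eqp e).symm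
              have := m₁ a u le_rfl this h'.le
              linarith
            have hwb : w = b := by
              by_contra hn
              have : pos w < pos b := lt_of_le_of_ne h3 fun e => hn (eqp e)
              have := m₂ w b h.le this le_rfl
              linarith
            rw [hua, hwb]; exact hab
          · have := Tr.E_bounds he
            exfalso; linarith
          · have := Tr.E_bounds he
            exfalso; linarith
    · intro u h1 h2
      rcases le_or_gt (pos u) (pos v) with h | h
      · rw [κl u h, Tr.vat_goL (b₁ u h1 h).2, t₁ u h1 h]
      · rw [κr u h.le, Tr.vat_goR (b₂ u h.le h2).1, t₂ u h.le h2]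
  · push Not at hc
    have two : ∀ u, pos a ≤ pos u → pos u ≤ pos b → u = a ∨ u = b := by
      intro u h1 h2
      rcases h1.eq_or_lt with h | h
      · exact Or.inl (eqp h).symm
      · exact Or.inr (eqp (le_antisymm h2 (hc u h)))
    have hne : b ≠ a := by rintro rfl; exact lt_irrefl _ hlt
    refine ⟨.leaf, fun u => if u = a then 0 else 1, .leaf a b ?_, by simp, by simp [hne], ?_, ?_, ?_,
      ?_⟩
    · intro v hv he
      have := hX v hv
      rcases Sym2.eq_iff.1 he with ⟨e1, e2⟩ | ⟨e1, e2⟩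
      · rw [e1, e2] at this
        have := hc v this.1
        omega
      · rw [e1, e2] at this; omega
    · intro u w h1 h2 h3
      rcases two u h1 (by omega) with rfl | rfl
      · rcases two w (by omega) h3 with rfl | rfl
        · exact absurd h2 (lt_irrefl _)
        · simp [hne]
      · omega
    · intro x
      simp only [Tr.vs]
      constructor
      · rintro (rfl | rfl)
        · exact ⟨a, le_rfl, hlt.le, by simp⟩
        · exact ⟨b, hlt.le, le_rfl, by simp [hne]⟩
      · rintro ⟨u, h1, h2, rfl⟩
        by_cases h : u = a <;> simp [h]
    · intro u w h1 h2 h3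
      rcases two u h1 (by omega) with rfl | rfl
      · rcases two w (by omega) h3 with rfl | rfl
        · exact absurd h2 (lt_irrefl _)
        · simp [hne, Tr.E, hab]
      · omega
    · intro u h1 h2
      rcases two u h1 h2 with rfl | rfl
      · simp [Tr.vat]
      · simp [Tr.vat, hne]

end TriPolygon

/-! ### Triangulations of points in convex position -/

section Triangulation

variable {n : ℕ} {p : Fin n → Plane} {G : SimpleGraph (Fin n)}

theorem IsTriangulation.triPolygon (hG : IsTriangulation p G) {pos : Fin n ≃ Fin n} {ε : ℝ}
    (h : ∀ a b c, pos a < pos b → pos b < pos c → 0 < ε * orient (p a) (p b) (p c)) :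
    TriPolygon G pos where
  noX := by
    intro a b c d hab hcd h1 h2 h3
    exact hG.1 s(a, b) hab s(c, d) hcd
      ((crosses_iff_interleave h (h1.trans h2) (h2.trans h3)).2 (Or.inl ⟨h1, h2, h3⟩))
  max := by
    intro a b hab hn
    obtain ⟨c, d, hcd, hx⟩ := hG.exists_crosses (by rintro rfl; exact lt_irrefl _ hab) hn
    rcases lt_trichotomy (pos c) (pos d) with h' | h' | h'
    · rcases (crosses_iff_interleave h hab h').1 hx with ⟨h1, h2, h3⟩ | ⟨h1, h2, h3⟩
      · exact ⟨c, d, hcd, h1, h2, Or.inr h3⟩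
      · exact ⟨d, c, hcd.symm, h2, h3, Or.inl h1⟩
    · exact absurd (pos.injective h') hcd.ne
    · rw [Sym2.eq_swap (a := c)] at hx
      rcases (crosses_iff_interleave h hab h').1 hx with ⟨h1, h2, h3⟩ | ⟨h1, h2, h3⟩
      · exact ⟨d, c, hcd.symm, h1, h2, Or.inr h3⟩
      · exact ⟨c, d, hcd, h2, h3, Or.inl h1⟩

theorem IsTriangulation.exists_elim_of_pos (hG : IsTriangulation p G) {pos : Fin n ≃ Fin n} {ε : ℝ}
    (h : ∀ a b c, pos a < pos b → pos b < pos c → 0 < ε * orient (p a) (p b) (p c)) {x y : Fin n}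
    (hx : (pos x : ℕ) = 0) (hy : (pos y : ℕ) + 1 = n) (hxy : x ≠ y) :
    ∃ (A B : Fin n → Fin n) (d : Fin n → ℕ) (T : Tr (Fin n)) (κ : Fin n → ℚ),
      Elim G x y A B pos d ∧ Hang A B (fun v => v ≠ x ∧ v ≠ y) x y T ∧ Tr.Model p G T κ ∧
        (∀ v, T.vat x y (κ v) = v) ∧ κ x = 0 ∧ κ y = 1 := by
  have P := hG.triPolygon h
  have hle : ∀ v, pos x ≤ pos v ∧ pos v ≤ pos y := by
    intro v
    have := (pos v).2
    constructor <;> omega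
  obtain ⟨A, B, d, hE, hu, -⟩ := P.exists_elim hx hy hxy
  have hlt : pos x < pos y := lt_of_le_of_ne (hle y).1 fun e => hxy (pos.injective e)
  obtain ⟨T, κ, hH, z, o, mono, range, adj, hv⟩ := P.exists_tree (A := A) (B := B)
    (X := fun v => v ≠ x ∧ v ≠ y) (fun v hv => ⟨hE.pA v hv.1 hv.2, hE.pB v hv.1 hv.2⟩)
    (fun a b v h1 h2 h3 h4 h5 => ⟨⟨by rintro rfl; have := hle a; omega,
      by rintro rfl; have := hle b; omega⟩, hu a b v h1 h2 h3 h4 h5⟩) n x y hE.root hlt (by omega)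
  have lt_iff : ∀ u w, κ u < κ w ↔ pos u < pos w := by
    intro u w
    refine ⟨fun h => ?_, fun h => mono u w (hle u).1 h (hle w).2⟩
    rcases lt_trichotomy (pos u) (pos w) with h' | h' | h'
    · exact h'
    · rw [pos.injective h'] at h; exact absurd h (lt_irrefl _)
    · exact absurd (mono w u (hle w).1 h' (hle u).2) (by linarith)
  refine ⟨A, B, d, T, κ, hE, hH, ⟨?_, ?_, ?_, ?_⟩, fun v => hv v (hle v).1 (hle v).2, z, o⟩
  · intro u w huw
    rw [← hv u (hle u).1 (hle u).2, huw, hv w (hle w).1 (hle w).2]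
  · intro q
    rw [range]
    exact ⟨fun ⟨v, h⟩ => ⟨v, h.2.2⟩, fun ⟨v, h⟩ => ⟨v, (hle v).1, (hle v).2, h⟩⟩
  · intro a b
    unfold Tr.SE
    constructor
    · intro hab
      rcases lt_trichotomy (pos a) (pos b) with h' | h' | h'
      · exact Or.inl ((adj a b (hle a).1 h' (hle b).2).1 hab)
      · exact absurd (pos.injective h') hab.ne
      · exact Or.inr ((adj b a (hle b).1 h' (hle a).2).1 hab.symm)
    · rintro (hab | hab)
      · exact (adj a b (hle a).1 ((lt_iff _ _).1 (Tr.E_bounds hab).2.1) (hle b).2).2 hab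
      · exact ((adj b a (hle b).1 ((lt_iff _ _).1 (Tr.E_bounds hab).2.1) (hle a).2).2 hab).symm
  · intro a b c d hab hcd
    unfold Separates
    simp only [lt_iff] at hab hcd ⊢
    rw [crosses_iff_interleave h hab hcd]
    omega

theorem exists_last (hp : ConvexIndependent ℝ p) (x : Fin n) {ε : ℝ} (hε : ε = 1 ∨ ε = -1)
    (hn : 3 ≤ n) : ∃ (pos : Fin n ≃ Fin n) (z : Fin n), (pos x : ℕ) = 0 ∧ (pos z : ℕ) + 1 = n ∧ x ≠ z ∧
      (∀ a b, a ≠ x → b ≠ x → a ≠ b → (pos a < pos b ↔ 0 < ε * orient (p x) (p a) (p b))) ∧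
      ∀ a b c, pos a < pos b → pos b < pos c → 0 < ε * orient (p a) (p b) (p c) := by
  obtain ⟨pos, h0, h1, h2⟩ := exists_pos hp x hε
  refine ⟨pos, pos.symm ⟨n - 1, by omega⟩, h0, by simp; omega, ?_, h1, h2⟩
  intro h
  rw [h, Equiv.apply_symm_apply] at h0
  simp only at h0
  omega

/-- A triangulation in which `x` has degree 2 is a triangulated polygon with root edge `x y`. -/
theorem IsTriangulation.exists_model (hp : ConvexIndependent ℝ p) (hG : IsTriangulation p G)
    (hn : 3 ≤ n) {x y : Fin n} (hxy : G.Adj x y)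
    (h : ∀ u v, u ≠ v → G.Adj x u → G.Adj x v → y = u ∨ y = v) :
    ∃ (A B : Fin n → Fin n) (pos : Fin n ≃ Fin n) (d : Fin n → ℕ) (T : Tr (Fin n)) (κ : Fin n → ℚ),
      Elim G x y A B pos d ∧ Hang A B (fun v => v ≠ x ∧ v ≠ y) x y T ∧ Tr.Model p G T κ ∧
        (∀ v, T.vat x y (κ v) = v) ∧ κ x = 0 ∧ κ y = 1 := by
  obtain ⟨pos, z, h0, hz, hxz, h1, h2⟩ := exists_last hp x (Or.inl rfl) hn
  by_cases hyz : y = z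
  · subst hyz
    obtain ⟨A, B, d, h⟩ := hG.exists_elim_of_pos h2 h0 hz hxz
    exact ⟨A, B, pos, d, h⟩
  -- The two neighbours of `x` are adjacent to it on the hull. If `y` is not the last vertex in the
  -- first orientation, it is the second one there, hence the last one in the reverse orientation.
  obtain ⟨pos', z', h0', hz', hxz', h1', h2'⟩ := exists_last hp x (Or.inr rfl) hn
  have P := hG.triPolygon h2
  obtain ⟨A₀, B₀, d₀, hE, -⟩ := P.exists_elim h0 hz hxz
  set u := pos.symm ⟨1, by omega⟩ with hu
  have pu : (pos u : ℕ) = 1 := by simp [hu]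
  have hxu : G.Adj x u := by
    by_contra hn
    obtain ⟨c, d, -, g1, g2, -⟩ := P.max (by omega) hn
    omega
  have huz : u ≠ z := by rintro h; rw [h] at pu; omega
  have hyu : y = u := (h u z huz hxu hE.root).resolve_right hyz
  have hyz' : y = z' := by
    by_contra hne
    have hz'y : pos z' < pos y := by
      rw [h1 z' y hxz'.symm hxy.ne' (Ne.symm hne), orient_swap]
      have : pos' y < pos' z' := by
        have e : pos' y ≠ pos' z' := fun e => hne (pos'.injective e)
        have := (pos' y).2
        omega
      rw [h1' y z' hxy.ne' hxz'.symm hne] at this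
      linarith
    have : pos z' ≠ pos x := fun e => hxz' (pos.injective e).symm
    rw [← hyu] at pu
    omega
  obtain ⟨A, B, d, h⟩ := hG.exists_elim_of_pos h2' h0' hz' hxz'
  rw [← hyz'] at h
  exact ⟨A, B, pos', d, h⟩

/-- `v` maximizes `d` outside `X`. Apexes over edges at `v` have larger `d`, so they belong to `X`.
-/
theorem Elim.exists_top {x y : Fin n} {A B : Fin n → Fin n} {pos : Fin n ≃ Fin n} {d : Fin n → ℕ}
    (hE : Elim G x y A B pos d) {X : Fin n → Prop} (h : ∃ v, v ≠ x ∧ v ≠ y ∧ ¬ X v) :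
    ∃ v, v ≠ x ∧ v ≠ y ∧ ¬ X v ∧ ∀ u, G.Adj v u → ¬ X u → u = A v ∨ u = B v := by
  classical
  obtain ⟨v, hv, hmax⟩ := Finset.exists_max_image
    (Finset.univ.filter fun v => v ≠ x ∧ v ≠ y ∧ ¬ X v) d
    (by obtain ⟨v, hv⟩ := h; exact ⟨v, by simpa using hv⟩)
  simp only [Finset.mem_filter, Finset.mem_univ, true_and] at hv hmax
  refine ⟨v, hv.1, hv.2.1, hv.2.2, fun u huv hu => ?_⟩
  rcases (hE.adj v u).1 huv with h | ⟨h1, h2, h3⟩ | ⟨_, _, h3⟩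
  · rcases Sym2.eq_iff.1 h with ⟨rfl, _⟩ | ⟨rfl, _⟩
    · exact absurd rfl hv.1
    · exact absurd rfl hv.2.1
  · have := hmax u ⟨h1, h2, hu⟩
    have hA := hE.dA u h1 h2
    have hB := hE.dB u h1 h2
    rcases h3 with h3 | h3
    · rw [← h3] at hA; omega
    · rw [← h3] at hB; omega
  · exact h3

/-- With nothing removed, the top vertex is an ear of the whole polygon. -/
theorem IsTriangulation.exists_degree_two (hp : ConvexIndependent ℝ p) (hG : IsTriangulation p G)
    (hn : 3 ≤ n) : ∃ x a b, a ≠ b ∧ ∀ u, G.Adj x u ↔ u = a ∨ u = b := by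
  obtain ⟨pos, z, h0, hz, hxz, -, h2⟩ := exists_last hp ⟨0, by omega⟩ (Or.inl rfl) hn
  obtain ⟨A, B, d, hE, -, hadj⟩ := (hG.triPolygon h2).exists_elim h0 hz hxz
  set u := pos.symm ⟨1, by omega⟩ with hu
  have pu : (pos u : ℕ) = 1 := by simp [hu]
  obtain ⟨v, h1, h2, -, h3⟩ := hE.exists_top (X := fun _ => False)
    ⟨u, by rintro h; rw [h] at pu; omega, by rintro h; rw [h] at pu; omega, not_false⟩
  refine ⟨v, A v, B v, (hE.base v h1 h2).ne, fun u => ⟨fun h => h3 u h not_false, ?_⟩⟩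
  rintro (rfl | rfl)
  · exact (hadj v h1 h2).1.symm
  · exact (hadj v h1 h2).2

end Triangulation

/-! ### Dynamic programming over the tree -/

namespace Tr

def size {α : Type} : Tr α → ℕ
  | leaf => 0
  | node _ l r => l.size + r.size + 1

end Tr

section Hang

variable {n : ℕ} {G : SimpleGraph (Fin n)} {x y : Fin n} {A B : Fin n → Fin n}
  {pos : Fin n ≃ Fin n} {d : Fin n → ℕ} {X : Fin n → Prop}

theorem Hang.unique (hE : Elim G x y A B pos d) (hX : ∀ v, X v → v ≠ x ∧ v ≠ y) {a b : Fin n}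
    {T T' : Tr (Fin n)} (h : Hang A B X a b T) (h' : Hang A B X a b T') : T = T' := by
  induction h generalizing T' with
  | leaf a b h =>
    cases h' with
    | leaf => rfl
    | node _ _ v l r hv he => exact absurd he (h v hv)
  | node a b v l r hv he _ _ ihl ihr =>
    cases h' with
    | leaf _ _ h => exact absurd he (h v hv)
    | node _ _ v' l' r' hv' he' hl' hr' =>
      have := hE.inj v v' (hX v hv).1 (hX v hv).2 (hX v' hv').1 (hX v' hv').2 (he.trans he'.symm)
      subst this
      rw [ihl hl', ihr hr']

/-- A new apex changes only the trees on its own base. The inner edges of any other tree have an end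
in `X`, and the ends of the base are not in `X`. -/
theorem Hang.insert {v a b : Fin n} {T : Tr (Fin n)} (h : Hang A B X a b T)
    (hA : ¬ X (A v)) (hB : ¬ X (B v)) (hab : s(A v, B v) ≠ s(a, b)) :
    Hang A B (fun u => X u ∨ u = v) a b T := by
  induction h with
  | leaf a b h =>
    refine .leaf a b ?_
    rintro u (hu | rfl)
    exacts [h u hu, hab]
  | node a b w l r hw he _ _ ihl ihr =>
    refine .node a b w l r (Or.inl hw) he (ihl fun e => ?_) (ihr fun e => ?_)
    · have : w ∈ s(A v, B v) := by rw [e]; exact Sym2.mem_mk_right _ _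
      rcases Sym2.mem_iff.1 this with rfl | rfl
      exacts [hA hw, hB hw]
    · have : w ∈ s(A v, B v) := by rw [e]; exact Sym2.mem_mk_left _ _
      rcases Sym2.mem_iff.1 this with rfl | rfl
      exacts [hA hw, hB hw]

/-- The bound is the distance of two positions in terms of truncated subtraction; every apex has its
own position strictly in between. -/
theorem Hang.size_lt (hE : Elim G x y A B pos d) (hX : ∀ v, X v → v ≠ x ∧ v ≠ y) {a b : Fin n}
    {T : Tr (Fin n)} (h : Hang A B X a b T) (hab : a ≠ b) :
    T.size < (pos a - pos b : ℕ) + (pos b - pos a : ℕ) := by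
  induction h with
  | leaf a b h =>
    have : (pos a : ℕ) ≠ pos b := fun e => hab (pos.injective (Fin.ext e))
    simp only [Tr.size]; omega
  | node a b v l r hv he _ _ ihl ihr =>
    have h1 := hE.pA v (hX v hv).1 (hX v hv).2
    have h2 := hE.pB v (hX v hv).1 (hX v hv).2
    have hlt : (pos a < pos v ∧ pos v < pos b) ∨ (pos b < pos v ∧ pos v < pos a) := by
      rcases Sym2.eq_iff.1 he with ⟨rfl, rfl⟩ | ⟨rfl, rfl⟩
      · exact Or.inl ⟨h1, h2⟩
      · exact Or.inr ⟨h1, h2⟩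
    have := ihl (by rintro rfl; omega)
    have := ihr (by rintro rfl; omega)
    simp only [Tr.size]
    omega

end Hang

namespace Auto

/-- The cost, plus one, of combining two subtrees. -/
def cand (f g : ℕ → ℕ) (τ : Lab × ℕ × ℕ × ℕ) : ℕ := f τ.2.1 + g τ.2.2.1 - 1 + τ.1.card

/-- The update of a table by a transition; `0` stands for infinity. -/
def relax (f g h : ℕ → ℕ) (τ : Lab × ℕ × ℕ × ℕ) : ℕ → ℕ :=
  if (f τ.2.1 ≠ 0 ∧ g τ.2.2.1 ≠ 0) ∧ (h τ.2.2.2 = 0 ∨ cand f g τ < h τ.2.2.2) then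
    Function.update h τ.2.2.2 (cand f g τ) else h

variable {V : Type} (D : Auto)

/-- The least cost, plus one, of a labelling accepted in a state; `0` if there is none. -/
def dp : Tr V → ℕ → ℕ
  | .leaf => fun q => if q = D.start then 1 else 0
  | .node _ l r => D.trans.foldl (relax (dp l) (dp r)) fun _ => 0

/-- The transition `τ` explains the value of the table `h` at `q`. -/
def Fits (f g h : ℕ → ℕ) (q : ℕ) (τ : Lab × ℕ × ℕ × ℕ) : Prop :=
  q = τ.2.2.2 ∧ f τ.2.1 ≠ 0 ∧ g τ.2.2.1 ≠ 0 ∧ cand f g τ = h q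

instance (f g h : ℕ → ℕ) (q : ℕ) (τ : Lab × ℕ × ℕ × ℕ) : Decidable (Fits f g h q τ) := by
  unfold Fits; infer_instance

/-- The first fitting transition is taken. The program tests the transitions in the same order and
so reconstructs exactly this tree. -/
def best : Tr V → ℕ → Tr Lab
  | .leaf, _ => .leaf
  | .node v l r, q =>
    match D.trans.find? fun τ => Fits (D.dp l) (D.dp r) (D.dp (.node v l r)) q τ with
    | some τ => .node τ.1 (best l τ.2.1) (best r τ.2.2.1)
    | none => .leaf

/-- The invariant of the fold: with `us` processed, each nonzero entry is attained by a transition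
in `us`, and no transition in `us` gives less. -/
theorem foldl_relax (f g : ℕ → ℕ) (ts : List (Lab × ℕ × ℕ × ℕ)) (h : ℕ → ℕ)
    (us : List (Lab × ℕ × ℕ × ℕ))
    (h1 : ∀ q, h q ≠ 0 → ∃ τ ∈ us, q = τ.2.2.2 ∧ f τ.2.1 ≠ 0 ∧ g τ.2.2.1 ≠ 0 ∧ cand f g τ = h q)
    (h2 : ∀ τ ∈ us, f τ.2.1 ≠ 0 → g τ.2.2.1 ≠ 0 → h τ.2.2.2 ≠ 0 ∧ h τ.2.2.2 ≤ cand f g τ) :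
    (∀ q, ts.foldl (relax f g) h q ≠ 0 → ∃ τ ∈ us ++ ts, Fits f g (ts.foldl (relax f g) h) q τ) ∧
    ∀ τ ∈ us ++ ts, f τ.2.1 ≠ 0 → g τ.2.2.1 ≠ 0 → ts.foldl (relax f g) h τ.2.2.2 ≠ 0 ∧
      ts.foldl (relax f g) h τ.2.2.2 ≤ cand f g τ := by
  induction ts generalizing h us with
  | nil => rw [List.append_nil]; exact ⟨h1, h2⟩
  | cons τ ts ih =>
    have := ih (relax f g h τ) (us ++ [τ]) ?_ ?_
    · simpa using this
    · intro q hq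
      unfold relax at hq ⊢
      split_ifs at hq ⊢ with hc
      · rw [Function.update_apply] at hq ⊢
        split_ifs at hq ⊢ with he
        · exact ⟨τ, by simp, he, hc.1.1, hc.1.2, rfl⟩
        · obtain ⟨σ, hσ, hr⟩ := h1 q hq
          exact ⟨σ, by simp [hσ], hr⟩
      · obtain ⟨σ, hσ, hr⟩ := h1 q hq
        exact ⟨σ, by simp [hσ], hr⟩
    · intro σ hσ hf hg
      rw [List.mem_append, List.mem_singleton] at hσ
      unfold relax
      split_ifs with hc
      · rw [Function.update_apply]
        have hpos : cand f g τ ≠ 0 := by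
          have := hc.1; unfold cand; omega
        split_ifs with he
        · refine ⟨hpos, ?_⟩
          rcases hσ with hσ | rfl
          · have := h2 σ hσ hf hg
            rw [he] at this
            have := hc.2
            omega
          · exact le_rfl
        · rcases hσ with hσ | rfl
          · exact h2 σ hσ hf hg
          · exact absurd rfl he
      · rcases hσ with hσ | rfl
        · exact h2 σ hσ hf hg
        · push Not at hc
          exact hc ⟨hf, hg⟩

variable {D}

theorem exists_fits {v : V} {l r : Tr V} {q : ℕ} (h : D.dp (.node v l r) q ≠ 0) :
    ∃ τ ∈ D.trans, Fits (D.dp l) (D.dp r) (D.dp (.node v l r)) q τ := by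
  have := (foldl_relax (D.dp l) (D.dp r) D.trans (fun _ => 0) [] (by simp) (by simp)).1 q h
  rw [List.nil_append] at this
  exact this

theorem dp_le_cand {v : V} {l r : Tr V} {τ : Lab × ℕ × ℕ × ℕ} (hτ : τ ∈ D.trans)
    (h1 : D.dp l τ.2.1 ≠ 0) (h2 : D.dp r τ.2.2.1 ≠ 0) : D.dp (.node v l r) τ.2.2.2 ≠ 0 ∧
      D.dp (.node v l r) τ.2.2.2 ≤ cand (D.dp l) (D.dp r) τ := by
  have := (foldl_relax (D.dp l) (D.dp r) D.trans (fun _ => 0) [] (by simp) (by simp)).2 τ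
  exact this (by simpa using hτ) h1 h2

theorem best_node {v : V} {l r : Tr V} {q : ℕ} (h : D.dp (.node v l r) q ≠ 0) :
    ∃ τ ∈ D.trans, (D.trans.find? fun τ => Fits (D.dp l) (D.dp r) (D.dp (.node v l r)) q τ) = some τ ∧
      Fits (D.dp l) (D.dp r) (D.dp (.node v l r)) q τ ∧
      D.best (.node v l r) q = .node τ.1 (D.best l τ.2.1) (D.best r τ.2.2.1) := by
  obtain ⟨σ, hσ, hf⟩ := exists_fits h
  cases he : D.trans.find? fun τ => Fits (D.dp l) (D.dp r) (D.dp (.node v l r)) q τ with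
  | none =>
    rw [List.find?_eq_none] at he
    exact absurd hf (by simpa using he σ hσ)
  | some τ =>
    refine ⟨τ, List.mem_of_find?_eq_some he, rfl, by simpa using List.find?_some he, ?_⟩
    rw [best, he]

theorem best_spec (T : Tr V) (q : ℕ) (h : D.dp T q ≠ 0) : D.Acc (D.best T q) q ∧
    (D.best T q).map (fun _ => ()) = T.map (fun _ => ()) ∧ (D.best T q).cost + 1 = D.dp T q := by
  induction T generalizing q with
  | leaf =>
    simp only [dp, ne_eq, ite_eq_right_iff, one_ne_zero, imp_false, not_not] at h
    simp [best, Acc, Tr.map, Tr.cost, dp, h]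
  | node v l r ihl ihr =>
    obtain ⟨τ, hτ, -, ⟨hq, h1, h2, h3⟩, hb⟩ := best_node h
    obtain ⟨al, sl, cl⟩ := ihl _ h1
    obtain ⟨ar, sr, cr⟩ := ihr _ h2
    rw [hb]
    refine ⟨⟨τ.2.1, τ.2.2.1, by rw [hq]; exact hτ, al, ar⟩, by simp [Tr.map, sl, sr], ?_⟩
    rw [← h3]
    simp only [Tr.cost, cand]
    omega

/-- At every node the table has been relaxed with the transition that the run on `S` uses. -/
theorem dp_le_cost {T : Tr V} {S : Tr Lab} {q : ℕ}
    (hs : S.map (fun _ => ()) = T.map (fun _ => ())) (h : D.Acc S q) :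
    D.dp T q ≠ 0 ∧ D.dp T q ≤ S.cost + 1 := by
  induction T generalizing S q with
  | leaf =>
    cases S with
    | leaf =>
      have h : q = D.start := h
      simp [dp, h]
    | node => simp [Tr.map] at hs
  | node v l r ihl ihr =>
    cases S with
    | leaf => simp [Tr.map] at hs
    | node a l' r' =>
      simp only [Tr.map, Tr.node.injEq, true_and] at hs
      obtain ⟨q₁, q₂, hτ, h1, h2⟩ := h
      obtain ⟨nl, cl⟩ := ihl hs.1 h1
      obtain ⟨nr, cr⟩ := ihr hs.2 h2
      obtain ⟨n', c'⟩ := dp_le_cand (v := v) hτ nl nr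
      refine ⟨n', c'.trans ?_⟩
      simp only [cand, Tr.cost]
      omega

/-- A bound for the sizes of the labels. -/
def width (D : Auto) : ℕ := (D.trans.map fun τ => τ.1.card).sum

theorem card_le_width {τ : Lab × ℕ × ℕ × ℕ} (h : τ ∈ D.trans) : τ.1.card ≤ D.width :=
  List.single_le_sum (fun _ _ => Nat.zero_le _) _ (List.mem_map.2 ⟨τ, h, rfl⟩)

/-- This keeps the table entries within words of `O(log n)` bits. -/
theorem dp_le (T : Tr V) (q : ℕ) : D.dp T q ≤ D.width * T.size + 1 := by
  induction T generalizing q with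
  | leaf => simp only [dp]; split_ifs <;> omega
  | node v l r ihl ihr =>
    by_cases h : D.dp (.node v l r) q = 0
    · omega
    · obtain ⟨τ, hτ, -, h1, h2, h3⟩ := exists_fits h
      have := ihl τ.2.1
      have := ihr τ.2.2.1
      have := card_le_width hτ
      rw [← h3]
      simp only [cand, Tr.size, mul_add, mul_one]
      omega

end Auto

/-! ### Running straight-line programs and loops -/

namespace RealRAM

namespace State

def setv (s : State) (x v : ℕ) : State := { s with var := Function.update s.var x v }

def sta (s : State) (A i v : ℕ) : State :=
  { s with arr := Function.update s.arr A (Function.update (s.arr A) i v) }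

/-- All words in the state are at most `B`. -/
def Bdd (s : State) (B : ℕ) : Prop := (∀ x, s.var x ≤ B) ∧ ∀ A i, s.arr A i ≤ B

theorem setv_var (s : State) (x v y : ℕ) : (s.setv x v).var y = if y = x then v else s.var y := by
  simp [setv, Function.update_apply]

theorem setv_arr (s : State) (x v : ℕ) : (s.setv x v).arr = s.arr := rfl

theorem sta_var (s : State) (A i v : ℕ) : (s.sta A i v).var = s.var := rfl

theorem sta_arr (s : State) (A i v C j : ℕ) :
    (s.sta A i v).arr C j = if C = A ∧ j = i then v else s.arr C j := by
  by_cases h : C = A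
  · subst h; simp [sta, Function.update_apply]
  · simp [sta, h]

theorem sta_arr_ne (s : State) (A i v C : ℕ) (h : C ≠ A) : (s.sta A i v).arr C = s.arr C := by
  simp [sta, h]

theorem Bdd.mono {s : State} {B C : ℕ} (h : s.Bdd B) (hBC : B ≤ C) : s.Bdd C :=
  ⟨fun x => (h.1 x).trans hBC, fun A i => (h.2 A i).trans hBC⟩

theorem Bdd.setv {s : State} {B x v : ℕ} (h : s.Bdd B) (hv : v ≤ B) : (s.setv x v).Bdd B := by
  refine ⟨fun y => ?_, h.2⟩
  rw [setv_var]; split_ifs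
  exacts [hv, h.1 y]

theorem Bdd.sta {s : State} {B A i v : ℕ} (h : s.Bdd B) (hv : v ≤ B) : (s.sta A i v).Bdd B := by
  refine ⟨h.1, fun C j => ?_⟩
  rw [sta_arr]; split_ifs
  exacts [hv, h.2 C j]

end State

namespace Expr

/-- An exponent that bounds the value. -/
def width : Expr → ℕ
  | const c => c + 1
  | var _ => 1
  | read _ _ => 1
  | add a b => a.width + b.width
  | sub a b => a.width + b.width
  | mul a b => a.width + b.width
  | div a b => a.width + b.width

theorem width_pos (e : Expr) : 1 ≤ e.width := by
  induction e <;> simp only [width] <;> omega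

theorem val_le {s : State} {B : ℕ} (hB : 2 ≤ B) (hs : s.Bdd B) (e : Expr) :
    e.val s ≤ B ^ e.width := by
  have two : ∀ e : Expr, 2 ≤ B ^ e.width := fun e =>
    hB.trans (Nat.le_self_pow (by have := e.width_pos; omega) B)
  have grow : ∀ a b : Expr, B ^ a.width ≤ B ^ (a.width + b.width) := fun a b =>
    Nat.pow_le_pow_right (by omega) (by omega)
  induction e with
  | const c =>
    simp only [val, width]
    calc c ≤ 2 ^ c := Nat.lt_two_pow_self.le
      _ ≤ B ^ c := Nat.pow_le_pow_left hB c
      _ ≤ B ^ (c + 1) := Nat.pow_le_pow_right (by omega) (by omega)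
  | var x => simpa [val, width] using hs.1 x
  | read A i _ => simpa [val, width] using hs.2 A (i.val s)
  | add a b iha ihb =>
    simp only [val, width]
    rw [pow_add]
    have := two a
    have := two b
    nlinarith
  | sub a b iha _ => exact (Nat.sub_le _ _).trans (iha.trans (grow a b))
  | mul a b iha ihb =>
    simp only [val, width]
    rw [pow_add]
    exact Nat.mul_le_mul iha ihb
  | div a b iha _ => exact (Nat.div_le_self _ _).trans (iha.trans (grow a b))

end Expr

namespace Prog

/-- No loops and no real numbers. -/
def Straight : Prog → Prop
  | skip => True
  | assign _ _ => True
  | store _ _ _ => True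
  | seq P Q => P.Straight ∧ Q.Straight
  | ite _ P Q => P.Straight ∧ Q.Straight
  | _ => False

open Classical in
/-- The effect of a straight-line program. -/
noncomputable def eff : Prog → State → State
  | assign x e, s => s.setv x (e.val s)
  | store A i e, s => s.sta A (i.val s) (e.val s)
  | seq P Q, s => Q.eff (P.eff s)
  | ite b P Q, s => if b.Holds s then P.eff s else Q.eff s
  | _, s => s

def width : Prog → ℕ
  | assign _ e => e.width
  | store _ i e => i.width + e.width
  | seq P Q => P.width * Q.width
  | ite _ P Q => P.width * Q.width
  | _ => 1

def time : Prog → ℕ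
  | assign _ e => e.cost + 1
  | store _ i e => i.cost + e.cost + 1
  | seq P Q => P.time + Q.time
  | ite b P Q => b.cost + 1 + (P.time + Q.time)
  | _ => 1

theorem width_pos (P : Prog) : 1 ≤ P.width := by
  induction P with
  | assign _ e => exact e.width_pos
  | store _ i e => simp only [width]; have := e.width_pos; omega
  | seq P Q h1 h2 => exact Nat.mul_pos h1 h2
  | ite b P Q h1 h2 => exact Nat.mul_pos h1 h2
  | _ => exact le_rfl

/-- Words bounded by `B` stay below a constant power of `B`, and the exponents multiply along the
program. For a branching both branches are charged, in `time` as in `width`. -/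
theorem exec_straight {W : ℕ} (P : Prog) : ∀ {s : State} {B : ℕ}, P.Straight → 2 ≤ B → s.Bdd B →
    B ^ P.width ≤ W → (∃ t ≤ P.time, Exec W P s t (P.eff s)) ∧ (P.eff s).Bdd (B ^ P.width) := by
  induction P with
  | skip =>
    intro s B _ _ hs _
    exact ⟨⟨1, le_rfl, .skip s⟩, by simpa [eff, width] using hs⟩
  | assign x e =>
    intro s B _ hB hs hW
    have := e.val_le hB hs
    exact ⟨⟨_, le_rfl, .assign s x e (this.trans hW)⟩,
      (hs.mono (Nat.le_self_pow (by have := e.width_pos; simp only [width]; omega) B)).setv this⟩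
  | store A i e =>
    intro s B _ hB hs hW
    have hi := i.val_le hB hs
    have he := e.val_le hB hs
    have h1 : B ^ i.width ≤ B ^ (i.width + e.width) := Nat.pow_le_pow_right (by omega) (by omega)
    have h2 : B ^ e.width ≤ B ^ (i.width + e.width) := Nat.pow_le_pow_right (by omega) (by omega)
    exact ⟨⟨_, le_rfl, .store s A i e (hi.trans (h1.trans hW)) (he.trans (h2.trans hW))⟩,
      (hs.mono (Nat.le_self_pow (by have := e.width_pos; simp only [width]; omega) B)).sta
        (he.trans h2)⟩
  | seq P Q ihP ihQ =>
    intro s B hS hB hs hW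
    simp only [width] at hW ⊢
    have hP := P.width_pos
    have hQ := Q.width_pos
    obtain ⟨⟨t, ht, e⟩, b⟩ := ihP hS.1 hB hs
      ((Nat.pow_le_pow_right (by omega) (Nat.le_mul_of_pos_right _ hQ)).trans hW)
    rw [pow_mul] at hW ⊢
    obtain ⟨⟨t', ht', e'⟩, b'⟩ := ihQ hS.2 (hB.trans (Nat.le_self_pow (by omega) B)) b hW
    exact ⟨⟨t + t', Nat.add_le_add ht ht', .seq e e'⟩, b'⟩
  | ite b P Q ihP ihQ =>
    intro s B hS hB hs hW
    simp only [width] at hW ⊢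
    have h1 : B ^ P.width ≤ B ^ (P.width * Q.width) :=
      Nat.pow_le_pow_right (by omega) (Nat.le_mul_of_pos_right _ Q.width_pos)
    have h2 : B ^ Q.width ≤ B ^ (P.width * Q.width) :=
      Nat.pow_le_pow_right (by omega) (Nat.le_mul_of_pos_left _ P.width_pos)
    by_cases hb : b.Holds s
    · obtain ⟨⟨t, ht, e⟩, bd⟩ := ihP hS.1 hB hs (h1.trans hW)
      simp only [eff, if_pos hb]
      exact ⟨⟨_, by simp only [time]; omega, .iteTrue hb e⟩, bd.mono h1⟩
    · obtain ⟨⟨t, ht, e⟩, bd⟩ := ihQ hS.2 hB hs (h2.trans hW)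
      simp only [eff, if_neg hb]
      exact ⟨⟨_, by simp only [time]; omega, .iteFalse hb e⟩, bd.mono h2⟩
  | _ => intro s B hS; exact hS.elim

end Prog

/-- The program halts within `T` steps in a state with the property `Q`. -/
def Runs (W : ℕ) (P : Prog) (s : State) (T : ℕ) (Q : State → Prop) : Prop :=
  ∃ t s', Exec W P s t s' ∧ t ≤ T ∧ Q s'

theorem Runs.seq {W : ℕ} {P Q : Prog} {s : State} {T₁ T₂ : ℕ} {R S : State → Prop}
    (h₁ : Runs W P s T₁ R) (h₂ : ∀ s', R s' → Runs W Q s' T₂ S) : Runs W (P.seq Q) s (T₁ + T₂) S := by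
  obtain ⟨t, s', e, ht, h⟩ := h₁
  obtain ⟨t', s'', e', ht', h'⟩ := h₂ s' h
  exact ⟨_, _, .seq e e', Nat.add_le_add ht ht', h'⟩

theorem Runs.straight {W B : ℕ} {P : Prog} {s : State} {Q : State → Prop} (hP : P.Straight)
    (hB : 2 ≤ B) (hs : s.Bdd B) (hW : B ^ P.width ≤ W) (hQ : Q (P.eff s)) : Runs W P s P.time Q := by
  obtain ⟨⟨t, ht, e⟩, -⟩ := P.exec_straight hP hB hs hW
  exact ⟨t, _, e, ht, hQ⟩

/-- A loop with an invariant `I` and a straight-line body; the first argument of `I` bounds the number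
of the remaining rounds. -/
theorem Runs.loop {W B : ℕ} {b : Test} {P : Prog} {I : ℕ → State → Prop} (hP : P.Straight)
    (hB : 2 ≤ B) (hW : B ^ P.width ≤ W) (hI : ∀ m s, I m s → s.Bdd B)
    (hstep : ∀ m s, I m s → b.Holds s → ∃ m' < m, I m' (P.eff s)) (m : ℕ) : ∀ s, I m s →
    Runs W (.while b P) s ((b.cost + 1 + P.time) * (m + 1)) fun s' => ∃ m', I m' s' ∧ ¬ b.Holds s' := by
  induction m using Nat.strong_induction_on with
  | _ m ih =>
  intro s hs
  by_cases hb : b.Holds s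
  · obtain ⟨⟨t, ht, e⟩, -⟩ := P.exec_straight hP hB (hI m s hs) hW
    obtain ⟨m', hm, hs'⟩ := hstep m s hs hb
    obtain ⟨t', s', e', ht', h'⟩ := ih m' hm _ hs'
    refine ⟨_, _, .whileTrue hb e e', ?_, h'⟩
    have : (b.cost + 1 + P.time) * (m' + 1) ≤ (b.cost + 1 + P.time) * m :=
      Nat.mul_le_mul_left _ hm
    rw [mul_add, mul_one]
    omega
  · exact ⟨_, s, .whileFalse hb, by nlinarith, m, hs, hb⟩

end RealRAM

/-! ### Pieces of the program

Variables: `0` number of points, `1` number of edges, `2` counter, `3` and `4` root edge, `5` and `6`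
head and tail of the queue, `7` apex, `8` and `9` base. Arrays: `0` and `1` edges, `2` degrees, `3` sums
of the neighbours, `4` sums of their squares, `5` square roots, `6` table, `7` apexes, `8` queue. -/

namespace RealRAM

open RealRAM.Expr RealRAM.Prog

def Prog.list : List Prog → Prog
  | [] => .skip
  | P :: Ps => .seq P (list Ps)

theorem Prog.straight_list {Ps : List Prog} (h : ∀ P ∈ Ps, P.Straight) : (Prog.list Ps).Straight := by
  induction Ps with
  | nil => trivial
  | cons P Ps ih => exact ⟨h P (by simp), ih fun Q hQ => h Q (by simp [hQ])⟩

theorem Prog.eff_nil (s : State) : (Prog.list []).eff s = s := rfl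

theorem Prog.eff_cons (P : Prog) (Ps : List Prog) (s : State) :
    (Prog.list (P :: Ps)).eff s = (Prog.list Ps).eff (P.eff s) := rfl

theorem Prog.eff_assign (x : ℕ) (e : Expr) (s : State) :
    (Prog.assign x e).eff s = s.setv x (e.val s) := rfl

theorem Prog.eff_store (A : ℕ) (i e : Expr) (s : State) :
    (Prog.store A i e).eff s = s.sta A (i.val s) (e.val s) := rfl

section Keys

variable {n K : ℕ}

/-- Division with remainder by `n`: ordered pairs have distinct cells, so memory can be addressed by
edges. -/
theorem pair_inj {a b a' b' : Fin n} : (a * n + b : ℕ) = a' * n + b' ↔ a = a' ∧ b = b' := by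
  constructor
  · intro h
    have hn : 0 < n := by have := b.2; omega
    have h1 : ((a * n + b : ℕ)) / n = (a' * n + b' : ℕ) / n := by rw [h]
    have h2 : ((a * n + b : ℕ)) % n = (a' * n + b' : ℕ) % n := by rw [h]
    rw [mul_comm, Nat.mul_add_div hn, Nat.div_eq_of_lt b.2, mul_comm, Nat.mul_add_div hn,
      Nat.div_eq_of_lt b'.2] at h1
    rw [mul_comm, Nat.mul_add_mod, Nat.mod_eq_of_lt b.2, mul_comm, Nat.mul_add_mod,
      Nat.mod_eq_of_lt b'.2] at h2
    exact ⟨Fin.ext (by omega), Fin.ext h2⟩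
  · rintro ⟨rfl, rfl⟩; rfl

theorem key_inj {a b a' b' : Fin n} {q q' : ℕ} (hq : q < K) (hq' : q' < K) :
    (a * n + b : ℕ) * K + q = (a' * n + b') * K + q' ↔ (a = a' ∧ b = b') ∧ q = q' := by
  rw [← pair_inj]
  constructor
  · intro h
    have hK : 0 < K := by omega
    have h1 : ((a * n + b : ℕ) * K + q) / K = ((a' * n + b' : ℕ) * K + q') / K := by rw [h]
    have h2 : ((a * n + b : ℕ) * K + q) % K = ((a' * n + b' : ℕ) * K + q') % K := by rw [h]
    rw [mul_comm _ K, Nat.mul_add_div hK, Nat.div_eq_of_lt hq, mul_comm _ K, Nat.mul_add_div hK,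
      Nat.div_eq_of_lt hq'] at h1
    rw [mul_comm _ K, Nat.mul_add_mod, Nat.mod_eq_of_lt hq, mul_comm _ K, Nat.mul_add_mod,
      Nat.mod_eq_of_lt hq'] at h2
    exact ⟨by omega, h2⟩
  · rintro ⟨h, rfl⟩; rw [h]

end Keys

/-- The cell of an edge in the apex array. -/
def pairE (a b : Expr) : Expr := add (mul a (var 0)) b

/-- The cell of an edge and a state in the table. -/
def keyE (K : ℕ) (a b q : Expr) : Expr := add (mul (pairE a b) (const K)) q

section Neighbours

variable {n : ℕ}

/-- The arrays store the number, the sum and the sum of the squares of the neighbours of `v`. -/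
def Nb (s : State) (N : Fin n → Finset (Fin n)) (off : Fin n → ℕ) (v : Fin n) : Prop :=
  s.arr 2 v = (N v).card + off v ∧ s.arr 3 v = ∑ u ∈ N v, (u : ℕ) ∧
    s.arr 4 v = ∑ u ∈ N v, (u : ℕ) * u

theorem sum_le_sq (N : Finset (Fin n)) : ∑ u ∈ N, (u : ℕ) ≤ n * n := by
  calc ∑ u ∈ N, (u : ℕ) ≤ ∑ _u ∈ N, n := Finset.sum_le_sum fun u _ => u.2.le
    _ = N.card * n := by rw [Finset.sum_const, smul_eq_mul]
    _ ≤ n * n := Nat.mul_le_mul_right _ (by simpa using N.card_le_univ)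

theorem sum_sq_le (N : Finset (Fin n)) : ∑ u ∈ N, (u : ℕ) * u ≤ n * (n * n) := by
  calc ∑ u ∈ N, (u : ℕ) * u ≤ ∑ _u ∈ N, n * n :=
        Finset.sum_le_sum fun u _ => Nat.mul_le_mul u.2.le u.2.le
    _ = N.card * (n * n) := by rw [Finset.sum_const, smul_eq_mul]
    _ ≤ n * (n * n) := Nat.mul_le_mul_right _ (by simpa using N.card_le_univ)

/-- `w` becomes a neighbour of `u`. -/
def addNb (u w : Expr) : Prog := .list [.store 2 u (add (read 2 u) (const 1)),
  .store 3 u (add (read 3 u) w), .store 4 u (add (read 4 u) (mul w w))]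

/-- `w` is no longer a neighbour of `u`. -/
def delNb (u w : Expr) : Prog := .list [.store 2 u (sub (read 2 u) (const 1)),
  .store 3 u (sub (read 3 u) w), .store 4 u (sub (read 4 u) (mul w w))]

theorem Nb.of_arr {s s' : State} {N : Fin n → Finset (Fin n)} {off : Fin n → ℕ} {v : Fin n}
    (h : Nb s N off v) (h2 : s'.arr 2 = s.arr 2) (h3 : s'.arr 3 = s.arr 3) (h4 : s'.arr 4 = s.arr 4) :
    Nb s' N off v := by
  unfold Nb; rw [h2, h3, h4]; exact h

theorem eff_addNb {s : State} {N : Fin n → Finset (Fin n)} {off : Fin n → ℕ} {a b : ℕ} {u w : Fin n}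
    {B : ℕ} (ha : s.var a = u) (hb : s.var b = w) (h : ∀ v, Nb s N off v) (hw : w ∉ N u)
    (hs : s.Bdd B) (hB : n * (n * n) + n * n + n + off u ≤ B) :
    ((addNb (var a) (var b)).eff s).var = s.var ∧
    (∀ C, C ≠ 2 → C ≠ 3 → C ≠ 4 → ((addNb (var a) (var b)).eff s).arr C = s.arr C) ∧
    (∀ v, Nb ((addNb (var a) (var b)).eff s) (Function.update N u (insert w (N u))) off v) ∧
    ((addNb (var a) (var b)).eff s).Bdd B := by
  have hN : ∀ v, Nb ((addNb (var a) (var b)).eff s) (Function.update N u (insert w (N u))) off v := by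
    intro v
    obtain ⟨h1, h2, h3⟩ := h v
    simp only [Nb, addNb, eff_cons, eff_nil, eff_store, val, State.sta_arr, State.sta_var, ha, hb,
      Function.update_apply, Fin.val_inj]
    by_cases hv : v = u
    · subst hv
      simp [hw, h1, h2, h3]
      omega
    · simp [hv, h1, h2, h3]
  have e2 : (N u).card + 1 ≤ n := by
    rw [← Finset.card_insert_of_notMem hw]
    simpa using Finset.card_le_univ (insert w (N u))
  have e3 := sum_le_sq (insert w (N u))
  have e4 := sum_sq_le (insert w (N u))
  rw [Finset.sum_insert hw] at e3 e4
  obtain ⟨h1, h2, h3⟩ := h u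
  refine ⟨rfl, fun C h2 h3 h4 => ?_, hN, ?_⟩
  · funext j
    simp [addNb, eff_cons, eff_nil, eff_store, State.sta_arr, h2, h3, h4]
  · simp only [addNb, eff_cons, eff_nil, eff_store]
    refine ((hs.sta ?_).sta ?_).sta ?_
    · simp only [val, ha, h1]; omega
    · simp [val, ha, hb, State.sta_arr, State.sta_var, h2]; omega
    · simp [val, ha, hb, State.sta_arr, State.sta_var, h3]; omega

theorem eff_delNb {s : State} {N : Fin n → Finset (Fin n)} {off : Fin n → ℕ} {a b : ℕ} {u w : Fin n}
    {B : ℕ} (ha : s.var a = u) (hb : s.var b = w) (hw : w ∈ N u) (hs : s.Bdd B) :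
    ((delNb (var a) (var b)).eff s).var = s.var ∧
    (∀ C, C ≠ 2 → C ≠ 3 → C ≠ 4 → ((delNb (var a) (var b)).eff s).arr C = s.arr C) ∧
    (∀ v, Nb s N off v →
      Nb ((delNb (var a) (var b)).eff s) (Function.update N u ((N u).erase w)) off v) ∧
    ((delNb (var a) (var b)).eff s).Bdd B := by
  have hN : ∀ v, Nb s N off v →
      Nb ((delNb (var a) (var b)).eff s) (Function.update N u ((N u).erase w)) off v := by
    intro v h
    obtain ⟨h1, h2, h3⟩ := h
    simp only [Nb, delNb, eff_cons, eff_nil, eff_store, val, State.sta_arr, State.sta_var, ha, hb,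
      Function.update_apply, Fin.val_inj]
    by_cases hv : v = u
    · subst hv
      have := Finset.card_pos.2 ⟨w, hw⟩
      have e2 := Finset.card_erase_of_mem hw
      have e3 := Finset.add_sum_erase (N v) (fun x => (x : ℕ)) hw
      have e4 := Finset.add_sum_erase (N v) (fun x => (x : ℕ) * x) hw
      simp [h1, h2, h3]
      omega
    · simp [hv, h1, h2, h3]
  refine ⟨rfl, fun C h2 h3 h4 => ?_, hN, ?_⟩
  · funext j
    simp [delNb, eff_cons, eff_nil, eff_store, State.sta_arr, h2, h3, h4]
  · simp only [delNb, eff_cons, eff_nil, eff_store]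
    refine ((hs.sta ?_).sta ?_).sta ?_
    · simp only [val]; have := hs.2 2 (s.var a); omega
    · simp [val, State.sta_arr, State.sta_var]; have := hs.2 3 (s.var a); omega
    · simp [val, State.sta_arr, State.sta_var]; have := hs.2 4 (s.var a); omega

end Neighbours

section Queue

variable {n : ℕ}

/-- The queue stores the list `L`. -/
def Que (s : State) (L : List (Fin n)) : Prop :=
  s.var 6 = L.length ∧ ∀ (j : ℕ) (h : j < L.length), s.arr 8 j = L[j]

def pushIf (e : Expr) : Prog := .ite (.eq (read 2 e) (const 2))
  (.list [.store 8 (var 6) e, .assign 6 (add (var 6) (const 1))]) .skip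

theorem eff_pushIf {s : State} {L : List (Fin n)} {a : ℕ} {u : Fin n} {B : ℕ} (ha : s.var a = u)
    (h : Que s L) (hs : s.Bdd B) (hB : n + L.length + 1 ≤ B) :
    (∀ y, y ≠ 6 → ((pushIf (var a)).eff s).var y = s.var y) ∧
    (∀ C, C ≠ 8 → ((pushIf (var a)).eff s).arr C = s.arr C) ∧
    Que ((pushIf (var a)).eff s) (if s.arr 2 u = 2 then L ++ [u] else L) ∧
    ((pushIf (var a)).eff s).Bdd B := by
  have hu := u.2
  obtain ⟨h1, h2⟩ := h
  by_cases hc : s.arr 2 u = 2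
  · have he : (pushIf (var a)).eff s = (s.sta 8 (s.var 6) u).setv 6 (s.var 6 + 1) := by
      simp [pushIf, eff, Test.Holds, val, ha, hc, Prog.list, State.sta_var]
    rw [he, if_pos hc]
    refine ⟨fun y hy => by simp [State.setv_var, State.sta_var, hy],
      fun C hC => by rw [State.setv_arr, State.sta_arr_ne _ _ _ _ _ hC],
      ⟨by simp [State.setv_var, h1], fun j hj => ?_⟩, (hs.sta (by omega)).setv (by omega)⟩
    rw [State.setv_arr, State.sta_arr, h1, List.getElem_append]
    by_cases hj' : j < L.length
    · rw [if_neg (by omega), dif_pos hj', h2]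
    · have : j = L.length := by simp at hj; omega
      simp [this]
  · have he : (pushIf (var a)).eff s = s := by
      simp [pushIf, eff, Test.Holds, val, ha, hc]
    rw [he, if_neg hc]
    exact ⟨fun _ _ => rfl, fun _ _ => rfl, ⟨h1, h2⟩, hs⟩

end Queue

section Ear

variable {n K : ℕ}

/-- The transition `τ` updates the table of the edge `a b` with apex in variable `7`. -/
def relaxP (K : ℕ) (a b : Expr) (τ : Lab × ℕ × ℕ × ℕ) : Prog :=
  let l := read 6 (keyE K a (var 7) (const τ.2.1))
  let r := read 6 (keyE K (var 7) b (const τ.2.2.1))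
  let o := read 6 (keyE K a b (const τ.2.2.2))
  let c := add (sub (add l r) (const 1)) (const τ.1.card)
  -- Tests have no disjunction: the last conjunct says that `o` is `0` or `c < o`.
  .ite (.and (.and (.not (.eq l (const 0))) (.not (.eq r (const 0))))
      (.not (.and (.not (.eq o (const 0))) (.not (.lt c o)))))
    (.store 6 (keyE K a b (const τ.2.2.2)) c) .skip

/-- The ear with apex in variable `7` is put on the edge `a b`. -/
def ear (K : ℕ) (D : Auto) (a b : Expr) : Prog :=
  .list (.store 7 (pairE a b) (var 7) :: .store 6 (keyE K a b (const D.start)) (const 0) ::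
    D.trans.map (relaxP K a b))

/-- The edges `u v`, `v w` and `u w` own disjoint blocks of the table, so the writes do not disturb
the entries that are read. -/
theorem eff_relax {s : State} {a b : ℕ} {u v w : Fin n} {f g h : ℕ → ℕ} (h0 : s.var 0 = n)
    (ha : s.var a = u) (hb : s.var b = w) (h7 : s.var 7 = v) (huv : u ≠ v) (hvw : v ≠ w)
    (hf : ∀ q < K, s.arr 6 ((u * n + v : ℕ) * K + q) = f q)
    (hg : ∀ q < K, s.arr 6 ((v * n + w : ℕ) * K + q) = g q) (ts : List (Lab × ℕ × ℕ × ℕ))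
    (hts : ∀ τ ∈ ts, τ.2.1 < K ∧ τ.2.2.1 < K ∧ τ.2.2.2 < K)
    (hh : ∀ q < K, s.arr 6 ((u * n + w : ℕ) * K + q) = h q) :
    ((Prog.list (ts.map (relaxP K (var a) (var b)))).eff s).var = s.var ∧
    (∀ C, C ≠ 6 → ((Prog.list (ts.map (relaxP K (var a) (var b)))).eff s).arr C = s.arr C) ∧
    (∀ q < K, ((Prog.list (ts.map (relaxP K (var a) (var b)))).eff s).arr 6
      ((u * n + w : ℕ) * K + q) = ts.foldl (Auto.relax f g) h q) ∧
    ∀ j, (∀ q < K, j ≠ (u * n + w : ℕ) * K + q) →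
      ((Prog.list (ts.map (relaxP K (var a) (var b)))).eff s).arr 6 j = s.arr 6 j := by
  induction ts generalizing s h with
  | nil => exact ⟨rfl, fun _ _ => rfl, hh, fun _ _ => rfl⟩
  | cons τ ts ih =>
    obtain ⟨k1, k2, k3⟩ := hts τ (by simp)
    rw [List.map_cons, eff_cons, List.foldl_cons]
    have hc : ((f τ.2.1 ≠ 0 ∧ g τ.2.2.1 ≠ 0) ∧ (h τ.2.2.2 = 0 ∨ Auto.cand f g τ < h τ.2.2.2)) ∧
        (relaxP K (var a) (var b) τ).eff s =
          s.sta 6 ((u * n + w : ℕ) * K + τ.2.2.2) (Auto.cand f g τ) ∨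
        ¬ ((f τ.2.1 ≠ 0 ∧ g τ.2.2.1 ≠ 0) ∧ (h τ.2.2.2 = 0 ∨ Auto.cand f g τ < h τ.2.2.2)) ∧
        (relaxP K (var a) (var b) τ).eff s = s := by
      by_cases hc : (f τ.2.1 ≠ 0 ∧ g τ.2.2.1 ≠ 0) ∧ (h τ.2.2.2 = 0 ∨ Auto.cand f g τ < h τ.2.2.2)
      · refine Or.inl ⟨hc, ?_⟩
        simp only [relaxP, eff, Test.Holds, keyE, pairE, val, h0, ha, hb, h7, hf _ k1, hg _ k2,
          hh _ k3]
        rw [if_pos]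
        · rfl
        · unfold Auto.cand at hc; tauto
      · refine Or.inr ⟨hc, ?_⟩
        simp only [relaxP, eff, Test.Holds, keyE, pairE, val, h0, ha, hb, h7, hf _ k1, hg _ k2,
          hh _ k3]
        rw [if_neg]
        unfold Auto.cand at hc; tauto
    have hts' : ∀ σ ∈ ts, σ.2.1 < K ∧ σ.2.2.1 < K ∧ σ.2.2.2 < K := fun σ hσ => hts σ (by simp [hσ])
    rcases hc with ⟨hc, he⟩ | ⟨hc, he⟩
    · rw [he, Auto.relax, if_pos hc]
      obtain ⟨i1, i2, i3, i4⟩ := ih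
        (s := s.sta 6 ((u * n + w : ℕ) * K + τ.2.2.2) (Auto.cand f g τ))
        (h := Function.update h τ.2.2.2 (Auto.cand f g τ)) h0 ha hb h7
        (fun q hq => by
          rw [State.sta_arr, if_neg, hf q hq]
          rw [key_inj hq k3]; exact fun h => hvw h.2.1.2)
        (fun q hq => by
          rw [State.sta_arr, if_neg, hg q hq]
          rw [key_inj hq k3]; exact fun h => huv h.2.1.1.symm)
        hts'
        (fun q hq => by
          rw [State.sta_arr, Function.update_apply]
          simp only [key_inj hq k3, true_and]
          split_ifs
          · rfl
          · exact hh q hq)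
      refine ⟨i1, fun C hC => by rw [i2 C hC, State.sta_arr_ne _ _ _ _ _ hC], i3, fun j hj => ?_⟩
      rw [i4 j hj, State.sta_arr, if_neg fun h => hj _ k3 h.2]
    · rw [he, Auto.relax, if_neg hc]
      exact ih h0 ha hb h7 hf hg hts' hh

/-- Until now the base was a leaf, with `1` in the state `start`. This entry is cleared first; all
others in the block are still `0`, that is, infinity. -/
theorem eff_ear {s : State} {D : Auto} {a b : ℕ} {u v w : Fin n} {f g : ℕ → ℕ} (h0 : s.var 0 = n)
    (ha : s.var a = u) (hb : s.var b = w) (h7 : s.var 7 = v) (huv : u ≠ v) (hvw : v ≠ w)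
    (hf : ∀ q < K, s.arr 6 ((u * n + v : ℕ) * K + q) = f q)
    (hg : ∀ q < K, s.arr 6 ((v * n + w : ℕ) * K + q) = g q)
    (hts : ∀ τ ∈ D.trans, τ.2.1 < K ∧ τ.2.2.1 < K ∧ τ.2.2.2 < K) (hD : D.start < K)
    (hh : ∀ q < K, q ≠ D.start → s.arr 6 ((u * n + w : ℕ) * K + q) = 0) :
    ((ear K D (var a) (var b)).eff s).var = s.var ∧
    (∀ C, C ≠ 6 → C ≠ 7 → ((ear K D (var a) (var b)).eff s).arr C = s.arr C) ∧
    (∀ j, ((ear K D (var a) (var b)).eff s).arr 7 j = if j = u * n + w then (v : ℕ) else s.arr 7 j) ∧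
    (∀ q < K, ((ear K D (var a) (var b)).eff s).arr 6
      ((u * n + w : ℕ) * K + q) = D.trans.foldl (Auto.relax f g) (fun _ => 0) q) ∧
    ∀ j, (∀ q < K, j ≠ (u * n + w : ℕ) * K + q) →
      ((ear K D (var a) (var b)).eff s).arr 6 j = s.arr 6 j := by
  set s1 := (s.sta 7 (u * n + w : ℕ) v).sta 6 ((u * n + w : ℕ) * K + D.start) 0 with hs1
  have he : (ear K D (var a) (var b)).eff s =
      (Prog.list (D.trans.map (relaxP K (var a) (var b)))).eff s1 := by
    simp only [ear, eff_cons, eff_store, keyE, pairE, val, State.sta_var, h0, ha, hb, h7, hs1]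
  have a6 : ∀ j, s1.arr 6 j = if j = (u * n + w : ℕ) * K + D.start then 0 else s.arr 6 j := by
    intro j
    simp [hs1, State.sta_arr]
  have a7 : ∀ j, s1.arr 7 j = if j = u * n + w then (v : ℕ) else s.arr 7 j := by
    intro j
    simp [hs1, State.sta_arr]
  obtain ⟨i1, i2, i3, i4⟩ := eff_relax (s := s1) (K := K) (f := f) (g := g) (h := fun _ => 0) h0 ha hb
    h7 huv hvw
    (fun q hq => by
      rw [a6, if_neg, hf q hq]
      rw [key_inj hq hD]; exact fun h => hvw h.1.2)
    (fun q hq => by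
      rw [a6, if_neg, hg q hq]
      rw [key_inj hq hD]; exact fun h => huv h.1.1.symm)
    D.trans hts
    (fun q hq => by
      rw [a6]
      split_ifs with h
      · rfl
      · exact hh q hq fun e => h (by rw [e]))
  rw [he]
  refine ⟨i1, fun C h6 h7 => ?_, fun j => by rw [i2 7 (by omega), a7], i3, fun j hj => ?_⟩
  · rw [i2 C h6]
    simp [hs1, State.sta_arr_ne _ _ _ _ _ h6, State.sta_arr_ne _ _ _ _ _ h7]
  · rw [i4 j hj, a6, if_neg (hj _ hD)]

end Ear

end RealRAM

/-! ### Reading the graph -/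

namespace RealRAM

open RealRAM.Expr RealRAM.Prog

/-- A loop that counts variable `2` up to `N`. The `4` per round is the cost `3` of the test and one
step for the loop. -/
theorem Runs.count {W B N x : ℕ} {P : Prog} {J : ℕ → State → Prop} (hP : P.Straight) (hB : 2 ≤ B)
    (hW : B ^ P.width ≤ W) (hJ : ∀ i s, J i s → s.Bdd B ∧ s.var 2 = i ∧ s.var x = N)
    (hstep : ∀ i s, i < N → J i s → J (i + 1) (P.eff s)) {s : State} (hs : J 0 s) :
    Runs W (.while (.lt (var 2) (var x)) P) s ((4 + P.time) * (N + 1)) (J N) := by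
  obtain ⟨t, s', e, ht, m', ⟨i, hi, h⟩, hb⟩ := Runs.loop (b := .lt (var 2) (var x)) (P := P) (W := W)
    (B := B) (I := fun m s => ∃ i, i + m = N ∧ J i s) hP hB hW
    (fun m s ⟨i, _, h⟩ => (hJ i s h).1)
    (by
      rintro m s ⟨i, hi, h⟩ hb
      obtain ⟨-, h2, hx⟩ := hJ i s h
      simp only [Test.Holds, val, h2, hx] at hb
      exact ⟨m - 1, by omega, i + 1, by omega, hstep i s hb h⟩)
    N s ⟨0, by omega, hs⟩
  obtain ⟨-, h2, hx⟩ := hJ i s' h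
  simp only [Test.Holds, val, h2, hx] at hb
  have : i = N := by omega
  exact ⟨t, s', e, ht, this ▸ h⟩

theorem Runs.mono {W T : ℕ} {P : Prog} {s : State} {Q R : State → Prop} (h : Runs W P s T Q)
    (hQ : ∀ s', Q s' → R s') : Runs W P s T R := by
  obtain ⟨t, s', e, ht, h⟩ := h
  exact ⟨t, s', e, ht, hQ s' h⟩

/-- The parameters: `n` points, `K` states, a bound `B` for the words in use. -/
structure Params (n K B : ℕ) (D : Auto) : Prop where
  hn : 3 ≤ n
  hB : n * (n * n) + n * n + n + 10 ≤ B
  hD : D.width * n + 1 ≤ B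
  hK : K ≤ B
  start : D.start < K
  trans : ∀ τ ∈ D.trans, τ.2.1 < K ∧ τ.2.2.1 < K ∧ τ.2.2.2 < K
  ne_start : ∀ τ ∈ D.trans, τ.2.2.2 ≠ D.start
  final : ∀ q ∈ D.final, q < K

section Phases

variable {n K B : ℕ} {D : Auto}

def Inp (es : List (Fin n × Fin n)) (s : State) : Prop :=
  s.var 0 = n ∧ s.var 1 = es.length ∧
    ∀ (i : ℕ) (h : i < es.length), s.arr 0 i = es[i].1 ∧ s.arr 1 i = es[i].2

/-- A table of square roots. -/
def SqT (n : ℕ) (s : State) : Prop := ∀ j < n, s.arr 5 (j * j) = j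

/-- The neighbours of `v` in a list of edges. -/
def nb (L : List (Sym2 (Fin n))) (v : Fin n) : Finset (Fin n) :=
  Finset.univ.filter fun u => s(v, u) ∈ L

/-- The initial table of the dynamic program. -/
def Tab0 (K start : ℕ) (L : List (Sym2 (Fin n))) (s : State) : Prop :=
  ∀ a b : Fin n, ∀ q < K, s.arr 6 ((a * n + b : ℕ) * K + q) =
    if q = start ∧ s(a, b) ∈ L then 1 else 0

def next : Prog := .assign 2 (add (var 2) (const 1))

def sqrtBody : Prog := .list [.store 5 (mul (var 2) (var 2)) (var 2), next]

/-- Only the cells at squares are filled, so `n` rounds suffice although the addresses grow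
quadratically. -/
theorem runs_sqrt (hp : Params n K B D) {W : ℕ} (hW : B ^ sqrtBody.width ≤ W)
    {p : Fin n → Plane} {es : List (Fin n × Fin n)} (hes : es.length ≤ 2 * n + 1) :
    Runs W (.while (.lt (var 2) (var 0)) sqrtBody) (inputState p es) ((4 + sqrtBody.time) * (n + 1))
      fun s => s.Bdd B ∧ Inp es s ∧ SqT n s ∧ ∀ C, C ≠ 0 → C ≠ 1 → C ≠ 5 → ∀ i, s.arr C i = 0 := by
  have hn := hp.hn
  have hB := hp.hB
  have hn2 : n * 3 ≤ n * n := Nat.mul_le_mul_left _ hn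
  refine (Runs.count (W := W) (B := B) (N := n) (x := 0) (P := sqrtBody)
    (s := inputState p es)
    (J := fun i s => s.Bdd B ∧ s.var 2 = i ∧ Inp es s ∧ (∀ j < i, s.arr 5 (j * j) = j) ∧
      ∀ C, C ≠ 0 → C ≠ 1 → C ≠ 5 → ∀ i, s.arr C i = 0)
    (straight_list (by simp [next, Straight])) (by omega) hW (fun i s h => ⟨h.1, h.2.1, h.2.2.1.1⟩)
    ?_ ?_).mono fun s h => ⟨h.1, h.2.2.1, h.2.2.2.1, h.2.2.2.2⟩
  · rintro i s hi ⟨h1, h2, h3, h4, h5⟩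
    have he : sqrtBody.eff s = (s.sta 5 (i * i) i).setv 2 (i + 1) := by
      simp [sqrtBody, next, eff_cons, eff_nil, eff_assign, eff_store, val, State.sta_var, h2]
    rw [he]
    refine ⟨(h1.sta (by omega)).setv (by omega), by simp [State.setv_var], ?_, ?_, ?_⟩
    · refine ⟨?_, ?_, fun j hj => ?_⟩
      · simpa [State.setv_var, State.sta_var] using h3.1
      · simpa [State.setv_var, State.sta_var] using h3.2.1
      · simpa [State.setv_arr, State.sta_arr] using h3.2.2 j hj
    · intro j hj
      simp only [State.setv_arr, State.sta_arr, true_and]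
      split_ifs with h
      · exact (Nat.mul_self_inj.1 h).symm
      · exact h4 j (lt_of_le_of_ne (by omega) (by rintro rfl; exact h rfl))
    · intro C h0 h1 h5' j
      simpa [State.setv_arr, State.sta_arr, h5'] using h5 C h0 h1 h5' j
  · refine ⟨⟨fun x => ?_, fun A i => ?_⟩, by simp [inputState], ⟨by simp [inputState],
      by simp [inputState], fun i hi => by simp [inputState, hi]⟩, by omega, ?_⟩
    · simp only [inputState]; split_ifs <;> omega
    · simp only [inputState]
      split_ifs with h1 h2 h3
      · have := es[i].1.2; omega
      · have := es[i].2.2; omega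
      all_goals omega
    · intro C h0 h1 _ i
      simp [inputState, h0, h1]

/-- Counts and power sums replace adjacency lists, since they can be updated in constant time when a
neighbour disappears. -/
def scanBody (K start : ℕ) : Prog := .list [.assign 8 (read 0 (var 2)), .assign 9 (read 1 (var 2)),
  addNb (var 8) (var 9), addNb (var 9) (var 8), .store 6 (keyE K (var 8) (var 9) (const start)) (const 1),
  .store 6 (keyE K (var 9) (var 8) (const start)) (const 1), next]

/-- The first edges have been read. -/
structure Scan (K start B : ℕ) (es : List (Fin n × Fin n)) (L : List (Sym2 (Fin n))) (s : State) :
    Prop where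
  bdd : s.Bdd B
  inp : Inp es s
  sqt : SqT n s
  nbs : ∀ v, Nb s (nb L) 0 v
  tab : Tab0 K start L s

theorem nb_append {L : List (Sym2 (Fin n))} {a b : Fin n} (hab : a ≠ b) (v : Fin n) :
    nb (L ++ [s(a, b)]) v = Function.update (Function.update (nb L) a (insert b (nb L a))) b
      (insert a (Function.update (nb L) a (insert b (nb L a)) b)) v := by
  have h0 : ∀ v u, u ∈ nb L v ↔ s(v, u) ∈ L := by simp [nb]
  ext u
  rw [Function.update_of_ne hab.symm]
  simp only [Function.update_apply]
  split_ifs with h1 h2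
  · subst h1
    simp only [nb, Finset.mem_insert, Finset.mem_filter, Finset.mem_univ, true_and, List.mem_append,
      List.mem_singleton, Sym2.eq_iff]
    tauto
  · subst h2
    simp only [nb, Finset.mem_insert, Finset.mem_filter, Finset.mem_univ, true_and, List.mem_append,
      List.mem_singleton, Sym2.eq_iff]
    tauto
  · simp only [nb, Finset.mem_filter, Finset.mem_univ, true_and, List.mem_append,
      List.mem_singleton, Sym2.eq_iff]
    tauto

theorem scan_step (hp : Params n K B D) {es : List (Fin n × Fin n)}
    (hd : (es.map fun q => s(q.1, q.2)).Nodup) (hne : ∀ q ∈ es, q.1 ≠ q.2)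
    {i : ℕ} (hi : i < es.length) (hes : es.length ≤ 2 * n + 1) {s : State} (h2 : s.var 2 = i)
    (h : Scan K D.start B es ((es.map fun q => s(q.1, q.2)).take i) s) :
    ((scanBody K D.start).eff s).var 2 = i + 1 ∧
      Scan K D.start B es ((es.map fun q => s(q.1, q.2)).take (i + 1))
        ((scanBody K D.start).eff s) := by
  have hn := hp.hn
  have hB := hp.hB
  have hn2 : n * 3 ≤ n * n := Nat.mul_le_mul_left _ hn
  obtain ⟨bdd, ⟨i0, i1, ia⟩, sqt, nbs, tab⟩ := h
  set L := (es.map fun q => s(q.1, q.2)).take i with hL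
  set a := es[i].1 with ha
  set b := es[i].2 with hb
  have hab : a ≠ b := hne _ (List.getElem_mem hi)
  have hL' : (es.map fun q => s(q.1, q.2)).take (i + 1) = L ++ [s(a, b)] := by
    rw [List.take_add_one, List.getElem?_eq_getElem (by simpa using hi)]
    simp [hL, ha, hb]
  have hnot : s(a, b) ∉ L := by
    have : (L ++ [s(a, b)]).Nodup := hL' ▸ hd.sublist (List.take_sublist _ _)
    rw [List.nodup_append] at this
    intro hm
    exact this.2.2 _ hm _ (by simp) rfl
  rw [hL']
  set s1 := (s.setv 8 a).setv 9 b with hs1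
  have v8 : s1.var 8 = a := by simp [hs1, State.setv_var]
  have v9 : s1.var 9 = b := by simp [hs1, State.setv_var]
  have b1 : s1.Bdd B := (bdd.setv (by have := a.2; omega)).setv (by have := b.2; omega)
  obtain ⟨e1, e2, e3, e4⟩ := eff_addNb (s := s1) (N := nb L) (off := 0) (B := B) v8 v9
    (fun v => (nbs v).of_arr rfl rfl rfl) (by simpa [nb] using hnot) b1 (by simp; omega)
  set s2 := (addNb (var 8) (var 9)).eff s1 with hs2
  obtain ⟨f1, f2, f3, f4⟩ := eff_addNb (s := s2) (a := 9) (b := 8) (u := b) (w := a) (off := 0)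
    (B := B) (by rw [e1, v9]) (by rw [e1, v8]) e3
    (by rw [Function.update_of_ne hab.symm]; simpa [nb, Sym2.eq_swap] using hnot) e4
    (by simp; omega)
  set s3 := (addNb (var 9) (var 8)).eff s2 with hs3
  have v0 : s3.var 0 = n := by rw [f1, e1]; simpa [hs1, State.setv_var] using i0
  have v8' : s3.var 8 = a := by rw [f1, e1, v8]
  have v9' : s3.var 9 = b := by rw [f1, e1, v9]
  have he : (scanBody K D.start).eff s = ((s3.sta 6 ((a * n + b : ℕ) * K + D.start) 1).sta 6
      ((b * n + a : ℕ) * K + D.start) 1).setv 2 (i + 1) := by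
    have r1 : s.arr 0 i = a := (ia i hi).1
    have r2 : s.arr 1 i = b := (ia i hi).2
    have v2 : s3.var 2 = i := by rw [f1, e1]; simpa [hs1, State.setv_var] using h2
    have : (Prog.assign 9 (read 1 (var 2))).eff ((Prog.assign 8 (read 0 (var 2))).eff s) = s1 := by
      simp [eff_assign, val, h2, r1, r2, State.setv_var, State.setv_arr, hs1]
    simp only [scanBody, eff_cons, eff_nil, this, next, ← hs2, ← hs3]
    simp [eff_store, eff_assign, val, keyE, pairE, v0, v8', v9', State.sta_var, v2]
  have ha6 : ∀ j, s3.arr 6 j = s.arr 6 j := fun j => by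
    rw [f2 6 (by omega) (by omega) (by omega), e2 6 (by omega) (by omega) (by omega), hs1]; rfl
  have hC : ∀ C, C ≠ 2 → C ≠ 3 → C ≠ 4 → C ≠ 6 → ((scanBody K D.start).eff s).arr C = s.arr C := by
    intro C h2 h3 h4 h6
    rw [he, State.setv_arr, State.sta_arr_ne _ _ _ _ _ h6, State.sta_arr_ne _ _ _ _ _ h6,
      f2 C h2 h3 h4, e2 C h2 h3 h4]
    rfl
  refine ⟨by rw [he]; simp [State.setv_var], ?_, ⟨?_, ?_, ?_⟩, ?_, ?_, ?_⟩
  · rw [he]; exact ((f4.sta (by omega)).sta (by omega)).setv (by omega)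
  · rw [he]; simpa [State.setv_var, State.sta_var] using v0
  · rw [he]
    simp only [State.setv_var, State.sta_var, f1, e1, hs1]
    simpa using i1
  · intro j hj
    rw [hC 0 (by omega) (by omega) (by omega) (by omega),
      hC 1 (by omega) (by omega) (by omega) (by omega)]
    exact ia j hj
  · intro j hj
    rw [hC 5 (by omega) (by omega) (by omega) (by omega)]
    exact sqt j hj
  · intro v
    have := f3 v
    rw [he]
    unfold Nb at this ⊢
    rw [nb_append hab, State.setv_arr, State.sta_arr_ne _ _ _ _ _ (by omega),
      State.sta_arr_ne _ _ _ _ _ (by omega), State.sta_arr_ne _ _ _ _ _ (by omega),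
      State.sta_arr_ne _ _ _ _ _ (by omega), State.sta_arr_ne _ _ _ _ _ (by omega),
      State.sta_arr_ne _ _ _ _ _ (by omega)]
    exact this
  · intro c d q hq
    rw [he, State.setv_arr]
    simp only [State.sta_arr, key_inj hq hp.start, ha6, tab c d q hq, true_and, List.mem_append,
      List.mem_singleton, Sym2.eq_iff]
    by_cases h1 : c = b ∧ d = a
    · by_cases h2 : q = D.start <;> simp [h1, h2]
    · by_cases h3 : c = a ∧ d = b
      · by_cases h2 : q = D.start <;> simp [h3, h2]
      · simp [h1, h3]

theorem runs_scan (hp : Params n K B D) {W : ℕ} (hW : B ^ (scanBody K D.start).width ≤ W)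
    {es : List (Fin n × Fin n)} (hd : (es.map fun q => s(q.1, q.2)).Nodup)
    (hne : ∀ q ∈ es, q.1 ≠ q.2) (hes : es.length ≤ 2 * n + 1) {s : State} (h2 : s.var 2 = 0)
    (h : Scan K D.start B es [] s) :
    Runs W (.while (.lt (var 2) (var 1)) (scanBody K D.start)) s
      ((4 + (scanBody K D.start).time) * (es.length + 1))
      (Scan K D.start B es (es.map fun q => s(q.1, q.2))) := by
  have hB := hp.hB
  obtain ⟨t, s, e, ht, h⟩ := Runs.count (W := W) (B := B) (N := es.length) (x := 1) (s := s)
    (J := fun i s => s.var 2 = i ∧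
      Scan K D.start B es ((es.map fun q => s(q.1, q.2)).take i) s)
    (P := scanBody K D.start)
    (straight_list (by simp [next, addNb, Prog.list, Straight])) (by omega) hW
    (fun i s h => ⟨h.2.bdd, h.1, h.2.inp.2.1⟩)
    (fun i s hi h => scan_step hp hd hne hi hes h.1 h.2) ⟨h2, by simpa using h⟩
  refine ⟨t, s, e, ht, ?_⟩
  have := h.2
  rwa [List.take_of_length_le (by simp)] at this

def findBody : Prog := .list [.assign 8 (read 0 (var 2)), .assign 9 (read 1 (var 2)),
  .ite (.eq (read 2 (var 8)) (const 2)) (.list [.assign 3 (var 8), .assign 4 (var 9)])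
    (.ite (.eq (read 2 (var 9)) (const 2)) (.list [.assign 3 (var 9), .assign 4 (var 8)]) .skip),
  next]

theorem eff_findBody {s : State} {i : ℕ} {a b : Fin n} (h2 : s.var 2 = i) (ha : s.arr 0 i = a)
    (hb : s.arr 1 i = b) : findBody.eff s =
      (if s.arr 2 a = 2 then (((s.setv 8 a).setv 9 b).setv 3 a).setv 4 b
        else if s.arr 2 b = 2 then (((s.setv 8 a).setv 9 b).setv 3 b).setv 4 a
        else (s.setv 8 a).setv 9 b).setv 2 (i + 1) := by
  have : (Prog.assign 9 (read 1 (var 2))).eff ((Prog.assign 8 (read 0 (var 2))).eff s) =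
      (s.setv 8 a).setv 9 b := by
    simp [eff_assign, val, h2, ha, hb, State.setv_var, State.setv_arr]
  simp only [findBody, eff_cons, eff_nil, this, next]
  simp only [eff, Prog.list, Test.Holds, val, State.setv_var, State.setv_arr]
  by_cases h1 : s.arr 2 a = 2
  · simp [h1, h2, State.setv_var]
  · by_cases h3 : s.arr 2 b = 2 <;> simp [h1, h3, h2, State.setv_var]

/-- The last listed edge with an end of degree two becomes the root edge. If no such edge had been
met, the edge in `hdeg` would not be listed. -/
theorem runs_find (hp : Params n K B D) {W : ℕ} (hW : B ^ findBody.width ≤ W)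
    {es : List (Fin n × Fin n)} (hes : es.length ≤ 2 * n + 1) {L : List (Sym2 (Fin n))}
    (hL : L = es.map fun q => s(q.1, q.2)) (hdeg : ∃ x u, s(x, u) ∈ L ∧ (nb L x).card = 2)
    {s : State} (h2 : s.var 2 = 0) (h : Scan K D.start B es L s) :
    Runs W (.while (.lt (var 2) (var 1)) findBody) s ((4 + findBody.time) * (es.length + 1))
      fun s => Scan K D.start B es L s ∧ ∃ x y : Fin n, s.var 3 = x ∧ s.var 4 = y ∧
        s(x, y) ∈ L ∧ (nb L x).card = 2 := by
  have hB := hp.hB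
  have hn2 : n * 3 ≤ n * n := Nat.mul_le_mul_left _ hp.hn
  refine (Runs.count (W := W) (B := B) (N := es.length) (x := 1) (s := s)
    (J := fun i s => s.var 2 = i ∧ Scan K D.start B es L s ∧
      ((∃ x y : Fin n, s.var 3 = x ∧ s.var 4 = y ∧ s(x, y) ∈ L ∧ (nb L x).card = 2) ∨
        ∀ (j : ℕ) (hj : j < es.length), j < i → (nb L es[j].1).card ≠ 2 ∧ (nb L es[j].2).card ≠ 2))
    (P := findBody)
    (straight_list (by simp [next, Prog.list, Straight])) (by omega) hW
    (fun i s h => ⟨h.2.1.bdd, h.1, h.2.1.inp.2.1⟩) ?_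
    ⟨h2, h, Or.inr (by omega)⟩).mono fun s h => ⟨h.2.1, h.2.2.resolve_right fun hn => ?_⟩
  · rintro i s hi ⟨h2, hS, hf⟩
    obtain ⟨r1, r2⟩ := hS.inp.2.2 i hi
    have he := eff_findBody h2 r1 r2
    have hmem : s(es[i].1, es[i].2) ∈ L := by
      rw [hL]; exact List.mem_map.2 ⟨_, List.getElem_mem hi, rfl⟩
    have d1 := (hS.nbs es[i].1).1
    have d2 := (hS.nbs es[i].2).1
    simp only [Pi.zero_apply, add_zero] at d1 d2
    rw [d1, d2] at he
    have l1 := es[i].1.2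
    have l2 := es[i].2.2
    have harr : (findBody.eff s).arr = s.arr := by
      rw [he]; split_ifs <;> rfl
    have hv : ∀ y, y ≠ 2 → y ≠ 3 → y ≠ 4 → y ≠ 8 → y ≠ 9 → (findBody.eff s).var y = s.var y := by
      intro y h2 h3 h4 h8 h9
      rw [he]; split_ifs <;> simp [State.setv_var, h2, h3, h4, h8, h9]
    refine ⟨by rw [he]; simp [State.setv_var], ⟨?_, ⟨?_, ?_, ?_⟩, ?_, ?_, ?_⟩, ?_⟩
    · rw [he]
      split_ifs
      · exact ((((hS.bdd.setv (by omega)).setv (by omega)).setv (by omega)).setv (by omega)).setv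
          (by omega)
      · exact ((((hS.bdd.setv (by omega)).setv (by omega)).setv (by omega)).setv (by omega)).setv
          (by omega)
      · exact ((hS.bdd.setv (by omega)).setv (by omega)).setv (by omega)
    · rw [hv 0 (by omega) (by omega) (by omega) (by omega) (by omega)]; exact hS.inp.1
    · rw [hv 1 (by omega) (by omega) (by omega) (by omega) (by omega)]; exact hS.inp.2.1
    · rw [harr]; exact hS.inp.2.2
    · unfold SqT; rw [harr]; exact hS.sqt
    · exact fun v => (hS.nbs v).of_arr (by rw [harr]) (by rw [harr]) (by rw [harr])
    · unfold Tab0; rw [harr]; exact hS.tab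
    · rw [he]
      by_cases c1 : (nb L es[i].1).card = 2
      · rw [if_pos c1]
        exact Or.inl ⟨es[i].1, es[i].2, by simp [State.setv_var], by simp [State.setv_var], hmem, c1⟩
      · by_cases c2 : (nb L es[i].2).card = 2
        · rw [if_neg c1, if_pos c2]
          exact Or.inl ⟨es[i].2, es[i].1, by simp [State.setv_var], by simp [State.setv_var],
            by rwa [Sym2.eq_swap], c2⟩
        · rw [if_neg c1, if_neg c2]
          rcases hf with ⟨x, y, h3, h4, h⟩ | hf
          · exact Or.inl ⟨x, y, by simpa [State.setv_var] using h3,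
              by simpa [State.setv_var] using h4, h⟩
          · refine Or.inr fun j hj hji => ?_
            rcases Nat.lt_succ_iff_lt_or_eq.1 hji with h | rfl
            · exact hf j hj h
            · exact ⟨c1, c2⟩
  · obtain ⟨x, u, hxu, hx⟩ := hdeg
    rw [hL, List.mem_map] at hxu
    obtain ⟨q, hq, he⟩ := hxu
    obtain ⟨j, hj, rfl⟩ := List.getElem_of_mem hq
    have := hn j hj hj
    rcases Sym2.eq_iff.1 he with ⟨e1, -⟩ | ⟨-, e1⟩
    · exact this.1 (e1 ▸ hx)
    · exact this.2 (e1 ▸ hx)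

end Phases

end RealRAM

/-! ### Elimination of ears -/

namespace RealRAM

open RealRAM.Expr RealRAM.Prog

section Init

variable {n K Bd : ℕ} {D : Auto}

/-- The ends of the root edge have an excess degree and are never removed. -/
def off (x y v : Fin n) : ℕ := if v = x ∨ v = y then 2 else 0

def initQ : Prog := .list [.store 2 (var 3) (add (read 2 (var 3)) (const 2)),
  .store 2 (var 4) (add (read 2 (var 4)) (const 2)), .assign 6 (const 0), .assign 5 (const 0),
  .assign 2 (const 0)]

def fillBody : Prog := .list [pushIf (var 2), next]

/-- The queue contains the vertices of degree 2 among the first `i` vertices. -/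
structure Fill (K start Bd : ℕ) (L : List (Sym2 (Fin n))) (x y : Fin n) (i : ℕ) (s : State) :
    Prop where
  bdd : s.Bdd Bd
  v0 : s.var 0 = n
  v2 : s.var 2 = i
  v3 : s.var 3 = x
  v4 : s.var 4 = y
  v5 : s.var 5 = 0
  sqt : SqT n s
  nbs : ∀ v, Nb s (nb L) (off x y) v
  tab : Tab0 K start L s
  que : ∃ Q : List (Fin n), Que s Q ∧ Q.Nodup ∧
    ∀ v, v ∈ Q ↔ (v : ℕ) < i ∧ (nb L v).card + off x y v = 2

theorem fill_init (hp : Params n K Bd D) {es : List (Fin n × Fin n)} {L : List (Sym2 (Fin n))}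
    {x y : Fin n} (hxy : x ≠ y) {s : State} (h : Scan K D.start Bd es L s) (h3 : s.var 3 = x)
    (h4 : s.var 4 = y) : Fill K D.start Bd L x y 0 (initQ.eff s) := by
  have hB := hp.hB
  have he : initQ.eff s = ((((s.sta 2 x (s.arr 2 x + 2)).sta 2 y (s.arr 2 y + 2)).setv 6 0).setv 5
      0).setv 2 0 := by
    simp [initQ, eff_cons, eff_nil, eff_store, eff_assign, val, State.sta_var, State.sta_arr, h3, h4,
      Fin.val_inj, hxy.symm]
  have hc : ∀ v, (nb L v).card ≤ n := fun v => by simpa using (nb L v).card_le_univ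
  have b1 := (h.nbs x).1
  have b2 := (h.nbs y).1
  simp only [Pi.zero_apply, add_zero] at b1 b2
  have c1 := hc x
  have c2 := hc y
  have harr : ∀ C, C ≠ 2 → (initQ.eff s).arr C = s.arr C := by
    intro C hC
    simp only [he, State.setv_arr]
    rw [State.sta_arr_ne _ _ _ _ _ hC, State.sta_arr_ne _ _ _ _ _ hC]
  refine ⟨?_, ?_, ?_, ?_, ?_, ?_, ?_, ?_, ?_, [], ⟨?_, by simp⟩, by simp, by simp⟩
  · rw [he]
    exact ((((h.bdd.sta (by omega)).sta (by omega)).setv (by omega)).setv (by omega)).setv (by omega)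
  · rw [he]; simpa [State.setv_var, State.sta_var] using h.inp.1
  · rw [he]; simp [State.setv_var]
  · rw [he]; simpa [State.setv_var, State.sta_var] using h3
  · rw [he]; simpa [State.setv_var, State.sta_var] using h4
  · rw [he]; simp [State.setv_var]
  · unfold SqT; rw [harr 5 (by omega)]; exact h.sqt
  · intro v
    obtain ⟨d1, d2, d3⟩ := h.nbs v
    unfold Nb
    rw [harr 3 (by omega), harr 4 (by omega)]
    refine ⟨?_, d2, d3⟩
    simp only [he, State.setv_arr, State.sta_arr, Fin.val_inj, true_and, off]
    simp only [Pi.zero_apply, add_zero] at d1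
    by_cases hy : v = y
    · subst hy; simp [b2]
    · by_cases hx : v = x
      · subst hx; simp [b1, hy]
      · simp [hx, hy, d1]
  · unfold Tab0; rw [harr 6 (by omega)]; exact h.tab
  · rw [he]; simp [State.setv_var]

theorem runs_fill (hp : Params n K Bd D) {W : ℕ} (hW : Bd ^ fillBody.width ≤ W)
    {L : List (Sym2 (Fin n))} {x y : Fin n} {s : State} (h : Fill K D.start Bd L x y 0 s) :
    Runs W (.while (.lt (var 2) (var 0)) fillBody) s ((4 + fillBody.time) * (n + 1))
      (Fill K D.start Bd L x y n) := by
  have hB := hp.hB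
  refine Runs.count (W := W) (B := Bd) (N := n) (x := 0) (s := s)
    (J := Fill K D.start Bd L x y) (P := fillBody)
    (straight_list (by simp [next, pushIf, Prog.list, Straight])) (by omega) hW
    (fun i s h => ⟨h.bdd, h.v2, h.v0⟩) ?_ h
  intro i s hi h
  obtain ⟨Q, hQ, hnd, hmem⟩ := h.que
  have hlen : Q.length ≤ n := by simpa using hnd.length_le_card
  have hn2 : n * 3 ≤ n * n := Nat.mul_le_mul_left _ hp.hn
  obtain ⟨e1, e2, e3, e4⟩ := eff_pushIf (a := 2) (u := ⟨i, hi⟩) (B := Bd) h.v2 hQ h.bdd (by omega)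
  have he : fillBody.eff s = ((pushIf (var 2)).eff s).setv 2 (i + 1) := by
    simp only [fillBody, eff_cons, eff_nil, next, eff_assign, val]
    rw [e1 2 (by omega), h.v2]
  have hv : ∀ y, y ≠ 2 → y ≠ 6 → (fillBody.eff s).var y = s.var y := by
    intro y h2 h6
    rw [he, State.setv_var, if_neg h2, e1 y h6]
  have ha : ∀ C, C ≠ 8 → (fillBody.eff s).arr C = s.arr C := by
    intro C hC
    rw [he, State.setv_arr, e2 C hC]
  refine ⟨?_, ?_, ?_, ?_, ?_, ?_, ?_, ?_, ?_,
    if s.arr 2 ((⟨i, hi⟩ : Fin n) : ℕ) = 2 then Q ++ [⟨i, hi⟩] else Q, ⟨?_, ?_⟩, ?_, ?_⟩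
  · rw [he]; exact e4.setv (by omega)
  · rw [hv 0 (by omega) (by omega), h.v0]
  · rw [he]; simp [State.setv_var]
  · rw [hv 3 (by omega) (by omega), h.v3]
  · rw [hv 4 (by omega) (by omega), h.v4]
  · rw [hv 5 (by omega) (by omega), h.v5]
  · unfold SqT; rw [ha 5 (by omega)]; exact h.sqt
  · exact fun v => (h.nbs v).of_arr (ha 2 (by omega)) (ha 3 (by omega)) (ha 4 (by omega))
  · unfold Tab0; rw [ha 6 (by omega)]; exact h.tab
  · rw [he, State.setv_var, if_neg (by omega), e3.1]
  · rw [he, State.setv_arr]; exact e3.2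
  · split_ifs
    · rw [List.nodup_append]
      refine ⟨hnd, by simp, fun a ha b hb => ?_⟩
      rw [List.mem_singleton] at hb
      subst hb
      rintro rfl
      exact absurd ((hmem _).1 ha).1 (by simp)
    · exact hnd
  · intro v
    have hd := (h.nbs ⟨i, hi⟩).1
    rcases lt_trichotomy (v : ℕ) i with hlt | heq | hgt
    · have hne : v ≠ ⟨i, hi⟩ := fun e => by rw [e] at hlt; exact lt_irrefl _ hlt
      split_ifs <;> simp [hmem, hne, hlt, Nat.lt_succ_of_lt hlt]
    · have hve : v = ⟨i, hi⟩ := Fin.ext heq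
      subst hve
      rw [hd]
      split_ifs with hc <;> simp [hmem, hc]
    · have hne : v ≠ ⟨i, hi⟩ := fun e => by rw [e] at hgt; exact lt_irrefl _ hgt
      split_ifs <;> simp [hmem, hne, not_lt.2 hgt.le, not_lt.2 (Nat.succ_le_of_lt hgt)]

end Init

section Elimination

variable {n K Bd : ℕ} {D : Auto} {G : SimpleGraph (Fin n)} {x y : Fin n} {A B : Fin n → Fin n}
  {pos : Fin n ≃ Fin n} {d : Fin n → ℕ}

open Classical in
/-- The neighbours of `v` outside of `X`. -/
noncomputable def rest (G : SimpleGraph (Fin n)) (X : List (Fin n)) (v : Fin n) : Finset (Fin n) :=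
  Finset.univ.filter fun u => G.Adj v u ∧ u ∉ X

theorem mem_rest {X : List (Fin n)} {u v : Fin n} : u ∈ rest G X v ↔ G.Adj v u ∧ u ∉ X := by
  simp [rest]

/-- The removed vertices `X`: with a vertex all ears on its edges have been removed. -/
structure Removed (G : SimpleGraph (Fin n)) (x y : Fin n) (A B : Fin n → Fin n) (X Q : List (Fin n)) :
    Prop where
  up : ∀ v, v ≠ x → v ≠ y → v ∉ X → A v ∉ X ∧ B v ∉ X
  deg : ∀ v, v ∉ X → (v ∈ Q ↔ (rest G X v).card + off x y v = 2)
  root : ∀ v ∈ Q, v ≠ x ∧ v ≠ y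
  sub : ∀ v ∈ X, v ∈ Q

theorem _root_.Elim.adj_base (hE : Elim G x y A B pos d) {v : Fin n} (h1 : v ≠ x) (h2 : v ≠ y) :
    G.Adj v (A v) ∧ G.Adj v (B v) :=
  ⟨(hE.adj _ _).2 (Or.inr (Or.inr ⟨h1, h2, Or.inl rfl⟩)),
    (hE.adj _ _).2 (Or.inr (Or.inr ⟨h1, h2, Or.inr rfl⟩))⟩

/-- Both ends of the base are still present by `up`, and only two neighbours remain. -/
theorem Removed.rest_eq (hE : Elim G x y A B pos d) {X Q : List (Fin n)}
    (h : Removed G x y A B X Q) {v : Fin n} (hv : v ∈ Q) (hvX : v ∉ X) :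
    rest G X v = {A v, B v} := by
  obtain ⟨h1, h2⟩ := h.root v hv
  have hd := (h.deg v hvX).1 hv
  simp only [off, h1, h2, or_self, if_false, add_zero] at hd
  refine (Finset.eq_of_subset_of_card_le ?_ ?_).symm
  · intro u hu
    rw [Finset.mem_insert, Finset.mem_singleton] at hu
    rw [mem_rest]
    rcases hu with rfl | rfl
    exacts [⟨(hE.adj_base h1 h2).1, (h.up v h1 h2 hvX).1⟩,
      ⟨(hE.adj_base h1 h2).2, (h.up v h1 h2 hvX).2⟩]
  · rw [hd, Finset.card_pair (hE.base v h1 h2).ne]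

/-- As long as `v` is present, an end `u` of its base has the three neighbours `v`, `A u`, `B u`, or
the excess degree `2` and a neighbour. So `u` is not in the queue yet, and no vertex enters it
twice. -/
theorem Removed.card_ne_two (hE : Elim G x y A B pos d) {X Q : List (Fin n)}
    (h : Removed G x y A B X Q) {v u : Fin n} (hv : v ∈ Q) (hvX : v ∉ X) (hu : u = A v ∨ u = B v) :
    (rest G X u).card + off x y u ≠ 2 := by
  obtain ⟨h1, h2⟩ := h.root v hv
  have hadj := hE.adj_base h1 h2
  have huX : u ∉ X := by
    rcases hu with rfl | rfl
    exacts [(h.up v h1 h2 hvX).1, (h.up v h1 h2 hvX).2]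
  have hmem : v ∈ rest G X u := by
    rw [mem_rest]
    rcases hu with rfl | rfl
    exacts [⟨hadj.1.symm, hvX⟩, ⟨hadj.2.symm, hvX⟩]
  have hpos := Finset.card_pos.2 ⟨v, hmem⟩
  unfold off
  split_ifs with hr
  · omega
  · push Not at hr
    have hdu : d u < d v := by
      rcases hu with rfl | rfl
      exacts [hE.dA v h1 h2, hE.dB v h1 h2]
    have dA := hE.dA u hr.1 hr.2
    have dB := hE.dB u hr.1 hr.2
    have hsub : ({v, A u, B u} : Finset (Fin n)) ⊆ rest G X u := by
      intro w hw
      simp only [Finset.mem_insert, Finset.mem_singleton] at hw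
      rcases hw with rfl | rfl | rfl
      · exact hmem
      · exact mem_rest.2 ⟨(hE.adj_base hr.1 hr.2).1, (h.up u hr.1 hr.2 huX).1⟩
      · exact mem_rest.2 ⟨(hE.adj_base hr.1 hr.2).2, (h.up u hr.1 hr.2 huX).2⟩
    have := Finset.card_le_card hsub
    rw [Finset.card_eq_three.2 ⟨v, A u, B u, fun e => by rw [← e] at dA; omega,
      fun e => by rw [← e] at dB; omega, (hE.base u hr.1 hr.2).ne, rfl⟩] at this
    omega

theorem rest_append (X : List (Fin n)) (v u : Fin n) : rest G (X ++ [v]) u = (rest G X u).erase v := by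
  ext w
  simp only [mem_rest, Finset.mem_erase, List.mem_append, List.mem_singleton]
  tauto

/-- The removal of `v` affects the degrees of `A v` and `B v` only, so no other vertex has to be
tested for the queue. -/
theorem Removed.step (hE : Elim G x y A B pos d) {X Q Q' : List (Fin n)}
    (h : Removed G x y A B X Q) {v : Fin n} (hv : v ∈ Q) (hvX : v ∉ X)
    (hQ' : ∀ u, u ∈ Q' ↔ u ∈ Q ∨
      (u = A v ∨ u = B v) ∧ (rest G (X ++ [v]) u).card + off x y u = 2) :
    Removed G x y A B (X ++ [v]) Q' := by
  obtain ⟨h1, h2⟩ := h.root v hv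
  have hr := h.rest_eq hE hv hvX
  have hup : ∀ w, w ≠ x → w ≠ y → w ∉ X ++ [v] → A w ∉ X ++ [v] ∧ B w ∉ X ++ [v] := by
    intro w w1 w2 hw
    simp only [List.mem_append, List.mem_singleton, not_or] at hw ⊢
    -- If `v` were in the base of a remaining `w`, then `w` would be a remaining neighbour of `v`,
    -- hence in the base of `v`, against the order given by `d`.
    have key : ∀ z, (z = A w ∨ z = B w) → z ≠ v := by
      rintro z hz rfl
      have hdz : d z < d w := by
        rcases hz with rfl | rfl
        exacts [hE.dA w w1 w2, hE.dB w w1 w2]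
      have : w ∈ rest G X z := by
        rw [mem_rest]
        refine ⟨?_, hw.1⟩
        rcases hz with rfl | rfl
        exacts [(hE.adj_base w1 w2).1.symm, (hE.adj_base w1 w2).2.symm]
      rw [hr, Finset.mem_insert, Finset.mem_singleton] at this
      have dA := hE.dA z h1 h2
      have dB := hE.dB z h1 h2
      rcases this with rfl | rfl <;> omega
    have := h.up w w1 w2 hw.1
    exact ⟨⟨this.1, key _ (Or.inl rfl)⟩, this.2, key _ (Or.inr rfl)⟩
  refine ⟨hup, ?_, ?_, ?_⟩
  · intro u hu
    rw [hQ']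
    simp only [List.mem_append, List.mem_singleton, not_or] at hu
    by_cases hb : u = A v ∨ u = B v
    · have := h.card_ne_two hE hv hvX hb
      have hnot : u ∉ Q := fun e => this ((h.deg u hu.1).1 e)
      simp [hnot, hb]
    · have : v ∉ rest G X u := by
        intro e
        have : u ∈ rest G X v := mem_rest.2 ⟨(mem_rest.1 e).1.symm, hu.1⟩
        rw [hr, Finset.mem_insert, Finset.mem_singleton] at this
        exact hb this
      rw [h.deg u hu.1, rest_append, Finset.erase_eq_of_notMem this]
      simp [hb]
  · intro u hu
    rcases (hQ' u).1 hu with hu | ⟨hb, hc⟩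
    · exact h.root u hu
    -- `x` and `y` are never removed and stay adjacent, so together with the excess their stored
    -- degrees exceed `2`.
    · have hxy : x ∉ X ++ [v] ∧ y ∉ X ++ [v] := by
        simp only [List.mem_append, List.mem_singleton, not_or]
        exact ⟨⟨fun e => (h.root x (h.sub x e)).1 rfl, h1.symm⟩,
          fun e => (h.root y (h.sub y e)).2 rfl, h2.symm⟩
      unfold off at hc
      constructor
      · intro e
        have := Finset.card_pos.2 ⟨y, mem_rest.2 ⟨e ▸ hE.root, hxy.2⟩⟩
        rw [if_pos (Or.inl e)] at hc
        omega
      · intro e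
        have := Finset.card_pos.2 ⟨x, mem_rest.2 ⟨e ▸ hE.root.symm, hxy.1⟩⟩
        rw [if_pos (Or.inr e)] at hc
        omega
  · intro u hu
    rw [List.mem_append, List.mem_singleton] at hu
    rcases hu with hu | rfl
    exacts [(hQ' u).2 (Or.inl (h.sub u hu)), (hQ' u).2 (Or.inl hv)]

end Elimination

end RealRAM

/-! ### The elimination loop -/

namespace RealRAM

open RealRAM.Expr RealRAM.Prog

section Elimination

variable {n K Bd : ℕ} {D : Auto} {G : SimpleGraph (Fin n)} {x y : Fin n} {A B : Fin n → Fin n}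
  {pos : Fin n ≃ Fin n} {d : Fin n → ℕ}

/-- Variables `10` and `11` receive the sum and the difference of the two remaining neighbours, so
`8` is the larger and `9` the smaller one. Which of them comes first along the polygon is unknown;
therefore both orientations of the base are processed. -/
def elimBody (K : ℕ) (D : Auto) : Prog := .list [.assign 7 (read 8 (var 5)),
  .assign 5 (add (var 5) (const 1)), .assign 10 (read 3 (var 7)),
  .assign 11 (read 5 (sub (mul (const 2) (read 4 (var 7))) (mul (var 10) (var 10)))),
  .assign 8 (div (add (var 10) (var 11)) (const 2)), .assign 9 (div (sub (var 10) (var 11)) (const 2)),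
  delNb (var 8) (var 7), delNb (var 9) (var 7), pushIf (var 8), pushIf (var 9),
  ear K D (var 8) (var 9), ear K D (var 9) (var 8)]

/-- The table and the apex array are correct for the subtrees with apexes in `X`. -/
structure Tables (K : ℕ) (D : Auto) (G : SimpleGraph (Fin n)) (A B : Fin n → Fin n) (X : List (Fin n))
    (s : State) : Prop where
  tab : ∃ Tf : Fin n → Fin n → Tr (Fin n), ∀ a b, Hang A B (fun v => v ∈ X) a b (Tf a b) ∧
    (G.Adj a b → ∀ q < K, s.arr 6 ((a * n + b : ℕ) * K + q) = D.dp (Tf a b) q)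
  apex : ∀ v ∈ X, s.arr 7 (A v * n + B v) = v ∧ s.arr 7 (B v * n + A v) = v

/-- The state after the removal of the first `h` vertices of the queue. -/
structure ElimInv (K Bd : ℕ) (D : Auto) (G : SimpleGraph (Fin n)) (x y : Fin n) (A B : Fin n → Fin n)
    (Q : List (Fin n)) (h : ℕ) (s : State) : Prop where
  bdd : s.Bdd Bd
  v0 : s.var 0 = n
  v3 : s.var 3 = x
  v4 : s.var 4 = y
  v5 : s.var 5 = h
  le : h ≤ Q.length
  que : Que s Q
  nodup : Q.Nodup
  sqt : SqT n s
  rem : Removed G x y A B (Q.take h) Q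
  nbs : ∀ v, v ∉ Q.take h → Nb s (rest G (Q.take h)) (off x y) v
  tables : Tables K D G A B (Q.take h) s

/-- `2 * (a² + b²) - (a + b)² = (a - b)²`, and the table holds the square root. -/
theorem recover {n a b : ℕ} (hab : a < n) (hb : b < n) {s : State} (hs : SqT n s) :
    ∃ p q : ℕ, ((p = a ∧ q = b) ∨ (p = b ∧ q = a)) ∧
      (a + b + s.arr 5 (2 * (a * a + b * b) - (a + b) * (a + b))) / 2 = p ∧
      (a + b - s.arr 5 (2 * (a * a + b * b) - (a + b) * (a + b))) / 2 = q := by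
  rcases le_total a b with h | h
  · obtain ⟨t, rfl⟩ := Nat.exists_eq_add_of_le h
    have : 2 * (a * a + (a + t) * (a + t)) - (a + (a + t)) * (a + (a + t)) = t * t :=
      Nat.sub_eq_of_eq_add (by ring)
    rw [this, hs t (by omega)]
    exact ⟨_, _, Or.inr ⟨rfl, rfl⟩, by omega, by omega⟩
  · obtain ⟨t, rfl⟩ := Nat.exists_eq_add_of_le h
    have : 2 * ((b + t) * (b + t) + b * b) - (b + t + b) * (b + t + b) = t * t :=
      Nat.sub_eq_of_eq_add (by ring)
    rw [this, hs t (by omega)]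
    exact ⟨_, _, Or.inl ⟨rfl, rfl⟩, by omega, by omega⟩

theorem mem_ite_append {α : Type} {Q : List α} {u a : α} {c : Prop} [Decidable c] :
    u ∈ (if c then Q ++ [a] else Q) ↔ u ∈ Q ∨ (u = a ∧ c) := by
  split_ifs with h <;> simp [h]

theorem nodup_ite_append {α : Type} {Q : List α} {a : α} {c : Prop} [Decidable c] (hQ : Q.Nodup)
    (ha : a ∉ Q) : (if c then Q ++ [a] else Q).Nodup := by
  split_ifs
  · exact List.nodup_append.2 ⟨hQ, by simp, fun z hz w hw => by
      rw [List.mem_singleton] at hw; rintro rfl; exact ha (hw ▸ hz)⟩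
  · exact hQ

theorem exists_ite_append {α : Type} {Q : List α} {a : α} {c : Prop} [Decidable c] :
    ∃ R, (if c then Q ++ [a] else Q) = Q ++ R := by
  split_ifs
  exacts [⟨_, rfl⟩, ⟨[], by simp⟩]

/-- Both orientations of an ear are put on its base. -/
theorem tables_step (hp : Params n K Bd D) (hE : Elim G x y A B pos d) {X : List (Fin n)}
    (hX : ∀ u ∈ X, u ≠ x ∧ u ≠ y) {v a b : Fin n} (hvX : v ∉ X) (hv : v ≠ x ∧ v ≠ y)
    (hup : A v ∉ X ∧ B v ∉ X) (hab : (a = A v ∧ b = B v) ∨ (a = B v ∧ b = A v)) {s : State}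
    (h : Tables K D G A B X s) (h0 : s.var 0 = n) (h8 : s.var 8 = a) (h9 : s.var 9 = b)
    (h7 : s.var 7 = v) (hs : s.Bdd Bd) {s' : State}
    (hs' : s' = (ear K D (var 9) (var 8)).eff ((ear K D (var 8) (var 9)).eff s)) :
    s'.var = s.var ∧ (∀ C, C ≠ 6 → C ≠ 7 → s'.arr C = s.arr C) ∧ s'.Bdd Bd ∧
      Tables K D G A B (X ++ [v]) s' := by
  obtain ⟨Tf, hT⟩ := h.tab
  have hadj := hE.adj_base hv.1 hv.2
  have hbase := hE.base v hv.1 hv.2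
  have hva : G.Adj v a ∧ G.Adj v b ∧ G.Adj a b := by
    rcases hab with ⟨rfl, rfl⟩ | ⟨rfl, rfl⟩
    exacts [⟨hadj.1, hadj.2, hbase⟩, ⟨hadj.2, hadj.1, hbase.symm⟩]
  obtain ⟨av, bv, abv⟩ := hva
  have hsym : s(A v, B v) = s(a, b) := by
    rcases hab with ⟨rfl, rfl⟩ | ⟨rfl, rfl⟩
    exacts [rfl, Sym2.eq_swap]
  have nva := av.ne
  have nvb := bv.ne
  have nab := abv.ne
  -- Distinct apexes have distinct bases, so the base of `v` carries no tree yet.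
  have leaf : ∀ {c e T}, s(A v, B v) = s(c, e) → Hang A B (fun v => v ∈ X) c e T → T = .leaf := by
    intro c e T he hT
    cases hT with
    | leaf => rfl
    | node _ _ w l r hw he' =>
      have hw' := hX w hw
      have := hE.inj v w hv.1 hv.2 hw'.1 hw'.2 (he.trans he'.symm)
      exact absurd (this ▸ hw) hvX
  obtain ⟨e1, e2, e3, e4, e5⟩ := eff_ear (s := s) (D := D) (K := K) (a := 8) (b := 9) (u := a) (v := v)
    (w := b) (f := D.dp (Tf a v)) (g := D.dp (Tf v b)) h0 h8 h9 h7 nva.symm nvb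
    (fun q hq => (hT a v).2 av.symm q hq) (fun q hq => (hT v b).2 bv q hq) hp.trans hp.start
    (fun q hq hne => by rw [(hT a b).2 abv q hq, leaf hsym (hT a b).1]; simp [Auto.dp, hne])
  set s1 := (ear K D (var 8) (var 9)).eff s with hs1
  have k1 : ∀ c e : Fin n, (c ≠ a ∨ e ≠ b) → ∀ q < K,
      s1.arr 6 ((c * n + e : ℕ) * K + q) = s.arr 6 ((c * n + e : ℕ) * K + q) := by
    intro c e hce q hq
    refine e5 _ fun q' hq' hk => ?_
    rw [key_inj hq hq'] at hk
    tauto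
  obtain ⟨f1, f2, f3, f4, f5⟩ := eff_ear (s := s1) (D := D) (K := K) (a := 9) (b := 8) (u := b) (v := v)
    (w := a) (f := D.dp (Tf b v)) (g := D.dp (Tf v a)) (by rw [e1, h0]) (by rw [e1, h9]) (by rw [e1, h8]) (by rw [e1, h7]) nvb.symm nva
    (fun q hq => by rw [k1 b v (Or.inl nab.symm) q hq]; exact (hT b v).2 bv.symm q hq)
    (fun q hq => by rw [k1 v a (Or.inl nva) q hq]; exact (hT v a).2 av q hq) hp.trans hp.start
    (fun q hq hne => by
      rw [k1 b a (Or.inl nab.symm) q hq, (hT b a).2 abv.symm q hq,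
        leaf (hsym.trans Sym2.eq_swap) (hT b a).1]; simp [Auto.dp, hne])
  rw [← hs'] at f1 f2 f3 f4 f5
  have k2 : ∀ c e : Fin n, (c ≠ b ∨ e ≠ a) → ∀ q < K,
      s'.arr 6 ((c * n + e : ℕ) * K + q) = s1.arr 6 ((c * n + e : ℕ) * K + q) := by
    intro c e hce q hq
    refine f5 _ fun q' hq' hk => ?_
    rw [key_inj hq hq'] at hk
    tauto
  have hX' : (fun u => u ∈ X ++ [v]) = fun u => u ∈ X ∨ u = v := by
    funext u; simp
  have ins : ∀ {c e T}, Hang A B (fun v => v ∈ X) c e T → s(A v, B v) ≠ s(c, e) →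
      Hang A B (fun u => u ∈ X ++ [v]) c e T := by
    intro c e T hT hne
    rw [hX']
    exact hT.insert hup.1 hup.2 hne
  have hne : ∀ c, s(A v, B v) ≠ s(c, v) ∧ s(A v, B v) ≠ s(v, c) := by
    intro c
    rw [hsym]
    constructor <;> intro e <;> rcases Sym2.eq_iff.1 e with ⟨r1, r2⟩ | ⟨r1, r2⟩
    exacts [nvb r2.symm, nva r1.symm, nva r1.symm, nvb r2.symm]
  have hang : ∀ {c e}, s(A v, B v) = s(c, e) →
      Hang A B (fun u => u ∈ X ++ [v]) c e (.node v (Tf c v) (Tf v e)) := fun he =>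
    .node _ _ v _ _ (by simp) he (ins (hT _ v).1 (hne _).1) (ins (hT v _).1 (hne _).2)
  have d1 : ∀ q < K, s'.arr 6 ((a * n + b : ℕ) * K + q) = D.dp (.node v (Tf a v) (Tf v b)) q := by
    intro q hq
    rw [k2 a b (Or.inl nab) q hq, e4 q hq]; rfl
  have d2 : ∀ q < K, s'.arr 6 ((b * n + a : ℕ) * K + q) = D.dp (.node v (Tf b v) (Tf v a)) q := by
    intro q hq
    rw [f4 q hq]; rfl
  have hXv : ∀ u ∈ X ++ [v], u ≠ x ∧ u ≠ y := by
    intro u hu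
    rw [List.mem_append, List.mem_singleton] at hu
    rcases hu with hu | rfl
    exacts [hX u hu, hv]
  -- The tree on an edge has at most `n` nodes, which bounds the words in the table.
  have bound : ∀ {c e T}, Hang A B (fun u => u ∈ X ++ [v]) c e T → c ≠ e → ∀ q, D.dp T q ≤ Bd := by
    intro c e T hT hce q
    have h1 := hT.size_lt hE hXv hce
    have h2 := (pos c).2
    have h3 := (pos e).2
    have h4 : T.size ≤ n := by omega
    exact (Auto.dp_le T q).trans ((Nat.add_le_add_right (Nat.mul_le_mul_left _ h4) 1).trans hp.hD)
  refine ⟨by rw [f1, e1], fun C h6 h7 => by rw [f2 C h6 h7, e2 C h6 h7], ⟨fun z => ?_, fun C j => ?_⟩,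
    ⟨fun c e => if c = a ∧ e = b then .node v (Tf a v) (Tf v b) else
      if c = b ∧ e = a then .node v (Tf b v) (Tf v a) else Tf c e, fun c e => ?_⟩, ?_⟩
  · rw [f1, e1]; exact hs.1 z
  · by_cases c6 : C = 6
    · subst c6
      by_cases h1 : ∃ q < K, j = (a * n + b : ℕ) * K + q
      · obtain ⟨q, hq, rfl⟩ := h1
        rw [d1 q hq]; exact bound (hang hsym) nab q
      by_cases h2 : ∃ q < K, j = (b * n + a : ℕ) * K + q
      · obtain ⟨q, hq, rfl⟩ := h2
        rw [d2 q hq]; exact bound (hang (hsym.trans Sym2.eq_swap)) nab.symm q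
      · push Not at h1 h2
        rw [f5 j h2, e5 j h1]; exact hs.2 6 j
    · by_cases c7 : C = 7
      · subst c7
        have := hp.hB
        have := v.2
        rw [f3, e3]
        split_ifs
        · omega
        · omega
        · exact hs.2 7 j
      · rw [f2 C c6 c7, e2 C c6 c7]; exact hs.2 C j
  · by_cases h1 : c = a ∧ e = b
    · obtain ⟨rfl, rfl⟩ := h1
      simp only [and_self, if_true]
      exact ⟨hang hsym, fun _ => d1⟩
    · by_cases h2 : c = b ∧ e = a
      · obtain ⟨rfl, rfl⟩ := h2
        simp only [h1, and_self, if_true, if_false]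
        exact ⟨hang (hsym.trans Sym2.eq_swap), fun _ => d2⟩
      · simp only [h1, h2, if_false]
        refine ⟨ins (hT c e).1 ?_, fun hce q hq => ?_⟩
        · rw [hsym]
          intro he
          rcases Sym2.eq_iff.1 he with ⟨r1, r2⟩ | ⟨r1, r2⟩
          exacts [h1 ⟨r1.symm, r2.symm⟩, h2 ⟨r2.symm, r1.symm⟩]
        · rw [k2 c e (by tauto) q hq, k1 c e (by tauto) q hq]
          exact (hT c e).2 hce q hq
  · intro w hw
    rw [f3, e3, f3, e3]
    simp only [pair_inj]
    rw [List.mem_append, List.mem_singleton] at hw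
    rcases hw with hw | rfl
    · have hne : s(A w, B w) ≠ s(a, b) := by
        rw [← hsym]
        intro he
        have hw' := hX w hw
        exact hvX (hE.inj w v hw'.1 hw'.2 hv.1 hv.2 he ▸ hw)
      rw [Ne, Sym2.eq_iff] at hne
      rw [if_neg (by tauto), if_neg (by tauto), if_neg (by tauto), if_neg (by tauto)]
      exact h.apex w hw
    · rcases hab with ⟨rfl, rfl⟩ | ⟨rfl, rfl⟩ <;> simp

-- The queue is also the record of the removed vertices: they are its first `h` entries, and later
-- pushes leave this prefix unchanged.
set_option maxHeartbeats 1000000 in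
theorem elim_step (hp : Params n K Bd D) (hE : Elim G x y A B pos d) {Q : List (Fin n)} {h : ℕ}
    {s : State} (hI : ElimInv K Bd D G x y A B Q h s) (hlt : h < Q.length) :
    ∃ Q', ElimInv K Bd D G x y A B Q' (h + 1) ((elimBody K D).eff s) := by
  have hB := hp.hB
  have hn2 : n * 3 ≤ n * n := Nat.mul_le_mul_left _ hp.hn
  set X := Q.take h with hX
  set v := Q[h] with hv
  have hX' : Q.take (h + 1) = X ++ [v] := by
    rw [List.take_add_one, List.getElem?_eq_getElem hlt]; simp [hX, hv]
  have hvQ : v ∈ Q := List.getElem_mem hlt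
  have hvX : v ∉ X := by
    have : (X ++ [v]).Nodup := hX' ▸ hI.nodup.sublist (List.take_sublist _ _)
    rw [List.nodup_append] at this
    intro hm
    exact this.2.2 _ hm _ (by simp) rfl
  have hroot := hI.rem.root v hvQ
  have hup := hI.rem.up v hroot.1 hroot.2 hvX
  have hr := hI.rem.rest_eq hE hvQ hvX
  have hadj := hE.adj_base hroot.1 hroot.2
  have hne := (hE.base v hroot.1 hroot.2).ne
  obtain ⟨p, q, hpq, hp1, hq1⟩ := recover (A v).2 (B v).2 hI.sqt
  obtain ⟨a, b, hab, rfl, rfl⟩ : ∃ a b : Fin n, ((a = A v ∧ b = B v) ∨ (a = B v ∧ b = A v)) ∧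
      (a : ℕ) = p ∧ (b : ℕ) = q := by
    rcases hpq with ⟨rfl, rfl⟩ | ⟨rfl, rfl⟩
    exacts [⟨_, _, Or.inl ⟨rfl, rfl⟩, rfl, rfl⟩, ⟨_, _, Or.inr ⟨rfl, rfl⟩, rfl, rfl⟩]
  have hab' : (a = A v ∨ a = B v) ∧ (b = A v ∨ b = B v) ∧ a ≠ b ∧ ∀ u, (u = A v ∨ u = B v) ↔
      (u = a ∨ u = b) := by
    rcases hab with ⟨rfl, rfl⟩ | ⟨rfl, rfl⟩
    exacts [⟨Or.inl rfl, Or.inr rfl, hne, fun u => Iff.rfl⟩,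
      ⟨Or.inr rfl, Or.inl rfl, hne.symm, fun u => Or.comm⟩]
  obtain ⟨ha', hb', nab, hiff⟩ := hab'
  have haX : a ∉ X ∧ b ∉ X := by
    rcases hab with ⟨rfl, rfl⟩ | ⟨rfl, rfl⟩
    exacts [hup, hup.symm]
  have hva : G.Adj v a ∧ G.Adj v b := by
    rcases hab with ⟨rfl, rfl⟩ | ⟨rfl, rfl⟩
    exacts [hadj, hadj.symm]
  -- the assignments
  obtain ⟨S, hS⟩ : ∃ S, S = ((A v : ℕ) + B v) := ⟨_, rfl⟩
  obtain ⟨δ, hδ⟩ : ∃ δ, δ = s.arr 5 (2 * ((A v : ℕ) * A v + B v * B v) - S * S) := ⟨_, rfl⟩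
  rw [← hS, ← hδ] at hp1 hq1
  set s1 := (((((s.setv 7 v).setv 5 (h + 1)).setv 10 S).setv 11 δ).setv 8 a).setv 9 b with hs1
  have hnb := hI.nbs v hvX
  have n3 : s.arr 3 v = S := by rw [hnb.2.1, hr, Finset.sum_pair hne, hS]
  have n4 : s.arr 4 v = (A v : ℕ) * A v + B v * B v := by rw [hnb.2.2, hr, Finset.sum_pair hne]
  have q8 : s.arr 8 h = v := hI.que.2 h hlt
  have he1 : (elimBody K D).eff s = (Prog.list [delNb (var 8) (var 7), delNb (var 9) (var 7),
      pushIf (var 8), pushIf (var 9), ear K D (var 8) (var 9), ear K D (var 9) (var 8)]).eff s1 := by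
    simp only [elimBody, eff_cons, eff_nil, eff_assign, val, hI.v5, q8]
    simp only [State.setv_arr, State.setv_var, reduceIte, Nat.reduceEqDiff,
      n3, n4, hI.v5, ← hδ, hp1, hq1, hs1]
  have v7 : s1.var 7 = v := by simp [hs1, State.setv_var]
  have v8 : s1.var 8 = a := by simp [hs1, State.setv_var]
  have v9 : s1.var 9 = b := by simp [hs1, State.setv_var]
  have b1 : s1.Bdd Bd := by
    have := v.2
    have := a.2
    have := b.2
    have := (A v).2
    have := (B v).2
    have hlen : Q.length ≤ n := by simpa using hI.nodup.length_le_card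
    exact (((((hI.bdd.setv (by omega)).setv (by omega)).setv (by omega)).setv
      (hδ ▸ hI.bdd.2 5 _)).setv (by omega)).setv (by omega)
  have a1 : s1.arr = s.arr := rfl
  clear_value s1
  -- the degrees
  have mA : v ∈ rest G X a := mem_rest.2 ⟨hva.1.symm, hvX⟩
  have mB : v ∈ rest G X b := mem_rest.2 ⟨hva.2.symm, hvX⟩
  obtain ⟨g1, g2, g3, g4⟩ := eff_delNb (s := s1) (N := rest G X) (off := off x y) (a := 8) (b := 7)
    (u := a) (w := v) v8 v7 mA b1
  set s2 := (delNb (var 8) (var 7)).eff s1 with hs2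
  clear_value s2
  obtain ⟨k1, k2, k3, k4⟩ := eff_delNb (s := s2)
    (N := Function.update (rest G X) a ((rest G X a).erase v)) (off := off x y) (a := 9) (b := 7)
    (u := b) (w := v) (by rw [g1, v9]) (by rw [g1, v7])
    (by rw [Function.update_of_ne nab.symm]; exact mB) g4
  set s3 := (delNb (var 9) (var 7)).eff s2 with hs3
  clear_value s3
  have hnb3 : ∀ u, u ∉ X ++ [v] → Nb s3 (rest G (X ++ [v])) (off x y) u := by
    intro u hu
    rw [List.mem_append, List.mem_singleton, not_or] at hu
    have h3 := k3 u (g3 u ((hI.nbs u hu.1).of_arr (by rw [a1]) (by rw [a1]) (by rw [a1])))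
    have : rest G (X ++ [v]) u = Function.update (Function.update (rest G X) a ((rest G X a).erase v)) b
        ((Function.update (rest G X) a ((rest G X a).erase v) b).erase v) u := by
      rw [rest_append, Function.update_of_ne nab.symm, Function.update_apply, Function.update_apply]
      split_ifs with c1 c2
      · rw [c1]
      · rw [c2]
      · refine Finset.erase_eq_of_notMem fun e => ?_
        have : u ∈ rest G X v := mem_rest.2 ⟨(mem_rest.1 e).1.symm, hu.1⟩
        rw [hr, Finset.mem_insert, Finset.mem_singleton, hiff] at this
        tauto
    unfold Nb at h3 ⊢
    rw [this]
    exact h3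
  have hav : a ∉ X ++ [v] ∧ b ∉ X ++ [v] := by
    simp only [List.mem_append, List.mem_singleton, not_or]
    exact ⟨⟨haX.1, hva.1.ne'⟩, haX.2, hva.2.ne'⟩
  have hdegA := (hnb3 a hav.1).1
  have hdegB := (hnb3 b hav.2).1
  -- the queue
  have hQ3 : Que s3 Q := by
    refine ⟨?_, fun j hj => ?_⟩
    · rw [k1, g1, hs1]; simpa [State.setv_var] using hI.que.1
    · rw [k2 8 (by omega) (by omega) (by omega), g2 8 (by omega) (by omega) (by omega), a1]
      exact hI.que.2 j hj
  have hlen : Q.length ≤ n := by simpa using hI.nodup.length_le_card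
  obtain ⟨l1, l2, l3, l4⟩ := eff_pushIf (s := s3) (a := 8) (u := a) (B := Bd) (by rw [k1, g1, v8]) hQ3
    k4 (by omega)
  set s4 := (pushIf (var 8)).eff s3 with hs4
  clear_value s4
  set Q1 := if s3.arr 2 a = 2 then Q ++ [a] else Q with hQ1
  clear_value Q1
  have hQ1len : Q1.length ≤ n + 1 := by
    rw [hQ1]; split_ifs
    · rw [List.length_append, List.length_singleton]; omega
    · omega
  obtain ⟨m1, m2, m3, m4⟩ := eff_pushIf (s := s4) (a := 9) (u := b) (B := Bd)
    (by rw [l1 9 (by omega), k1, g1, v9]) l3 l4 (by omega)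
  set s5 := (pushIf (var 9)).eff s4 with hs5
  clear_value s5
  rw [l2 2 (by omega)] at m3
  set Q2 := if s3.arr 2 b = 2 then Q1 ++ [b] else Q1 with hQ2
  clear_value Q2
  have hmem : ∀ u, u ∈ Q2 ↔ u ∈ Q ∨
      (u = A v ∨ u = B v) ∧ (rest G (X ++ [v]) u).card + off x y u = 2 := by
    intro u
    have e1 : u ∈ Q1 ↔ u ∈ Q ∨ (u = a ∧ (rest G (X ++ [v]) u).card + off x y u = 2) := by
      rw [hQ1, hdegA, mem_ite_append]
      exact or_congr_right (and_congr_right fun e => by rw [e])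
    have e2 : u ∈ Q2 ↔ u ∈ Q1 ∨ (u = b ∧ (rest G (X ++ [v]) u).card + off x y u = 2) := by
      rw [hQ2, hdegB, mem_ite_append]
      exact or_congr_right (and_congr_right fun e => by rw [e])
    rw [e2, e1, hiff, or_assoc, ← or_and_right]
  have haQ : a ∉ Q ∧ b ∉ Q := by
    constructor
    · intro e
      exact hI.rem.card_ne_two hE hvQ hvX ha' ((hI.rem.deg a haX.1).1 e)
    · intro e
      exact hI.rem.card_ne_two hE hvQ hvX hb' ((hI.rem.deg b haX.2).1 e)
  have hnd1 : Q1.Nodup := by rw [hQ1]; exact nodup_ite_append hI.nodup haQ.1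
  have hnd2 : Q2.Nodup := by
    rw [hQ2]
    refine nodup_ite_append hnd1 fun e => ?_
    rw [hQ1, mem_ite_append] at e
    exact e.elim haQ.2 fun e => nab e.1.symm
  obtain ⟨R, hR⟩ : ∃ R, Q2 = Q ++ R := by
    obtain ⟨R, hR⟩ : ∃ R, Q1 = Q ++ R := by rw [hQ1]; exact exists_ite_append
    obtain ⟨R', hR'⟩ : ∃ R, Q2 = Q1 ++ R := by rw [hQ2]; exact exists_ite_append
    exact ⟨R ++ R', by rw [hR', hR, List.append_assoc]⟩
  have htake : Q2.take (h + 1) = X ++ [v] := by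
    rw [hR, List.take_append_of_le_length hlt, hX']
  -- the tables
  have hv5 : ∀ z, z ≠ 6 → s5.var z = s1.var z := fun z hz => by rw [m1 z hz, l1 z hz, k1, g1]
  have ha5 : ∀ C, C ≠ 2 → C ≠ 3 → C ≠ 4 → C ≠ 8 → s5.arr C = s.arr C := fun C h2 h3 h4 h8 => by
    rw [m2 C h8, l2 C h8, k2 C h2 h3 h4, g2 C h2 h3 h4, a1]
  have hT5 : Tables K D G A B X s5 := by
    refine ⟨?_, ?_⟩
    · rw [ha5 6 (by omega) (by omega) (by omega) (by omega)]; exact hI.tables.tab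
    · rw [ha5 7 (by omega) (by omega) (by omega) (by omega)]; exact hI.tables.apex
  have hz : ∀ z, z ≠ 5 → z ≠ 7 → z ≠ 8 → z ≠ 9 → z ≠ 10 → z ≠ 11 → s1.var z = s.var z := by
    intro z h5 h7 h8 h9 h10 h11
    rw [hs1]
    simp [State.setv_var, h5, h7, h8, h9, h10, h11]
  obtain ⟨t1, t2, t3, t4⟩ := tables_step hp hE (fun u hu => hI.rem.root u (hI.rem.sub u hu)) hvX hroot
    hup hab hT5 (by rw [hv5 0 (by omega), hz 0 (by omega) (by omega) (by omega) (by omega) (by omega)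
      (by omega), hI.v0]) (by rw [hv5 8 (by omega), v8]) (by rw [hv5 9 (by omega), v9])
    (by rw [hv5 7 (by omega), v7]) m4 rfl
  have he : (elimBody K D).eff s =
      (ear K D (var 9) (var 8)).eff ((ear K D (var 8) (var 9)).eff s5) := by
    rw [he1]; simp only [eff_cons, eff_nil, ← hs2, ← hs3, ← hs4, ← hs5]
  rw [← he] at t1 t2 t3 t4
  refine ⟨Q2, t3, ?_, ?_, ?_, ?_, ?_, ⟨?_, fun j hj => ?_⟩, hnd2, ?_, ?_, ?_, ?_⟩
  · rw [t1, hv5 0 (by omega), hz 0 (by omega) (by omega) (by omega) (by omega) (by omega) (by omega),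
      hI.v0]
  · rw [t1, hv5 3 (by omega), hz 3 (by omega) (by omega) (by omega) (by omega) (by omega) (by omega),
      hI.v3]
  · rw [t1, hv5 4 (by omega), hz 4 (by omega) (by omega) (by omega) (by omega) (by omega) (by omega),
      hI.v4]
  · rw [t1, hv5 5 (by omega), hs1]; simp [State.setv_var]
  · rw [hR, List.length_append]; omega
  · rw [t1, m3.1]
  · rw [t2 8 (by omega) (by omega), m3.2 j hj]
  · unfold SqT
    rw [t2 5 (by omega) (by omega), ha5 5 (by omega) (by omega) (by omega) (by omega)]
    exact hI.sqt
  · rw [htake]; exact hI.rem.step hE hvQ hvX hmem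
  · rw [htake]
    intro u hu
    refine (hnb3 u hu).of_arr ?_ ?_ ?_
    · rw [t2 2 (by omega) (by omega), m2 2 (by omega), l2 2 (by omega)]
    · rw [t2 3 (by omega) (by omega), m2 3 (by omega), l2 3 (by omega)]
    · rw [t2 4 (by omega) (by omega), m2 4 (by omega), l2 4 (by omega)]
  · rw [htake]; exact t4

theorem straight_relaxP (K : ℕ) (a b : Expr) (τ : Lab × ℕ × ℕ × ℕ) : (relaxP K a b τ).Straight :=
  ⟨trivial, trivial⟩

theorem straight_ear (K : ℕ) (D : Auto) (a b : Expr) : (ear K D a b).Straight := by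
  refine straight_list fun P hP => ?_
  simp only [List.mem_cons, List.mem_map] at hP
  rcases hP with rfl | rfl | ⟨τ, -, rfl⟩
  exacts [trivial, trivial, straight_relaxP K a b τ]

theorem straight_elimBody (K : ℕ) (D : Auto) : (elimBody K D).Straight := by
  refine straight_list fun P hP => ?_
  simp only [List.mem_cons, List.not_mem_nil, or_false] at hP
  rcases hP with rfl | rfl | rfl | rfl | rfl | rfl | rfl | rfl | rfl | rfl | rfl | rfl
  all_goals first
    | exact trivial
    | exact straight_ear _ _ _ _
    | exact straight_list (by simp [Straight])
    | exact ⟨straight_list (by simp [Straight]), trivial⟩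

/-- The state after the elimination of all ears. -/
structure Eliminated (K Bd : ℕ) (D : Auto) (G : SimpleGraph (Fin n)) (x y : Fin n)
    (A B : Fin n → Fin n) (s : State) : Prop where
  bdd : s.Bdd Bd
  v0 : s.var 0 = n
  v3 : s.var 3 = x
  v4 : s.var 4 = y
  tab : ∃ Tf : Fin n → Fin n → Tr (Fin n), ∀ a b, Hang A B (fun v => v ≠ x ∧ v ≠ y) a b (Tf a b) ∧
    (G.Adj a b → ∀ q < K, s.arr 6 ((a * n + b : ℕ) * K + q) = D.dp (Tf a b) q)
  apex : ∀ v, v ≠ x → v ≠ y → s.arr 7 (A v * n + B v) = v ∧ s.arr 7 (B v * n + A v) = v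

/-- The queue has no repetitions, so there are at most `n` rounds. It does not run empty too early:
while a vertex besides `x` and `y` remains, `Elim.exists_top` provides one with two remaining
neighbours. -/
theorem runs_elim (hp : Params n K Bd D) (hE : Elim G x y A B pos d) {W : ℕ}
    (hW : Bd ^ (elimBody K D).width ≤ W) {Q : List (Fin n)} {s : State}
    (h : ElimInv K Bd D G x y A B Q 0 s) :
    Runs W (.while (.lt (var 5) (var 6)) (elimBody K D)) s ((4 + (elimBody K D).time) * (n + 1))
      (Eliminated K Bd D G x y A B) := by
  have hB := hp.hB
  refine (Runs.loop (b := .lt (var 5) (var 6)) (P := elimBody K D) (W := W) (B := Bd)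
    (I := fun m s => ∃ Q h, h + m = n ∧ ElimInv K Bd D G x y A B Q h s) (straight_elimBody K D)
    (by omega) hW (fun m s ⟨Q, h, _, hI⟩ => hI.bdd) ?_ n s ⟨Q, 0, by omega, h⟩).mono ?_
  · rintro m s ⟨Q, h, hm, hI⟩ hb
    have hlen : Q.length ≤ n := by simpa using hI.nodup.length_le_card
    simp only [Test.Holds, val, hI.v5, hI.que.1] at hb
    obtain ⟨Q', hI'⟩ := elim_step hp hE hI hb
    exact ⟨m - 1, by omega, Q', h + 1, by omega, hI'⟩
  · rintro s ⟨m, ⟨Q, h, hm, hI⟩, hb⟩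
    simp only [Test.Holds, val, hI.v5, hI.que.1, not_lt] at hb
    have htake : Q.take h = Q := List.take_of_length_le hb
    have hrem := hI.rem
    have htab := hI.tables
    rw [htake] at hrem htab
    have hall : (fun v => v ∈ Q) = fun v => v ≠ x ∧ v ≠ y := by
      funext v
      refine propext ⟨hrem.root v, fun hv => ?_⟩
      by_contra hn
      obtain ⟨u, u1, u2, u3, u4⟩ := hE.exists_top (X := fun v => v ∈ Q) ⟨v, hv.1, hv.2, hn⟩
      refine u3 ((hrem.deg u u3).2 ?_)
      have hup := hrem.up u u1 u2 u3
      have hadj := hE.adj_base u1 u2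
      have : rest G Q u = {A u, B u} := by
        ext w
        rw [mem_rest, Finset.mem_insert, Finset.mem_singleton]
        constructor
        · exact fun hw => u4 w hw.1 hw.2
        · rintro (rfl | rfl)
          exacts [⟨hadj.1, hup.1⟩, ⟨hadj.2, hup.2⟩]
      rw [this, Finset.card_pair (hE.base u u1 u2).ne]
      simp [off, u1, u2]
    refine ⟨hI.bdd, hI.v0, hI.v3, hI.v4, ?_, fun v h1 h2 => htab.apex v ?_⟩
    · have := htab.tab
      rwa [hall] at this
    · have : v ∈ Q ↔ v ≠ x ∧ v ≠ y := iff_of_eq (congrFun hall v)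
      exact this.2 ⟨h1, h2⟩

/-- The elimination starts with the state in which the queue has been filled. -/
theorem elimInv_zero (hE : Elim G x y A B pos d) {L : List (Sym2 (Fin n))}
    (hL : ∀ u v, s(u, v) ∈ L ↔ G.Adj u v) {s : State} (h : Fill K D.start Bd L x y n s) :
    ∃ Q, ElimInv K Bd D G x y A B Q 0 s := by
  obtain ⟨Q, hQ, hnd, hmem⟩ := h.que
  have hrest : rest G ([] : List (Fin n)) = nb L := by
    funext v; ext u
    simp [mem_rest, nb, hL]
  refine ⟨Q, h.bdd, h.v0, h.v3, h.v4, h.v5, Nat.zero_le _, hQ, hnd, h.sqt, ⟨?_, ?_, ?_, ?_⟩, ?_, ?_, ?_⟩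
  · intro v _ _ _; simp
  · intro v _
    rw [hmem, List.take_zero, hrest]
    simp
  · intro v hv
    have hd := ((hmem v).1 hv).2
    unfold off at hd
    constructor
    · rintro rfl
      have := Finset.card_pos.2 ⟨y, show y ∈ nb L v by simpa [nb, hL] using hE.root⟩
      rw [if_pos (Or.inl rfl)] at hd; omega
    · rintro rfl
      have := Finset.card_pos.2 ⟨x, show x ∈ nb L v by simpa [nb, hL] using hE.root.symm⟩
      rw [if_pos (Or.inr rfl)] at hd; omega
  · simp
  · intro v _
    rw [List.take_zero, hrest]
    exact h.nbs v
  · refine ⟨fun _ _ => .leaf, fun a b => ⟨.leaf a b (by simp), fun hab q hq => ?_⟩⟩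
    rw [h.tab a b q hq]
    simp [Auto.dp, hL, hab]
  · simp

end Elimination

end RealRAM

/-! ### Output of an optimal solution

Variables: `11` size of the stack, `12` number of edges of the output, `13` state, `14` value. Arrays:
`9`, `10`, `11` stack. -/

theorem Auto.best_WL {V : Type} {D : Auto} {M : ℕ} (hG : ∀ τ ∈ D.trans, Tr.GoodLab M τ.1) (T : Tr V)
    (q : ℕ) (h : D.dp T q ≠ 0) : (D.best T q).WL M := by
  induction T generalizing q with
  | leaf => trivial
  | node v l r ihl ihr =>
    obtain ⟨τ, hτ, -, ⟨-, h1, h2, -⟩, hb⟩ := Auto.best_node h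
    rw [hb]
    exact ⟨hG τ hτ, ihl _ h1, ihr _ h2⟩

namespace RealRAM

open RealRAM.Expr RealRAM.Prog

section Pick

variable {n K Bd : ℕ} {D : Auto}

def pickOne (K q : ℕ) : Prog :=
  let o := read 6 (keyE K (var 3) (var 4) (const q))
  .ite (.and (.not (.eq o (const 0))) (.not (.and (.not (.eq (var 14) (const 0)))
    (.not (.lt o (var 14)))))) (.list [.assign 14 o, .assign 13 (const q)]) .skip

/-- The invariant, with `us` already inspected: variable `14` is the least nonzero entry or `0` if
there is none, and variable `13` is a state that attains it. -/
theorem eff_pick {x y : Fin n} {f : ℕ → ℕ} {qs : List ℕ} (hqs : ∀ q ∈ qs, q < K) (hK : K ≤ Bd)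
    {us : List ℕ} {s : State} (hs : s.Bdd Bd) (h0 : s.var 0 = n) (h3 : s.var 3 = x) (h4 : s.var 4 = y)
    (hf : ∀ q < K, s.arr 6 ((x * n + y : ℕ) * K + q) = f q)
    (h1 : s.var 14 ≠ 0 → s.var 13 ∈ us ∧ f (s.var 13) = s.var 14)
    (h2 : ∀ q ∈ us, f q ≠ 0 → s.var 14 ≠ 0 ∧ s.var 14 ≤ f q) {s' : State}
    (hs' : s' = (Prog.list (qs.map (pickOne K))).eff s) :
    s'.arr = s.arr ∧ (∀ z, z ≠ 13 → z ≠ 14 → s'.var z = s.var z) ∧ s'.Bdd Bd ∧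
      (s'.var 14 ≠ 0 → s'.var 13 ∈ us ++ qs ∧ f (s'.var 13) = s'.var 14) ∧
      ∀ q ∈ us ++ qs, f q ≠ 0 → s'.var 14 ≠ 0 ∧ s'.var 14 ≤ f q := by
  induction qs generalizing s us with
  | nil => subst hs'; rw [List.append_nil]; exact ⟨rfl, fun _ _ _ => rfl, hs, h1, h2⟩
  | cons q qs ih =>
    have hq := hqs q (by simp)
    rw [List.map_cons, eff_cons] at hs'
    have hqs' : ∀ q ∈ qs, q < K := fun q hq => hqs q (by simp [hq])
    have key : (pickOne K q).eff s =
        if f q ≠ 0 ∧ (s.var 14 = 0 ∨ f q < s.var 14) then (s.setv 14 (f q)).setv 13 q else s := by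
      simp only [pickOne, eff, Test.Holds, keyE, pairE, val, h0, h3, h4, hf q hq]
      by_cases hc : f q ≠ 0 ∧ (s.var 14 = 0 ∨ f q < s.var 14)
      · rw [if_pos hc, if_pos (by tauto)]
        simp only [eff_cons, eff_nil, eff_assign, val, h0, h3, h4, hf q hq]
      · rw [if_neg hc, if_neg (by tauto)]
    rw [key] at hs'
    rw [List.append_cons]
    by_cases hc : f q ≠ 0 ∧ (s.var 14 = 0 ∨ f q < s.var 14)
    · rw [if_pos hc] at hs'
      have hb : f q ≤ Bd := by rw [← hf q hq]; exact hs.2 _ _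
      obtain ⟨r1, r2, r3, r4, r5⟩ := ih hqs' (us := us ++ [q]) (s := (s.setv 14 (f q)).setv 13 q)
        ((hs.setv hb).setv (by omega)) (by simpa [State.setv_var] using h0)
        (by simpa [State.setv_var] using h3) (by simpa [State.setv_var] using h4) hf
        (by simp [State.setv_var])
        (by
          intro q' hq' hfq
          simp only [State.setv_var]
          refine ⟨by simpa using hc.1, ?_⟩
          rw [List.mem_append, List.mem_singleton] at hq'
          rcases hq' with hq' | rfl
          · have := h2 q' hq' hfq
            simp; omega
          · simp)
        hs'
      refine ⟨r1, fun z h13 h14 => ?_, r3, r4, r5⟩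
      rw [r2 z h13 h14]; simp [State.setv_var, h13, h14]
    · rw [if_neg hc] at hs'
      exact ih hqs' (us := us ++ [q]) hs h0 h3 h4 hf
        (fun h => ⟨List.mem_append_left _ (h1 h).1, (h1 h).2⟩)
        (by
          intro q' hq' hfq
          rw [List.mem_append, List.mem_singleton] at hq'
          rcases hq' with hq' | rfl
          · exact h2 q' hq' hfq
          · push Not at hc
            exact hc hfq)
        hs'

end Pick

section Trace

variable {n K Bd M : ℕ} {D : Auto} {G : SimpleGraph (Fin n)} {x y : Fin n} {A B : Fin n → Fin n}
  {pos : Fin n ≃ Fin n} {d : Fin n → ℕ}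

/-- The vertex at the dyadic rational `z` of the polygon on the edge `a b`. -/
def exprAt : ℕ → ℚ → Expr → Expr → Expr
  | 0, z, a, b => if z ≤ 0 then a else b
  | k + 1, z, a, b => if z ≤ 1 / 2 then exprAt k (2 * z) a (read 7 (pairE a b))
      else exprAt k (2 * z - 1) (read 7 (pairE a b)) b

theorem val_exprAt_zero (s : State) (k : ℕ) (a b : Expr) : (exprAt k 0 a b).val s = a.val s := by
  induction k generalizing b with
  | zero => simp [exprAt]
  | succ k ih => simp [exprAt, ih]

theorem val_exprAt_one (s : State) (k : ℕ) (a b : Expr) : (exprAt k 1 a b).val s = b.val s := by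
  induction k generalizing a with
  | zero => rw [exprAt, if_neg (by norm_num)]
  | succ k ih =>
    rw [exprAt, if_neg (by norm_num), show (2 : ℚ) * 1 - 1 = 1 by norm_num, ih]

/-- The tables of the dynamic program are complete. -/
structure Solved (K : ℕ) (D : Auto) (G : SimpleGraph (Fin n)) (x y : Fin n) (A B : Fin n → Fin n)
    (s : State) : Prop where
  v0 : s.var 0 = n
  tab : ∀ a b T, G.Adj a b → Hang A B (fun v => v ≠ x ∧ v ≠ y) a b T →
    ∀ q < K, s.arr 6 ((a * n + b : ℕ) * K + q) = D.dp T q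
  apex : ∀ a b v, v ≠ x → v ≠ y → s(A v, B v) = s(a, b) → s.arr 7 (a * n + b) = v

theorem Eliminated.solved (hE : Elim G x y A B pos d) {s : State}
    (h : Eliminated K Bd D G x y A B s) : Solved K D G x y A B s := by
  refine ⟨h.v0, fun a b T hab hT q hq => ?_, fun a b v h1 h2 he => ?_⟩
  · obtain ⟨Tf, hTf⟩ := h.tab
    rw [(hTf a b).2 hab q hq, hT.unique hE (fun v hv => hv) (hTf a b).1]
  · rcases Sym2.eq_iff.1 he with ⟨rfl, rfl⟩ | ⟨rfl, rfl⟩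
    exacts [(h.apex v h1 h2).1, (h.apex v h1 h2).2]

theorem Solved.congr {s s' : State} (h : Solved K D G x y A B s) (h0 : s'.var 0 = s.var 0)
    (h6 : s'.arr 6 = s.arr 6) (h7 : s'.arr 7 = s.arr 7) : Solved K D G x y A B s' :=
  ⟨h0.trans h.v0, by rw [h6]; exact h.tab, by rw [h7]; exact h.apex⟩

/-- The address `z` is known when the program is written, so the descent through the apex array is
an expression of constant size. -/
theorem val_exprAt {s : State} (h : Solved K D G x y A B s) (k : ℕ) : ∀ {u w : Fin n}
    {T : Tr (Fin n)} {z : ℚ} {a b : Expr}, Hang A B (fun v => v ≠ x ∧ v ≠ y) u w T → T.vs z → Dy k z →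
    a.val s = u → b.val s = w → (exprAt k z a b).val s = T.vat u w z := by
  induction k with
  | zero =>
    intro u w T z a b _ hz hd ha hb
    have hbd := Tr.vs_bounds hz
    rcases hbd.1.eq_or_lt with rfl | h0
    · rw [val_exprAt_zero, Tr.vat_zero, ha]
    · rcases hbd.2.eq_or_lt with rfl | h1
      · rw [val_exprAt_one, Tr.vat_one, hb]
      · exact (Dy.not_lt_one hd h0 h1).elim
  | succ k ih =>
    intro u w T z a b hT hz hd ha hb
    cases hT with
    | leaf =>
      rcases hz with rfl | rfl
      · rw [val_exprAt_zero, Tr.vat_zero, ha]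
      · rw [val_exprAt_one, Tr.vat_one, hb]
    | node _ _ v l r hv he hl hr =>
      have hm : (read 7 (pairE a b)).val s = v := by
        simp only [val, pairE, ha, hb, h.v0]
        exact h.apex u w v hv.1 hv.2 he
      rw [exprAt, Tr.vat]
      split_ifs with hc
      · exact ih hl ((Tr.vs_left hc).1 hz) (Dy.two_mul_iff.2 hd) ha hm
      · exact ih hr ((Tr.vs_right (not_le.1 hc).le).1 hz) (Dy.two_mul_sub_iff.2 hd) hm hb

/-- The output contains the list `fs`. -/
def Out (s : State) (fs : List (Fin n × Fin n)) : Prop :=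
  s.var 12 = fs.length ∧
    ∀ (i : ℕ) (h : i < fs.length), s.arr 0 i = fs[i].1 ∧ s.arr 1 i = fs[i].2

/-- The output overwrites the edges of the input, which are no longer needed. -/
noncomputable def emit (M : ℕ) (e : ℚ × ℚ) : Prog := .list [
  .store 0 (var 12) (exprAt M e.1 (var 8) (var 9)), .store 1 (var 12) (exprAt M e.2 (var 8) (var 9)),
  .assign 12 (add (var 12) (const 1))]

/-- The points of a chord. -/
def vat2 (T : Tr (Fin n)) (a b : Fin n) (e : ℚ × ℚ) : Fin n × Fin n :=
  (T.vat a b e.1, T.vat a b e.2)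

theorem eff_emit {a b : Fin n} {T : Tr (Fin n)} (hT : Hang A B (fun v => v ≠ x ∧ v ≠ y) a b T)
    {es : List (ℚ × ℚ)} (hes : ∀ e ∈ es, (T.vs e.1 ∧ Dy M e.1) ∧ T.vs e.2 ∧ Dy M e.2) {s : State}
    (h : Solved K D G x y A B s) (h8 : s.var 8 = a) (h9 : s.var 9 = b) {fs : List (Fin n × Fin n)}
    (ho : Out s fs) (hs : s.Bdd Bd) (hB : n + fs.length + es.length ≤ Bd) {s' : State}
    (hs' : s' = (Prog.list (es.map (emit M))).eff s) :
    (∀ z, z ≠ 12 → s'.var z = s.var z) ∧ (∀ C, C ≠ 0 → C ≠ 1 → s'.arr C = s.arr C) ∧ s'.Bdd Bd ∧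
      Out s' (fs ++ es.map (vat2 T a b)) := by
  induction es generalizing s fs with
  | nil =>
    subst hs'
    rw [List.map_nil, List.append_nil]
    exact ⟨fun _ _ => rfl, fun _ _ _ => rfl, hs, ho⟩
  | cons e es ih =>
    obtain ⟨⟨v1, d1⟩, v2, d2⟩ := hes e (by simp)
    rw [List.map_cons, eff_cons] at hs'
    rw [List.length_cons] at hB
    have l1 := (T.vat a b e.1).2
    have l2 := (T.vat a b e.2).2
    have he : (emit M e).eff s = ((s.sta 0 fs.length (T.vat a b e.1)).sta 1 fs.length
        (T.vat a b e.2)).setv 12 (fs.length + 1) := by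
      have hS : Solved K D G x y A B (s.sta 0 fs.length (T.vat a b e.1)) :=
        h.congr rfl (State.sta_arr_ne _ _ _ _ _ (by omega)) (State.sta_arr_ne _ _ _ _ _ (by omega))
      simp only [emit, eff_cons, eff_nil, eff_store, eff_assign,
        val_exprAt h M hT v1 d1 (a := var 8) (b := var 9) h8 h9]
      simp only [val, ho.1, State.sta_var,
        val_exprAt hS M hT v2 d2 (a := var 8) (b := var 9) h8 h9]
    rw [he] at hs'
    obtain ⟨r1, r2, r3, r4⟩ := ih (fun e he => hes e (by simp [he])) (fs := fs ++ [vat2 T a b e])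
      (s := ((s.sta 0 fs.length (T.vat a b e.1)).sta 1 fs.length (T.vat a b e.2)).setv 12 (fs.length + 1))
      (h.congr rfl
        (by rw [State.setv_arr, State.sta_arr_ne _ _ _ _ _ (by omega), State.sta_arr_ne _ _ _ _ _ (by omega)])
        (by rw [State.setv_arr, State.sta_arr_ne _ _ _ _ _ (by omega), State.sta_arr_ne _ _ _ _ _ (by omega)]))
      (by simpa [State.setv_var, State.sta_var] using h8)
      (by simpa [State.setv_var, State.sta_var] using h9)
      ⟨by simp [State.setv_var], fun i hi => by
        simp only [State.setv_arr, State.sta_arr, List.getElem_append]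
        by_cases hi' : i < fs.length
        · have := ho.2 i hi'
          simp [hi', hi'.ne, this]
        · have : i = fs.length := by simp at hi; omega
          subst this
          simp [vat2]⟩
      (((hs.sta (by omega)).sta (by omega)).setv (by omega)) (by simp; omega) hs'
    refine ⟨fun z hz => ?_, fun C h0 h1 => ?_, r3, by simpa using r4⟩
    · rw [r1 z hz]; simp [State.setv_var, State.sta_var, hz]
    · rw [r2 C h0 h1, State.setv_arr, State.sta_arr_ne _ _ _ _ _ h1, State.sta_arr_ne _ _ _ _ _ h0]

/-- A frame consists of an edge, a state and the tree on the edge. -/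
abbrev Frame (n : ℕ) : Type := Fin n × Fin n × ℕ × Tr (Fin n)

/-- The stack contains the frames; the first is the top. -/
def Stk (s : State) : List (Frame n) → Prop
  | [] => True
  | f :: fr => s.arr 9 fr.length = f.1 ∧ s.arr 10 fr.length = f.2.1 ∧ s.arr 11 fr.length = f.2.2.1 ∧
      Stk s fr

theorem Stk.congr {s s' : State} {fr : List (Frame n)} (h : Stk s fr)
    (h9 : ∀ j < fr.length, s'.arr 9 j = s.arr 9 j ∧ s'.arr 10 j = s.arr 10 j ∧
      s'.arr 11 j = s.arr 11 j) : Stk s' fr := by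
  induction fr with
  | nil => trivial
  | cons f fr ih =>
    obtain ⟨h1, h2, h3, h4⟩ := h
    have := h9 fr.length (by simp)
    exact ⟨this.1.trans h1, this.2.1.trans h2, this.2.2.trans h3,
      ih h4 fun j hj => h9 j (by simp; omega)⟩

def pushF (a b : Expr) (q : ℕ) : Prog := .list [.store 9 (var 11) a, .store 10 (var 11) b,
  .store 11 (var 11) (const q), .assign 11 (add (var 11) (const 1))]

theorem eff_pushF {a b : ℕ} {u w : Fin n} {q : ℕ} {T : Tr (Fin n)} {s : State} {fr : List (Frame n)}
    (ha : s.var a = u) (hb : s.var b = w) (h11 : s.var 11 = fr.length) (hst : Stk s fr)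
    (hs : s.Bdd Bd) (hn : n ≤ Bd) (hq : q ≤ Bd) (hl : fr.length + 1 ≤ Bd) {s' : State}
    (hs' : s' = (pushF (var a) (var b) q).eff s) :
    (∀ z, z ≠ 11 → s'.var z = s.var z) ∧ (∀ C, C ≠ 9 → C ≠ 10 → C ≠ 11 → s'.arr C = s.arr C) ∧
      s'.Bdd Bd ∧ s'.var 11 = ((u, w, q, T) :: fr).length ∧ Stk s' ((u, w, q, T) :: fr) := by
  have hu := u.2
  have hw := w.2
  have he : s' = (((s.sta 9 fr.length u).sta 10 fr.length w).sta 11 fr.length q).setv 11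
      (fr.length + 1) := by
    rw [hs']
    simp only [pushF, eff_cons, eff_nil, eff_store, eff_assign, val, State.sta_var, ha, hb, h11]
  subst he
  refine ⟨fun z hz => by simp [State.setv_var, State.sta_var, hz], fun C h9 h10 h11 => ?_,
    (((hs.sta (by omega)).sta (by omega)).sta hq).setv hl, by simp [State.setv_var], ?_, ?_, ?_,
    hst.congr fun j hj => ?_⟩
  · rw [State.setv_arr, State.sta_arr_ne _ _ _ _ _ h11, State.sta_arr_ne _ _ _ _ _ h10,
      State.sta_arr_ne _ _ _ _ _ h9]
  · simp [State.setv_arr, State.sta_arr]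
  · simp [State.setv_arr, State.sta_arr]
  · simp [State.setv_arr, State.sta_arr]
  · simp [State.setv_arr, State.sta_arr, hj.ne]

/-- The left child is pushed last and hence treated first, so that the output has the order of
`Tr.chords`. -/
noncomputable def act (M : ℕ) (τ : Lab × ℕ × ℕ × ℕ) : Prog := .list [
  .list (τ.1.toList.map (emit M)), pushF (var 7) (var 9) τ.2.2.1, pushF (var 8) (var 7) τ.2.1]

/-- The transition `τ` explains the entry of the current frame. -/
def fitsT (K : ℕ) (τ : Lab × ℕ × ℕ × ℕ) : Test :=
  let l := read 6 (keyE K (var 8) (var 7) (const τ.2.1))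
  let r := read 6 (keyE K (var 7) (var 9) (const τ.2.2.1))
  .and (.eq (var 13) (const τ.2.2.2)) (.and (.not (.eq l (const 0))) (.and (.not (.eq r (const 0)))
    (.eq (add (sub (add l r) (const 1)) (const τ.1.card))
      (read 6 (keyE K (var 8) (var 9) (var 13))))))

noncomputable def chain (K M : ℕ) : List (Lab × ℕ × ℕ × ℕ) → Prog
  | [] => .skip
  | τ :: ts => .ite (fitsT K τ) (act M τ) (chain K M ts)

/-- For leaves: their state `start` is the target of no transition, so their frames are dropped
without effect. -/
theorem eff_chain_none {ts : List (Lab × ℕ × ℕ × ℕ)} {s : State}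
    (h : ∀ τ ∈ ts, τ.2.2.2 ≠ s.var 13) : (chain K M ts).eff s = s := by
  induction ts with
  | nil => rfl
  | cons τ ts ih =>
    have h1 := h τ (by simp)
    rw [chain, eff, if_neg, ih fun σ hσ => h σ (by simp [hσ])]
    simp only [fitsT, Test.Holds, val]
    exact fun h => h1 h.1.symm

theorem eff_chain {f g h : ℕ → ℕ} {a b v : Fin n} {q : ℕ} {s : State} (h0 : s.var 0 = n)
    (h8 : s.var 8 = a) (h9 : s.var 9 = b) (h7 : s.var 7 = v) (h13 : s.var 13 = q) (hq : q < K)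
    (hf : ∀ q < K, s.arr 6 ((a * n + v : ℕ) * K + q) = f q)
    (hg : ∀ q < K, s.arr 6 ((v * n + b : ℕ) * K + q) = g q)
    (hh : ∀ q < K, s.arr 6 ((a * n + b : ℕ) * K + q) = h q)
    {ts : List (Lab × ℕ × ℕ × ℕ)} (hts : ∀ τ ∈ ts, τ.2.1 < K ∧ τ.2.2.1 < K ∧ τ.2.2.2 < K)
    {τ : Lab × ℕ × ℕ × ℕ} (hτ : ts.find? (fun τ => Auto.Fits f g h q τ) = some τ) :
    (chain K M ts).eff s = (act M τ).eff s := by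
  induction ts with
  | nil => simp at hτ
  | cons σ ts ih =>
    obtain ⟨k1, k2, k3⟩ := hts σ (by simp)
    have hiff : (fitsT K σ).Holds s ↔ Auto.Fits f g h q σ := by
      simp only [fitsT, Test.Holds, keyE, pairE, val, h0, h7, h8, h9, h13, hf _ k1, hg _ k2, hh _ hq]
      rfl
    rw [chain, eff]
    rw [List.find?_cons] at hτ
    by_cases hc : Auto.Fits f g h q σ
    · rw [if_pos (hiff.2 hc)]
      simp only [hc, decide_true] at hτ
      rw [Option.some.inj hτ]
    · rw [if_neg (fun h => hc (hiff.1 h))]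
      simp only [hc, decide_false] at hτ
      exact ih (fun τ h => hts τ (by simp [h])) hτ

noncomputable def traceBody (K M : ℕ) (D : Auto) : Prog := .list [
  .assign 11 (sub (var 11) (const 1)), .assign 8 (read 9 (var 11)), .assign 9 (read 10 (var 11)),
  .assign 13 (read 11 (var 11)), .assign 7 (read 7 (pairE (var 8) (var 9))), chain K M D.trans]

/-- The edges that are still to be put out for a frame. -/
noncomputable def fout (D : Auto) (f : Frame n) : List (Fin n × Fin n) :=
  (D.best f.2.2.2 f.2.2.1).chords.map (vat2 f.2.2.2 f.1 f.2.1)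

structure Valid (K : ℕ) (D : Auto) (G : SimpleGraph (Fin n)) (x y : Fin n) (A B : Fin n → Fin n)
    (f : Frame n) : Prop where
  hang : Hang A B (fun v => v ≠ x ∧ v ≠ y) f.1 f.2.1 f.2.2.2
  adj : G.Adj f.1 f.2.1
  dp : D.dp f.2.2.2 f.2.2.1 ≠ 0
  lt : f.2.2.1 < K
  vs : ∀ e ∈ (D.best f.2.2.2 f.2.2.1).chords, f.2.2.2.vs e.1 ∧ f.2.2.2.vs e.2

/-- The frames and the output so far make up the list `total`. -/
structure TraceInv (K Bd : ℕ) (D : Auto) (G : SimpleGraph (Fin n)) (x y : Fin n) (A B : Fin n → Fin n)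
    (r : ℕ) (total : List (Fin n × Fin n)) (fr : List (Frame n)) (fs : List (Fin n × Fin n))
    (s : State) : Prop where
  bdd : s.Bdd Bd
  solved : Solved K D G x y A B s
  v14 : s.var 14 = r
  v11 : s.var 11 = fr.length
  stk : Stk s fr
  valid : ∀ f ∈ fr, Valid K D G x y A B f
  out : Out s fs
  total_eq : fs ++ fr.flatMap (fout D) = total

/-- The number of rounds for a list of frames. -/
def rounds (fr : List (Frame n)) : ℕ := (fr.map fun f => 2 * f.2.2.2.size + 1).sum

theorem length_le_rounds (fr : List (Frame n)) : fr.length ≤ rounds fr := by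
  induction fr with
  | nil => simp [rounds]
  | cons f fr ih =>
    simp only [rounds, List.map_cons, List.sum_cons, List.length_cons] at ih ⊢
    omega

/-- The two children together need one round less than the node, as `size` counts the node itself,
and the chords in its label move from `fout` to the output. -/
theorem trace_step (hp : Params n K Bd D) (hE : Elim G x y A B pos d)
    (hG : ∀ τ ∈ D.trans, Tr.GoodLab M τ.1) {r : ℕ} {total fs : List (Fin n × Fin n)} {f : Frame n}
    {fr : List (Frame n)} (hlen : n + total.length ≤ Bd) (hr : rounds (f :: fr) ≤ Bd) {s : State}
    (h : TraceInv K Bd D G x y A B r total (f :: fr) fs s) :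
    ∃ fr' fs', rounds fr' < rounds (f :: fr) ∧
      TraceInv K Bd D G x y A B r total fr' fs' ((traceBody K M D).eff s) := by
  obtain ⟨a, b, q, T⟩ := f
  have hv := h.valid _ (List.mem_cons_self ..)
  obtain ⟨hang, adj, dp, lt, vs⟩ := hv
  simp only at hang adj dp lt vs
  obtain ⟨t9, t10, t11, hst⟩ := h.stk
  simp only at t9 t10 t11
  have hK := hp.hK
  have ha := a.2
  have hb := b.2
  -- For a leaf this value is meaningless, but it has no influence.
  set w := s.arr 7 (a * n + b) with hw
  set s1 := (((((s.setv 11 fr.length).setv 8 a).setv 9 b).setv 13 q).setv 7 w) with hs1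
  have hfr := length_le_rounds fr
  have hr1 : rounds ((a, b, q, T) :: fr) = 2 * T.size + 1 + rounds fr := by
    simp [rounds]
  have b1 : s1.Bdd Bd := ((((h.bdd.setv (by omega)).setv (by omega)).setv (by omega)).setv
    (by omega)).setv (h.bdd.2 _ _)
  have he : (traceBody K M D).eff s = (chain K M D.trans).eff s1 := by
    have v11 : s.var 11 - 1 = fr.length := by rw [h.v11]; simp
    simp only [traceBody, eff_cons, eff_nil, eff_assign, val, v11]
    simp only [State.setv_arr, State.setv_var, reduceIte, Nat.reduceEqDiff, t9, t10, t11, pairE, val,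
      h.solved.v0, ← hw, hs1, OfNat.zero_ne_ofNat]
  have S1 : Solved K D G x y A B s1 := h.solved.congr (by simp [hs1, State.setv_var]) rfl rfl
  have st1 : Stk s1 fr := hst.congr fun _ _ => ⟨rfl, rfl, rfl⟩
  have o1 : Out s1 fs := ⟨by simpa [hs1, State.setv_var] using h.out.1, h.out.2⟩
  have v0 : s1.var 0 = n := S1.v0
  have v7 : s1.var 7 = w := by simp [hs1, State.setv_var]
  have v8 : s1.var 8 = a := by simp [hs1, State.setv_var]
  have v9 : s1.var 9 = b := by simp [hs1, State.setv_var]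
  have v11 : s1.var 11 = fr.length := by simp [hs1, State.setv_var]
  have v13 : s1.var 13 = q := by simp [hs1, State.setv_var]
  have v14 : s1.var 14 = r := by simpa [hs1, State.setv_var] using h.v14
  clear_value s1
  rw [he]
  have htot := h.total_eq
  cases hang with
  | leaf _ _ hl =>
    have hq : q = D.start := by
      simp only [Auto.dp, ne_eq, ite_eq_right_iff, one_ne_zero, imp_false, not_not] at dp
      exact dp
    rw [eff_chain_none fun τ hτ => by rw [v13, hq]; exact hp.ne_start τ hτ]
    refine ⟨fr, fs, by omega, b1, S1, v14, v11, st1,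
      fun f hf => h.valid f (List.mem_cons_of_mem _ hf), o1, ?_⟩
    rw [← htot]
    simp [fout, Auto.best, Tr.chords]
  | node _ _ v l r' hX hbase hL hR =>
    have hwv : w = v := by rw [hw]; exact h.solved.apex a b v hX.1 hX.2 hbase
    rw [hwv] at v7
    obtain ⟨τ, hτ, hfind, ⟨hq, f1, f2, f3⟩, hbest⟩ := Auto.best_node dp
    have hadj := hE.adj_base hX.1 hX.2
    have hav : G.Adj a v ∧ G.Adj v b := by
      rcases Sym2.eq_iff.1 hbase with ⟨rfl, rfl⟩ | ⟨rfl, rfl⟩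
      exacts [⟨hadj.1.symm, hadj.2⟩, ⟨hadj.2.symm, hadj.1⟩]
    obtain ⟨k1, k2, k3⟩ := hp.trans τ hτ
    have hWL := Auto.best_WL hG _ _ dp
    rw [hbest] at vs hWL
    have hch : (Tr.node τ.1 (D.best l τ.2.1) (D.best r' τ.2.2.1)).chords =
      τ.1.toList ++ ((D.best l τ.2.1).chords.map goL ++ (D.best r' τ.2.2.1).chords.map goR) := rfl
    rw [hch] at vs
    have bl : ∀ e ∈ (D.best l τ.2.1).chords, 0 ≤ e.1 ∧ e.1 ≤ 1 ∧ 0 ≤ e.2 ∧ e.2 ≤ 1 := by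
      intro e he
      have := Tr.F_bounds hWL.2.1 (Tr.mem_chords.1 he)
      refine ⟨this.1, ?_, ?_, this.2.2.1⟩ <;> linarith [this.1, this.2.1, this.2.2.1]
    have br : ∀ e ∈ (D.best r' τ.2.2.1).chords, 0 ≤ e.1 ∧ e.1 ≤ 1 ∧ 0 ≤ e.2 ∧ e.2 ≤ 1 := by
      intro e he
      have := Tr.F_bounds hWL.2.2 (Tr.mem_chords.1 he)
      refine ⟨this.1, ?_, ?_, this.2.2.1⟩ <;> linarith [this.1, this.2.1, this.2.2.1]
    have hfo : fout D (a, b, q, Tr.node v l r') = τ.1.toList.map (vat2 (Tr.node v l r') a b) ++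
        (fout D (a, v, τ.2.1, l) ++ fout D (v, b, τ.2.2.1, r')) := by
      simp only [fout, hbest, hch, List.map_append, List.map_map]
      congr 2
      · refine List.map_congr_left fun e he => ?_
        have := bl e he
        simp only [Function.comp, vat2, goL, Tr.vat_goL this.2.1, Tr.vat_goL this.2.2.2]
      · refine List.map_congr_left fun e he => ?_
        have := br e he
        simp only [Function.comp, vat2, goR, Tr.vat_goR this.1, Tr.vat_goR this.2.2.1]
    have hllen : n + fs.length + τ.1.toList.length ≤ Bd := by
      rw [← htot, List.flatMap_cons, hfo] at hlen
      simp only [List.length_append, List.length_map] at hlen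
      omega
    rw [eff_chain v0 v8 v9 v7 v13 lt (S1.tab a v l hav.1 hL) (S1.tab v b r' hav.2 hR)
      (S1.tab a b _ adj (.node _ _ v l r' hX hbase hL hR)) hp.trans hfind]
    obtain ⟨s2, hs2⟩ : ∃ s2, s2 = (Prog.list (τ.1.toList.map (emit M))).eff s1 := ⟨_, rfl⟩
    obtain ⟨s3, hs3⟩ : ∃ s3, s3 = (pushF (var 7) (var 9) τ.2.2.1).eff s2 := ⟨_, rfl⟩
    obtain ⟨s4, hs4⟩ : ∃ s4, s4 = (pushF (var 8) (var 7) τ.2.1).eff s3 := ⟨_, rfl⟩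
    have hact : (act M τ).eff s1 = s4 := by
      simp only [act, eff_cons, eff_nil, ← hs2, ← hs3, ← hs4]
    rw [hact]
    obtain ⟨m1, m2, m3, m4⟩ := eff_emit (T := .node v l r') (.node _ _ v l r' hX hbase hL hR)
      (es := τ.1.toList) (M := M) (fun e he => by
        have h1 := vs e (List.mem_append_left _ he)
        have h2 := hWL.1 e (Finset.mem_toList.1 he)
        exact ⟨⟨h1.1, h2.1⟩, h1.2, h2.2.1⟩) S1 v8 v9 o1 b1 hllen hs2
    have hsz : (Tr.node v l r').size = l.size + r'.size + 1 := rfl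
    obtain ⟨p1, p2, p3, p4, p5⟩ := eff_pushF (T := r') (u := v) (w := b) (a := 7) (b := 9)
      (by rw [m1 7 (by omega), v7]) (by rw [m1 9 (by omega), v9])
      (by rw [m1 11 (by omega), v11])
      (st1.congr fun j _ => ⟨by rw [m2 9 (by omega) (by omega)], by rw [m2 10 (by omega) (by omega)],
        by rw [m2 11 (by omega) (by omega)]⟩) m3 (by omega) (by omega) (by omega) hs3
    obtain ⟨c1, c2, c3, c4, c5⟩ := eff_pushF (T := l) (u := a) (w := v) (a := 8) (b := 7)
      (by rw [p1 8 (by omega), m1 8 (by omega), v8]) (by rw [p1 7 (by omega), m1 7 (by omega), v7])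
      p4 p5 p3 (by omega) (by omega) (by rw [List.length_cons]; omega) hs4
    have hvar : ∀ z, z ≠ 11 → z ≠ 12 → s4.var z = s1.var z := fun z h11 h12 => by
      rw [c1 z h11, p1 z h11, m1 z h12]
    have harr : ∀ C, C ≠ 0 → C ≠ 1 → C ≠ 9 → C ≠ 10 → C ≠ 11 → s4.arr C = s1.arr C :=
      fun C h0 h1 h9 h10 h11 => by rw [c2 C h9 h10 h11, p2 C h9 h10 h11, m2 C h0 h1]
    refine ⟨(a, v, τ.2.1, l) :: (v, b, τ.2.2.1, r') :: fr,
      fs ++ τ.1.toList.map (vat2 (Tr.node v l r') a b), ?_, c3, ?_, ?_, c4, c5, ?_, ?_, ?_⟩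
    · rw [hr1, hsz]; simp only [rounds, List.map_cons, List.sum_cons]; omega
    · exact S1.congr (hvar 0 (by omega) (by omega))
        (harr 6 (by omega) (by omega) (by omega) (by omega) (by omega))
        (harr 7 (by omega) (by omega) (by omega) (by omega) (by omega))
    · rw [hvar 14 (by omega) (by omega), v14]
    · intro f hf
      rw [List.mem_cons, List.mem_cons] at hf
      rcases hf with rfl | rfl | hf
      · refine ⟨hL, hav.1, f1, k1, fun e he => ?_⟩
        have h1 := vs (goL e) (List.mem_append_right _ (List.mem_append_left _
          (List.mem_map.2 ⟨e, he, rfl⟩)))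
        have h2 := bl e he
        simp only [goL] at h1
        rw [Tr.vs_left (by linarith), Tr.vs_left (by linarith)] at h1
        convert h1 using 2 <;> ring
      · refine ⟨hR, hav.2, f2, k2, fun e he => ?_⟩
        have h1 := vs (goR e) (List.mem_append_right _ (List.mem_append_right _
          (List.mem_map.2 ⟨e, he, rfl⟩)))
        have h2 := br e he
        simp only [goR] at h1
        rw [Tr.vs_right (by linarith), Tr.vs_right (by linarith)] at h1
        convert h1 using 2 <;> ring
      · exact h.valid f (List.mem_cons_of_mem _ hf)
    · refine ⟨?_, fun i hi => ?_⟩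
      · rw [c1 12 (by omega), p1 12 (by omega), m4.1]
      · rw [c2 0 (by omega) (by omega) (by omega), p2 0 (by omega) (by omega) (by omega),
          c2 1 (by omega) (by omega) (by omega), p2 1 (by omega) (by omega) (by omega)]
        exact m4.2 i hi
    · rw [← htot, List.flatMap_cons, List.flatMap_cons, List.flatMap_cons, hfo]
      simp only [List.append_assoc]

theorem straight_traceBody (K M : ℕ) (D : Auto) : (traceBody K M D).Straight := by
  have hemit : ∀ es : List (ℚ × ℚ), (Prog.list (es.map (emit M))).Straight := by
    intro es
    refine straight_list fun P hP => ?_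
    obtain ⟨e, -, rfl⟩ := List.mem_map.1 hP
    exact straight_list (by simp [Straight])
  have hpush : ∀ a b q, (pushF a b q).Straight := fun a b q => straight_list (by simp [Straight])
  have hchain : ∀ ts, (chain K M ts).Straight := by
    intro ts
    induction ts with
    | nil => trivial
    | cons τ ts ih => exact ⟨straight_list (by simp [hemit, hpush]), ih⟩
  exact straight_list (by simp [Straight, hchain])

theorem runs_trace (hp : Params n K Bd D) (hE : Elim G x y A B pos d)
    (hG : ∀ τ ∈ D.trans, Tr.GoodLab M τ.1) {W r : ℕ} (hW : Bd ^ (traceBody K M D).width ≤ W)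
    {total fs : List (Fin n × Fin n)} {fr : List (Frame n)} (hlen : n + total.length ≤ Bd)
    (hr : rounds fr ≤ Bd) {s : State} (h : TraceInv K Bd D G x y A B r total fr fs s) :
    Runs W (.while (.lt (const 0) (var 11)) (traceBody K M D)) s
      ((4 + (traceBody K M D).time) * (rounds fr + 1)) fun s => s.var 14 = r ∧ s.Bdd Bd ∧ Out s total := by
  have hB := hp.hB
  refine (Runs.loop (b := .lt (const 0) (var 11)) (P := traceBody K M D) (W := W) (B := Bd)
    (I := fun m s => m ≤ Bd ∧ ∃ fr fs, rounds fr = m ∧ TraceInv K Bd D G x y A B r total fr fs s)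
    (straight_traceBody K M D) (by omega) hW (fun m s ⟨_, fr, fs, _, hI⟩ => hI.bdd) ?_ (rounds fr) s
    ⟨hr, fr, fs, rfl, h⟩).mono ?_
  · rintro m s ⟨hm, fr, fs, rfl, hI⟩ hb
    cases fr with
    | nil => simp [Test.Holds, val, hI.v11] at hb
    | cons f fr =>
      obtain ⟨fr', fs', hlt, hI'⟩ := trace_step hp hE hG hlen hm hI
      exact ⟨rounds fr', hlt, by omega, fr', fs', rfl, hI'⟩
  · rintro s ⟨m, ⟨hm, fr, fs, rfl, hI⟩, hb⟩
    cases fr with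
    | nil =>
      have := hI.total_eq
      rw [List.flatMap_nil, List.append_nil] at this
      exact ⟨hI.v14, hI.bdd, this ▸ hI.out⟩
    | cons f fr => simp [Test.Holds, val, hI.v11] at hb

end Trace

end RealRAM

/-! ### Optimal augmentations and the dynamic program -/

section Optimum

variable {n k l M : ℕ} {p : Fin n → Plane} {G : SimpleGraph (Fin n)} {T : Tr (Fin n)} {κ : Fin n → ℚ}
  {D : Auto}

/-- Points determine their addresses, and chords are sorted, so distinct chords yield distinct
unordered pairs. -/
theorem Tr.Model.listsEdges (m : Tr.Model p G T κ) {S : Tr Lab} (hS : S.WL M)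
    (hF : ∀ x y, (x, y) ∈ S.F → T.vs x ∧ T.vs y) {f : ℚ → Fin n} (hf : ∀ v, f (κ v) = v) :
    ListsEdges (S.chords.map fun e => (f e.1, f e.2)) (Tr.pull κ S.F : Set (Sym2 (Fin n))) := by
  have hκ : ∀ e ∈ S.chords, κ (f e.1) = e.1 ∧ κ (f e.2) = e.2 := by
    intro e he
    obtain ⟨h1, h2⟩ := hF e.1 e.2 (Tr.mem_chords.1 he)
    obtain ⟨a, ha⟩ := (m.range _).1 h1
    obtain ⟨b, hb⟩ := (m.range _).1 h2
    rw [← ha, ← hb, hf, hf]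
    exact ⟨rfl, rfl⟩
  constructor
  · rw [List.map_map]
    refine List.Nodup.map_on ?_ (Tr.nodup_chords hS)
    intro e he e' he' h
    obtain ⟨h1, h2⟩ := hκ e he
    obtain ⟨h3, h4⟩ := hκ e' he'
    have b := (Tr.F_bounds hS (Tr.mem_chords.1 he)).2.1
    have b' := (Tr.F_bounds hS (Tr.mem_chords.1 he')).2.1
    rcases Sym2.eq_iff.1 h with ⟨c1, c2⟩ | ⟨c1, c2⟩ <;> dsimp only at c1 c2
    · ext
      · rw [← h1, ← h3, c1]
      · rw [← h2, ← h4, c2]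
    · rw [← h1, ← h2, c1, c2, h3, h4] at b
      exact (lt_asymm b b').elim
  · ext e
    induction e with | _ a b
    simp only [List.map_map, List.mem_map, Set.mem_ofPred_eq, Finset.mem_coe, Tr.mem_pull, Function.comp]
    constructor
    · rintro ⟨e, he, h⟩
      have hc := Tr.mem_chords.1 he
      obtain ⟨h1, h2⟩ := hκ e he
      rcases Sym2.eq_iff.1 h with ⟨c1, c2⟩ | ⟨c1, c2⟩
      · rw [← c1, ← c2, h1, h2]; exact Or.inl hc
      · rw [← c1, ← c2, h1, h2]; exact Or.inr hc
    · rintro (h | h)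
      · exact ⟨_, Tr.mem_chords.2 h, by rw [hf, hf]⟩
      · exact ⟨_, Tr.mem_chords.2 h, by rw [hf, hf, Sym2.eq_swap]⟩

/-- Every augmentation comes from an accepted labelled tree of the same cost. This gives both the
optimality of the table and, if no final entry is finite, the nonexistence of solutions. -/
theorem Tr.Model.exists_dp_le (m : Tr.Model p G T κ) (hk : k = 3 ∨ k = 4)
    (hD : ∀ S : Tr Lab, (∃ q ∈ D.final, D.Acc S q) ↔ S.WL M ∧ S.Good k l 1) (hM : l < M)
    {F : Finset (Sym2 (Fin n))} (hF : IsAugmentation k l p G F) :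
    ∃ q ∈ D.final, D.dp T q ≠ 0 ∧ D.dp T q ≤ F.card + 1 := by
  obtain ⟨S, hS, hSF, hsh, rfl⟩ := m.exists_tree hM hF
  obtain ⟨q, hq, hacc⟩ := (hD S).2 ⟨hS, ((m.isAugmentation_pull hk hS hSF hsh).1 hF).2⟩
  refine ⟨q, hq, ?_⟩
  rw [m.card_pull, Tr.card_F hS]
  · exact Auto.dp_le_cost hsh hacc
  · intro x y h
    have := hSF x y h
    exact ⟨(Tr.vs_congr hsh x).1 this.1, (Tr.vs_congr hsh y).1 this.2, (Tr.F_bounds hS h).2.1⟩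

theorem Auto.best_good
    (hD : ∀ S : Tr Lab, (∃ q ∈ D.final, D.Acc S q) ↔ S.WL M ∧ S.Good k l 1) {q : ℕ}
    (hq : q ∈ D.final) (h : D.dp T q ≠ 0) : (D.best T q).WL M ∧ (D.best T q).Good k l 1 ∧
      ∀ x y, (x, y) ∈ (D.best T q).F → T.vs x ∧ T.vs y := by
  obtain ⟨hacc, hsh, -⟩ := Auto.best_spec T q h
  obtain ⟨hWL, hgood⟩ := (hD _).1 ⟨q, hq, hacc⟩
  exact ⟨hWL, hgood, fun x y h => ⟨(Tr.vs_congr hsh x).1 (hgood.1 x y h).1,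
    (Tr.vs_congr hsh y).1 (hgood.1 x y h).2⟩⟩

theorem Tr.Model.isMinAugmentation_best (m : Tr.Model p G T κ) (hk : k = 3 ∨ k = 4)
    (hD : ∀ S : Tr Lab, (∃ q ∈ D.final, D.Acc S q) ↔ S.WL M ∧ S.Good k l 1) (hM : l < M)
    (hkn : k < n) {q : ℕ} (hq : q ∈ D.final) (h : D.dp T q ≠ 0)
    (hmin : ∀ q' ∈ D.final, D.dp T q' ≠ 0 → D.dp T q ≤ D.dp T q') :
    IsMinAugmentation k l p G (Tr.pull κ (D.best T q).F) := by
  obtain ⟨-, hsh, hcost⟩ := Auto.best_spec T q h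
  obtain ⟨hWL, hgood, hvs⟩ := Auto.best_good hD hq h
  refine ⟨(m.isAugmentation_pull hk hWL hgood.1 hsh).2 ⟨hkn, hgood⟩, fun F' hF' => ?_⟩
  obtain ⟨q', hq', h', hle⟩ := m.exists_dp_le hk hD hM hF'
  have := hmin q' hq' h'
  rw [m.card_pull, Tr.card_F hWL]
  · omega
  · exact fun x y h => ⟨(hvs x y h).1, (hvs x y h).2, (Tr.F_bounds hWL h).2.1⟩

theorem Elim.length_chords_le {x y : Fin n} {A B : Fin n → Fin n} {pos : Fin n ≃ Fin n}
    {d : Fin n → ℕ} (hE : Elim G x y A B pos d) {T : Tr (Fin n)}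
    (hT : Hang A B (fun v => v ≠ x ∧ v ≠ y) x y T) {q : ℕ} (h : D.dp T q ≠ 0) :
    T.size < n ∧ (D.best T q).chords.length ≤ D.width * n := by
  have hs := hT.size_lt hE (fun v hv => hv) hE.root.ne
  have h1 := (pos x).2
  have h2 := (pos y).2
  have hn : T.size < n := by omega
  refine ⟨hn, ?_⟩
  have h3 := Auto.dp_le (D := D) T q
  have h4 := (Auto.best_spec T q h).2.2
  rw [Tr.length_chords]
  have : D.width * T.size ≤ D.width * n := Nat.mul_le_mul_left _ hn.le
  omega

end Optimum

/-! ### The complete program and its running time -/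

namespace RealRAM

open RealRAM.Expr RealRAM.Prog

variable {n k l K Bd M : ℕ} {D : Auto} {p : Fin n → Plane} {G : SimpleGraph (Fin n)} {x y : Fin n}
  {A B : Fin n → Fin n} {pos : Fin n ≃ Fin n} {d : Fin n → ℕ}

def pick (K : ℕ) (D : Auto) : Prog := .list (.assign 14 (const 0) :: D.final.map (pickOne K))

/-- The automaton does not see the condition `k < n`. If it fails, variable `14` is reset to `0`,
the sign of failure. -/
def enter (k : ℕ) : Prog := .list [
  .ite (.lt (const k) (var 0)) .skip (.assign 14 (const 0)), .assign 12 (const 0),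
  .ite (.eq (var 14) (const 0)) (.assign 11 (const 0)) (.list [.store 9 (const 0) (var 3),
    .store 10 (const 0) (var 4), .store 11 (const 0) (var 13), .assign 11 (const 1)])]

/-- In the case of failure the stack starts empty, so the same trace loop covers both cases. -/
theorem enter_spec (hk : k = 3 ∨ k = 4)
    (hD : ∀ S : Tr Lab, (∃ q ∈ D.final, D.Acc S q) ↔ S.WL M ∧ S.Good k l 1) (hM : l < M)
    (hp : Params n K Bd D) (hE : Elim G x y A B pos d) {T : Tr (Fin n)}
    (hT : Hang A B (fun v => v ≠ x ∧ v ≠ y) x y T) {κ : Fin n → ℚ} (m : Tr.Model p G T κ)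
    (hκ : ∀ v, T.vat x y (κ v) = v) {s : State} (h : Eliminated K Bd D G x y A B s) :
    ((pick K D).eff s).Bdd Bd ∧ ∃ r total fr, rounds fr ≤ 2 * n + 1 ∧ total.length ≤ D.width * n ∧
      TraceInv K Bd D G x y A B r total fr [] ((enter k).eff ((pick K D).eff s)) ∧
      ((r ≠ 0 ∧ ∃ F, IsMinAugmentation k l p G F ∧ ListsEdges total (F : Set (Sym2 (Fin n)))) ∨
        (r = 0 ∧ ¬ ∃ F, IsAugmentation k l p G F)) := by
  have hB := hp.hB
  obtain ⟨s1, hs1⟩ : ∃ s1, s1 = (Prog.list (D.final.map (pickOne K))).eff (s.setv 14 0) := ⟨_, rfl⟩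
  have he : (pick K D).eff s = s1 := by rw [hs1, pick, eff_cons]; rfl
  obtain ⟨p1, p2, p3, p4, p5⟩ := eff_pick (x := x) (y := y) (f := D.dp T) (us := []) hp.final hp.hK
    (h.bdd.setv (x := 14) (v := 0) (by omega)) (by simpa [State.setv_var] using h.v0)
    (by simpa [State.setv_var] using h.v3) (by simpa [State.setv_var] using h.v4)
    ((h.solved hE).tab x y T hE.root hT) (by simp [State.setv_var]) (by simp) hs1
  rw [List.nil_append] at p4 p5
  rw [he]
  have v0 : s1.var 0 = n := by rw [p2 0 (by omega) (by omega)]; simpa [State.setv_var] using h.v0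
  have v3 : s1.var 3 = x := by rw [p2 3 (by omega) (by omega)]; simpa [State.setv_var] using h.v3
  have v4 : s1.var 4 = y := by rw [p2 4 (by omega) (by omega)]; simpa [State.setv_var] using h.v4
  have S1 : Solved K D G x y A B s1 := (h.solved hE).congr (by rw [v0, h.v0]) (by rw [p1]; rfl)
    (by rw [p1]; rfl)
  clear he hs1
  refine ⟨p3, ?_⟩
  have hkk : ¬ k < n → ¬ ∃ F, IsAugmentation k l p G F := fun hc ⟨F, hF⟩ => hc hF.2.1.1
  by_cases hc : k < n ∧ s1.var 14 ≠ 0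
  · obtain ⟨hkn, h14⟩ := hc
    obtain ⟨hq, hdp⟩ := p4 h14
    rw [← hdp] at h14
    set q := s1.var 13 with hqdef
    obtain ⟨hsz, hlen⟩ := hE.length_chords_le hT h14
    obtain ⟨hWL, hgood, hvs⟩ := Auto.best_good hD hq h14
    have hqK := hp.final q hq
    have hK := hp.hK
    have hx := x.2
    have hy := y.2
    have he : (enter k).eff s1 = ((((s1.setv 12 0).sta 9 0 x).sta 10 0 y).sta 11 0 q).setv 11 1 := by
      simp [enter, eff_cons, eff_nil, eff, Test.Holds, val, State.setv_var,
        State.sta_var, v0, v3, v4, hkn, ← hdp, h14, ← hqdef]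
    rw [he]
    refine ⟨D.dp T q, (D.best T q).chords.map (vat2 T x y), [(x, y, q, T)], ?_, by simpa using hlen,
      ⟨?_, ?_, ?_, ?_, ?_, ?_, ?_, ?_⟩, Or.inl ⟨h14, _, m.isMinAugmentation_best hk hD hM hkn hq h14
        fun q' hq' h' => ?_, m.listsEdges hWL hvs hκ⟩⟩
    · simp [rounds]; omega
    · exact ((((p3.setv (by omega)).sta (by omega)).sta (by omega)).sta (by omega)).setv (by omega)
    · exact S1.congr (by simp [State.setv_var, State.sta_var])
        (by rw [State.setv_arr, State.sta_arr_ne _ _ _ _ _ (by omega),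
          State.sta_arr_ne _ _ _ _ _ (by omega), State.sta_arr_ne _ _ _ _ _ (by omega), State.setv_arr])
        (by rw [State.setv_arr, State.sta_arr_ne _ _ _ _ _ (by omega),
          State.sta_arr_ne _ _ _ _ _ (by omega), State.sta_arr_ne _ _ _ _ _ (by omega), State.setv_arr])
    · simp [State.setv_var, State.sta_var, hdp]
    · simp [State.setv_var]
    · simp [Stk, State.setv_arr, State.sta_arr]
    · intro f hf
      rw [List.mem_singleton] at hf
      subst hf
      exact ⟨hT, hE.root, h14, hqK, fun e he => hvs _ _ (Tr.mem_chords.1 he)⟩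
    · exact ⟨by simp [State.setv_var, State.sta_var], by simp⟩
    · simp [fout]
    · rw [hdp]; exact (p5 q' hq' h').2
  · have he : (enter k).eff s1 = (((if k < n then s1 else s1.setv 14 0).setv 12 0).setv 11 0) := by
      by_cases hkn : k < n
      · have h14 : s1.var 14 = 0 := by tauto
        simp [enter, eff_cons, eff_nil, eff, Test.Holds, val, State.setv_var, v0, hkn, h14]
      · simp [enter, eff_cons, eff_nil, eff, Test.Holds, val, State.setv_var, v0, hkn]
    have hb : (if k < n then s1 else s1.setv 14 0).Bdd Bd := by
      split_ifs; exacts [p3, p3.setv (by omega)]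
    rw [he]
    refine ⟨0, [], [], by simp [rounds], by simp, ⟨(hb.setv (by omega)).setv (by omega), ?_, ?_, ?_,
      trivial, by simp, ⟨by simp [State.setv_var], by simp⟩, rfl⟩, Or.inr ⟨rfl, ?_⟩⟩
    · refine S1.congr ?_ ?_ ?_ <;> split_ifs <;> simp [State.setv_var, State.setv_arr]
    · by_cases hkn : k < n
      · have h14 : s1.var 14 = 0 := by tauto
        simp [State.setv_var, hkn, h14]
      · simp [State.setv_var, hkn]
    · simp [State.setv_var]
    · by_cases hkn : k < n
      · rintro ⟨F, hF⟩
        obtain ⟨q, hq, h0, -⟩ := m.exists_dp_le hk hD hM hF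
        exact hc ⟨hkn, (p5 q hq h0).1⟩
      · exact hkk hkn

end RealRAM

namespace RealRAM

open RealRAM.Expr RealRAM.Prog

variable {n k l K Bd M : ℕ} {D : Auto} {p : Fin n → Plane} {G : SimpleGraph (Fin n)} {x y : Fin n}
  {A B : Fin n → Fin n} {pos : Fin n ≃ Fin n} {d : Fin n → ℕ}

def finish : Prog := .list [.assign 1 (var 12),
  .ite (.eq (var 14) (const 0)) (.assign 0 (const 0)) (.assign 0 (const 1))]

/-- The straight-line pieces of the program, and the bodies of its loops. -/
noncomputable def pieces (k K M : ℕ) (D : Auto) : List Prog :=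
  [sqrtBody, scanBody K D.start, findBody, initQ, fillBody, elimBody K D, pick K D, enter k,
    traceBody K M D, finish]

noncomputable def program (k K M : ℕ) (D : Auto) : Prog :=
  .seq (.while (.lt (var 2) (var 0)) sqrtBody) <| .seq (.assign 2 (const 0)) <|
  .seq (.while (.lt (var 2) (var 1)) (scanBody K D.start)) <| .seq (.assign 2 (const 0)) <|
  .seq (.while (.lt (var 2) (var 1)) findBody) <| .seq initQ <|
  .seq (.while (.lt (var 2) (var 0)) fillBody) <|
  .seq (.while (.lt (var 5) (var 6)) (elimBody K D)) <| .seq (pick K D) <| .seq (enter k) <|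
  .seq (.while (.lt (const 0) (var 11)) (traceBody K M D)) finish

theorem Scan.reset {start : ℕ} {es : List (Fin n × Fin n)} {L : List (Sym2 (Fin n))} {s : State}
    (h : Scan K start Bd es L s) : Scan K start Bd es L (s.setv 2 0) :=
  ⟨h.bdd.setv (Nat.zero_le _), ⟨by simpa [State.setv_var] using h.inp.1,
    by simpa [State.setv_var] using h.inp.2.1, h.inp.2.2⟩, h.sqt, h.nbs, h.tab⟩

theorem straight_pick (K : ℕ) (D : Auto) : (pick K D).Straight := by
  refine straight_list fun P hP => ?_
  rw [List.mem_cons, List.mem_map] at hP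
  rcases hP with rfl | ⟨q, -, rfl⟩
  · trivial
  · simp [pickOne, Prog.list, Straight]

theorem eq_or_eq_of_card_nb {L : List (Sym2 (Fin n))} (hL : ∀ u v, s(u, v) ∈ L ↔ G.Adj u v)
    (hxy : s(x, y) ∈ L) (hc : (nb L x).card = 2) :
    ∀ u v, u ≠ v → G.Adj x u → G.Adj x v → y = u ∨ y = v := by
  intro u v huv hu hv
  have hsub : ({u, v} : Finset (Fin n)) ⊆ nb L x := by
    intro w hw
    rw [Finset.mem_insert, Finset.mem_singleton] at hw
    rcases hw with rfl | rfl <;> simp [nb, hL, hu, hv]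
  have heq := Finset.eq_of_subset_of_card_le hsub (by rw [hc, Finset.card_pair huv])
  have hy : y ∈ nb L x := by simpa [nb] using hxy
  rw [← heq] at hy
  simpa using hy

/-- Every edge is the root edge or joins a vertex to an end of its base. -/
theorem Elim.length_le (hE : Elim G x y A B pos d) {L : List (Sym2 (Fin n))} (hnd : L.Nodup)
    (hL : ∀ u v, s(u, v) ∈ L ↔ G.Adj u v) : L.length ≤ 2 * n + 1 := by
  rw [← List.toFinset_card_of_nodup hnd]
  have hsub : L.toFinset ⊆ insert s(x, y) (Finset.univ.image (fun v => s(v, A v)) ∪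
      Finset.univ.image (fun v => s(v, B v))) := by
    intro e he
    induction e with | _ u w
    rw [List.mem_toFinset, hL, hE.adj] at he
    simp only [Finset.mem_insert, Finset.mem_union, Finset.mem_image, Finset.mem_univ, true_and]
    rcases he with he | ⟨-, -, rfl | rfl⟩ | ⟨-, -, rfl | rfl⟩
    · exact Or.inl he
    · exact Or.inr (Or.inl ⟨w, Sym2.eq_swap⟩)
    · exact Or.inr (Or.inr ⟨w, Sym2.eq_swap⟩)
    · exact Or.inr (Or.inl ⟨u, rfl⟩)
    · exact Or.inr (Or.inr ⟨u, rfl⟩)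
  have h1 : (Finset.univ.image (fun v => s(v, A v))).card ≤ n := by
    simpa using Finset.card_image_le (s := Finset.univ) (f := fun v => s(v, A v))
  have h2 : (Finset.univ.image (fun v => s(v, B v))).card ≤ n := by
    simpa using Finset.card_image_le (s := Finset.univ) (f := fun v => s(v, B v))
  have h3 := Finset.card_le_card hsub
  have h4 := Finset.card_insert_le s(x, y) (Finset.univ.image (fun v => s(v, A v)) ∪
      Finset.univ.image (fun v => s(v, B v)))
  have h5 := Finset.card_union_le (Finset.univ.image (fun v => s(v, A v)))
    (Finset.univ.image (fun v => s(v, B v)))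
  omega

/-- The tree model is fixed only after the root edge has been found. The earlier model at an
arbitrary vertex of degree two merely bounds the number of edges. -/
theorem runs_program (hk : k = 3 ∨ k = 4)
    (hD : ∀ S : Tr Lab, (∃ q ∈ D.final, D.Acc S q) ↔ S.WL M ∧ S.Good k l 1) (hM : l < M)
    (hlab : ∀ τ ∈ D.trans, Tr.GoodLab M τ.1) (hp : Params n K Bd D) (hBd : n + D.width * n ≤ Bd)
    (hc : ConvexIndependent ℝ p) (hG : IsTriangulation p G) {es : List (Fin n × Fin n)}
    (hes : ListsEdges es G.edgeSet) {W : ℕ} (hW : ∀ P ∈ pieces k K M D, Bd ^ P.width ≤ W) :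
    Runs W (program k K M D) (inputState p es)
      (((pieces k K M D).map fun P => 4 + P.time).sum * (2 * n + 2)) fun s =>
        (∃ F, IsMinAugmentation k l p G F ∧ OutputsEdges s F) ∨
          (ReportsNone s ∧ ¬ ∃ F, IsAugmentation k l p G F) := by
  have hn := hp.hn
  have hB := hp.hB
  obtain ⟨L, hLdef⟩ : ∃ L, L = es.map fun q => s(q.1, q.2) := ⟨_, rfl⟩
  have hnd : L.Nodup := hLdef ▸ hes.1
  have hL : ∀ u v, s(u, v) ∈ L ↔ G.Adj u v := by
    intro u v
    rw [← SimpleGraph.mem_edgeSet, ← hes.2, hLdef]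
    rfl
  obtain ⟨x₀, a, b, hab, hdeg⟩ := hG.exists_degree_two hc hn
  have hcard : (nb L x₀).card = 2 := by
    rw [← Finset.card_pair hab]
    congr 1
    ext u
    simp [nb, hL, hdeg]
  have hxa : s(x₀, a) ∈ L := (hL _ _).2 ((hdeg a).2 (Or.inl rfl))
  have hlen : es.length ≤ 2 * n + 1 := by
    obtain ⟨A, B, pos, d, T, κ, hE, -⟩ :=
      hG.exists_model hc hn ((hL _ _).1 hxa) (eq_or_eq_of_card_nb hL hxa hcard)
    have := Elim.length_le hE hnd hL
    rwa [hLdef, List.length_map] at this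
  have hne : ∀ q ∈ es, q.1 ≠ q.2 := fun q hq =>
    ((hL q.1 q.2).1 (hLdef ▸ List.mem_map.2 ⟨q, hq, rfl⟩)).ne
  have hassign : ∀ s : State, s.Bdd Bd → ∀ Q : State → Prop, Q (s.setv 2 0) →
      Runs W (.assign 2 (const 0)) s 2 Q := fun s hs Q hQ =>
    ⟨_, _, .assign s 2 (const 0) (Nat.zero_le _), le_rfl, hQ⟩
  have key : Runs W (program k K M D) (inputState p es)
      ((4 + sqrtBody.time) * (n + 1) + (2 + ((4 + (scanBody K D.start).time) * (es.length + 1) + (2 +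
        ((4 + findBody.time) * (es.length + 1) + (initQ.time + ((4 + fillBody.time) * (n + 1) +
        ((4 + (elimBody K D).time) * (n + 1) + ((pick K D).time + ((enter k).time +
        ((4 + (traceBody K M D).time) * (2 * n + 2) + finish.time)))))))))))
      fun s => (∃ F, IsMinAugmentation k l p G F ∧ OutputsEdges s F) ∨
          (ReportsNone s ∧ ¬ ∃ F, IsAugmentation k l p G F) := by
    refine (runs_sqrt hp (hW _ (by simp [pieces])) hlen).seq fun s ⟨h1, h2, h3, h4⟩ => ?_
    refine (hassign s h1 (fun s => s.var 2 = 0 ∧ Scan K D.start Bd es [] s) ⟨by simp [State.setv_var],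
      Scan.reset ⟨h1, h2, h3, fun v => ?_, fun a b q hq => ?_⟩⟩).seq fun s ⟨h2, h⟩ => ?_
    · simp [Nb, nb, h4]
    · simp [h4]
    refine (runs_scan hp (hW _ (by simp [pieces])) hes.1 hne hlen h2 h).seq fun s h => ?_
    rw [← hLdef] at h
    refine (hassign s h.bdd (fun s => s.var 2 = 0 ∧ Scan K D.start Bd es L s)
      ⟨by simp [State.setv_var], h.reset⟩).seq fun s ⟨h2, h⟩ => ?_
    refine (runs_find hp (hW _ (by simp [pieces])) hlen hLdef ⟨x₀, a, hxa, hcard⟩ h2 h).seq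
      fun s ⟨h, x, y, h3, h4, hxy, hc2⟩ => ?_
    have hadj := (hL _ _).1 hxy
    obtain ⟨A, B, pos, d, T, κ, hE, hT, m, hκ, -⟩ :=
      hG.exists_model hc hn hadj (eq_or_eq_of_card_nb hL hxy hc2)
    refine (Runs.straight (straight_list (by simp [Straight])) (by omega) h.bdd
      (hW initQ (by simp [pieces])) (fill_init hp hadj.ne h h3 h4)).seq fun s h => ?_
    refine (runs_fill hp (hW _ (by simp [pieces])) h).seq fun s h => ?_
    obtain ⟨Q, h⟩ := elimInv_zero (A := A) (B := B) hE hL h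
    refine (runs_elim hp hE (hW _ (by simp [pieces])) h).seq fun s h => ?_
    obtain ⟨hb, r, total, fr, hr, htot, hI, hfin⟩ := enter_spec hk hD hM hp hE hT m hκ h
    have hn2 : n * 3 ≤ n * n := Nat.mul_le_mul_left _ hn
    refine (Runs.straight (straight_pick K D) (by omega) h.bdd (hW _ (by simp [pieces]))
      (Q := fun s' => s' = (pick K D).eff s) rfl).seq fun s' hs' => ?_
    subst hs'
    refine (Runs.straight (straight_list (by simp [Straight, Prog.list])) (by omega) hb
      (hW (enter k) (by simp [pieces])) hI).seq fun s h => ?_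
    obtain ⟨t, s', e, ht, h14, hb, hout⟩ := runs_trace hp hE hlab (hW _ (by simp [pieces]))
      (by omega) (by omega) h
    refine Runs.seq (R := fun s => s.var 14 = r ∧ s.Bdd Bd ∧ Out s total)
      ⟨t, s', e, ht.trans (Nat.mul_le_mul_left _ (by omega)), h14, hb, hout⟩
      fun s ⟨h14, hb, hout⟩ => ?_
    refine Runs.straight (straight_list (by simp [Straight])) (by omega) hb
      (hW finish (by simp [pieces])) ?_
    rcases hfin with ⟨hr, F, hF, hls⟩ | ⟨hr, hno⟩
    · have he : finish.eff s = (s.setv 1 total.length).setv 0 1 := by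
        simp [finish, eff_cons, eff_nil, eff, Test.Holds, val, State.setv_var, h14, hr,
          hout.1]
      rw [he]
      exact Or.inl ⟨F, hF, by simp [State.setv_var], total, hls, by simp [State.setv_var], hout.2⟩
    · refine Or.inr ⟨?_, hno⟩
      simp [ReportsNone, finish, eff_cons, eff_nil, eff, Test.Holds, val, State.setv_var,
        h14, hr]
  obtain ⟨t, s, e, ht, h⟩ := key
  refine ⟨t, s, e, ht.trans ?_, h⟩
  have g : ∀ c, ∀ m ≤ 2 * n + 2, (4 + c) * m ≤ (4 + c) * (2 * n + 2) := fun c m hm =>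
    Nat.mul_le_mul_left _ hm
  have g' : ∀ c, 4 + c ≤ (4 + c) * (2 * n + 2) := fun c => Nat.le_mul_of_pos_right _ (by omega)
  have g1 := g sqrtBody.time (n + 1) (by omega)
  have g2 := g (scanBody K D.start).time (es.length + 1) (by omega)
  have g3 := g findBody.time (es.length + 1) (by omega)
  have g4 := g fillBody.time (n + 1) (by omega)
  have g5 := g (elimBody K D).time (n + 1) (by omega)
  have g6 := g' initQ.time
  have g7 := g' (pick K D).time
  have g8 := g' (enter k).time
  have g9 := g' finish.time
  simp only [pieces, List.map_cons, List.map_nil, List.sum_cons, List.sum_nil, add_zero, add_mul _ _ (2 * n + 2)]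
  simp only [add_mul _ _ (2 * n + 2)] at g1 g2 g3 g4 g5 g6 g7 g8 g9 ⊢
  omega

/-- The inequality `m + 1 ≤ n ^ m` turns the constants of the automaton into powers of `n`. -/
theorem params_pow (hn : 3 ≤ n) (start : D.start < K)
    (trans : ∀ τ ∈ D.trans, τ.2.1 < K ∧ τ.2.2.1 < K ∧ τ.2.2.2 < K)
    (ne_start : ∀ τ ∈ D.trans, τ.2.2.2 ≠ D.start) (final : ∀ q ∈ D.final, q < K) :
    Params n K (n ^ (D.width + K + 5)) D ∧ n + D.width * n ≤ n ^ (D.width + K + 5) := by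
  have hself : ∀ m, m + 1 ≤ n ^ m := fun m => Nat.lt_pow_self (by omega)
  have mono : ∀ m ≤ D.width + K + 5, n ^ m ≤ n ^ (D.width + K + 5) := fun m hm =>
    Nat.pow_le_pow_right (by omega) hm
  have h1 : (D.width + 1) * n ≤ n ^ (D.width + 1) := by
    rw [pow_succ]; exact Nat.mul_le_mul_right _ (hself _)
  have h2 := mono (D.width + 1) (by omega)
  have h3 := mono 5 (by omega)
  have h4 := mono K (by omega)
  have h5 := hself K
  rw [add_mul, one_mul] at h1
  refine ⟨⟨hn, le_trans ?_ h3, by omega, by omega, start, trans, ne_start, final⟩, by omega⟩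
  have e2 : 3 * n ≤ n * n := Nat.mul_le_mul_right _ hn
  have e3 : 3 * (n * n) ≤ n * (n * n) := Nat.mul_le_mul_right _ hn
  have e4 : 3 * (n * (n * n)) ≤ n * (n * (n * n)) := Nat.mul_le_mul_right _ hn
  have e5 : 3 * (n * (n * (n * n))) ≤ n * (n * (n * (n * n))) := Nat.mul_le_mul_right _ hn
  have e : n ^ 5 = n * (n * (n * (n * n))) := by ring
  omega

end RealRAM

/-- For `k = 3, 4` and every constant `l`, some real RAM program, run on a triangulation of `n`
points in convex position with words of `O(log n)` bits, finds in `O(n)` steps a minimum set of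
new edges whose addition makes the graph `k`-connected and `l`-planar, or reports that no set of
new edges does. -/
theorem mainTheorem9 (k : ℕ) (hk : k = 3 ∨ k = 4) (l : ℕ) :
    ∃ (P : RealRAM.Prog) (c : ℕ),
      ∀ (n : ℕ), 3 ≤ n →
      ∀ (p : Fin n → Plane), ConvexIndependent ℝ p →
      ∀ (G : SimpleGraph (Fin n)), IsTriangulation p G →
      ∀ (es : List (Fin n × Fin n)), ListsEdges es G.edgeSet →
        ∃ (t : ℕ) (s' : RealRAM.State),
          RealRAM.Exec (n ^ c) P (inputState p es) t s' ∧ t ≤ c * n ∧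
          ((∃ F, IsMinAugmentation k l p G F ∧ OutputsEdges s' F) ∨
            (ReportsNone s' ∧ ¬ ∃ F, IsAugmentation k l p G F)) := by
  -- The level `l + 3` exceeds `l`, so that it covers all labels of solutions, and is at least `3`,
  -- as the locality argument requires.
  obtain ⟨D, K, hstart, htrans, hfinal, hD⟩ := Tr.exists_auto k l (l + 3) (by omega)
  set Ps := RealRAM.pieces k K (l + 3) D with hPs
  set b := D.width + K + 5 with hb
  -- One constant serves twice: the first summand bounds the time, since `2 * n + 2 ≤ 4 * n`, and
  -- the second one the exponent of the word bound.
  refine ⟨RealRAM.program k K (l + 3) D,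
    4 * (Ps.map fun P => 4 + P.time).sum + b * (Ps.map fun P => P.width).sum,
    fun n hn p hp G hG es hes => ?_⟩
  obtain ⟨hpar, hbd⟩ := RealRAM.params_pow (n := n) hn hstart
    (fun τ hτ => ⟨(htrans τ hτ).2.1, (htrans τ hτ).2.2.1, (htrans τ hτ).2.2.2.1⟩)
    (fun τ hτ => (htrans τ hτ).2.2.2.2) hfinal
  obtain ⟨t, s, e, ht, h⟩ := RealRAM.runs_program (k := k) (l := l)
    (W := n ^ (4 * (Ps.map fun P => 4 + P.time).sum + b * (Ps.map fun P => P.width).sum)) hk hD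
    (by omega) (fun τ hτ => (htrans τ hτ).1) hpar hbd hp hG hes (by
      intro P hP
      rw [← pow_mul]
      refine Nat.pow_le_pow_right (by omega) (le_trans ?_ (Nat.le_add_left _ _))
      exact Nat.mul_le_mul_left _ (List.single_le_sum (fun _ _ => Nat.zero_le _) _
        (List.mem_map.2 ⟨P, hP, rfl⟩)))
  refine ⟨t, s, e, ht.trans ?_, h⟩
  rw [add_mul]
  refine le_trans ?_ (Nat.le_add_right _ _)
  rw [mul_comm 4, mul_assoc]
  exact Nat.mul_le_mul_left _ (by omega)
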